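/- **Setting.** Fix a real number $\Delta\neq 0$ and an integer $N\ge 1$. Let $\mathcal X_N$ be the set of $X=\{x_1<\dots<x_N\}\subset\mathbb Z$, with orthonormal basis $\{e_X\}$ of $\ell^2(\mathcal X_N)$ ($e_X$ has up spins exactly at the sites of $X$). Let $H=\sum_{j\in\mathbb Z}h_{j,j+1}$, $h_{j,j+1}=\sigma_j^+\sigma_{j+1}^-+\sigma_j^-\sigma_{j+1}^++\frac{\Delta}{2}(\sigma_j^3\sigma_{j+1}^3-1)$, be the XXZ Hamiltonian on $\ell^2(\mathcal X_N)$, and for $Y=\{y_1<\dots<y_N\}\in\mathcal X_N$ let $\Psi(t)=e^{-\mathrm i tH}e_Y=\sum_X\psi(X;t)e_X$. Put $\mathcal F_N(x,t)=\mathbb P_Y(X_1(t)\ge x)=\sum_{n\ge x}\ \sum_{X\in\mathcal X_N,\,x_1=n}|\psi(X;t)|^2$ for $x\in\mathbb Z$, $t\in\mathbb R$. **Index sets and integrands.** For $0\le n\le N$ let $\mathcal T_n$ be the set of maps $\tau:\{1,\dots,N\}\to\{0,1,\dots,N\}$ with $|\tau^{-1}(0)|=n$ and $|\tau^{-1}(k)|\le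 1$ for $k=1,\dots,N$. For $\tau\in\mathcal T_n$ and $M=N-n$ put $K_1=\tau^{-1}(0)$, $K_2=K_1^c=\{k_1<\dots<k_M\}$, $\tau_\ell=\tau(k_\ell)$, $J_2=\{\tau_1,\dots,\tau_M\}$, $J_1=J_2^c$, and let $\mathrm{inv}(\tau)$ be the number of pairs $\ell<\ell'$ with $\tau_\ell>\tau_{\ell'}$. With $\varepsilon(\xi)=\xi+\xi^{-1}-2\Delta$ and $d(x,y)=\frac{1}{(1-xy)(x+y-2\Delta xy)}$, let $$D_N(\xi,\zeta;\tau)=(-1)^{\mathrm{inv}(\tau)+\sum_{\ell}(\tau_\ell-k_\ell)}\det\big(d(\xi_j,\zeta_k)\big)_{j\in J_1,\,k\in K_1}$$ (rows and columns in increasing order), $$I_N(\xi,\zeta;\tau)=\frac{\prod_{j\in J_1,k\in K_1}(\xi_j+\zeta_k-2\Delta\xi_j\zeta_k)\;D_N(\xi,\zeta;\tau)}{\prod_{j<k;\,j,k\in J_1}(1+\xi_j\xi_k-2\Delta\xi_j)\prod_{j<k;\,j,k\in K_1}(1+\zeta_j\zeta_k-2\Delta\zeta_j)}\prod_{j\in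 J_1}\xi_j^{x-y_j-1}e^{-\mathrm i t\varepsilon(\xi_j)}\prod_{k\in K_1}\zeta_k^{x-y_k-1}e^{\mathrm i t\varepsilon(\zeta_k)},$$ $$f(\xi,\zeta;\tau)=\prod_{\ell=1}^M\Bigg(\prod_{\substack{k>\tau_\ell\\ k\ne\tau_{\ell+1},\dots,\tau_M}}\frac{1+\xi_{\tau_\ell}\xi_k-2\Delta\xi_k}{1+\xi_{\tau_\ell}\xi_k-2\Delta\xi_{\tau_\ell}}\prod_{\substack{k>k_\ell\\ k\ne k_{\ell+1},\dots,k_M}}\frac{\xi_{\tau_\ell}+\zeta_k-2\Delta\xi_{\tau_\ell}\zeta_k}{\xi_{\tau_\ell}+\zeta_k-2\Delta}\Bigg)\prod_{\ell=1}^M\xi_{\tau_\ell}^{y_{k_\ell}-y_{\tau_\ell}-1}.$$ **Contours.** All contours are closed and counterclockwise. For $\rho>\sqrt3$ let $\Gamma_+(\rho)$ consist of the two segments from $\mathrm i$ to $\mathrm i+e^{\pi\mathrm i/6}$ and to $\mathrm i+e^{5\pi\mathrm i/6}$, the two horizontal segments from these end points outward to the circle $|z|=\rho$, and the arc of that circle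 with $\mathrm{Im}\,z\le\frac32$; let $\Gamma_-(\rho)$ be its mirror image in the real axis. Let $\widehat\Gamma=\widehat\Gamma_{\epsilon_1,\epsilon_2}$ be the rectangle with corners $\pm\sqrt{R^2-1}\pm\mathrm i$ whose upper side is modified by a half-circle of radius $\epsilon_1$ around $\mathrm i$ bulging out of the rectangle and a half-circle of radius $\epsilon_2$ around $\mathrm i+2\Delta$ bulging into it. **Proposition 7.6.** For every sufficiently small $\epsilon_1>0$ (depending only on $\Delta$) and every sufficiently small $\epsilon_2>0$ (depending only on $\Delta,\epsilon_1$), the following holds for all $N\ge1$, $Y\in\mathcal X_N$, $x\in\mathbb Z$, $t\in\mathbb R$, and all $R,R'$ with $$\max\{2|\Delta|^{-1},2(1+2|\Delta|)\}<R<\max\{4|\Delta|^{-1},4(1+2|\Delta|)\}<R'/2:$$ $$\mathcal F_N(x,t)=\sum_{n=0}^N\sum_{\tau\in\mathcal T_n}\oint_{\Gamma_+}\!\!\cdots\oint_{\Gamma_-}I_N(\xi,\zeta;\tau)\Big(\oint_{\widehat\Gamma}\cdots\oint_{\widehat\Gamma}f(\xi,\zeta;\tau)\,d^{J_2}\xi\Big)\,d^{K_1}\zeta\,d^{J_1}\xi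 ,$$ where $\Gamma_+=\Gamma_+(R)$, $\Gamma_-=\Gamma_-(R')$, each differential carries a factor $(2\pi\mathrm i)^{-1}$, and the integrals are iterated: $\xi_j$ ($j\in J_1$) runs over $\Gamma_+$ (outermost), $\zeta_k$ ($k\in K_1$) over $\Gamma_-$, $\xi_j$ ($j\in J_2$) over $\widehat\Gamma$ (innermost), and within each group the variable of smallest index is outermost. -/

import Mathlib

open Finset

noncomputable section

namespace XXZ

/-! ### The XXZ chain on `ℤ`

A spin configuration with finitely many up spins is the finite set `X` of the sites of its up spins.
A state is described by its coefficients `ψ X` in the basis `e_X`; the following operators are the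
Pauli operators, written on coefficients. -/

/-- `σ_j^3 e_X = e_X` if `j ∈ X`, and `-e_X` otherwise. -/
def pauliThree (j : ℤ) (ψ : Finset ℤ → ℂ) : Finset ℤ → ℂ :=
  fun X => if j ∈ X then ψ X else -ψ X

/-- `σ_j^+ e_X = e_{X ∪ {j}}` if `j ∉ X`, and `0` otherwise. -/
def pauliPlus (j : ℤ) (ψ : Finset ℤ → ℂ) : Finset ℤ → ℂ :=
  fun X => if j ∈ X then ψ (X.erase j) else 0

/-- `σ_j^- e_X = e_{X ∖ {j}}` if `j ∈ X`, and `0` otherwise. -/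
def pauliMinus (j : ℤ) (ψ : Finset ℤ → ℂ) : Finset ℤ → ℂ :=
  fun X => if j ∈ X then 0 else ψ (insert j X)

/-- The bond operator
`h_{j,j+1} = σ_j^+ σ_{j+1}^- + σ_j^- σ_{j+1}^+ + (Δ/2) (σ_j^3 σ_{j+1}^3 - 1)`. -/
def bond (Δ : ℝ) (j : ℤ) (ψ : Finset ℤ → ℂ) : Finset ℤ → ℂ :=
  fun X => pauliPlus j (pauliMinus (j + 1) ψ) X + pauliMinus j (pauliPlus (j + 1) ψ) X
    + (Δ : ℂ) / 2 * (pauliThree j (pauliThree (j + 1) ψ) X - ψ X)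

/-- The formal Hamiltonian `H = ∑_{j ∈ ℤ} h_{j,j+1}`; at each configuration only finitely many
bonds contribute. -/
def formalHamiltonian (Δ : ℝ) (ψ : Finset ℤ → ℂ) : Finset ℤ → ℂ :=
  fun X => ∑ᶠ j : ℤ, bond Δ j ψ X

/-- Configurations of `N` up spins. -/
abbrev Config (N : ℕ) : Type := {X : Finset ℤ // X.card = N}

/-- The `N`-particle Hilbert space `ℓ²(𝒳_N)`. -/
abbrev Sector (N : ℕ) : Type := lp (fun _ : Config N => ℂ) 2

/-- The coefficients of an `N`-particle state, extended by `0` to all configurations. -/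
def extend {N : ℕ} (ψ : Config N → ℂ) : Finset ℤ → ℂ :=
  fun X => if h : X.card = N then ψ ⟨X, h⟩ else 0

/-- Exchange of the spins at the sites `j` and `j + 1`. -/
def exchange (j : ℤ) (X : Finset ℤ) : Finset ℤ :=
  X.map (Equiv.swap j (j + 1)).toEmbedding

/-- The bonds of a configuration that join antiparallel spins. -/
def activeBonds (X : Finset ℤ) : Finset ℤ :=
  (X ∪ X.image (fun k => k - 1)).filter (fun j => ¬(j ∈ X ↔ j + 1 ∈ X))

lemma mem_activeBonds {X : Finset ℤ} {j : ℤ} :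
    j ∈ activeBonds X ↔ ¬(j ∈ X ↔ j + 1 ∈ X) := by
  simp only [activeBonds, mem_filter, mem_union, mem_image, and_iff_right_iff_imp]
  intro h
  by_cases hj : j ∈ X
  · exact Or.inl hj
  · refine Or.inr ⟨j + 1, ?_, by ring⟩
    by_contra h'
    exact h ⟨fun a => absurd a hj, fun a => absurd a h'⟩

lemma card_activeBonds_le (X : Finset ℤ) : (activeBonds X).card ≤ 2 * X.card := by
  refine (card_filter_le _ _).trans ((card_union_le _ _).trans ?_)
  have := card_image_le (s := X) (f := fun k : ℤ => k - 1)
  omega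

lemma mem_exchange {j k : ℤ} {X : Finset ℤ} :
    k ∈ exchange j X ↔ Equiv.swap j (j + 1) k ∈ X := by
  simp only [exchange, mem_map_equiv, Equiv.symm_swap]

lemma exchange_exchange (j : ℤ) (X : Finset ℤ) : exchange j (exchange j X) = X := by
  ext k
  simp [mem_exchange]

lemma mem_activeBonds_exchange {j : ℤ} {X : Finset ℤ} :
    j ∈ activeBonds (exchange j X) ↔ j ∈ activeBonds X := by
  simp only [mem_activeBonds, mem_exchange, Equiv.swap_apply_left, Equiv.swap_apply_right]
  tauto

lemma card_exchange (j : ℤ) (X : Finset ℤ) : (exchange j X).card = X.card :=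
  card_map _

/-- The action of a bond operator: it annihilates parallel spins, and on antiparallel spins it is
the exchange minus `Δ`. -/
lemma bond_apply (Δ : ℝ) (j : ℤ) (ψ : Finset ℤ → ℂ) (X : Finset ℤ) :
    bond Δ j ψ X = if j ∈ activeBonds X then ψ (exchange j X) - Δ * ψ X else 0 := by
  have hne : j + 1 ≠ j := by omega
  by_cases h1 : j ∈ X <;> by_cases h2 : j + 1 ∈ X
  · simp [bond, pauliPlus, pauliMinus, pauliThree, mem_activeBonds, h1, h2, hne]
  · have e : insert (j + 1) (X.erase j) = exchange j X := by
      ext k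
      rw [mem_exchange]
      by_cases hk : k = j
      · subst hk; simp [h2]
      · by_cases hk' : k = j + 1
        · subst hk'; simp [h1]
        · simp [Equiv.swap_apply_of_ne_of_ne hk hk', hk, hk']
    simp [bond, pauliPlus, pauliMinus, pauliThree, mem_activeBonds, h1, h2, e]
    ring
  · have e : (insert j X).erase (j + 1) = exchange j X := by
      ext k
      rw [mem_exchange]
      by_cases hk : k = j
      · subst hk; simp [h2]
      · by_cases hk' : k = j + 1
        · subst hk'; simp [h1]
        · simp [Equiv.swap_apply_of_ne_of_ne hk hk', hk, hk']
    simp [bond, pauliPlus, pauliMinus, pauliThree, mem_activeBonds, h1, h2, e]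
    ring
  · simp [bond, pauliPlus, pauliMinus, pauliThree, mem_activeBonds, h1, h2, hne]

lemma formalHamiltonian_apply (Δ : ℝ) (ψ : Finset ℤ → ℂ) (X : Finset ℤ) :
    formalHamiltonian Δ ψ X = ∑ j ∈ activeBonds X, (ψ (exchange j X) - Δ * ψ X) := by
  rw [formalHamiltonian, finsum_eq_sum_of_support_subset (s := activeBonds X)]
  · exact sum_congr rfl fun j hj => by rw [bond_apply, if_pos hj]
  · intro j hj
    by_contra h
    exact hj ((bond_apply Δ j ψ X).trans (if_neg (by simpa using h)))

lemma sum_extend_le {N : ℕ} (ψ : Sector N) (S : Finset (Finset ℤ)) :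
    ∑ X ∈ S, ‖extend (fun X => ψ X) X‖ ^ 2 ≤ ‖ψ‖ ^ 2 := by
  classical
  have h2 : (0 : ℝ) < (2 : ENNReal).toReal := by norm_num
  have key := lp.sum_rpow_le_norm_rpow h2 ψ (S.subtype (fun X => X.card = N))
  simp only [ENNReal.toReal_ofNat, Real.rpow_ofNat] at key
  have e1 : ∑ X ∈ S, ‖extend (fun X => ψ X) X‖ ^ 2 =
      ∑ X ∈ S with X.card = N, ‖extend (fun X => ψ X) X‖ ^ 2 := by
    refine (Finset.sum_filter_of_ne fun X _ hX => ?_).symm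
    by_contra h
    exact hX (by simp [extend, h])
  rw [e1, ← Finset.sum_subtype_eq_sum_filter]
  refine le_trans (le_of_eq (sum_congr rfl fun X _ => ?_)) key
  simp [extend, X.2]

lemma sum_hamiltonian_le (Δ : ℝ) {N : ℕ} (ψ : Sector N) (s : Finset (Config N)) :
    ∑ X ∈ s, ‖formalHamiltonian Δ (extend fun X => ψ X) X.1‖ ^ 2
      ≤ 8 * (N : ℝ) ^ 2 * (1 + Δ ^ 2) * ‖ψ‖ ^ 2 := by
  classical
  set φ : Finset ℤ → ℂ := extend fun X => ψ X with hφ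
  have step1 : ∀ X : Config N, ‖formalHamiltonian Δ φ X.1‖ ^ 2 ≤
      4 * N * (∑ j ∈ activeBonds X.1, ‖φ (exchange j X.1)‖ ^ 2)
        + 8 * N ^ 2 * Δ ^ 2 * ‖φ X.1‖ ^ 2 := by
    intro X
    have hc : ((activeBonds X.1).card : ℝ) ≤ 2 * N := by
      have := card_activeBonds_le X.1
      rw [X.2] at this
      exact_mod_cast this
    rw [formalHamiltonian_apply]
    have a1 : ‖∑ j ∈ activeBonds X.1, (φ (exchange j X.1) - Δ * φ X.1)‖ ^ 2 ≤
        (activeBonds X.1).card * ∑ j ∈ activeBonds X.1, ‖φ (exchange j X.1) - Δ * φ X.1‖ ^ 2 :=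
      (pow_le_pow_left₀ (norm_nonneg _) (norm_sum_le _ _) 2).trans sq_sum_le_card_mul_sum_sq
    have a2 : ∀ j ∈ activeBonds X.1, ‖φ (exchange j X.1) - Δ * φ X.1‖ ^ 2 ≤
        2 * ‖φ (exchange j X.1)‖ ^ 2 + 2 * Δ ^ 2 * ‖φ X.1‖ ^ 2 := by
      intro j _
      have h := norm_sub_le (φ (exchange j X.1)) (Δ * φ X.1)
      rw [norm_mul, Complex.norm_real, Real.norm_eq_abs] at h
      have h' := pow_le_pow_left₀ (norm_nonneg _) h 2
      nlinarith [sq_nonneg (‖φ (exchange j X.1)‖ - |Δ| * ‖φ X.1‖), sq_abs Δ]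
    have a3 := sum_le_sum a2
    rw [sum_add_distrib, ← mul_sum, sum_const, nsmul_eq_mul] at a3
    have p1 : 0 ≤ ∑ j ∈ activeBonds X.1, ‖φ (exchange j X.1)‖ ^ 2 :=
      sum_nonneg fun _ _ => by positivity
    have p2 : 0 ≤ 2 * Δ ^ 2 * ‖φ X.1‖ ^ 2 := by positivity
    calc _ ≤ _ := a1
      _ ≤ (2 * N) * (2 * ∑ j ∈ activeBonds X.1, ‖φ (exchange j X.1)‖ ^ 2
            + 2 * N * (2 * Δ ^ 2 * ‖φ X.1‖ ^ 2)) := by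
          gcongr
          exact a3.trans (by gcongr)
      _ = _ := by ring
  have step2 : ∑ X ∈ s, ∑ j ∈ activeBonds X.1, ‖φ (exchange j X.1)‖ ^ 2 ≤ 2 * N * ‖ψ‖ ^ 2 := by
    set T : Finset (Σ _ : Config N, ℤ) := s.sigma fun X => activeBonds X.1 with hT
    set S : Finset (Finset ℤ) := T.image fun p => exchange p.2 p.1.1 with hS
    have b1 : ∑ X ∈ s, ∑ j ∈ activeBonds X.1, ‖φ (exchange j X.1)‖ ^ 2 =
        ∑ p ∈ T, ‖φ (exchange p.2 p.1.1)‖ ^ 2 := by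
      rw [hT, sum_sigma]
    set e : (Σ _ : Config N, ℤ) → (Σ _ : Finset ℤ, ℤ) :=
      fun p => ⟨exchange p.2 p.1.1, p.2⟩ with he
    have hinj : Set.InjOn e T := by
      rintro ⟨X, j⟩ _ ⟨X', j'⟩ _ h
      simp only [he, Sigma.mk.injEq, heq_eq_eq] at h
      obtain ⟨h1, rfl⟩ := h
      have := congrArg (exchange j) h1
      rw [exchange_exchange, exchange_exchange] at this
      rw [Subtype.ext this]
    have b2 : ∑ p ∈ T, ‖φ (exchange p.2 p.1.1)‖ ^ 2 = ∑ q ∈ T.image e, ‖φ q.1‖ ^ 2 :=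
      (sum_image (f := fun q : (Σ _ : Finset ℤ, ℤ) => ‖φ q.1‖ ^ 2) hinj).symm
    have b3 : T.image e ⊆ S.sigma fun X => activeBonds X := by
      intro q hq
      obtain ⟨p, hp, rfl⟩ := mem_image.1 hq
      rw [mem_sigma]
      refine ⟨mem_image_of_mem _ hp, ?_⟩
      exact mem_activeBonds_exchange.2 (mem_sigma.1 hp).2
    have b4 : ∑ q ∈ T.image e, ‖φ q.1‖ ^ 2 ≤ ∑ X ∈ S, ∑ _j ∈ activeBonds X, ‖φ X‖ ^ 2 := by
      rw [sum_sigma']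
      exact sum_le_sum_of_subset_of_nonneg b3 fun _ _ _ => by positivity
    have b5 : ∀ X ∈ S, ∑ _j ∈ activeBonds X, ‖φ X‖ ^ 2 ≤ 2 * N * ‖φ X‖ ^ 2 := by
      intro X hX
      obtain ⟨p, _, rfl⟩ := mem_image.1 hX
      have := card_activeBonds_le (exchange p.2 p.1.1)
      rw [card_exchange, p.1.2] at this
      rw [sum_const, nsmul_eq_mul]
      gcongr
      exact_mod_cast this
    rw [b1, b2]
    refine b4.trans ((sum_le_sum b5).trans ?_)
    rw [← mul_sum]
    gcongr
    exact sum_extend_le ψ S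
  have step3 : ∑ X ∈ s, ‖φ X.1‖ ^ 2 ≤ ‖ψ‖ ^ 2 := by
    have := sum_extend_le ψ (s.map (Function.Embedding.subtype _))
    rwa [sum_map] at this
  refine (sum_le_sum fun X _ => step1 X).trans ?_
  rw [sum_add_distrib, ← mul_sum, ← mul_sum]
  have c1 : 4 * (N : ℝ) * ∑ X ∈ s, ∑ j ∈ activeBonds X.1, ‖φ (exchange j X.1)‖ ^ 2 ≤
      4 * N * (2 * N * ‖ψ‖ ^ 2) := by gcongr
  have c2 : 8 * (N : ℝ) ^ 2 * Δ ^ 2 * ∑ X ∈ s, ‖φ X.1‖ ^ 2 ≤ 8 * N ^ 2 * Δ ^ 2 * ‖ψ‖ ^ 2 := by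
    gcongr
  linarith

/-- The XXZ Hamiltonian on the `N`-particle space; it is a bounded operator there. -/
def hamiltonian (N : ℕ) (Δ : ℝ) : Sector N →L[ℂ] Sector N :=
  LinearMap.mkContinuous
    { toFun := fun ψ => ⟨fun X => formalHamiltonian Δ (extend fun X => ψ X) X.1,
        memℓp_gen' (C := 8 * (N : ℝ) ^ 2 * (1 + Δ ^ 2) * ‖ψ‖ ^ 2) fun s => by
          simpa using sum_hamiltonian_le Δ ψ s⟩
      map_add' := fun ψ χ => by
        ext X
        simp only [formalHamiltonian_apply, lp.coeFn_add, Pi.add_apply, ← sum_add_distrib]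
        refine sum_congr rfl fun j _ => ?_
        simp only [extend, card_exchange, X.2, dite_true]
        ring
      map_smul' := fun c ψ => by
        ext X
        simp only [formalHamiltonian_apply, lp.coeFn_smul, Pi.smul_apply, smul_eq_mul, mul_sum,
          RingHom.id_apply]
        refine sum_congr rfl fun j _ => ?_
        simp only [extend, card_exchange, X.2, dite_true]
        ring }
    (Real.sqrt (8 * (N : ℝ) ^ 2 * (1 + Δ ^ 2)))
    (fun ψ => by
      have h2 : (0 : ℝ) < (2 : ENNReal).toReal := by norm_num
      refine lp.norm_le_of_forall_sum_le h2 (by positivity) fun s => ?_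
      have := sum_hamiltonian_le Δ ψ s
      simp only [ENNReal.toReal_ofNat, Real.rpow_ofNat, mul_pow,
        Real.sq_sqrt (show 0 ≤ 8 * (N : ℝ) ^ 2 * (1 + Δ ^ 2) by positivity)]
      exact this)

/-- The initial configuration `Y = {y_1 < ⋯ < y_N}`. -/
def initialConfig {N : ℕ} (y : Fin N → ℤ) (hy : StrictMono y) : Config N :=
  ⟨univ.map ⟨y, hy.injective⟩, by simp⟩

/-- `Ψ_N(t) = exp(-i t H) e_Y`, the solution of the Schrödinger equation `i ∂Ψ/∂t = H Ψ` with
`Ψ(0) = e_Y`. -/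
def wave (Δ : ℝ) {N : ℕ} (y : Fin N → ℤ) (hy : StrictMono y) (t : ℝ) : Sector N :=
  NormedSpace.exp ((-(Complex.I * t)) • hamiltonian N Δ) (lp.single 2 (initialConfig y hy) 1)

/-- The probability `𝒫_Y(x, m; t)` that at time `t` the `m`-th particle from the left
(counted from `0`) is at `x`. -/
def positionProb (Δ : ℝ) {N : ℕ} (y : Fin N → ℤ) (hy : StrictMono y) (t : ℝ) (m : Fin N)
    (x : ℤ) : ℝ :=
  ∑' X : Config N, if X.1.orderEmbOfFin X.2 m = x then ‖wave Δ y hy t X‖ ^ 2 else 0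

/-- `𝓕_N(x,t) = ℙ_Y(X_1(t) ≥ x) = ∑_{n ≥ x} 𝒫_Y(n, 1; t)`. -/
def leftmostTail (Δ : ℝ) {N : ℕ} (hN : 0 < N) (y : Fin N → ℤ) (hy : StrictMono y) (x : ℤ)
    (t : ℝ) : ℝ :=
  ∑' n : ℕ, positionProb Δ y hy t ⟨0, hN⟩ (x + n)

/-! ### Contours -/

/-- A contour: a list of pieces, each parametrized by `[0, 1]` and traversed in turn. -/
abbrev Contour : Type := List (ℝ → ℂ)

/-- The straight segment from `a` to `b`. -/
def segment (a b : ℂ) : ℝ → ℂ := fun s => a + s * (b - a)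

/-- The arc `c + r e^{iθ}`, with `θ` running from `α` to `β`. -/
def arc (c : ℂ) (r α β : ℝ) : ℝ → ℂ :=
  fun s => c + r * Complex.exp (Complex.I * (α + s * (β - α)))

/-- The contour integral; the differential incorporates the factor `(2πi)⁻¹`. -/
def contourIntegral (Γ : Contour) (F : ℂ → ℂ) : ℂ :=
  (2 * Real.pi * Complex.I)⁻¹ *
    (Γ.map fun γ => ∫ s in (0 : ℝ)..1, F (γ s) * deriv γ s).sum

/-- The iterated contour integral `∮_Γ ⋯ ∮_Γ F dv_{j_1} ⋯ dv_{j_m}` over the variables `v_j` with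
`j` in the list; the other variables keep the value given by the last argument. -/
def iteratedIntegral {ι : Type} [DecidableEq ι] (Γ : Contour) :
    List ι → ((ι → ℂ) → ℂ) → (ι → ℂ) → ℂ
  | [], F, v => F v
  | j :: l, F, v => contourIntegral Γ fun z => iteratedIntegral Γ l F (Function.update v j z)

/-- The contour `Γ_+`, counterclockwise: the horizontal line of height `3/2` from the circle of
radius `R` to `i + e^{iπ/6}`, the segments to `i` and on to `i + e^{5iπ/6}`, the horizontal line
back to the circle, and the arc of the circle with `Im z ≤ 3/2`. -/
def gammaPlus (R : ℝ) : Contour :=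
  [segment (Real.sqrt (R ^ 2 - 9 / 4) + 3 / 2 * Complex.I)
      (Complex.I + Complex.exp (Complex.I * Real.pi / 6)),
    segment (Complex.I + Complex.exp (Complex.I * Real.pi / 6)) Complex.I,
    segment Complex.I (Complex.I + Complex.exp (5 * Complex.I * Real.pi / 6)),
    segment (Complex.I + Complex.exp (5 * Complex.I * Real.pi / 6))
      (-Real.sqrt (R ^ 2 - 9 / 4) + 3 / 2 * Complex.I),
    arc 0 R (Real.pi - Real.arcsin (3 / (2 * R))) (2 * Real.pi + Real.arcsin (3 / (2 * R)))]

/-- The contour `Γ_-`, counterclockwise: the mirror image in the real axis of the above, with the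
arc of the circle with `Im z ≥ -3/2`. -/
def gammaMinus (R : ℝ) : Contour :=
  [segment (-Real.sqrt (R ^ 2 - 9 / 4) - 3 / 2 * Complex.I)
      (-Complex.I + Complex.exp (-(5 * Complex.I * Real.pi / 6))),
    segment (-Complex.I + Complex.exp (-(5 * Complex.I * Real.pi / 6))) (-Complex.I),
    segment (-Complex.I) (-Complex.I + Complex.exp (-(Complex.I * Real.pi / 6))),
    segment (-Complex.I + Complex.exp (-(Complex.I * Real.pi / 6)))
      (Real.sqrt (R ^ 2 - 9 / 4) - 3 / 2 * Complex.I),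
    arc 0 R (-Real.arcsin (3 / (2 * R))) (Real.pi + Real.arcsin (3 / (2 * R)))]

/-- The contour `Γ̂`, counterclockwise: the rectangle with corners `± L ± i`, `L = √(R² - 1)`, whose
upper side has an outward half-circle of radius `ε₁` around `i` and an inward half-circle of radius
`ε₂` around `i + 2Δ`. -/
def gammaHat (Δ R ε₁ ε₂ : ℝ) : Contour :=
  let L : ℂ := (Real.sqrt (R ^ 2 - 1) : ℝ)
  let i : ℂ := Complex.I
  let c : ℂ := i + 2 * Δ
  [segment (-L + i) (-L - i), segment (-L - i) (L - i), segment (L - i) (L + i)] ++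
    if 0 < Δ then
      [segment (L + i) (c + ε₂), arc c ε₂ 0 (-Real.pi), segment (c - ε₂) (i + ε₁),
        arc i ε₁ 0 Real.pi, segment (i - ε₁) (-L + i)]
    else
      [segment (L + i) (i + ε₁), arc i ε₁ 0 Real.pi, segment (i - ε₁) (c + ε₂),
        arc c ε₂ 0 (-Real.pi), segment (c - ε₂) (-L + i)]

/-! ### Index sets and integrands

A map `τ : {1,…,N} → {0,1,…,N}` is encoded as `τ : Fin N → Option (Fin N)`, with `none` in place
of `0`. -/

/-- `𝒯_n`: the maps with `|τ⁻¹(0)| = n` and `|τ⁻¹(k)| ≤ 1` for all `k ≠ 0`. -/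
def maps (N n : ℕ) : Finset (Fin N → Option (Fin N)) :=
  univ.filter fun τ => (univ.filter fun k => τ k = none).card = n ∧
    ∀ j : Fin N, (univ.filter fun k => τ k = some j).card ≤ 1

variable {N : ℕ}

/-- `K₁ = τ⁻¹(0)`. -/
def setK1 (τ : Fin N → Option (Fin N)) : Finset (Fin N) := univ.filter fun k => τ k = none

/-- `K₂`, the complement of `K₁`. -/
def setK2 (τ : Fin N → Option (Fin N)) : Finset (Fin N) := (setK1 τ)ᶜ

/-- `J₂ = τ(K₂)`. -/
def setJ2 (τ : Fin N → Option (Fin N)) : Finset (Fin N) :=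
  univ.filter fun j => ∃ k ∈ setK2 τ, τ k = some j

/-- `J₁`, the complement of `J₂`. -/
def setJ1 (τ : Fin N → Option (Fin N)) : Finset (Fin N) := (setJ2 τ)ᶜ

/-- The pairs `(k_ℓ, τ_ℓ)`, that is, `(k, τ(k))` with `k ∈ K₂`. -/
def graph (τ : Fin N → Option (Fin N)) : Finset (Fin N × Fin N) :=
  univ.filter fun q => τ q.1 = some q.2

/-- The number of inversions of `τ : K₂ → J₂`. -/
def inversions (τ : Fin N → Option (Fin N)) : ℕ :=
  ((graph τ ×ˢ graph τ).filter fun p => p.1.1 < p.2.1 ∧ p.2.2 < p.1.2).card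

/-- `d(x,y) = 1 / ((1 - xy)(x + y - 2Δxy))`. -/
def dKernel (Δ : ℝ) (x y : ℂ) : ℂ := 1 / ((1 - x * y) * (x + y - 2 * Δ * x * y))

/-- `ε(ξ) = ξ + 1/ξ - 2Δ`. -/
def energy (Δ : ℝ) (ξ : ℂ) : ℂ := ξ + 1 / ξ - 2 * Δ

/-- `det (a j k)` with `j ∈ J`, `k ∈ K` in increasing order, for index sets of the same size. -/
def minor (J K : Finset (Fin N)) (a : Fin N → Fin N → ℂ) : ℂ :=
  if h : J.card = K.card then
    Matrix.det (Matrix.of fun p q : Fin K.card => a (J.orderEmbOfFin h p) (K.orderEmbOfFin rfl q))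
  else 0

/-- `D_N(ξ,ζ;τ) = (-1)^{∑_ℓ (τ_ℓ - k_ℓ)} (-1)^{inv(τ)} det (d(ξ_j,ζ_k))_{j ∈ J₁, k ∈ K₁}`. -/
def detD (Δ : ℝ) (τ : Fin N → Option (Fin N)) (ξ ζ : Fin N → ℂ) : ℂ :=
  (-1) ^ (∑ q ∈ graph τ, (((q.2 : ℕ) : ℤ) - ((q.1 : ℕ) : ℤ))) * (-1) ^ inversions τ *
    minor (setJ1 τ) (setK1 τ) fun j k => dKernel Δ (ξ j) (ζ k)

/-- `I_N(ξ,ζ;τ)`. -/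
def integrandI (Δ : ℝ) (y : Fin N → ℤ) (x : ℤ) (t : ℝ) (τ : Fin N → Option (Fin N))
    (ξ ζ : Fin N → ℂ) : ℂ :=
  (∏ j ∈ setJ1 τ, ∏ k ∈ setK1 τ, (ξ j + ζ k - 2 * Δ * ξ j * ζ k)) * detD Δ τ ξ ζ /
      ((∏ j ∈ setJ1 τ, ∏ k ∈ setJ1 τ with j < k, (1 + ξ j * ξ k - 2 * Δ * ξ j)) *
        ∏ j ∈ setK1 τ, ∏ k ∈ setK1 τ with j < k, (1 + ζ j * ζ k - 2 * Δ * ζ j)) *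
    (∏ j ∈ setJ1 τ, ξ j ^ (x - y j - 1) * Complex.exp (-(Complex.I * t * energy Δ (ξ j)))) *
    ∏ k ∈ setK1 τ, ζ k ^ (x - y k - 1) * Complex.exp (Complex.I * t * energy Δ (ζ k))

/-- `f(ξ,ζ;τ)`. The first inner product is over the `k > τ_ℓ` other than `τ_{ℓ+1}, …, τ_M`, the
second one over the `k > k_ℓ` other than `k_{ℓ+1}, …, k_M`. -/
def integrandF (Δ : ℝ) (y : Fin N → ℤ) (τ : Fin N → Option (Fin N)) (ξ ζ : Fin N → ℂ) : ℂ :=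
  (∏ q ∈ graph τ,
    (∏ k : Fin N with q.2 < k ∧ ∀ q' ∈ graph τ, q.1 < q'.1 → k ≠ q'.2,
        (1 + ξ q.2 * ξ k - 2 * Δ * ξ k) / (1 + ξ q.2 * ξ k - 2 * Δ * ξ q.2)) *
      ∏ k : Fin N with q.1 < k ∧ ∀ q' ∈ graph τ, q.1 < q'.1 → k ≠ q'.1,
        (ξ q.2 + ζ k - 2 * Δ * ξ q.2 * ζ k) / (ξ q.2 + ζ k - 2 * Δ)) *
    ∏ q ∈ graph τ, ξ q.2 ^ (y q.1 - y q.2 - 1)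

/-- The term of the series that belongs to `τ`:
`∮_{Γ_+}⋯∮_{Γ_-} I_N(ξ,ζ;τ) (∮_Γ̂⋯∮_Γ̂ f(ξ,ζ;τ) d^{J₂}ξ) d^{K₁}ζ d^{J₁}ξ`. -/
def seriesTerm (Δ : ℝ) (y : Fin N → ℤ) (x : ℤ) (t R R' ε₁ ε₂ : ℝ)
    (τ : Fin N → Option (Fin N)) : ℂ :=
  iteratedIntegral (gammaPlus R) ((setJ1 τ).sort (· ≤ ·))
    (fun ξ => iteratedIntegral (gammaMinus R') ((setK1 τ).sort (· ≤ ·))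
      (fun ζ => integrandI Δ y x t τ ξ ζ *
        iteratedIntegral (gammaHat Δ R ε₁ ε₂) ((setJ2 τ).sort (· ≤ ·))
          (fun ξ' => integrandF Δ y τ ξ' ζ) ξ) 0) 0

end XXZ

end

noncomputable section

open Complex (I exp norm_real normSq_apply abs_im_le_norm abs_re_le_norm norm_ofNat sq_norm I_im norm_I)
open Function (update update_of_ne update_self uncurry update_apply update_idem update_eq_self comp_apply)
open Real (pi sqrt arcsin norm_eq_abs)
open Equiv.Perm (sign sign_swap)
open intervalIntegral (integral_congr integral_add integral_const_mul integral_smul)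
open Equiv (swap Perm swap_apply_left swap_apply_right swap_apply_of_ne_of_ne swap_apply_eq_iff)

namespace XXZ

/-! ### Contour integrals -/

/-- The points of a contour. -/
def trace (Γ : Contour) : Set ℂ := {z | ∃ γ ∈ Γ, ∃ s ∈ Set.Icc (0 : ℝ) 1, γ s = z}

/-- All pieces of the contour are continuously differentiable. -/
def IsSmooth (Γ : Contour) : Prop := ∀ γ ∈ Γ, ContDiff ℝ 1 γ

/-- The integral along one piece of a contour. -/
def pieceIntegral (γ : ℝ → ℂ) (F : ℂ → ℂ) : ℂ := ∫ s in (0 : ℝ)..1, F (γ s) * deriv γ s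

lemma contourIntegral_nil (F : ℂ → ℂ) : contourIntegral [] F = 0 := by
  simp [contourIntegral]

lemma contourIntegral_cons (γ : ℝ → ℂ) (Γ : Contour) (F : ℂ → ℂ) :
    contourIntegral (γ :: Γ) F =
      (2 * pi * I)⁻¹ * pieceIntegral γ F + contourIntegral Γ F := by
  simp [contourIntegral, pieceIntegral, mul_add]

lemma contourIntegral_append (Γ Γ' : Contour) (F : ℂ → ℂ) :
    contourIntegral (Γ ++ Γ') F = contourIntegral Γ F + contourIntegral Γ' F := by
  simp [contourIntegral, mul_add]

lemma mem_trace_cons {γ : ℝ → ℂ} {Γ : Contour} {z : ℂ} :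
    z ∈ trace (γ :: Γ) ↔ z ∈ γ '' Set.Icc (0 : ℝ) 1 ∨ z ∈ trace Γ := by
  simp [trace]

lemma trace_nil : trace [] = ∅ := by simp [trace]

lemma trace_cons (γ : ℝ → ℂ) (Γ : Contour) :
    trace (γ :: Γ) = γ '' Set.Icc (0 : ℝ) 1 ∪ trace Γ := by
  ext z; exact mem_trace_cons

lemma trace_append (Γ Γ' : Contour) : trace (Γ ++ Γ') = trace Γ ∪ trace Γ' := by
  induction Γ with
  | nil => simp [trace_nil]
  | cons γ Γ ih => rw [List.cons_append, trace_cons, ih, trace_cons, Set.union_assoc]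

lemma isSmooth_cons {γ : ℝ → ℂ} {Γ : Contour} :
    IsSmooth (γ :: Γ) ↔ ContDiff ℝ 1 γ ∧ IsSmooth Γ := by
  simp [IsSmooth]

lemma isSmooth_append {Γ Γ' : Contour} : IsSmooth (Γ ++ Γ') ↔ IsSmooth Γ ∧ IsSmooth Γ' := by
  simp only [IsSmooth, List.mem_append, or_imp, forall_and]

lemma isSmooth_nil : IsSmooth [] := by simp [IsSmooth]

lemma pieceIntegral_congr {γ : ℝ → ℂ} {F G : ℂ → ℂ}
    (h : ∀ z ∈ γ '' Set.Icc (0 : ℝ) 1, F z = G z) : pieceIntegral γ F = pieceIntegral γ G := by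
  refine integral_congr fun s hs => ?_
  rw [Set.uIcc_of_le zero_le_one] at hs
  simp only [h (γ s) ⟨s, hs, rfl⟩]

lemma contourIntegral_congr {Γ : Contour} {F G : ℂ → ℂ} (h : ∀ z ∈ trace Γ, F z = G z) :
    contourIntegral Γ F = contourIntegral Γ G := by
  induction Γ with
  | nil => simp [contourIntegral_nil]
  | cons γ Γ ih =>
    rw [contourIntegral_cons, contourIntegral_cons, ih fun z hz => h z (mem_trace_cons.2 (.inr hz)),
      pieceIntegral_congr fun z hz => h z (mem_trace_cons.2 (.inl hz))]

lemma countable_passages {γ : ℝ → ℂ} (hγ : ContDiff ℝ 1 γ) (z : ℂ) :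
    {s | γ s = z ∧ deriv γ s ≠ 0}.Countable := by
  refine (countable_setOfPred_isolated_right_within
    (s := {s | γ s = z ∧ deriv γ s ≠ 0})).mono ?_
  intro s hs
  refine ⟨hs, ?_⟩
  have hd : HasDerivAt γ (deriv γ s) s := (hγ.differentiable one_ne_zero s).hasDerivAt
  have := hd.eventually_ne (c := z) hs.2
  rw [← Filter.empty_mem_iff_bot, mem_nhdsWithin_iff_eventually]
  rw [eventually_nhdsWithin_iff] at this
  filter_upwards [this] with u hu hu'
  exact hu (ne_of_gt hu'.2) hu'.1.1

lemma contourIntegral_congr_off_countable {Γ : Contour} (hΓ : IsSmooth Γ) {B : Set ℂ}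
    (hB : B.Countable) {F G : ℂ → ℂ} (h : ∀ z ∈ trace Γ, z ∉ B → F z = G z) :
    contourIntegral Γ F = contourIntegral Γ G := by
  induction Γ with
  | nil => simp [contourIntegral_nil]
  | cons γ Γ ih =>
    rw [isSmooth_cons] at hΓ
    rw [contourIntegral_cons, contourIntegral_cons,
      ih hΓ.2 fun z hz => h z (mem_trace_cons.2 (.inr hz))]
    congr 2
    refine intervalIntegral.integral_congr_ae ?_
    have hc : (⋃ z ∈ B, {s | γ s = z ∧ deriv γ s ≠ 0}).Countable :=
      hB.biUnion fun z _ => countable_passages hΓ.1 z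
    filter_upwards [hc.ae_notMem MeasureTheory.volume] with s hs hs'
    rw [Set.uIoc_of_le zero_le_one] at hs'
    by_cases hd : deriv γ s = 0
    · simp [hd]
    · rw [h (γ s) (mem_trace_cons.2 (.inl ⟨s, Set.Ioc_subset_Icc_self hs', rfl⟩)) fun hz =>
        hs (Set.mem_biUnion hz ⟨rfl, hd⟩)]

lemma intervalIntegrable_piece {γ : ℝ → ℂ} (hγ : ContDiff ℝ 1 γ) {F : ℂ → ℂ}
    (hF : ContinuousOn F (γ '' Set.Icc (0 : ℝ) 1)) :
    IntervalIntegrable (fun s => F (γ s) * deriv γ s) MeasureTheory.volume 0 1 := by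
  refine ContinuousOn.intervalIntegrable ?_
  rw [Set.uIcc_of_le zero_le_one]
  exact (hF.comp hγ.continuous.continuousOn (Set.mapsTo_image _ _)).mul
    (hγ.continuous_deriv le_rfl).continuousOn

lemma contourIntegral_add {Γ : Contour} (hΓ : IsSmooth Γ) {F G : ℂ → ℂ}
    (hF : ContinuousOn F (trace Γ)) (hG : ContinuousOn G (trace Γ)) :
    contourIntegral Γ (fun z => F z + G z) = contourIntegral Γ F + contourIntegral Γ G := by
  induction Γ with
  | nil => simp [contourIntegral_nil]
  | cons γ Γ ih =>
    rw [isSmooth_cons] at hΓ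
    rw [trace_cons] at hF hG
    rw [contourIntegral_cons, contourIntegral_cons, contourIntegral_cons,
      ih hΓ.2 (hF.mono Set.subset_union_right) (hG.mono Set.subset_union_right)]
    have : pieceIntegral γ (fun z => F z + G z) = pieceIntegral γ F + pieceIntegral γ G := by
      simp only [pieceIntegral, add_mul]
      exact integral_add
        (intervalIntegrable_piece hΓ.1 (hF.mono Set.subset_union_left))
        (intervalIntegrable_piece hΓ.1 (hG.mono Set.subset_union_left))
    rw [this]; ring

lemma contourIntegral_const_mul (Γ : Contour) (c : ℂ) (F : ℂ → ℂ) :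
    contourIntegral Γ (fun z => c * F z) = c * contourIntegral Γ F := by
  induction Γ with
  | nil => simp [contourIntegral_nil]
  | cons γ Γ ih =>
    rw [contourIntegral_cons, contourIntegral_cons, ih]
    have : pieceIntegral γ (fun z => c * F z) = c * pieceIntegral γ F := by
      simp only [pieceIntegral, mul_assoc, integral_const_mul]
    rw [this]; ring

lemma contourIntegral_zero (Γ : Contour) : contourIntegral Γ (fun _ => 0) = 0 := by
  simpa using contourIntegral_const_mul Γ 0 fun _ => 0

lemma contourIntegral_sum {Γ : Contour} (hΓ : IsSmooth Γ) {α : Type*} (A : Finset α)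
    {F : α → ℂ → ℂ} (hF : ∀ a ∈ A, ContinuousOn (F a) (trace Γ)) :
    contourIntegral Γ (fun z => ∑ a ∈ A, F a z) = ∑ a ∈ A, contourIntegral Γ (F a) := by
  classical
  induction A using Finset.induction_on with
  | empty => simpa using contourIntegral_zero Γ
  | insert a A ha ih =>
    simp only [Finset.sum_insert ha]
    rw [contourIntegral_add hΓ (hF a (mem_insert_self _ _)),
      ih fun b hb => hF b (mem_insert_of_mem hb)]
    exact continuousOn_finsetSum _ fun b hb => hF b (mem_insert_of_mem hb)

/-- Continuous dependence of contour integrals on parameters. -/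
lemma continuousOn_contourIntegral {X : Type*} [TopologicalSpace X] {Γ : Contour}
    (hΓ : IsSmooth Γ) {S : Set X} {f : X → ℂ → ℂ}
    (hf : ContinuousOn (uncurry f) (S ×ˢ trace Γ)) :
    ContinuousOn (fun x => contourIntegral Γ (f x)) S := by
  induction Γ with
  | nil => simpa [contourIntegral_nil] using continuousOn_const
  | cons γ Γ ih =>
    rw [isSmooth_cons] at hΓ
    rw [trace_cons] at hf
    simp only [contourIntegral_cons]
    refine (continuousOn_const.mul ?_).add
      (ih hΓ.2 (hf.mono (Set.prod_mono le_rfl Set.subset_union_right)))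
    rw [continuousOn_iff_continuous_domRestrict]
    let cl : ℝ → ℝ := fun s => (Set.projIcc (0 : ℝ) 1 zero_le_one s : ℝ)
    have hcl : Continuous cl := continuous_subtype_val.comp continuous_projIcc
    have e : S.domRestrict (fun x => pieceIntegral γ (f x)) =
        fun x : S => ∫ s in (0 : ℝ)..1, f x (γ (cl s)) * deriv γ (cl s) := by
      funext x
      refine integral_congr fun s hs => ?_
      rw [Set.uIcc_of_le zero_le_one] at hs
      simp only [cl, Set.projIcc_of_mem _ hs]
    rw [e]
    refine intervalIntegral.continuous_parametric_intervalIntegral_of_continuous' ?_ 0 1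
    refine Continuous.mul ?_ ((hΓ.1.continuous_deriv le_rfl).comp (hcl.comp continuous_snd))
    have : (fun p : S × ℝ => f p.1 (γ (cl p.2))) =
        uncurry f ∘ fun p : S × ℝ => ((p.1 : X), γ (cl p.2)) := rfl
    show Continuous fun p : S × ℝ => f p.1 (γ (cl p.2))
    rw [this]
    refine hf.comp_continuous ?_ fun p => ⟨p.1.2, .inl ⟨cl p.2, Subtype.coe_prop _, rfl⟩⟩
    exact (continuous_subtype_val.comp continuous_fst).prodMk
      (hΓ.1.continuous.comp (hcl.comp continuous_snd))

/-- Fubini's theorem for contour integrals. -/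
lemma contourIntegral_swap {Γ Γ' : Contour} (hΓ : IsSmooth Γ) (hΓ' : IsSmooth Γ') {G : ℂ → ℂ → ℂ}
    (hG : ContinuousOn (uncurry G) (trace Γ ×ˢ trace Γ')) :
    contourIntegral Γ (fun z => contourIntegral Γ' fun w => G z w) =
      contourIntegral Γ' fun w => contourIntegral Γ fun z => G z w := by
  have hG' : ContinuousOn (uncurry fun w z => G z w) (trace Γ' ×ˢ trace Γ) :=
    hG.comp continuous_swap.continuousOn fun p hp => ⟨hp.2, hp.1⟩
  induction Γ with
  | nil => simp [contourIntegral_nil, contourIntegral_zero]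
  | cons γ Γ ih =>
    rw [isSmooth_cons] at hΓ
    simp only [contourIntegral_cons]
    rw [trace_cons] at hG hG'
    rw [ih hΓ.2 (hG.mono (Set.prod_mono Set.subset_union_right le_rfl))
      (hG'.mono (Set.prod_mono le_rfl Set.subset_union_right))]
    have h1 : ContinuousOn (fun w => pieceIntegral γ fun z => G z w) (trace Γ') := by
      have := continuousOn_contourIntegral (Γ := [γ]) (S := trace Γ') (f := fun w z => G z w)
        (by simpa [IsSmooth] using hΓ.1) (hG'.mono (Set.prod_mono le_rfl (by
          rw [trace_cons, trace_nil, Set.union_empty]; exact Set.subset_union_left)))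
      simp only [contourIntegral_cons, contourIntegral_nil, add_zero] at this
      have h2 := this.const_smul (2 * pi * I : ℂ)
      refine h2.congr fun w _ => ?_
      have : (2 * pi * I : ℂ) ≠ 0 := Complex.two_pi_I_ne_zero
      exact (mul_inv_cancel_left₀ this _).symm
    rw [contourIntegral_add hΓ', contourIntegral_const_mul]
    rotate_left
    · exact continuousOn_const.mul h1
    · exact continuousOn_contourIntegral hΓ.2
        (hG'.mono (Set.prod_mono le_rfl Set.subset_union_right))
    congr 2
    clear ih hG' h1
    replace hG := hG.mono (Set.prod_mono Set.subset_union_left (le_refl (trace Γ')))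
    induction Γ' with
    | nil => simp [contourIntegral_nil, pieceIntegral]
    | cons δ Γ' ih =>
      rw [isSmooth_cons] at hΓ'
      rw [trace_cons] at hG
      have hGδ := hG.mono (Set.prod_mono (le_refl (γ '' Set.Icc (0 : ℝ) 1)) Set.subset_union_left)
      have hGΓ := hG.mono (Set.prod_mono (le_refl (γ '' Set.Icc (0 : ℝ) 1)) Set.subset_union_right)
      rw [contourIntegral_cons, ← ih hΓ'.2 hGΓ]
      have hc : ContinuousOn (fun z => pieceIntegral δ fun w => G z w)
          (γ '' Set.Icc (0 : ℝ) 1) := by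
        have := continuousOn_contourIntegral (Γ := [δ]) (S := γ '' Set.Icc (0 : ℝ) 1)
          (f := fun z w => G z w)
          (by simpa [IsSmooth] using hΓ'.1) (hGδ.mono (Set.prod_mono le_rfl (by
            rw [trace_cons, trace_nil, Set.union_empty])))
        simp only [contourIntegral_cons, contourIntegral_nil, add_zero] at this
        have h2 := this.const_smul (2 * pi * I : ℂ)
        refine h2.congr fun w _ => ?_
        have : (2 * pi * I : ℂ) ≠ 0 := Complex.two_pi_I_ne_zero
        exact (mul_inv_cancel_left₀ this _).symm
      have hadd : pieceIntegral γ (fun z => contourIntegral (δ :: Γ') fun w => G z w) =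
          (2 * pi * I)⁻¹ * pieceIntegral γ (fun z => pieceIntegral δ fun w => G z w)
            + pieceIntegral γ fun z => contourIntegral Γ' fun w => G z w := by
        simp only [contourIntegral_cons]
        simp only [pieceIntegral, add_mul, mul_assoc]
        rw [← integral_const_mul, ← integral_add]
        · have := (intervalIntegrable_piece hΓ.1 hc).const_mul (2 * pi * I)⁻¹
          simpa [pieceIntegral, mul_assoc] using this
        · exact intervalIntegrable_piece hΓ.1 (continuousOn_contourIntegral hΓ'.2 hGΓ)
      rw [hadd]
      congr 2
      simp only [pieceIntegral, ← intervalIntegral.integral_mul_const]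
      rw [MeasureTheory.intervalIntegral_intervalIntegral_swap]
      · refine integral_congr fun s _ => ?_
        refine integral_congr fun u _ => ?_
        ring
      · refine MeasureTheory.IntegrableOn.mono_set (t := Set.Icc 0 1 ×ˢ Set.Icc 0 1) ?_
          (Set.prod_mono ?_ ?_)
        · refine ContinuousOn.integrableOn_compact (isCompact_Icc.prod isCompact_Icc) ?_
          refine ContinuousOn.mul (ContinuousOn.mul ?_ ?_) ?_
          · exact hGδ.comp (f := fun p : ℝ × ℝ => (γ p.1, δ p.2))
              (Continuous.continuousOn (by
                have := hΓ.1.continuous; have := hΓ'.1.continuous; fun_prop))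
              fun p hp => ⟨⟨p.1, hp.1, rfl⟩, ⟨p.2, hp.2, rfl⟩⟩
          · exact ((hΓ'.1.continuous_deriv le_rfl).comp continuous_snd).continuousOn
          · exact ((hΓ.1.continuous_deriv le_rfl).comp continuous_fst).continuousOn
        · rw [Set.uIoc_of_le zero_le_one]; exact Set.Ioc_subset_Icc_self
        · rw [Set.uIoc_of_le zero_le_one]; exact Set.Ioc_subset_Icc_self

end XXZ

namespace XXZ

/-! ### Iterated contour integrals -/

set_option linter.unusedSectionVars false

variable {ι : Type} [DecidableEq ι]

/-- The iterated contour integral with a contour for each variable. -/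
def iter (Γ : ι → Contour) : List ι → ((ι → ℂ) → ℂ) → (ι → ℂ) → ℂ
  | [], F, v => F v
  | j :: l, F, v => contourIntegral (Γ j) fun z => iter Γ l F (update v j z)

/-- The points whose coordinates outside the list lie in the given sets. -/
def offBox (l : List ι) (T : ι → Set ℂ) : Set (ι → ℂ) := {v | ∀ j, j ∉ l → v j ∈ T j}

lemma mem_offBox_nil {T : ι → Set ℂ} {v : ι → ℂ} : v ∈ offBox [] T ↔ ∀ j, v j ∈ T j := by
  simp [offBox]

lemma update_mem_offBox {l : List ι} {T : ι → Set ℂ} {v : ι → ℂ} {j : ι} {z : ℂ}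
    (hv : v ∈ offBox (j :: l) T) (hz : z ∈ T j) : update v j z ∈ offBox l T := by
  intro k hk
  by_cases h : k = j
  · subst h; simpa using hz
  · rw [update_of_ne h]
    exact hv k (by simp [h, hk])

lemma iter_congr {Γ : ι → Contour} {T : ι → Set ℂ} {l : List ι}
    (hT : ∀ j ∈ l, trace (Γ j) ⊆ T j) {F G : (ι → ℂ) → ℂ} (h : ∀ v ∈ offBox [] T, F v = G v)
    {v : ι → ℂ} (hv : v ∈ offBox l T) : iter Γ l F v = iter Γ l G v := by
  induction l generalizing v with
  | nil => exact h v hv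
  | cons j l ih =>
    exact contourIntegral_congr fun z hz => ih (fun k hk => hT k (.tail _ hk))
      (update_mem_offBox hv (hT j (.head _) hz))

lemma iter_congr_contour {Γ Γ' : ι → Contour} {l : List ι} (h : ∀ j ∈ l, Γ j = Γ' j)
    (F : (ι → ℂ) → ℂ) (v : ι → ℂ) : iter Γ l F v = iter Γ' l F v := by
  induction l generalizing v with
  | nil => rfl
  | cons j l ih =>
    simp only [iter, h j (.head _)]
    congr 1
    funext z
    exact ih (fun k hk => h k (.tail _ hk)) _

lemma iter_append (Γ : ι → Contour) (l l' : List ι) (F : (ι → ℂ) → ℂ) (v : ι → ℂ) :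
    iter Γ (l ++ l') F v = iter Γ l (iter Γ l' F) v := by
  induction l generalizing v with
  | nil => rfl
  | cons j l ih => simp only [List.cons_append, iter, ih]

lemma iter_const_mul (Γ : ι → Contour) (l : List ι) (c : ℂ) (F : (ι → ℂ) → ℂ) (v : ι → ℂ) :
    iter Γ l (fun v => c * F v) v = c * iter Γ l F v := by
  induction l generalizing v with
  | nil => rfl
  | cons j l ih => simp only [iter, ih, contourIntegral_const_mul]

lemma iter_zero (Γ : ι → Contour) (l : List ι) (v : ι → ℂ) : iter Γ l (fun _ => 0) v = 0 := by
  simpa using iter_const_mul Γ l 0 (fun _ => 0) v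

/-- Variables outside the list are parameters. -/
lemma iter_mul_of_indep (Γ : ι → Contour) (l : List ι) (g F : (ι → ℂ) → ℂ) (v : ι → ℂ)
    (hg : ∀ v, ∀ j ∈ l, ∀ z, g (update v j z) = g v) :
    iter Γ l (fun v => g v * F v) v = g v * iter Γ l F v := by
  induction l generalizing v with
  | nil => rfl
  | cons j l ih =>
    simp only [iter]
    rw [← contourIntegral_const_mul]
    congr 1
    funext z
    rw [ih _ fun v k hk => hg v k (.tail _ hk), hg v j (.head _)]

lemma continuousOn_update {X : Type*} [TopologicalSpace X] (j : ι) (l : List ι)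
    (T : ι → Set ℂ) (A : Set X) {Γ : Contour} (hT : trace Γ ⊆ T j) :
    ContinuousOn (fun q : (X × (ι → ℂ)) × ℂ => (q.1.1, update q.1.2 j q.2))
      ((A ×ˢ offBox (j :: l) T) ×ˢ trace Γ) ∧
    Set.MapsTo (fun q : (X × (ι → ℂ)) × ℂ => (q.1.1, update q.1.2 j q.2))
      ((A ×ˢ offBox (j :: l) T) ×ˢ trace Γ) (A ×ˢ offBox l T) := by
  refine ⟨Continuous.continuousOn ?_, fun q hq => ⟨hq.1.1, update_mem_offBox hq.1.2 (hT hq.2)⟩⟩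
  exact (continuous_fst.comp continuous_fst).prodMk
    ((continuous_snd.comp continuous_fst).update j continuous_snd)

lemma continuousOn_iter_param {X : Type*} [TopologicalSpace X] {A : Set X} {Γ : ι → Contour}
    {T : ι → Set ℂ} {l : List ι} (hs : ∀ j ∈ l, IsSmooth (Γ j)) (hT : ∀ j ∈ l, trace (Γ j) ⊆ T j)
    {F : X → (ι → ℂ) → ℂ} (hF : ContinuousOn (uncurry F) (A ×ˢ offBox [] T)) :
    ContinuousOn (fun q : X × (ι → ℂ) => iter Γ l (F q.1) q.2) (A ×ˢ offBox l T) := by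
  induction l with
  | nil => exact hF
  | cons j l ih =>
    have := ih (fun k hk => hs k (.tail _ hk))
      fun k hk => hT k (.tail _ hk)
    obtain ⟨h1, h2⟩ := continuousOn_update (X := X) j l T A (hT j (.head _))
    exact continuousOn_contourIntegral (hs j (.head _))
      (f := fun (q : X × (ι → ℂ)) z => iter Γ l (F q.1) (update q.2 j z))
      (this.comp h1 h2)

lemma continuousOn_iter {Γ : ι → Contour}
    {T : ι → Set ℂ} {l : List ι} (hs : ∀ j ∈ l, IsSmooth (Γ j)) (hT : ∀ j ∈ l, trace (Γ j) ⊆ T j)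
    {F : (ι → ℂ) → ℂ} (hF : ContinuousOn F (offBox [] T)) :
    ContinuousOn (iter Γ l F) (offBox l T) := by
  have := continuousOn_iter_param (X := Unit) (A := Set.univ) hs hT (F := fun _ => F)
    (hF.comp continuousOn_snd fun q hq => hq.2)
  exact this.comp (f := fun v => ((), v)) (by fun_prop) fun v hv => ⟨trivial, hv⟩

lemma continuousOn_iter_slice {Γ : ι → Contour} {T : ι → Set ℂ} {j : ι} {l : List ι}
    (hs : ∀ j ∈ l, IsSmooth (Γ j)) (hT : ∀ k ∈ l, trace (Γ k) ⊆ T k)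
    {F : (ι → ℂ) → ℂ} (hF : ContinuousOn F (offBox [] T)) {v : ι → ℂ}
    (hv : v ∈ offBox (j :: l) T) :
    ContinuousOn (fun z => iter Γ l F (update v j z)) (T j) :=
  (continuousOn_iter hs hT hF).comp (f := fun z => update v j z)
    ((continuous_const (y := v)).update j continuous_id).continuousOn
    fun _ hz => update_mem_offBox hv hz

lemma iter_sum {Γ : ι → Contour} {T : ι → Set ℂ} {l : List ι} (hs : ∀ j ∈ l, IsSmooth (Γ j))
    (hT : ∀ j ∈ l, trace (Γ j) ⊆ T j) {α : Type*} (A : Finset α) {F : α → (ι → ℂ) → ℂ}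
    (hF : ∀ a ∈ A, ContinuousOn (F a) (offBox [] T)) {v : ι → ℂ} (hv : v ∈ offBox l T) :
    iter Γ l (fun v => ∑ a ∈ A, F a v) v = ∑ a ∈ A, iter Γ l (F a) v := by
  induction l generalizing v with
  | nil => rfl
  | cons j l ih =>
    have hs' : ∀ k ∈ l, IsSmooth (Γ k) := fun k hk => hs k (.tail _ hk)
    have hT' : ∀ k ∈ l, trace (Γ k) ⊆ T k := fun k hk => hT k (.tail _ hk)
    simp only [iter]
    rw [← contourIntegral_sum (hs j (.head _))]
    · exact contourIntegral_congr fun z hz => ih hs' hT'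
        (update_mem_offBox hv (hT j (.head _) hz))
    · exact fun a ha => (continuousOn_iter_slice hs' hT' (hF a ha) hv).mono
        (hT j (.head _))

lemma iter_add {Γ : ι → Contour} {T : ι → Set ℂ} {l : List ι} (hs : ∀ j ∈ l, IsSmooth (Γ j))
    (hT : ∀ j ∈ l, trace (Γ j) ⊆ T j) {F G : (ι → ℂ) → ℂ} (hF : ContinuousOn F (offBox [] T))
    (hG : ContinuousOn G (offBox [] T)) {v : ι → ℂ} (hv : v ∈ offBox l T) :
    iter Γ l (fun v => F v + G v) v = iter Γ l F v + iter Γ l G v := by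
  have := iter_sum hs hT (univ : Finset Bool) (F := fun b => if b then F else G)
    (by rintro (_ | _) _ <;> simpa) hv
  simpa using this

lemma iter_cons_cons_comm {Γ : ι → Contour} {T : ι → Set ℂ} {a b : ι} {l : List ι}
    (hs : ∀ j ∈ a :: b :: l, IsSmooth (Γ j)) (hT : ∀ j ∈ a :: b :: l, trace (Γ j) ⊆ T j)
    {F : (ι → ℂ) → ℂ} (hF : ContinuousOn F (offBox [] T)) {v : ι → ℂ}
    (hv : v ∈ offBox (a :: b :: l) T) :
    iter Γ (a :: b :: l) F v = iter Γ (b :: a :: l) F v := by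
  by_cases hab : a = b
  · rw [hab]
  simp only [List.mem_cons, forall_eq_or_imp] at hs hT
  simp only [iter]
  rw [contourIntegral_swap hs.1 hs.2.1]
  · congr 1; funext w; congr 1; funext z
    rw [Function.update_comm hab]
  · refine (continuousOn_iter hs.2.2 hT.2.2 hF).comp
      (f := fun p : ℂ × ℂ => update (update v a p.1) b p.2)
      (Continuous.continuousOn ?_) fun p hp => ?_
    · exact ((continuous_const (y := v)).update a continuous_fst).update b continuous_snd
    · exact update_mem_offBox (update_mem_offBox hv (hT.1 hp.1)) (hT.2.1 hp.2)

lemma offBox_perm {l l' : List ι} (h : l.Perm l') (T : ι → Set ℂ) : offBox l T = offBox l' T := by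
  ext v; simp only [offBox, Set.mem_ofPred_eq, h.mem_iff]

lemma iter_perm {Γ : ι → Contour} {T : ι → Set ℂ} {l l' : List ι} (h : l.Perm l')
    (hs : ∀ j ∈ l, IsSmooth (Γ j)) (hT : ∀ j ∈ l, trace (Γ j) ⊆ T j)
    {F : (ι → ℂ) → ℂ} (hF : ContinuousOn F (offBox [] T)) {v : ι → ℂ} (hv : v ∈ offBox l T) :
    iter Γ l F v = iter Γ l' F v := by
  induction h generalizing v with
  | nil => rfl
  | cons j _ ih =>
    exact contourIntegral_congr fun z hz => ih (fun k hk => hs k (.tail _ hk))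
      (fun k hk => hT k (.tail _ hk))
      (update_mem_offBox hv (hT j (.head _) hz))
  | swap a b l => exact iter_cons_cons_comm hs hT hF hv
  | trans h1 h2 ih1 ih2 =>
    rw [ih1 hs hT hv, ih2 (fun k hk => hs k (h1.mem_iff.2 hk)) (fun k hk => hT k (h1.mem_iff.2 hk))
      (by rwa [← offBox_perm h1])]

/-- Replacing the contour of one variable. -/
lemma iter_replace {Γ : ι → Contour} {T : ι → Set ℂ} {l : List ι} {i : ι} (hi : i ∈ l)
    (hl : l.Nodup) {C : Contour} {S : Set ℂ} (hs : ∀ j ∈ l, IsSmooth (Γ j)) (hC : IsSmooth C)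
    (hT : ∀ j ∈ l, trace (Γ j) ⊆ T j) (hS : trace C ⊆ S)
    {F : (ι → ℂ) → ℂ} (hF : ContinuousOn F (offBox [] T))
    (hF' : ContinuousOn F (offBox [] (update T i S)))
    (h : ∀ v ∈ offBox [i] T, contourIntegral (Γ i) (fun z => F (update v i z)) =
      contourIntegral C fun z => F (update v i z))
    {v : ι → ℂ} (hv : v ∈ offBox l T) :
    iter Γ l F v = iter (update Γ i C) l F v := by
  have hp : l.Perm (l.erase i ++ [i]) :=
    (List.perm_cons_erase hi).trans (List.perm_append_singleton _ _).symm
  have hi' : i ∉ l.erase i := hl.not_mem_erase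
  have hv' : v ∈ offBox l (update T i S) := fun j hj => by
    have e : j ≠ i := by rintro rfl; exact hj hi
    rw [update_of_ne e]
    exact hv j hj
  rw [iter_perm hp hs hT hF hv, iter_perm (T := update T i S) hp ?_ ?_ hF' hv', iter_append,
    iter_append, iter_congr_contour (Γ := update Γ i C) (Γ' := Γ) fun j hj =>
      update_of_ne (by rintro rfl; exact hi' hj) _ _]
  · have hv2 : v ∈ offBox (l.erase i) fun j => if j = i then Set.univ else T j := by
      intro j hj
      by_cases e : j = i
      · simp [e]
      · simp only [e, if_false]
        exact hv j fun hj' => hj ((List.mem_erase_of_ne e).2 hj')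
    refine iter_congr (T := fun j => if j = i then Set.univ else T j) (fun j hj => ?_) ?_ hv2
    · rw [if_neg (by rintro rfl; exact hi' hj)]
      exact hT j (List.mem_of_mem_erase hj)
    · intro w hw
      simp only [iter, update_self]
      refine h w fun j hj => ?_
      have := mem_offBox_nil.1 hw j
      rwa [if_neg (by simpa using hj)] at this
  · intro j hj
    by_cases e : j = i
    · subst e; simpa using hC
    · rw [update_of_ne e]; exact hs j hj
  · intro j hj
    by_cases e : j = i
    · subst e; simpa using hS
    · rw [update_of_ne e, update_of_ne e]; exact hT j hj

/-- An iterated integral vanishes if the integral over one of the variables does. -/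
lemma iter_eq_zero {Γ : ι → Contour} {T : ι → Set ℂ} {l : List ι} {l' : List ι}
    (hp : ∃ l₀, l.Perm (l₀ ++ l')) (hs : ∀ j ∈ l, IsSmooth (Γ j))
    (hT : ∀ j ∈ l, trace (Γ j) ⊆ T j) {F : (ι → ℂ) → ℂ} (hF : ContinuousOn F (offBox [] T))
    (h : ∀ v ∈ offBox l' T, iter Γ l' F v = 0) {v : ι → ℂ} (hv : v ∈ offBox l T) :
    iter Γ l F v = 0 := by
  obtain ⟨l₀, hp⟩ := hp
  rw [iter_perm hp hs hT hF hv, iter_append]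
  have hv' : v ∈ offBox l₀ fun j => if j ∈ l' then Set.univ else T j := by
    intro j hj
    by_cases e : j ∈ l'
    · simp [e]
    · simp only [e, if_false]
      exact hv j fun hj' => by
        rcases List.mem_append.1 (hp.mem_iff.1 hj') with h1 | h1
        exacts [hj h1, e h1]
  rw [iter_congr (T := fun j => if j ∈ l' then Set.univ else T j) (G := fun _ => 0) ?_ ?_ hv',
    iter_zero]
  · intro j hj
    by_cases e : j ∈ l'
    · simp [e]
    · simp only [e, if_false]
      exact hT j (hp.mem_iff.2 (List.mem_append_left _ hj))
  · intro w hw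
    refine h w fun j hj => ?_
    have := mem_offBox_nil.1 hw j
    rwa [if_neg hj] at this

/-- Relabelling the variables. -/
lemma iter_map {κ : Type} [DecidableEq κ] (e : κ ≃ ι) (Γ : ι → Contour) (l : List κ)
    (F : (ι → ℂ) → ℂ) (v : ι → ℂ) :
    iter Γ (l.map e) F v = iter (Γ ∘ e) l (fun u => F (u ∘ e.symm)) (v ∘ e) := by
  induction l generalizing v with
  | nil => simp [iter, Function.comp_assoc]
  | cons j l ih =>
    simp only [List.map_cons, iter, ih, comp_apply]
    congr 1; funext z
    congr 1
    rw [Function.update_comp_eq_of_injective _ e.injective]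

/-- A bound for iterated integrals. -/
lemma exists_bound (Γ : Contour) (hΓ : IsSmooth Γ) : ∃ c : ℝ, 0 ≤ c ∧ ∀ (F : ℂ → ℂ) (C : ℝ),
    (∀ z ∈ trace Γ, ‖F z‖ ≤ C) → ‖contourIntegral Γ F‖ ≤ c * C := by
  induction Γ with
  | nil => exact ⟨0, le_rfl, fun F C _ => by simp [contourIntegral_nil]⟩
  | cons γ Γ ih =>
    rw [isSmooth_cons] at hΓ
    obtain ⟨c, hc, h⟩ := ih hΓ.2
    obtain ⟨m, hm⟩ := isCompact_Icc.exists_bound_of_continuousOn (s := Set.Icc (0 : ℝ) 1)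
      (hΓ.1.continuous_deriv le_rfl).continuousOn
    have hm0 : 0 ≤ m := (norm_nonneg _).trans (hm 0 ⟨le_rfl, zero_le_one⟩)
    refine ⟨‖(2 * pi * I : ℂ)⁻¹‖ * m + c, by positivity, fun F C hF => ?_⟩
    rw [contourIntegral_cons, add_mul]
    refine (norm_add_le _ _).trans (add_le_add ?_ (h F C fun z hz => hF z (mem_trace_cons.2 (.inr hz))))
    rw [norm_mul, mul_assoc _ m C]
    gcongr
    have := intervalIntegral.norm_integral_le_of_norm_le_const (a := 0) (b := 1) (C := m * C)
      (f := fun s => F (γ s) * deriv γ s) fun s hs => by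
        rw [Set.uIoc_of_le zero_le_one] at hs
        have hs' := Set.Ioc_subset_Icc_self hs
        rw [norm_mul, mul_comm]
        exact mul_le_mul (hm s hs') (hF _ (mem_trace_cons.2 (.inl ⟨s, hs', rfl⟩)))
          (norm_nonneg _) hm0
    simp only [sub_zero, abs_one, mul_one] at this
    exact this

lemma exists_bound_iter (Γ : ι → Contour) (l : List ι) (hs : ∀ j ∈ l, IsSmooth (Γ j)) :
    ∃ c : ℝ, 0 ≤ c ∧ ∀ (T : ι → Set ℂ), (∀ j ∈ l, trace (Γ j) ⊆ T j) →
      ∀ (F : (ι → ℂ) → ℂ) (C : ℝ), (∀ v ∈ offBox [] T, ‖F v‖ ≤ C) →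
        ∀ v ∈ offBox l T, ‖iter Γ l F v‖ ≤ c * C := by
  induction l with
  | nil => exact ⟨1, zero_le_one, fun T _ F C hF v hv => by simpa [iter] using hF v hv⟩
  | cons j l ih =>
    obtain ⟨c, hc, h⟩ := ih fun k hk => hs k (.tail _ hk)
    obtain ⟨c', hc', h'⟩ := exists_bound (Γ j) (hs j (.head _))
    refine ⟨c' * c, by positivity, fun T hT F C hF v hv => ?_⟩
    rw [mul_assoc]
    exact h' _ _ fun z hz => h T (fun k hk => hT k (.tail _ hk)) F C hF _
      (update_mem_offBox hv (hT j (.head _) hz))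

end XXZ

namespace XXZ

set_option linter.unusedSectionVars false

section
variable {ι : Type} [DecidableEq ι]

/-- Replacing the contours of all variables. -/
lemma iter_replace_all {Γ Γ' : ι → Contour} {T : ι → Set ℂ} {l : List ι}
    (hl : l.Nodup) (hs : ∀ j ∈ l, IsSmooth (Γ j)) (hs' : ∀ j ∈ l, IsSmooth (Γ' j))
    (hT : ∀ j ∈ l, trace (Γ j) ⊆ T j) (hT' : ∀ j ∈ l, trace (Γ' j) ⊆ T j)
    {F : (ι → ℂ) → ℂ} (hF : ContinuousOn F (offBox [] T))
    (h : ∀ j ∈ l, ∀ v ∈ offBox [j] T, contourIntegral (Γ j) (fun z => F (update v j z)) =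
      contourIntegral (Γ' j) fun z => F (update v j z))
    {v : ι → ℂ} (hv : v ∈ offBox l T) : iter Γ l F v = iter Γ' l F v := by
  induction l generalizing v with
  | nil => rfl
  | cons j l ih =>
    have hl' := List.nodup_cons.1 hl
    have e1 : iter Γ (j :: l) F v = iter (update Γ' j (Γ j)) (j :: l) F v := by
      simp only [iter, update_self]
      refine contourIntegral_congr fun z hz => ?_
      rw [ih hl'.2 (fun k hk => hs k (.tail _ hk))
        (fun k hk => hs' k (.tail _ hk))
        (fun k hk => hT k (.tail _ hk))
        (fun k hk => hT' k (.tail _ hk))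
        (fun k hk => h k (.tail _ hk))
        (update_mem_offBox hv (hT j (.head _) hz))]
      refine iter_congr_contour (fun k hk => ?_) _ _
      rw [update_of_ne (by rintro rfl; exact hl'.1 hk)]
    have e2 : update (update Γ' j (Γ j)) j (Γ' j) = Γ' := by simp
    rw [e1, iter_replace (i := j) (C := Γ' j) (S := T j) (T := T) (.head _) hl ?_
      (hs' j (.head _)) ?_ (hT' j (.head _)) hF (by simpa using hF) ?_ hv, e2]
    · intro k hk
      by_cases e : k = j
      · subst e; simpa using hs k hk
      · rw [update_of_ne e]; exact hs' k hk
    · intro k hk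
      by_cases e : k = j
      · subst e; simpa using hT k hk
      · rw [update_of_ne e]; exact hT' k hk
    · simpa using h j (.head _)

end

/-! ### Circles -/

/-- The circle of radius `ρ` around the origin. -/
def circ (ρ : ℝ) : Contour := [arc 0 ρ 0 (2 * pi)]

lemma contDiff_arc (c : ℂ) (r α β : ℝ) : ContDiff ℝ 1 (arc c r α β) := by
  have h : ContDiff ℝ 1 fun s : ℝ => (s : ℂ) := Complex.ofRealCLM.contDiff
  unfold arc
  exact contDiff_const.add (contDiff_const.mul
    ((contDiff_const.mul (contDiff_const.add (h.mul contDiff_const))).cexp))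

lemma contDiff_segment (a b : ℂ) : ContDiff ℝ 1 (segment a b) := by
  have h : ContDiff ℝ 1 fun s : ℝ => (s : ℂ) := Complex.ofRealCLM.contDiff
  unfold segment
  exact contDiff_const.add (h.mul contDiff_const)

lemma isSmooth_circ (ρ : ℝ) : IsSmooth (circ ρ) := by
  simpa [circ, isSmooth_cons, isSmooth_nil] using contDiff_arc 0 ρ 0 (2 * pi)

lemma arc_zero_eq (ρ s : ℝ) : arc 0 ρ 0 (2 * pi) s = circleMap 0 ρ (2 * pi * s) := by
  simp only [arc, circleMap]
  congr 3
  push_cast; ring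

lemma norm_of_mem_circ {ρ : ℝ} (hρ : 0 ≤ ρ) {z : ℂ} (hz : z ∈ trace (circ ρ)) : ‖z‖ = ρ := by
  rw [circ, trace_cons, trace_nil, Set.union_empty] at hz
  obtain ⟨s, _, rfl⟩ := hz
  rw [arc_zero_eq, norm_circleMap_zero, abs_of_nonneg hρ]

lemma contourIntegral_circ (ρ : ℝ) (F : ℂ → ℂ) :
    contourIntegral (circ ρ) F = (2 * pi * I)⁻¹ * ∮ z in C(0, ρ), F z := by
  rw [circ, contourIntegral_cons, contourIntegral_nil, add_zero]
  congr 1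
  have e : arc 0 ρ 0 (2 * pi) = fun s => circleMap 0 ρ (2 * pi * s) :=
    funext (arc_zero_eq ρ)
  have hd : ∀ s : ℝ, deriv (fun s => circleMap 0 ρ (2 * pi * s)) s =
      (2 * pi : ℝ) • deriv (circleMap 0 ρ) (2 * pi * s) := by
    intro s
    exact ((hasDerivAt_circleMap 0 ρ (2 * pi * s)).scomp s
      (by simpa using (hasDerivAt_id s).const_mul (2 * pi))).deriv.trans (by
        rw [deriv_circleMap])
  rw [pieceIntegral, e, circleIntegral]
  simp only [hd]
  have := intervalIntegral.smul_integral_comp_mul_left (a := 0) (b := 1)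
    (fun θ => deriv (circleMap 0 ρ) θ • F (circleMap 0 ρ θ)) (2 * pi)
  rw [mul_zero, mul_one] at this
  rw [← this, ← integral_smul]
  refine integral_congr fun s _ => ?_
  simp only [smul_eq_mul, Complex.real_smul]
  ring

lemma contourIntegral_circ_eq {a b : ℝ} (ha : 0 < a) (hab : a ≤ b) {F : ℂ → ℂ}
    (hF : ∀ z, a ≤ ‖z‖ → ‖z‖ ≤ b → DifferentiableAt ℂ F z) :
    contourIntegral (circ a) F = contourIntegral (circ b) F := by
  rw [contourIntegral_circ, contourIntegral_circ,
    Complex.circleIntegral_eq_of_differentiable_on_annulus_off_countable ha hab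
      Set.countable_empty]
  · intro z hz
    simp only [Set.mem_sdiff, Metric.mem_closedBall, dist_zero_right, Metric.mem_ball, not_lt] at hz
    exact (hF z hz.2 hz.1).continuousAt.continuousWithinAt
  · intro z hz
    simp only [Set.mem_sdiff, Metric.mem_closedBall, dist_zero_right, Metric.mem_ball, not_le,
      Set.mem_empty_iff_false, not_false_eq_true, and_true] at hz
    exact hF z hz.2.le hz.1.le

lemma contourIntegral_circ_zpow {ρ : ℝ} (hρ : 0 < ρ) (n : ℤ) :
    contourIntegral (circ ρ) (fun z => z ^ n) = if n = -1 then 1 else 0 := by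
  rw [contourIntegral_circ]
  split_ifs with h
  · subst h
    have := circleIntegral.integral_sub_center_inv 0 hρ.ne'
    simp only [sub_zero] at this
    simp only [zpow_neg_one, this]
    exact inv_mul_cancel₀ Complex.two_pi_I_ne_zero
  · have := circleIntegral.integral_sub_zpow_of_ne h 0 0 ρ
    simp only [sub_zero] at this
    rw [this, mul_zero]

/-- Dividing out zeros does not affect the invariance of circle integrals. -/
lemma contourIntegral_circ_eq_of_zeros {a b : ℝ} (ha : 0 < a) (hab : a ≤ b) (S : Finset ℂ)
    (hSa : ∀ c ∈ S, ‖c‖ ≠ a) (hSb : ∀ c ∈ S, ‖c‖ < b) {F : ℂ → ℂ}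
    (hF : ∀ z, a ≤ ‖z‖ → ‖z‖ ≤ b → DifferentiableAt ℂ F z)
    (hS : ∀ c ∈ S, a < ‖c‖ → F c = 0) :
    contourIntegral (circ a) (fun z => F z / ∏ c ∈ S, (z - c)) =
      contourIntegral (circ b) fun z => F z / ∏ c ∈ S, (z - c) := by
  induction S using Finset.induction_on generalizing F with
  | empty => simpa using contourIntegral_circ_eq ha hab hF
  | insert c S hc ih =>
    have hca := hSa c (mem_insert_self _ _)
    have hcb := hSb c (mem_insert_self _ _)
    simp only [prod_insert hc]
    rcases lt_or_gt_of_ne hca with h | h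
    · have hne : ∀ z, a ≤ ‖z‖ → z - c ≠ 0 := fun z hz e => by
        rw [sub_eq_zero.1 e] at hz; exact absurd hz (not_le.2 h)
      have := ih (F := fun z => F z / (z - c)) (fun d hd => hSa d (mem_insert_of_mem hd))
        (fun d hd => hSb d (mem_insert_of_mem hd))
        (fun z h1 h2 => (hF z h1 h2).div (by fun_prop) (hne z h1))
        (fun d hd hd' => by simp [hS d (mem_insert_of_mem hd) hd'])
      simpa only [div_div] using this
    · have hopen : IsOpen {z : ℂ | a < ‖z‖ ∧ ‖z‖ < b} :=
        (isOpen_lt continuous_const continuous_norm).inter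
          (isOpen_lt continuous_norm continuous_const)
      have hFc : F c = 0 := hS c (mem_insert_self _ _) h
      have hd : ∀ z, a ≤ ‖z‖ → ‖z‖ ≤ b → DifferentiableAt ℂ (dslope F c) z := by
        intro z h1 h2
        by_cases e : z = c
        · subst e
          have hn := hopen.mem_nhds (show z ∈ {z : ℂ | a < ‖z‖ ∧ ‖z‖ < b} from ⟨h, hcb⟩)
          exact ((Complex.differentiableOn_dslope hn).2 fun w hw =>
            (hF w hw.1.le hw.2.le).differentiableWithinAt).differentiableAt hn
        · exact (differentiableAt_dslope_of_ne e).2 (hF z h1 h2)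
      have he : ∀ z, z ≠ c → F z / (z - c) = dslope F c z := by
        intro z hz
        rw [dslope_of_ne _ hz, slope_def_field, hFc, sub_zero]
      have hzero : ∀ d ∈ S, a < ‖d‖ → dslope F c d = 0 := by
        intro d hdS h'
        rw [← he d (by rintro rfl; exact hc hdS), hS d (mem_insert_of_mem hdS) h', zero_div]
      have := ih (fun d hd => hSa d (mem_insert_of_mem hd))
        (fun d hd => hSb d (mem_insert_of_mem hd)) hd hzero
      calc _ = contourIntegral (circ a) (fun z => dslope F c z / ∏ c ∈ S, (z - c)) :=
            contourIntegral_congr fun z hz => by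
              rw [← div_div, he z]
              rintro rfl; exact hca (norm_of_mem_circ ha.le hz)
        _ = _ := this
        _ = _ := contourIntegral_congr fun z hz => by
              rw [← div_div, he z]
              rintro rfl; exact hcb.ne (norm_of_mem_circ (ha.le.trans hab) hz)

lemma norm_contourIntegral_circ_le {ρ C : ℝ} (hρ : 0 ≤ ρ) {F : ℂ → ℂ}
    (h : ∀ z, ‖z‖ = ρ → ‖F z‖ ≤ C) : ‖contourIntegral (circ ρ) F‖ ≤ ρ * C := by
  rw [contourIntegral_circ]
  have := circleIntegral.norm_two_pi_i_inv_smul_integral_le_of_norm_le_const (c := 0) (f := F) hρ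
    (C := C) fun z hz => h z (by simpa using hz)
  simpa using this

/-- The circle integrals do not depend on the radii. -/
lemma iter_circ_radius {ι : Type} [DecidableEq ι] [Fintype ι] {l : List ι} (hl : l.Nodup)
    {ρ ρ' : ι → ℝ} (h0 : ∀ j ∈ l, 0 < ρ j) (h : ∀ j ∈ l, ρ j ≤ ρ' j) {T : ι → Set ℂ}
    (hT : ∀ j ∈ l, ∀ z, ρ j ≤ ‖z‖ → ‖z‖ ≤ ρ' j → z ∈ T j) {F : (ι → ℂ) → ℂ}
    (hF : ∀ v ∈ offBox [] T, DifferentiableAt ℂ F v) {v : ι → ℂ} (hv : v ∈ offBox l T) :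
    iter (fun j => circ (ρ j)) l F v = iter (fun j => circ (ρ' j)) l F v := by
  set T' : ι → Set ℂ := fun j => if j ∈ l then {z | ρ j ≤ ‖z‖ ∧ ‖z‖ ≤ ρ' j} else T j with hT'
  have hsub : offBox [] T' ⊆ offBox [] T := fun w hw => mem_offBox_nil.2 fun j => by
    have := mem_offBox_nil.1 hw j
    by_cases e : j ∈ l
    · simp only [hT', e, if_true] at this; exact hT j e _ this.1 this.2
    · simpa only [hT', e, if_false] using this
  refine iter_replace_all (T := T') hl (fun _ _ => isSmooth_circ _) (fun _ _ => isSmooth_circ _)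
    ?_ ?_ (fun w hw => (hF w (hsub hw)).continuousAt.continuousWithinAt) ?_ ?_
  · intro j hj z hz
    have := norm_of_mem_circ (h0 j hj).le hz
    simp only [hT', hj, if_true]; exact ⟨this.ge, this.le.trans (h j hj)⟩
  · intro j hj z hz
    have := norm_of_mem_circ ((h0 j hj).le.trans (h j hj)) hz
    simp only [hT', hj, if_true]; exact ⟨(h j hj).trans this.ge, this.le⟩
  · intro j hj w hw
    refine contourIntegral_circ_eq (h0 j hj) (h j hj) fun z h1 h2 => ?_
    have hm : update w j z ∈ offBox [] T' := update_mem_offBox hw (by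
      simp only [hT', hj, if_true]; exact ⟨h1, h2⟩)
    exact (hF _ (hsub hm)).comp z (hasDerivAt_update w j z).differentiableAt
  · intro j hj
    simp only [hT', hj, if_false]; exact hv j hj

lemma differentiableAt_div {E : Type*} [NormedAddCommGroup E] [NormedSpace ℂ E] {f g : E → ℂ}
    {w : E} (hf : DifferentiableAt ℂ f w) (hg : DifferentiableAt ℂ g w) (h : g w ≠ 0) :
    DifferentiableAt ℂ (fun w => f w / g w) w := by
  simp only [div_eq_mul_inv]
  exact hf.mul (hg.fun_inv h)

lemma le_norm_one_add_mul_sub {Δ : ℝ} {z w : ℂ} {κ r : ℝ}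
    (hz : ‖z‖ ≤ r) (h : 1 + 2 * |Δ| * r + κ ≤ ‖z‖ * ‖w‖) : κ ≤ ‖1 + z * w - 2 * Δ * z‖ := by
  have h1 : ‖z * w‖ ≤ ‖1 + z * w - 2 * Δ * z‖ + ‖(2 * Δ * z - 1 : ℂ)‖ := by
    refine le_trans (le_of_eq ?_) (norm_add_le _ _)
    congr 1; ring
  have h2 : ‖(2 * Δ * z - 1 : ℂ)‖ ≤ 2 * |Δ| * r + 1 := by
    refine (norm_sub_le _ _).trans ?_
    simp only [norm_mul, norm_real, norm_eq_abs, norm_one, norm_ofNat]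
    gcongr
  rw [norm_mul] at h1
  linarith

/-- A double integral vanishes by letting one circle shrink and the other one grow. -/
lemma double_integral_eq_zero {Δ r ρ : ℝ} (hr : 0 < r) (hρ : 0 < ρ)
    (hrρ : 1 + 2 * |Δ| * r < r * ρ)
    (S : Finset ℂ) (hS : ∀ c ∈ S, ‖c‖ ≠ ρ) {φ : ℂ → ℂ → ℂ}
    (hφ : ∀ z w, z ≠ 0 → ‖z‖ ≤ r → ρ ≤ ‖w‖ → DifferentiableAt ℂ (uncurry φ) (z, w))
    (hzero : ∀ z, ‖z‖ = r → ∀ c ∈ S, ρ < ‖c‖ → φ z c = 0)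
    {C : ℝ} {m β : ℤ} (hmβ : β - m + 1 ≤ S.card)
    (hgrowth : ∀ z w, z ≠ 0 → ‖z‖ ≤ r → ρ ≤ ‖w‖ → ‖φ z w‖ ≤ C * (‖z‖ ^ m * ‖w‖ ^ β)) :
    contourIntegral (circ r) (fun z => contourIntegral (circ ρ) fun w =>
      φ z w / (1 + z * w - 2 * Δ * z) / ∏ c ∈ S, (w - c)) = 0 := by
  set κ : ℝ := r * ρ - (1 + 2 * |Δ| * r) with hκ
  have hκ0 : 0 < κ := by linarith
  have hC : 0 ≤ C := by
    have := (norm_nonneg _).trans (hgrowth r ρ (by exact_mod_cast hr.ne') (by simp [abs_of_pos hr])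
      (by simp [abs_of_pos hρ]))
    exact nonneg_of_mul_nonneg_left this (by simp; positivity)
  have hden : ∀ z w : ℂ, ‖z‖ ≤ r → r * ρ ≤ ‖z‖ * ‖w‖ → κ ≤ ‖1 + z * w - 2 * Δ * z‖ :=
    fun z w h1 h2 => le_norm_one_add_mul_sub h1 (by linarith)
  have hden' : ∀ z w : ℂ, ‖z‖ ≤ r → r * ρ ≤ ‖z‖ * ‖w‖ → 1 + z * w - 2 * Δ * z ≠ 0 :=
    fun z w h1 h2 e => by have := hden z w h1 h2; rw [e, norm_zero] at this; linarith
  have key : ∀ L : ℝ, 1 ≤ L → (∀ c ∈ S, 2 * ‖c‖ < L * ρ) →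
      ‖contourIntegral (circ r) (fun z => contourIntegral (circ ρ) fun w =>
      φ z w / (1 + z * w - 2 * Δ * z) / ∏ c ∈ S, (w - c))‖ ≤
        ρ * r * (C * (r ^ m * ρ ^ β) / κ / (ρ / 2) ^ S.card) / L := by
    intro L hL hLS
    have hL0 : 0 < L := by linarith
    have hρL : ρ ≤ L * ρ := le_mul_of_one_le_left hρ.le hL
    have hrL : r / L ≤ r := div_le_self hr.le hL
    have hrL0 : 0 < r / L := by positivity
    have step1 : contourIntegral (circ r) (fun z => contourIntegral (circ ρ) fun w =>
        φ z w / (1 + z * w - 2 * Δ * z) / ∏ c ∈ S, (w - c)) =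
        contourIntegral (circ r) (fun z => contourIntegral (circ (L * ρ)) fun w =>
        φ z w / (1 + z * w - 2 * Δ * z) / ∏ c ∈ S, (w - c)) := by
      refine contourIntegral_congr fun z hz => ?_
      have hz := norm_of_mem_circ hr.le hz
      have hz0 : z ≠ 0 := by rw [← norm_pos_iff, hz]; exact hr
      refine contourIntegral_circ_eq_of_zeros hρ hρL S hS (fun c hc => ?_) (fun w h1 _ => ?_)
        fun c hc h => ?_
      · have := hLS c hc; have := norm_nonneg c; linarith
      · refine DifferentiableAt.div ?_ (by fun_prop)
          (hden' z w hz.le (by rw [hz]; gcongr))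
        exact (hφ z w hz0 hz.le h1).comp w (f := fun w => (z, w)) (by fun_prop)
      · simp [hzero z hz c hc h]
    have hprod : ∀ w : ℂ, ‖w‖ = L * ρ → (L * ρ / 2) ^ S.card ≤ ‖∏ c ∈ S, (w - c)‖ := by
      intro w hw
      rw [norm_prod, ← prod_const]
      refine prod_le_prod (fun _ _ => by positivity) fun c hc => ?_
      have := norm_sub_norm_le w c
      have := hLS c hc
      linarith
    have hprod' : ∀ w : ℂ, ‖w‖ = L * ρ → ∏ c ∈ S, (w - c) ≠ 0 := by
      intro w hw h
      have := hprod w hw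
      rw [h, norm_zero] at this
      exact absurd this (not_le.2 (by positivity))
    have step2 : contourIntegral (circ r) (fun z => contourIntegral (circ (L * ρ)) fun w =>
        φ z w / (1 + z * w - 2 * Δ * z) / ∏ c ∈ S, (w - c)) =
        contourIntegral (circ (L * ρ)) fun w => contourIntegral (circ (r / L)) fun z =>
        φ z w / (1 + z * w - 2 * Δ * z) / ∏ c ∈ S, (w - c) := by
      rw [contourIntegral_swap (isSmooth_circ _) (isSmooth_circ _)
        (G := fun z w => φ z w / (1 + z * w - 2 * Δ * z) / ∏ c ∈ S, (w - c))]
      · refine contourIntegral_congr fun w hw => ?_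
        have hw := norm_of_mem_circ (by positivity) hw
        refine (contourIntegral_circ_eq hrL0 hrL fun z h1 h2 => ?_).symm
        have hz0 : z ≠ 0 := by rw [← norm_pos_iff]; linarith
        have hd : DifferentiableAt ℂ (fun z : ℂ => 1 + z * w - 2 * Δ * z) z := by fun_prop
        refine DifferentiableAt.div_const (DifferentiableAt.div ?_ hd (hden' z w h2 ?_)) _
        · exact (hφ z w hz0 h2 (by rw [hw]; exact hρL)).comp z (f := fun z => (z, w))
            (by fun_prop)
        · rw [hw]
          calc r * ρ = r / L * (L * ρ) := by field_simp
            _ ≤ _ := by gcongr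
      · rintro ⟨z, w⟩ ⟨hz, hw⟩
        have hz := norm_of_mem_circ hr.le hz
        have hw := norm_of_mem_circ (by positivity) hw
        have hz0 : z ≠ 0 := by rw [← norm_pos_iff, hz]; exact hr
        have h1 : ContinuousAt (uncurry φ) (z, w) :=
          (hφ z w hz0 hz.le (by rw [hw]; exact hρL)).continuousAt
        refine ContinuousAt.continuousWithinAt ?_
        refine (h1.div (f := uncurry φ) (g := fun q : ℂ × ℂ => 1 + q.1 * q.2 - 2 * Δ * q.1)
          (by fun_prop) ?_).div (g := fun q : ℂ × ℂ => ∏ c ∈ S, (q.2 - c)) (by fun_prop)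
            (hprod' w hw)
        exact hden' z w hz.le (by rw [hz, hw]; gcongr)
    rw [step1, step2]
    refine (norm_contourIntegral_circ_le (by positivity) fun w hw =>
      norm_contourIntegral_circ_le hrL0.le (C := C * ((r / L) ^ m * (L * ρ) ^ β) / κ /
        (L * ρ / 2) ^ S.card) fun z hz => ?_).trans ?_
    · have hz0 : z ≠ 0 := by rw [← norm_pos_iff, hz]; exact hrL0
      have hzr : ‖z‖ ≤ r := by rw [hz]; exact hrL
      have g := hgrowth z w hz0 hzr (by rw [hw]; exact hρL)
      rw [norm_div, norm_div]
      rw [hz, hw] at g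
      have d1 := hden z w hzr (by
        rw [hz, hw]; apply le_of_eq; field_simp)
      gcongr
      exact hprod w hw
    · have e1 : (r / L) ^ m * (L * ρ) ^ β = r ^ m * ρ ^ β * L ^ (β - m) := by
        rw [div_zpow, mul_zpow, zpow_sub₀ hL0.ne']; ring
      have e2 : (L * ρ / 2) ^ S.card = L ^ (S.card : ℤ) * (ρ / 2) ^ S.card := by
        rw [zpow_natCast, ← mul_pow, mul_div_assoc]
      have e3 : L ^ (β - m) / L ^ (S.card : ℤ) ≤ 1 / L := by
        rw [← zpow_sub₀ hL0.ne', one_div, ← zpow_neg_one]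
        exact zpow_le_zpow_right₀ hL (by omega)
      calc L * ρ * (r / L * (C * ((r / L) ^ m * (L * ρ) ^ β) / κ / (L * ρ / 2) ^ S.card))
          = ρ * r * (C * (r ^ m * ρ ^ β) / κ / (ρ / 2) ^ S.card) *
              (L ^ (β - m) / L ^ (S.card : ℤ)) := by
            rw [e1, e2]; field_simp
        _ ≤ ρ * r * (C * (r ^ m * ρ ^ β) / κ / (ρ / 2) ^ S.card) * (1 / L) := by gcongr
        _ = _ := by ring
  rw [← norm_le_zero_iff]
  have ht : Filter.Tendsto (fun L : ℝ => ρ * r * (C * (r ^ m * ρ ^ β) / κ / (ρ / 2) ^ S.card) / L)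
      Filter.atTop (nhds 0) := tendsto_const_nhds.div_atTop Filter.tendsto_id
  refine ge_of_tendsto ht ?_
  have h1 : ∀ᶠ L : ℝ in Filter.atTop, ∀ c ∈ S, 2 * ‖c‖ < L * ρ := by
    rw [Filter.eventually_all_finset]
    intro c _
    filter_upwards [Filter.eventually_gt_atTop (2 * ‖c‖ / ρ)] with L hL
    rwa [div_lt_iff₀ hρ] at hL
  filter_upwards [h1, Filter.eventually_ge_atTop 1] with L a b
  exact key L b a

/-- Partial fractions for the product of `1 + z w_b - 2 Δ z`. -/
lemma inv_prod_one_add_mul {ι : Type} [DecidableEq ι] {B : Finset ι} (hB : B.Nonempty) (Δ : ℝ)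
    {z : ℂ} (hz : z ≠ 0) {w : ι → ℂ} (hw : Set.InjOn w B)
    (hne : ∀ b ∈ B, 1 + z * w b - 2 * Δ * z ≠ 0) :
    (∏ b ∈ B, (1 + z * w b - 2 * Δ * z))⁻¹ = ∑ b ∈ B, (-1) ^ (B.card - 1) * z ^ (1 - B.card : ℤ) /
      (1 + z * w b - 2 * Δ * z) / ∏ c ∈ B.erase b, (w b - w c) := by
  have h1 := congrArg (Polynomial.eval (z⁻¹ - 2 * Δ))
    (Lagrange.sum_basis (s := B) (v := fun b => -w b) (fun b hb c hc h => hw hb hc (neg_inj.1 h)) hB)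
  rw [Polynomial.eval_finsetSum, Polynomial.eval_one] at h1
  have h2 := congrArg (fun s => s * (∏ b ∈ B, (1 + z * w b - 2 * Δ * z))⁻¹) h1
  simp only [one_mul, sum_mul] at h2
  rw [← h2]
  refine sum_congr rfl fun b hb => ?_
  have hcard : ((B.erase b).card : ℤ) = B.card - 1 := by
    rw [card_erase_of_mem hb]; have := card_pos.2 hB; omega
  have e1 : Polynomial.eval (z⁻¹ - 2 * Δ) (Lagrange.basis B (fun b => -w b) b) =
      ∏ c ∈ B.erase b, ((-1) * z⁻¹ * (1 + z * w c - 2 * Δ * z) / (w b - w c)) := by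
    rw [Lagrange.basis, Polynomial.eval_prod]
    refine prod_congr rfl fun c hc => ?_
    have hbc : w b - w c ≠ 0 := fun h =>
      (mem_erase.1 hc).1 (hw (mem_erase.1 hc).2 hb (sub_eq_zero.1 h).symm)
    have hbc' : -w b - -w c ≠ 0 := by
      rw [neg_sub_neg, ← neg_sub]; exact neg_ne_zero.2 hbc
    simp only [Lagrange.basisDivisor, Polynomial.eval_mul, Polynomial.eval_C, Polynomial.eval_sub,
      Polynomial.eval_X]
    field_simp
    ring
  rw [e1, prod_div_distrib, prod_mul_distrib, prod_const, ← mul_prod_erase B _ hb, mul_pow]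
  have hp : ∏ c ∈ B.erase b, (1 + z * w c - 2 * Δ * z) ≠ 0 :=
    prod_ne_zero_iff.2 fun c hc => hne c (mem_erase.1 hc).2
  have e2 : z ^ (1 - B.card : ℤ) = z⁻¹ ^ (B.erase b).card := by
    rw [← zpow_natCast, inv_zpow', hcard]; congr 1; ring
  rw [e2, card_erase_of_mem hb]
  have := hne b hb
  generalize ∏ c ∈ B.erase b, (1 + z * w c - 2 * Δ * z) = P at hp ⊢
  field_simp

/-- The torus integral that underlies the initial condition. -/
theorem iter_eq_zero_of_growth {ι : Type} [DecidableEq ι] [Fintype ι] {Δ r ρ : ℝ} (hr : 0 < r)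
    (hρ : 0 < ρ) (hrρ : 1 + 2 * |Δ| * r < r * ρ) {a : ι} {B : Finset ι} (hB : B.Nonempty)
    (ha : a ∉ B) {l : List ι} (hl : l.Nodup) (hlB : ∀ j, j ∈ l ↔ j ∈ B) {Γ : ι → Contour}
    (hΓa : Γ a = circ r) (hΓ : ∀ b ∈ B, Γ b = circ ρ) {T : ι → Set ℂ}
    (hTa : ∀ z, z ≠ 0 → ‖z‖ ≤ r → z ∈ T a) (hTB : ∀ b ∈ B, ∀ z, ρ ≤ ‖z‖ → z ∈ T b)
    {Φ : (ι → ℂ) → ℂ} (hΦ : ∀ w ∈ offBox [] T, DifferentiableAt ℂ Φ w)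
    (hzero : ∀ w ∈ offBox [] T, ∀ b ∈ B, ∀ c ∈ B, b ≠ c → w b = w c → Φ w = 0)
    (hgrowth : ∀ b ∈ B, ∀ M : ℝ, ∃ (C : ℝ) (m β : ℤ), β + 1 ≤ m ∧ ∀ w ∈ offBox [] T, w a ≠ 0 →
      ‖w a‖ ≤ r → (∀ b ∈ B, ρ ≤ ‖w b‖) → (∀ c ∈ B, c ≠ b → ‖w c‖ ≤ M) →
        ‖Φ w‖ ≤ C * (‖w a‖ ^ m * ‖w b‖ ^ β))
    {u : ι → ℂ} (hu : u ∈ offBox (a :: l) T) :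
    iter Γ (a :: l) (fun w => Φ w / ∏ b ∈ B, (1 + w a * w b - 2 * Δ * w a)) u = 0 := by
  set ρ' : ι → ℝ := fun j => if j = a then r else ρ with hρ'
  set σ : ι → ℝ := fun j => if j = a then r else ρ * (2 + (Fintype.equivFin ι j : ℕ)) with hσ
  have hBa : ∀ b ∈ B, b ≠ a := by rintro b hb rfl; exact ha hb
  have hla : a ∉ l := by rwa [hlB]
  have hnd : (a :: l).Nodup := List.nodup_cons.2 ⟨hla, hl⟩
  have hσB : ∀ b ∈ B, ρ < σ b := fun b hb => by
    simp only [hσ, hBa b hb, if_false]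
    nlinarith [(Nat.cast_nonneg (Fintype.equivFin ι b : ℕ) : (0 : ℝ) ≤ _)]
  have hσinj : ∀ b ∈ B, ∀ c ∈ B, σ b = σ c → b = c := fun b hb c hc h => by
    simp only [hσ, hBa b hb, hBa c hc, if_false] at h
    have := mul_left_cancel₀ hρ.ne' h
    have : (Fintype.equivFin ι b : ℕ) = (Fintype.equivFin ι c : ℕ) := by
      exact_mod_cast add_left_cancel this
    exact (Fintype.equivFin ι).injective (Fin.ext this)
  have hσ0 : ∀ j, 0 < σ j := fun j => by
    by_cases h : j = a
    · simp only [hσ, h, if_true]; exact hr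
    · simp only [hσ, h, if_false]; positivity
  have hσa : σ a = r := by simp [hσ]
  have hden : ∀ w : ι → ℂ, ‖w a‖ = r → ∀ b ∈ B, ρ ≤ ‖w b‖ →
      1 + w a * w b - 2 * Δ * w a ≠ 0 := fun w h1 b _ h2 e => by
    have := le_norm_one_add_mul_sub (Δ := Δ) (κ := r * ρ - (1 + 2 * |Δ| * r)) h1.le (w := w b) (by
      rw [h1, add_sub_cancel]; gcongr)
    rw [e, norm_zero] at this
    linarith
  set T₁ : ι → Set ℂ := fun j => if j = a then {z | ‖z‖ = r} else
    if j ∈ B then {z | ρ ≤ ‖z‖} else T j with hT₁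
  have hT₁a : ∀ w ∈ offBox [] T₁, ‖w a‖ = r := fun w hw => by
    simpa [hT₁] using mem_offBox_nil.1 hw a
  have hT₁B : ∀ w ∈ offBox [] T₁, ∀ b ∈ B, ρ ≤ ‖w b‖ := fun w hw b hb => by
    simpa [hT₁, hBa b hb, hb] using mem_offBox_nil.1 hw b
  have hT₁T : offBox [] T₁ ⊆ offBox [] T := fun w hw => mem_offBox_nil.2 fun j => by
    have := mem_offBox_nil.1 hw j
    by_cases e : j = a
    · subst e
      have := hT₁a w hw
      exact hTa _ (by rw [← norm_pos_iff, this]; exact hr) this.le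
    · by_cases e' : j ∈ B
      · exact hTB j e' _ (hT₁B w hw j e')
      · simpa only [hT₁, e, e', if_false] using this
  have hu₁ : u ∈ offBox (a :: l) T₁ := fun j hj => by
    have h := hu j hj
    simp only [List.mem_cons, not_or, hlB] at hj
    simpa only [hT₁, hj.1, hj.2, if_false] using h
  have e1 : iter Γ (a :: l) (fun w => Φ w / ∏ b ∈ B, (1 + w a * w b - 2 * Δ * w a)) u =
      iter (fun j => circ (σ j)) (a :: l)
        (fun w => Φ w / ∏ b ∈ B, (1 + w a * w b - 2 * Δ * w a)) u := by
    rw [iter_congr_contour (Γ' := fun j => circ (ρ' j))]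
    · refine iter_circ_radius (T := T₁) hnd (fun j _ => ?_) (fun j hj => ?_) (fun j hj => ?_)
        (fun w hw => ?_) hu₁
      · simp only [hρ']; split_ifs <;> assumption
      · by_cases e : j = a
        · simp [hρ', hσ, e]
        · simp only [hρ', e, if_false]
          exact (hσB j ((hlB j).1 (by simpa [e] using hj))).le
      · intro z h1 h2
        by_cases e : j = a
        · subst e
          simp only [hρ', hσ, hT₁, if_true] at h1 h2 ⊢
          exact le_antisymm h2 h1
        · have : j ∈ B := (hlB j).1 (by simpa [e] using hj)
          simpa only [hT₁, e, this, if_true, if_false, hρ', Set.mem_ofPred_eq] using h1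
      · have hd : DifferentiableAt ℂ
            (fun w : ι → ℂ => ∏ b ∈ B, (1 + w a * w b - 2 * Δ * w a)) w := by fun_prop
        have hne : ∏ b ∈ B, (1 + w a * w b - 2 * Δ * w a) ≠ 0 :=
          prod_ne_zero_iff.2 fun b hb => hden w (hT₁a w hw) b hb (hT₁B w hw b hb)
        exact differentiableAt_div (hΦ w (hT₁T hw)) hd hne
    · intro j hj
      by_cases e : j = a
      · subst e; simp [hρ', hΓa]
      · simp only [hρ', e, if_false]
        exact hΓ j ((hlB j).1 (by simpa [e] using hj))
  set T₂ : ι → Set ℂ := fun j => if j = a ∨ j ∈ B then {z | ‖z‖ = σ j} else T j with hT₂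
  have hT₂n : ∀ w ∈ offBox [] T₂, ∀ j, (j = a ∨ j ∈ B) → ‖w j‖ = σ j := fun w hw j hj => by
    simpa [hT₂, hj] using mem_offBox_nil.1 hw j
  have hT₂₁ : offBox [] T₂ ⊆ offBox [] T₁ := fun w hw => mem_offBox_nil.2 fun j => by
    have h := mem_offBox_nil.1 hw j
    by_cases e : j = a
    · subst e; simpa [hT₁, hσa] using hT₂n w hw j (.inl rfl)
    · by_cases e' : j ∈ B
      · have := hT₂n w hw j (.inr e')
        simp only [hT₁, e, e', if_true, if_false]
        exact (hσB j e').le.trans this.ge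
      · simpa only [hT₁, hT₂, e, e', if_false, or_self] using h
  have hinj : ∀ w ∈ offBox [] T₂, Set.InjOn w B := fun w hw b hb c hc h => by
    refine hσinj b hb c hc ?_
    rw [← hT₂n w hw b (.inr hb), ← hT₂n w hw c (.inr hc), h]
  have hu₂ : u ∈ offBox (a :: l) T₂ := fun j hj => by
    have h := hu j hj
    simp only [List.mem_cons, not_or, hlB] at hj
    simpa only [hT₂, hj.1, hj.2, if_false, or_self] using h
  have hTr : ∀ j ∈ a :: l, trace (circ (σ j)) ⊆ T₂ j := fun j hj z hz => by
    have h := norm_of_mem_circ (hσ0 j).le hz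
    simp only [List.mem_cons, hlB] at hj
    simpa only [hT₂, hj, if_true, Set.mem_ofPred_eq] using h
  set G : ι → (ι → ℂ) → ℂ := fun b w => (-1) ^ (B.card - 1) * w a ^ (1 - B.card : ℤ) * Φ w /
      (1 + w a * w b - 2 * Δ * w a) / ∏ c ∈ B.erase b, (w b - w c) with hG
  have e2 : iter (fun j => circ (σ j)) (a :: l)
        (fun w => Φ w / ∏ b ∈ B, (1 + w a * w b - 2 * Δ * w a)) u =
      iter (fun j => circ (σ j)) (a :: l) (fun w => ∑ b ∈ B, G b w) u := by
    refine iter_congr hTr (fun w hw => ?_) hu₂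
    have hw1 := hT₂₁ hw
    have hwa : w a ≠ 0 := by rw [← norm_pos_iff, hT₁a w hw1]; exact hr
    rw [div_eq_mul_inv, inv_prod_one_add_mul hB Δ hwa (hinj w hw)
      fun b hb => hden w (hT₁a w hw1) b hb (hT₁B w hw1 b hb), mul_sum]
    refine sum_congr rfl fun b _ => ?_
    simp only [hG]; ring
  have hGc : ∀ b ∈ B, ContinuousOn (G b) (offBox [] T₂) := fun b hb w hw => by
    have hw1 := hT₂₁ hw
    have hwa : w a ≠ 0 := by rw [← norm_pos_iff, hT₁a w hw1]; exact hr
    have h1 := hΦ w (hT₁T hw1)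
    have d1 : DifferentiableAt ℂ (fun w : ι → ℂ => w a ^ (1 - B.card : ℤ)) w :=
      (differentiableAt_apply a w).zpow (.inl hwa)
    have d2 : DifferentiableAt ℂ (fun w : ι → ℂ => 1 + w a * w b - 2 * Δ * w a) w := by fun_prop
    have d3 : DifferentiableAt ℂ (fun w : ι → ℂ => ∏ c ∈ B.erase b, (w b - w c)) w := by fun_prop
    have n2 := hden w (hT₁a w hw1) b hb (hT₁B w hw1 b hb)
    have n3 : ∏ c ∈ B.erase b, (w b - w c) ≠ 0 := prod_ne_zero_iff.2 fun c hc h =>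
      (mem_erase.1 hc).1 (hinj w hw hb (mem_erase.1 hc).2 (sub_eq_zero.1 h)).symm
    have d : DifferentiableAt ℂ (G b) w := 
      differentiableAt_div (differentiableAt_div ((d1.const_mul _).mul h1) d2 n2) d3 n3
    exact d.continuousAt.continuousWithinAt
  rw [e1, e2, iter_sum (fun _ _ => isSmooth_circ _) hTr B hGc hu₂]
  refine sum_eq_zero fun b hb => ?_
  have hbl : b ∈ l := (hlB b).2 hb
  refine iter_eq_zero (l' := [a, b]) ⟨l.erase b, ?_⟩ (fun _ _ => isSmooth_circ _) hTr (hGc b hb)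
    (fun v hv => ?_) hu₂
  · refine ((List.perm_cons_erase hbl).cons a).trans ?_
    exact (List.perm_append_comm (l₁ := [a, b]))
  set M : ℝ := ∑ j, σ j with hM
  obtain ⟨C, m, β, hmβ, hbound⟩ := hgrowth b hb M
  have hba := hBa b hb
  have hvσ : ∀ c ∈ B.erase b, ‖v c‖ = σ c := fun c hc => by
    have := hv c (by simp [hBa c (mem_erase.1 hc).2, (mem_erase.1 hc).1])
    simpa only [hT₂, (mem_erase.1 hc).2, or_true, if_true, Set.mem_ofPred_eq] using this
  have hcard : ((B.erase b).image v).card = B.card - 1 := by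
    rw [card_image_of_injOn, card_erase_of_mem hb]
    intro c hc d hd h
    refine hσinj c (mem_erase.1 hc).2 d (mem_erase.1 hd).2 ?_
    rw [← hvσ c hc, ← hvσ d hd, h]
  have hmem : ∀ z w, z ≠ 0 → ‖z‖ ≤ r → ρ ≤ ‖w‖ →
      update (update v a z) b w ∈ offBox [] T := by
    intro z w h0 h1 h2
    refine mem_offBox_nil.2 fun j => ?_
    by_cases e : j = b
    · subst e; simpa using hTB j hb _ h2
    rw [update_of_ne e]
    by_cases e' : j = a
    · subst e'; simpa using hTa _ h0 h1
    rw [update_of_ne e']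
    have h := hv j (by simp [e, e'])
    by_cases e'' : j ∈ B
    · refine hTB j e'' _ ?_
      simp only [hT₂, e'', or_true, if_true] at h
      exact (hσB j e'').le.trans (le_of_eq h.symm)
    · simpa only [hT₂, e', e'', or_self, if_false] using h
  have hc1 := card_pos.2 hB
  have := double_integral_eq_zero (Δ := Δ) (r := r) (ρ := σ b) hr (hσ0 b)
    (hrρ.trans (by have := hσB b hb; gcongr)) ((B.erase b).image v) (fun c hc => ?_)
    (φ := fun z w => (-1) ^ (B.card - 1) * z ^ (1 - B.card : ℤ) *
      Φ (update (update v a z) b w)) (fun z w h0 h1 h2 => ?_)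
    (fun z hz c hc hc' => ?_) (C := C) (m := m + (1 - B.card)) (β := β) ?_ (fun z w h0 h1 h2 => ?_)
  · simp only [iter, hσa]
    rw [← this]
    congr 1; funext z; congr 1; funext w
    simp only [hG, update_self, update_of_ne hba.symm]
    congr 1
    rw [prod_image]
    · refine prod_congr rfl fun c hc => ?_
      rw [update_of_ne (mem_erase.1 hc).1,
        update_of_ne (hBa c (mem_erase.1 hc).2)]
    · intro c hc d hd h
      refine hσinj c (mem_erase.1 hc).2 d (mem_erase.1 hd).2 ?_
      rw [← hvσ c hc, ← hvσ d hd, h]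
  · obtain ⟨d, hd, rfl⟩ := mem_image.1 hc
    rw [hvσ d hd]
    intro h
    exact (mem_erase.1 hd).1 (hσinj d (mem_erase.1 hd).2 b hb h)
  · have h2' := (hσB b hb).le.trans h2
    have h3 := hΦ _ (hmem z w h0 h1 h2')
    have h4 : DifferentiableAt ℂ
        (fun q : ℂ × ℂ => update (update v a q.1) b q.2) (z, w) := by
      rw [differentiableAt_pi]
      intro j
      by_cases e : j = b
      · subst e; simp
      simp only [update_of_ne e]
      by_cases e' : j = a
      · subst e'; simp
      simp [update_of_ne e']
    refine DifferentiableAt.mul (DifferentiableAt.const_mul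
      (DifferentiableAt.zpow differentiableAt_fst (.inl h0)) _) ?_
    exact DifferentiableAt.comp (z, w) (g := Φ) h3 h4
  · obtain ⟨d, hd, rfl⟩ := mem_image.1 hc
    have hz0 : z ≠ 0 := by rw [← norm_pos_iff, hz]; exact hr
    have hd' := mem_erase.1 hd
    rw [hzero _ (hmem z (v d) hz0 hz.le ((hσB b hb).le.trans hc'.le)) b hb d hd'.2 hd'.1.symm
      (by simp [update_of_ne hd'.1, update_of_ne (hBa d hd'.2)]), mul_zero]
  · rw [hcard]; omega
  · have h2' := (hσB b hb).le.trans h2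
    have h := hbound _ (hmem z w h0 h1 h2') (by simp [update_of_ne hba.symm, h0])
      (by simp [update_of_ne hba.symm, h1]) (fun c hc => ?_) (fun c hc hcb => ?_)
    · simp only [update_self, update_of_ne hba.symm] at h
      have hz : 0 < ‖z‖ := norm_pos_iff.2 h0
      rw [norm_mul, norm_mul, norm_pow, norm_neg, norm_one, one_pow, one_mul, norm_zpow,
        zpow_add₀ hz.ne']
      calc _ ≤ ‖z‖ ^ (1 - B.card : ℤ) * (C * (‖z‖ ^ m * ‖w‖ ^ β)) := by gcongr
        _ = _ := by ring
    · by_cases e : c = b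
      · subst e; simpa using h2'
      · rw [update_of_ne e, update_of_ne (hBa c hc), hvσ c (mem_erase.2 ⟨e, hc⟩)]
        exact (hσB c hc).le
    · rw [update_of_ne hcb, update_of_ne (hBa c hc), hvσ c (mem_erase.2 ⟨hcb, hc⟩)]
      exact single_le_sum (f := σ) (fun j _ => (hσ0 j).le) (mem_univ c)

/-! ### The factors of the Bethe ansatz -/

/-- `1 + a b - 2 Δ a`. -/
def pFac (Δ : ℝ) (a b : ℂ) : ℂ := 1 + a * b - 2 * Δ * a

/-- `a + b - 2 Δ a b`. -/
def rFac (Δ : ℝ) (a b : ℂ) : ℂ := a + b - 2 * Δ * a * b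

lemma norm_pFac_ge {Δ R : ℝ} (hR : 2 + 4 * |Δ| ≤ R) {a b : ℂ} (ha : 1 ≤ ‖a‖) (hb : R ≤ ‖b‖) :
    1 / 2 * (‖a‖ * ‖b‖) ≤ ‖pFac Δ a b‖ := by
  have h1 : ‖a * b‖ ≤ ‖pFac Δ a b‖ + ‖(2 * Δ * a - 1 : ℂ)‖ := by
    refine le_trans (le_of_eq ?_) (norm_add_le _ _)
    congr 1; rw [pFac]; ring
  have h2 : ‖(2 * Δ * a - 1 : ℂ)‖ ≤ 2 * |Δ| * ‖a‖ + 1 := by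
    refine (norm_sub_le _ _).trans (le_of_eq ?_)
    simp only [norm_mul, norm_real, norm_eq_abs, norm_one, norm_ofNat]
  rw [norm_mul] at h1
  have h3 : ‖a‖ * (2 + 4 * |Δ|) ≤ ‖a‖ * ‖b‖ := by gcongr; linarith
  nlinarith [abs_nonneg Δ]

lemma norm_pFac_le (Δ : ℝ) {a b : ℂ} {c : ℝ} (ha : 1 ≤ ‖a‖) (hb : ‖b‖ ≤ c) :
    ‖pFac Δ a b‖ ≤ (1 + c + 2 * |Δ|) * ‖a‖ := by
  have h1 : ‖pFac Δ a b‖ ≤ ‖(1 : ℂ)‖ + ‖a * b‖ + ‖(2 * Δ * a : ℂ)‖ :=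
    (norm_sub_le _ _).trans (add_le_add (norm_add_le _ _) le_rfl)
  simp only [norm_mul, norm_real, norm_eq_abs, norm_one, norm_ofNat] at h1
  have : ‖a‖ * ‖b‖ ≤ ‖a‖ * c := by gcongr
  nlinarith

lemma norm_pFac_le' (Δ : ℝ) {a b : ℂ} (ha : 1 ≤ ‖a‖) (hb : 1 ≤ ‖b‖) :
    ‖pFac Δ a b‖ ≤ (2 + 2 * |Δ|) * (‖a‖ * ‖b‖) := by
  have h := norm_pFac_le Δ ha (le_refl ‖b‖)
  have : ‖a‖ * 1 ≤ ‖a‖ * ‖b‖ := by gcongr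
  have h' : (1 + 2 * |Δ|) * (‖a‖ * 1) ≤ (1 + 2 * |Δ|) * (‖a‖ * ‖b‖) := by gcongr
  nlinarith

lemma pFac_ne_zero {Δ R : ℝ} (hR : 2 + 4 * |Δ| ≤ R) {a b : ℂ} (ha : 1 ≤ ‖a‖) (hb : R ≤ ‖b‖) :
    pFac Δ a b ≠ 0 := by
  have h := norm_pFac_ge hR ha hb
  have : 0 < R := by have := abs_nonneg Δ; linarith
  rw [← norm_pos_iff]
  refine lt_of_lt_of_le ?_ h
  have : 0 < ‖b‖ := by linarith
  positivity

/-! ### Products over pairs -/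

variable {N : ℕ}

/-- The product over the pairs `j < k` in `S`. -/
def pairProd {M : Type*} [CommMonoid M] (S : Finset (Fin N)) (f : Fin N → Fin N → M) : M :=
  ∏ j ∈ S, ∏ k ∈ S, if j < k then f j k else 1

lemma pairProd_erase {M : Type*} [CommMonoid M] (f : Fin N → Fin N → M) (m : Fin N) :
    pairProd univ f = pairProd (univ.erase m) f * (∏ j, if j < m then f j m else 1) *
      ∏ k, if m < k then f m k else 1 := by
  have h1 : ∀ j, (∏ k, if j < k then f j k else 1) =
      (if j < m then f j m else 1) * ∏ k ∈ univ.erase m, if j < k then f j k else 1 :=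
    fun j => (mul_prod_erase univ _ (mem_univ m)).symm
  have h2 : (∏ j, if j < m then f j m else 1) =
      ∏ j ∈ univ.erase m, if j < m then f j m else 1 := by
    rw [← mul_prod_erase univ _ (mem_univ m)]; simp
  rw [pairProd, ← mul_prod_erase univ _ (mem_univ m), h2]
  simp only [h1, prod_mul_distrib, pairProd, lt_irrefl, if_false, one_mul]
  ac_rfl

lemma pairProd_mul_self (S : Finset (Fin N)) (u : Fin N → ℝ) :
    pairProd S (fun j k => u j * u k) = (∏ j ∈ S, u j) ^ (S.card - 1) := by
  have h1 : pairProd S (fun j k => u j * u k) =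
      ∏ j ∈ S, ∏ k ∈ S, (if j < k then u j else 1) * (if k < j then u j else 1) := by
    simp only [prod_mul_distrib, pairProd]
    rw [prod_comm (s := S) (t := S) (f := fun j k => if k < j then u j else 1)]
    simp only [← prod_mul_distrib]
    refine prod_congr rfl fun j _ => prod_congr rfl fun k _ => ?_
    split_ifs <;> simp
  rw [h1, ← prod_pow]
  refine prod_congr rfl fun j hj => ?_
  rw [← mul_prod_erase S _ hj, ← card_erase_of_mem hj, ← prod_const]
  simp only [lt_irrefl, if_false, one_mul]
  refine prod_congr rfl fun k hk => ?_
  rcases lt_or_gt_of_ne (mem_erase.1 hk).1 with h | h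
  · simp [h, h.not_gt]
  · simp [h, h.not_gt]

lemma pairProd_mono {S : Finset (Fin N)} {f g : Fin N → Fin N → ℝ}
    (h0 : ∀ j ∈ S, ∀ k ∈ S, j < k → 0 ≤ f j k) (h : ∀ j ∈ S, ∀ k ∈ S, j < k → f j k ≤ g j k) :
    pairProd S f ≤ pairProd S g := by
  refine prod_le_prod (fun j hj => prod_nonneg fun k hk => ?_) fun j hj =>
    prod_le_prod (fun k hk => ?_) fun k hk => ?_
  · split_ifs with e
    exacts [h0 j hj k hk e, zero_le_one]
  · split_ifs with e
    exacts [h0 j hj k hk e, zero_le_one]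
  · split_ifs with e
    exacts [h j hj k hk e, le_rfl]

lemma norm_pairProd (S : Finset (Fin N)) (f : Fin N → Fin N → ℂ) :
    ‖pairProd S f‖ = pairProd S fun j k => ‖f j k‖ := by
  simp only [pairProd, norm_prod]
  refine prod_congr rfl fun j _ => prod_congr rfl fun k _ => ?_
  split_ifs <;> simp

lemma pairProd_ne_zero {S : Finset (Fin N)} {f : Fin N → Fin N → ℂ}
    (h : ∀ j ∈ S, ∀ k ∈ S, j < k → f j k ≠ 0) : pairProd S f ≠ 0 :=
  prod_ne_zero_iff.2 fun j hj => prod_ne_zero_iff.2 fun k hk => by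
    split_ifs with e
    exacts [h j hj k hk e, one_ne_zero]

lemma differentiableAt_prod {E ι : Type*} [NormedAddCommGroup E] [NormedSpace ℂ E]
    {S : Finset ι} {f : ι → E → ℂ} {w : E} (h : ∀ j ∈ S, DifferentiableAt ℂ (f j) w) :
    DifferentiableAt ℂ (fun w => ∏ j ∈ S, f j w) w := by
  classical
  induction S using Finset.induction_on with
  | empty => simp
  | insert a S ha ih =>
    simp only [prod_insert ha]
    exact (h a (mem_insert_self _ _)).mul (ih fun j hj => h j (mem_insert_of_mem hj))

lemma differentiableAt_pairProd {E : Type*} [NormedAddCommGroup E] [NormedSpace ℂ E]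
    {S : Finset (Fin N)} {f : Fin N → Fin N → E → ℂ} {w : E}
    (h : ∀ j ∈ S, ∀ k ∈ S, j < k → DifferentiableAt ℂ (f j k) w) :
    DifferentiableAt ℂ (fun w => pairProd S fun j k => f j k w) w := by
  unfold pairProd
  refine differentiableAt_prod fun j hj => differentiableAt_prod fun k hk => ?_
  split_ifs with e
  exacts [h j hj k hk e, differentiableAt_const _]

lemma pairProd_const_le (S : Finset (Fin N)) {c : ℝ} (hc : 0 ≤ c) :
    0 ≤ pairProd S (fun _ _ => c) :=
  prod_nonneg fun _ _ => prod_nonneg fun _ _ => by split_ifs <;> [exact hc; exact zero_le_one]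

lemma pairProd_mul (S : Finset (Fin N)) {M : Type*} [CommMonoid M] (f g : Fin N → Fin N → M) :
    pairProd S (fun j k => f j k * g j k) = pairProd S f * pairProd S g := by
  simp only [pairProd, ← prod_mul_distrib]
  refine prod_congr rfl fun j _ => prod_congr rfl fun k _ => ?_
  split_ifs <;> simp

lemma pairProd_congr {M : Type*} [CommMonoid M] {S : Finset (Fin N)} {f g : Fin N → Fin N → M}
    (h : ∀ j ∈ S, ∀ k ∈ S, j < k → f j k = g j k) : pairProd S f = pairProd S g :=
  prod_congr rfl fun j hj => prod_congr rfl fun k hk => by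
    split_ifs with e
    exacts [h j hj k hk e, rfl]

/-- A monomial is controlled by two of its variables if the others are bounded. -/
lemma exists_prod_zpow_le {ι : Type*} [Fintype ι] [DecidableEq ι] {a b : ι} (hab : a ≠ b)
    (e : ι → ℤ) {β : ℤ} (hb : e b ≤ β) (M : ℝ) : ∃ C : ℝ, 0 ≤ C ∧ ∀ n : ι → ℝ,
      (∀ j, j ≠ a → j ≠ b → 1 ≤ n j ∧ n j ≤ M) → 0 < n a → 1 ≤ n b →
        ∏ j, n j ^ e j ≤ C * (n a ^ e a * n b ^ β) := by
  refine ⟨∏ j ∈ (univ.erase a).erase b, (max M 1) ^ |e j|, by positivity, fun n hn ha hb1 => ?_⟩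
  rw [← mul_prod_erase univ _ (mem_univ a),
    ← mul_prod_erase (univ.erase a) _ (mem_erase.2 ⟨hab.symm, mem_univ b⟩), ← mul_assoc, mul_comm]
  have hb0 : 0 < n b := by linarith
  have h0 : ∀ j ∈ (univ.erase a).erase b, 1 ≤ n j ∧ n j ≤ M := fun j hj =>
    hn j (mem_erase.1 (mem_erase.1 hj).2).1 (mem_erase.1 hj).1
  refine mul_le_mul (prod_le_prod (fun j hj => ?_) fun j hj => ?_) ?_ (by positivity)
    (by positivity)
  · have := (h0 j hj).1
    positivity
  · have := h0 j hj
    calc n j ^ e j ≤ n j ^ |e j| := zpow_le_zpow_right₀ this.1 (le_abs_self _)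
      _ ≤ _ := zpow_le_zpow_left₀ (abs_nonneg _) (by linarith) (this.2.trans (le_max_left _ _))
  · gcongr

/-! ### Factorized integrals -/

lemma iter_prod {ι : Type} [DecidableEq ι] (Γ : ι → Contour) {l : List ι} (hl : l.Nodup)
    (f : ι → ℂ → ℂ) (v : ι → ℂ) :
    iter Γ l (fun v => ∏ j ∈ l.toFinset, f j (v j)) v =
      ∏ j ∈ l.toFinset, contourIntegral (Γ j) (f j) := by
  induction l generalizing v with
  | nil => simp [iter]
  | cons j l ih =>
    have hl' := List.nodup_cons.1 hl
    have hj : j ∉ l.toFinset := by simpa using hl'.1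
    simp only [List.toFinset_cons, prod_insert hj]
    have h1 : ∀ v, iter Γ l (fun v => f j (v j) * ∏ k ∈ l.toFinset, f k (v k)) v =
        f j (v j) * ∏ k ∈ l.toFinset, contourIntegral (Γ k) (f k) := fun v => by
      rw [iter_mul_of_indep Γ l (fun v => f j (v j)) _ v, ih hl'.2]
      intro v k hk z
      rw [update_of_ne (by rintro rfl; exact hl'.1 hk)]
    simp only [iter, h1, update_self]
    rw [mul_comm, ← contourIntegral_const_mul]
    congr 1; funext z; ring

lemma perm_apply_inv {ι : Type*} (σ : Perm ι) (j : ι) : σ (σ⁻¹ j) = j :=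
  σ.apply_symm_apply j

lemma perm_inv_apply {ι : Type*} (σ : Perm ι) (j : ι) : σ⁻¹ (σ j) = j :=
  σ.symm_apply_apply j

/-! ### Completeness of the Bethe ansatz -/

/-- The integrand of the propagator at time `0`. -/
def planeTerm (Δ : ℝ) (y x : Fin N → ℤ) (σ : Perm (Fin N)) (ξ : Fin N → ℂ) : ℂ :=
  (sign σ : ℤ) * pairProd univ (fun k k' => pFac Δ (ξ (σ k)) (ξ (σ k'))) /
    pairProd univ (fun j j' => pFac Δ (ξ j) (ξ j')) * ∏ j, ξ j ^ (x (σ⁻¹ j) - y j - 1)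

/-- The part of `planeTerm` that is left after cancellation, if `σ m = a`, without the denominator
that depends on `ξ_a`. -/
def reducedTerm (Δ : ℝ) (y x : Fin N → ℤ) (m a : Fin N) (σ : Perm (Fin N))
    (ξ : Fin N → ℂ) : ℂ :=
  (sign σ : ℤ) * pairProd (univ.erase m) (fun k k' => pFac Δ (ξ (σ k)) (ξ (σ k'))) /
    pairProd (univ.erase a) (fun j j' => pFac Δ (ξ j) (ξ j')) *
      (∏ b ∈ Ioc a m, pFac Δ (ξ b) (ξ a)) * ∏ j, ξ j ^ (x (σ⁻¹ j) - y j - 1)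

/-- The permutations that fix everything above `m` and send `m` to `a`. -/
def fixingAbove (m a : Fin N) : Finset (Perm (Fin N)) :=
  univ.filter fun σ => (∀ k, m < k → σ k = k) ∧ σ m = a

lemma inv_lt_iff_of_mem_fixingAbove {m a : Fin N} {σ : Perm (Fin N)}
    (hσ : σ ∈ fixingAbove m a) (j : Fin N) : σ⁻¹ j < m ↔ j ≤ m ∧ j ≠ a := by
  obtain ⟨-, h1, h2⟩ := mem_filter.1 hσ
  constructor
  · intro h
    constructor
    · by_contra hj
      rw [not_le] at hj
      have : σ⁻¹ j = j := by rw [Equiv.Perm.inv_eq_iff_eq, h1 j hj]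
      rw [this] at h
      exact absurd h hj.not_gt
    · rintro rfl
      rw [← h2, perm_inv_apply] at h
      exact lt_irrefl _ h
  · rintro ⟨h3, h4⟩
    rcases lt_trichotomy (σ⁻¹ j) m with h | h | h
    · exact h
    · exact absurd (by rw [← h2, ← h, perm_apply_inv]) h4
    · have := h1 _ h
      rw [perm_apply_inv] at this
      rw [← this] at h
      exact absurd h3 h.not_ge

lemma planeTerm_eq (Δ : ℝ) (y x : Fin N → ℤ) {m a : Fin N} (ham : a < m)
    {σ : Perm (Fin N)} (hσ : σ ∈ fixingAbove m a) {ξ : Fin N → ℂ}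
    (h : ∀ j k, pFac Δ (ξ j) (ξ k) ≠ 0) :
    planeTerm Δ y x σ ξ = reducedTerm Δ y x m a σ ξ / ∏ b ∈ Ioc a m, pFac Δ (ξ a) (ξ b) := by
  obtain ⟨-, h1, h2⟩ := mem_filter.1 hσ
  have e1 : (∏ k, if k < m then pFac Δ (ξ (σ k)) (ξ (σ m)) else 1) =
      (∏ j, if j < a then pFac Δ (ξ j) (ξ a) else 1) * ∏ b ∈ Ioc a m, pFac Δ (ξ b) (ξ a) := by
    rw [← Equiv.prod_comp σ⁻¹]
    simp only [perm_apply_inv, h2, inv_lt_iff_of_mem_fixingAbove hσ]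
    have : (∏ b ∈ Ioc a m, pFac Δ (ξ b) (ξ a)) =
        ∏ b, if a < b ∧ b ≤ m then pFac Δ (ξ b) (ξ a) else 1 := by
      rw [← prod_filter]; congr 1; ext b; simp
    rw [this, ← prod_mul_distrib]
    refine prod_congr rfl fun j _ => ?_
    rcases lt_trichotomy j a with h | h | h
    · simp [h, h.ne, h.not_gt, (h.trans ham).le]
    · simp [h]
    · simp [h, h.ne', h.not_gt]
  have e2 : (∏ k, if m < k then pFac Δ (ξ (σ m)) (ξ (σ k)) else 1) =
      ∏ k, if m < k then pFac Δ (ξ a) (ξ k) else 1 := by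
    refine prod_congr rfl fun k _ => ?_
    split_ifs with hk
    · rw [h1 k hk, h2]
    · rfl
  have e3 : (∏ k, if a < k then pFac Δ (ξ a) (ξ k) else 1) =
      (∏ b ∈ Ioc a m, pFac Δ (ξ a) (ξ b)) * ∏ k, if m < k then pFac Δ (ξ a) (ξ k) else 1 := by
    have : (∏ b ∈ Ioc a m, pFac Δ (ξ a) (ξ b)) =
        ∏ b, if a < b ∧ b ≤ m then pFac Δ (ξ a) (ξ b) else 1 := by
      rw [← prod_filter]; congr 1; ext b; simp
    rw [this, ← prod_mul_distrib]
    refine prod_congr rfl fun j _ => ?_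
    rcases le_or_gt j m with h | h
    · simp [h, h.not_gt]
    · simp [h, h.not_ge, ham.trans h]
  have n1 : (∏ j, if j < a then pFac Δ (ξ j) (ξ a) else 1) ≠ 0 :=
    prod_ne_zero_iff.2 fun j _ => by split_ifs <;> simp [h]
  have n2 : (∏ k, if m < k then pFac Δ (ξ a) (ξ k) else 1) ≠ 0 :=
    prod_ne_zero_iff.2 fun j _ => by split_ifs <;> simp [h]
  have n3 : ∏ b ∈ Ioc a m, pFac Δ (ξ a) (ξ b) ≠ 0 := prod_ne_zero_iff.2 fun j _ => h _ _
  have n4 : pairProd (univ.erase a) (fun j j' => pFac Δ (ξ j) (ξ j')) ≠ 0 :=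
    pairProd_ne_zero fun _ _ _ _ _ => h _ _
  rw [planeTerm, reducedTerm, pairProd_erase _ m, pairProd_erase _ a, e1, e2, e3]
  field_simp

/-- The sum over the permutations vanishes if two of the variables coincide. -/
lemma sum_reducedTerm_eq_zero (Δ : ℝ) (y x : Fin N → ℤ) {m a b c : Fin N} (hb : b ∈ Ioc a m)
    (hc : c ∈ Ioc a m) (hbc : b ≠ c) {ξ : Fin N → ℂ} (h : ξ b = ξ c) (h0 : ∀ j, ξ j ≠ 0) :
    ∑ σ ∈ fixingAbove m a, reducedTerm Δ y x m a σ ξ = 0 := by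
  have hs : ∀ j, ξ (swap b c j) = ξ j := fun j => by
    rcases eq_or_ne j b with rfl | h1
    · rw [swap_apply_left, h]
    rcases eq_or_ne j c with rfl | h2
    · rw [swap_apply_right, h]
    rw [swap_apply_of_ne_of_ne h1 h2]
  rw [mem_Ioc] at hb hc
  refine sum_involution (fun σ _ => swap b c * σ) (fun σ hσ => ?_) (fun σ hσ _ e => ?_)
    (fun σ hσ => ?_) fun σ hσ => ?_
  · have e1 : ∏ j, ξ j ^ (x ((swap b c * σ)⁻¹ j) - y j - 1) =
        ∏ j, ξ j ^ (x (σ⁻¹ j) - y j - 1) := by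
      have h1 : ∀ τ : Perm (Fin N), ∏ j, ξ j ^ (x (τ⁻¹ j) - y j - 1) =
          (∏ k, ξ (τ k) ^ x k) * ∏ j, ξ j ^ (- y j - 1) := fun τ => by
        rw [← Equiv.prod_comp τ⁻¹ fun k => ξ (τ k) ^ x k, ← prod_mul_distrib]
        refine prod_congr rfl fun j _ => ?_
        rw [perm_apply_inv, ← zpow_add₀ (h0 j)]
        congr 1; ring
      rw [h1, h1]
      simp only [Equiv.Perm.mul_apply, hs]
    simp only [reducedTerm, Equiv.Perm.mul_apply, hs, e1, Equiv.Perm.sign_mul,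
      sign_swap hbc]
    push_cast
    ring
  · have : swap b c = 1 := by simpa using e
    exact hbc (Equiv.swap_eq_one_iff.1 this)
  · obtain ⟨-, h1, h2⟩ := mem_filter.1 hσ
    refine mem_filter.2 ⟨mem_univ _, fun k hk => ?_, ?_⟩
    · rw [Equiv.Perm.mul_apply, h1 k hk, swap_apply_of_ne_of_ne]
      · exact (hb.2.trans_lt hk).ne'
      · exact (hc.2.trans_lt hk).ne'
    · rw [Equiv.Perm.mul_apply, h2, swap_apply_of_ne_of_ne hb.1.ne hc.1.ne]
  · simp

lemma exists_reducedTerm_le {Δ R : ℝ} (hR : 2 + 4 * |Δ| ≤ R) {y x : Fin N → ℤ}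
    (hx : StrictMono x) {m a b : Fin N} (hb : b ∈ Ioc a m) {σ : Perm (Fin N)}
    (hσ : σ ∈ fixingAbove m a) (M : ℝ) :
    ∃ C : ℝ, 0 ≤ C ∧ ∀ ξ : Fin N → ℂ, ξ a ≠ 0 → ‖ξ a‖ ≤ R → (∀ j, j ≠ a → R ≤ ‖ξ j‖) →
      (∀ j, j ≠ a → j ≠ b → ‖ξ j‖ ≤ M) →
        ‖reducedTerm Δ y x m a σ ξ‖ ≤ C * (‖ξ a‖ ^ (x m - y a - 1) * ‖ξ b‖ ^ (x m - y b - 1)) := by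
  have hσ2 := (mem_filter.1 hσ).2.2
  have hab : a < b := (mem_Ioc.1 hb).1
  have hR1 : 1 ≤ R := by have := abs_nonneg Δ; linarith
  set e : Fin N → ℤ := fun j => x (σ⁻¹ j) - y j - 1 + if j ∈ Ioc a m then 1 else 0 with he
  have hea : e a = x m - y a - 1 := by
    simp [he, ← hσ2]
  have heb : e b ≤ x m - y b - 1 := by
    have h1 : x (σ⁻¹ b) < x m :=
      hx ((inv_lt_iff_of_mem_fixingAbove hσ b).2 ⟨(mem_Ioc.1 hb).2, hab.ne'⟩)
    simp only [he, hb, if_true]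
    linarith
  obtain ⟨C, hC, hbound⟩ := exists_prod_zpow_le hab.ne e heb M
  set c₁ : ℝ := pairProd (univ.erase m) fun _ _ => 2 + 2 * |Δ|
  set c₂ : ℝ := pairProd (univ.erase a) fun _ _ => (1 / 2 : ℝ) with hc₂
  have hc₁0 : 0 ≤ c₁ := pairProd_const_le _ (by positivity)
  have hc₂0 : 0 < c₂ := prod_pos fun _ _ => prod_pos fun _ _ => by split_ifs <;> norm_num
  refine ⟨c₁ / c₂ * (1 + R + 2 * |Δ|) ^ (Ioc a m).card * C, by positivity,
    fun ξ h0 h1 h2 h3 => ?_⟩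
  have h4 : ∀ j, j ≠ a → 1 ≤ ‖ξ j‖ := fun j hj => hR1.trans (h2 j hj)
  set U : ℝ := (∏ j ∈ univ.erase a, ‖ξ j‖) ^ ((univ.erase a).card - 1) with hU
  have hU0 : 0 < U := by
    refine pow_pos (prod_pos fun j hj => ?_) _
    have := h4 j (mem_erase.1 hj).1; linarith
  have k1 : ‖pairProd (univ.erase m) fun k k' => pFac Δ (ξ (σ k)) (ξ (σ k'))‖ ≤ c₁ * U := by
    have hk : ∀ k ∈ univ.erase m, 1 ≤ ‖ξ (σ k)‖ := fun k hk => h4 _ (by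
      rw [← hσ2]; exact fun e => (mem_erase.1 hk).1 (σ.injective e))
    have : U = pairProd (univ.erase m) fun k k' => ‖ξ (σ k)‖ * ‖ξ (σ k')‖ := by
      rw [pairProd_mul_self (univ.erase m) fun k => ‖ξ (σ k)‖, hU, card_erase_of_mem (mem_univ _),
        card_erase_of_mem (mem_univ _)]
      congr 1
      refine (prod_bij (fun k _ => σ k) (fun k hk => ?_) (fun _ _ _ _ h => σ.injective h)
        (fun j hj => ⟨σ⁻¹ j, ?_, by simp⟩) fun _ _ => rfl).symm
      · rw [← hσ2]
        exact mem_erase.2 ⟨fun e => (mem_erase.1 hk).1 (σ.injective e), mem_univ _⟩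
      · refine mem_erase.2 ⟨fun e => (mem_erase.1 hj).1 ?_, mem_univ _⟩
        rw [← hσ2, ← e, perm_apply_inv]
    rw [this, ← pairProd_mul, norm_pairProd]
    exact pairProd_mono (fun _ _ _ _ _ => norm_nonneg _) fun j hj k hk' _ =>
      norm_pFac_le' Δ (hk j hj) (hk k hk')
  have k2 : c₂ * U ≤ ‖pairProd (univ.erase a) fun j j' => pFac Δ (ξ j) (ξ j')‖ := by
    rw [hU, ← pairProd_mul_self, ← pairProd_mul, norm_pairProd]
    refine pairProd_mono (fun j _ k _ _ => by positivity) fun j hj k hk _ => ?_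
    exact norm_pFac_ge hR (h4 j (mem_erase.1 hj).1) (h2 k (mem_erase.1 hk).1)
  have k3 : ‖∏ b ∈ Ioc a m, pFac Δ (ξ b) (ξ a)‖ ≤
      (1 + R + 2 * |Δ|) ^ (Ioc a m).card * ∏ j ∈ Ioc a m, ‖ξ j‖ := by
    rw [norm_prod, ← prod_const, ← prod_mul_distrib]
    exact prod_le_prod (fun _ _ => norm_nonneg _) fun j hj =>
      norm_pFac_le Δ (h4 j (mem_Ioc.1 hj).1.ne') h1
  have k4 : (∏ j ∈ Ioc a m, ‖ξ j‖) * ‖∏ j, ξ j ^ (x (σ⁻¹ j) - y j - 1)‖ = ∏ j, ‖ξ j‖ ^ e j := by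
    have : (∏ j ∈ Ioc a m, ‖ξ j‖) = ∏ j, ‖ξ j‖ ^ (if j ∈ Ioc a m then 1 else 0 : ℤ) := by
      rw [← prod_subset (subset_univ (Ioc a m))]
      · exact prod_congr rfl fun j hj => by simp only [hj, if_true, zpow_one]
      · intro j _ hj; simp only [hj, if_false, zpow_zero]
    rw [this, norm_prod, ← prod_mul_distrib]
    refine prod_congr rfl fun j _ => ?_
    have : ‖ξ j‖ ≠ 0 := by
      rcases eq_or_ne j a with rfl | hj
      · exact norm_ne_zero_iff.2 h0
      · have := h4 j hj; linarith
    rw [norm_zpow, ← zpow_add₀ this]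
    congr 1; rw [he]; ring
  have k5 := hbound (fun j => ‖ξ j‖) (fun j hja hjb => ⟨h4 j hja, h3 j hja hjb⟩)
    (norm_pos_iff.2 h0) (h4 b hab.ne')
  have ks : ‖((sign σ : ℤ) : ℂ)‖ = 1 := by
    rcases Int.units_eq_one_or (sign σ) with h | h <;> simp [h]
  rw [reducedTerm, norm_mul, norm_mul, norm_div, norm_mul, ks, one_mul]
  calc _ ≤ c₁ * U / (c₂ * U) * ((1 + R + 2 * |Δ|) ^ (Ioc a m).card * ∏ j ∈ Ioc a m, ‖ξ j‖) *
        ‖∏ j, ξ j ^ (x (σ⁻¹ j) - y j - 1)‖ := by gcongr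
    _ = c₁ / c₂ * (1 + R + 2 * |Δ|) ^ (Ioc a m).card * ∏ j, ‖ξ j‖ ^ e j := by
        rw [← k4]; field_simp
    _ ≤ c₁ / c₂ * (1 + R + 2 * |Δ|) ^ (Ioc a m).card *
          (C * (‖ξ a‖ ^ (x m - y a - 1) * ‖ξ b‖ ^ (x m - y b - 1))) := by
        rw [← hea]; gcongr
    _ = _ := by ring

lemma differentiableAt_reducedTerm {Δ R : ℝ} (hR : 2 + 4 * |Δ| ≤ R) (y x : Fin N → ℤ)
    (m a : Fin N) (σ : Perm (Fin N)) {ξ : Fin N → ℂ} (h0 : ξ a ≠ 0)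
    (h : ∀ j, j ≠ a → R ≤ ‖ξ j‖) : DifferentiableAt ℂ (reducedTerm Δ y x m a σ) ξ := by
  have hR1 : 1 ≤ R := by have := abs_nonneg Δ; linarith
  have h4 : ∀ j, j ≠ a → 1 ≤ ‖ξ j‖ := fun j hj => hR1.trans (h j hj)
  have hd : ∀ j k, DifferentiableAt ℂ (fun ξ : Fin N → ℂ => pFac Δ (ξ j) (ξ k)) ξ := fun j k => by
    unfold pFac; fun_prop
  refine DifferentiableAt.mul (DifferentiableAt.mul (differentiableAt_div
    (DifferentiableAt.const_mul (differentiableAt_pairProd fun _ _ _ _ _ => hd _ _) _)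
    (differentiableAt_pairProd fun _ _ _ _ _ => hd _ _) ?_)
    (differentiableAt_prod fun _ _ => hd _ _)) (differentiableAt_prod fun j _ => ?_)
  · exact pairProd_ne_zero fun j hj k hk _ =>
      pFac_ne_zero hR (h4 j (mem_erase.1 hj).1) (h k (mem_erase.1 hk).1)
  · refine (differentiableAt_apply j ξ).zpow (.inl ?_)
    rcases eq_or_ne j a with rfl | hj
    · exact h0
    · rw [← norm_pos_iff]; have := h4 j hj; linarith

lemma continuousOn_planeTerm {Δ R : ℝ} (hR : 2 + 4 * |Δ| ≤ R) (y x : Fin N → ℤ)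
    (σ : Perm (Fin N)) :
    ContinuousOn (planeTerm Δ y x σ) (offBox [] fun _ => {z : ℂ | ‖z‖ = R}) := by
  intro ξ hξ
  have hξ : ∀ j, ‖ξ j‖ = R := mem_offBox_nil.1 hξ
  have hR1 : 1 ≤ R := by have := abs_nonneg Δ; linarith
  have hd : ∀ j k, DifferentiableAt ℂ (fun ξ : Fin N → ℂ => pFac Δ (ξ j) (ξ k)) ξ := fun j k => by
    unfold pFac; fun_prop
  refine (DifferentiableAt.continuousAt (𝕜 := ℂ) (DifferentiableAt.mul (differentiableAt_div
    (DifferentiableAt.const_mul (differentiableAt_pairProd fun _ _ _ _ _ => hd _ _) _)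
    (differentiableAt_pairProd fun _ _ _ _ _ => hd _ _) ?_)
    (differentiableAt_prod fun j _ => ?_))).continuousWithinAt
  · exact pairProd_ne_zero fun j _ k _ _ =>
      pFac_ne_zero hR (hR1.trans (hξ j).ge) (hξ k).ge
  · refine (differentiableAt_apply j ξ).zpow (.inl ?_)
    rw [← norm_pos_iff, hξ]; linarith

lemma iter_sum_planeTerm_eq_zero {Δ R : ℝ} (hR : 2 + 4 * |Δ| ≤ R) {y x : Fin N → ℤ}
    (hy : StrictMono y) (hx : StrictMono x) {L : List (Fin N)} (hL : L.Nodup)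
    (hmem : ∀ j, j ∈ L) {m a : Fin N} (ham : a < m) :
    iter (fun _ => circ R) L (fun ξ => ∑ σ ∈ fixingAbove m a, planeTerm Δ y x σ ξ) 0 = 0 := by
  have hΔ := abs_nonneg Δ
  have hR1 : 1 ≤ R := by linarith
  have hR0 : 0 < R := by linarith
  have htr : ∀ j ∈ L, trace (circ R) ⊆ {z : ℂ | ‖z‖ = R} :=
    fun _ _ _ hz => norm_of_mem_circ hR0.le hz
  refine iter_eq_zero (T := fun _ => {z : ℂ | ‖z‖ = R}) (l' := a :: (Ioc a m).toList)
    ⟨(univ \ insert a (Ioc a m)).toList, ?_⟩ (fun _ _ => isSmooth_circ R) htr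
    (continuousOn_finsetSum _ fun σ _ => continuousOn_planeTerm hR y x σ) (fun u hu => ?_)
    fun j hj => absurd (hmem j) hj
  · refine (List.perm_ext_iff_of_nodup hL ?_).2 fun j => ?_
    · refine List.Nodup.append (nodup_toList _) ?_ ?_
      · simp [nodup_toList]
      · intro j h1 h2
        simp only [mem_toList, mem_sdiff, mem_univ, true_and, mem_insert, not_or] at h1
        rcases List.mem_cons.1 h2 with h | h
        exacts [h1.1 h, h1.2 (mem_toList.1 h)]
    · simp only [hmem, true_iff, List.mem_append, mem_toList, mem_sdiff, mem_univ, true_and,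
        mem_insert, List.mem_cons]
      tauto
  set T : Fin N → Set ℂ := fun j => if j = a then {z | z ≠ 0 ∧ ‖z‖ ≤ R} else
    if j ∈ Ioc a m then {z | R ≤ ‖z‖} else {z | ‖z‖ = R} with hT
  have hTa : ∀ w ∈ offBox [] T, w a ≠ 0 ∧ ‖w a‖ ≤ R := fun w hw => by
    simpa [hT] using mem_offBox_nil.1 hw a
  have hTj : ∀ w ∈ offBox [] T, ∀ j, j ≠ a → R ≤ ‖w j‖ := fun w hw j hj => by
    have := mem_offBox_nil.1 hw j
    simp only [hT, hj, if_false] at this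
    split_ifs at this
    · exact this
    · exact (show ‖w j‖ = R from this).ge
  have hTn : ∀ w ∈ offBox [] T, ∀ j, j ≠ a → j ∉ Ioc a m → ‖w j‖ = R := fun w hw j hj hj' => by
    have := mem_offBox_nil.1 hw j
    simpa only [hT, hj, hj', if_false, Set.mem_ofPred_eq] using this
  have haB : a ∉ Ioc a m := by simp
  have hmB : m ∈ Ioc a m := by simp [ham]
  have hmemT : ∀ j, j ∈ (Ioc a m).toList ↔ j ∈ Ioc a m := fun j => mem_toList
  have key := iter_eq_zero_of_growth (Δ := Δ) (r := R) (ρ := R) hR0 hR0 (by nlinarith) (a := a)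
    (B := Ioc a m) ⟨m, hmB⟩ haB (nodup_toList _) hmemT (Γ := fun _ => circ R) rfl (fun _ _ => rfl)
    (T := T) (fun z h0 h1 => by simp [hT, h0, h1])
    (fun b hb z hz => by
      have : b ≠ a := by rintro rfl; exact haB hb
      simpa only [hT, this, hb, if_true, if_false, Set.mem_ofPred_eq] using hz)
    (Φ := fun ξ => ∑ σ ∈ fixingAbove m a, reducedTerm Δ y x m a σ ξ)
    (fun w hw => DifferentiableAt.fun_sum fun σ _ =>
      differentiableAt_reducedTerm hR y x m a σ (hTa w hw).1 (hTj w hw))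
    (fun w hw b hb c hc hbc h => sum_reducedTerm_eq_zero Δ y x hb hc hbc h fun j => by
      rcases eq_or_ne j a with rfl | hj
      · exact (hTa w hw).1
      · rw [← norm_pos_iff]; have := hTj w hw j hj; linarith)
    (fun b hb M => ?_) (u := u) ?_
  · rw [← key]
    refine iter_congr (T := fun _ => {z : ℂ | ‖z‖ = R}) (fun _ _ _ hz => norm_of_mem_circ hR0.le hz)
      (fun v hv => ?_) hu
    have hv : ∀ j, ‖v j‖ = R := mem_offBox_nil.1 hv
    rw [sum_div]
    refine sum_congr rfl fun σ hσ => ?_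
    exact planeTerm_eq Δ y x ham hσ fun j k =>
      pFac_ne_zero hR (hR1.trans (hv j).ge) (hv k).ge
  · have hab := (mem_Ioc.1 hb).1
    choose! C hC0 hC using fun σ (hσ : σ ∈ fixingAbove m a) =>
      exists_reducedTerm_le hR (y := y) hx hb hσ (max M R)
    refine ⟨∑ σ ∈ fixingAbove m a, C σ, x m - y a - 1, x m - y b - 1, ?_,
      fun w hw h0 h1 _ h3 => ?_⟩
    · have := hy hab; omega
    · rw [sum_mul]
      refine (norm_sum_le _ _).trans (sum_le_sum fun σ hσ => hC σ hσ w h0 h1 (hTj w hw) ?_)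
      intro j hja hjb
      by_cases hj : j ∈ Ioc a m
      · exact (h3 j hj hjb).trans (le_max_left _ _)
      · exact (hTn w hw j hja hj).le.trans (le_max_right _ _)
  · intro j hj
    have h := hu j hj
    simp only [List.mem_cons, not_or, mem_toList] at hj
    simpa only [hT, hj.1, hj.2, if_false] using h

/-- The plane waves of the Bethe ansatz are complete. -/
theorem iter_sum_planeTerm {Δ R : ℝ} (hR : 2 + 4 * |Δ| ≤ R) {y x : Fin N → ℤ}
    (hy : StrictMono y) (hx : StrictMono x) {L : List (Fin N)} (hL : L.Nodup)
    (hmem : ∀ j, j ∈ L) :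
    iter (fun _ => circ R) L (fun ξ => ∑ σ, planeTerm Δ y x σ ξ) 0 = if y = x then 1 else 0 := by
  have hΔ := abs_nonneg Δ
  have hR1 : 1 ≤ R := by linarith
  have hR0 : 0 < R := by linarith
  have htr : ∀ j ∈ L, trace (circ R) ⊆ {z : ℂ | ‖z‖ = R} :=
    fun _ _ _ hz => norm_of_mem_circ hR0.le hz
  have h0 : (0 : Fin N → ℂ) ∈ offBox L fun _ => {z : ℂ | ‖z‖ = R} := fun j hj => absurd (hmem j) hj
  have hcont := continuousOn_planeTerm hR y x
  have hsum : ∀ A : Finset (Perm (Fin N)),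
      iter (fun _ => circ R) L (fun ξ => ∑ σ ∈ A, planeTerm Δ y x σ ξ) 0 =
        ∑ σ ∈ A, iter (fun _ => circ R) L (planeTerm Δ y x σ) 0 := fun A =>
    iter_sum (T := fun _ => {z : ℂ | ‖z‖ = R}) (fun _ _ => isSmooth_circ R) htr A
      (fun σ _ => hcont σ) h0
  set A : ℕ → Finset (Perm (Fin N)) :=
    fun m => univ.filter fun σ => ∀ k : Fin N, m ≤ k → σ k = k with hA
  have step : ∀ m, ∑ σ ∈ A m, iter (fun _ => circ R) L (planeTerm Δ y x σ) 0 =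
      if y = x then 1 else 0 := by
    intro m
    induction m with
    | zero =>
      have : A 0 = {1} := by
        ext σ
        simp [hA, Equiv.ext_iff]
      rw [this, sum_singleton]
      have e1 : iter (fun _ => circ R) L (planeTerm Δ y x 1) 0 =
          iter (fun _ => circ R) L (fun ξ => ∏ j ∈ L.toFinset, ξ j ^ (x j - y j - 1)) 0 := by
        refine iter_congr htr (fun ξ hξ => ?_) h0
        have hξ : ∀ j, ‖ξ j‖ = R := mem_offBox_nil.1 hξ
        have hu : L.toFinset = univ := by ext j; simp [hmem]
        have : pairProd univ (fun j j' => pFac Δ (ξ j) (ξ j')) ≠ 0 :=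
          pairProd_ne_zero fun j _ k _ _ => pFac_ne_zero hR (hR1.trans (hξ j).ge) (hξ k).ge
        simp [planeTerm, hu, div_self this]
      rw [e1, iter_prod (fun _ => circ R) hL fun j z => z ^ (x j - y j - 1)]
      simp only [contourIntegral_circ_zpow hR0]
      split_ifs with h
      · exact prod_eq_one fun j _ => by simp [h]
      · obtain ⟨j, hj⟩ := Function.ne_iff.1 h
        refine prod_eq_zero (i := j) (by simpa using hmem j) ?_
        rw [if_neg]; omega
    | succ m ih =>
      by_cases hm : m < N
      · rw [← sum_fiberwise (A (m + 1)) (fun σ => σ ⟨m, hm⟩),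
          ← add_sum_erase univ _ (mem_univ (⟨m, hm⟩ : Fin N)), ← ih]
        have e0 : (A (m + 1)).filter (fun σ => σ ⟨m, hm⟩ = ⟨m, hm⟩) = A m := by
          ext σ
          simp only [hA, mem_filter, mem_univ, true_and]
          constructor
          · rintro ⟨h1, h2⟩ k hk
            rcases hk.lt_or_eq with h | h
            · exact h1 k h
            · have : k = ⟨m, hm⟩ := Fin.ext h.symm
              rw [this, h2]
          · exact fun h => ⟨fun k hk => h k (by omega), h _ le_rfl⟩
        rw [e0, add_eq_left]
        refine sum_eq_zero fun a ha => ?_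
        have e1 : (A (m + 1)).filter (fun σ => σ ⟨m, hm⟩ = a) = fixingAbove ⟨m, hm⟩ a := by
          ext σ
          simp only [hA, fixingAbove, mem_filter, mem_univ, true_and, Fin.lt_def]
          rfl
        rw [e1, ← hsum]
        rcases lt_or_gt_of_ne (mem_erase.1 ha).1 with h | h
        · exact iter_sum_planeTerm_eq_zero hR hy hx hL hmem h
        · have : fixingAbove ⟨m, hm⟩ a = ∅ := by
            refine eq_empty_of_forall_notMem fun σ hσ => ?_
            obtain ⟨-, h1, h2⟩ := mem_filter.1 hσ
            exact (mem_erase.1 ha).1 (σ.injective ((h1 a h).trans h2.symm))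
          rw [this]
          simpa using iter_zero (fun _ => circ R) L (0 : Fin N → ℂ)
      · have : A (m + 1) = A m := by
          ext σ
          simp only [hA, mem_filter, mem_univ, true_and]
          exact ⟨fun _ k hk => absurd k.2 (by omega), fun _ k hk => absurd k.2 (by omega)⟩
        rw [this, ih]
  have := step N
  rw [← hsum] at this
  rw [← this]
  congr 1
  funext ξ
  refine sum_congr ?_ fun _ _ => rfl
  ext σ
  simp only [hA, mem_filter, mem_univ, true_and, true_iff]
  exact fun k hk => absurd k.2 (by omega)

/-! ### Two residue computations -/

lemma contourIntegral_circ_eq_zero {ρ : ℝ} (hρ : 0 ≤ ρ) {F : ℂ → ℂ}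
    (hF : ∀ z, ‖z‖ ≤ ρ → DifferentiableAt ℂ F z) : contourIntegral (circ ρ) F = 0 := by
  rw [contourIntegral_circ, Complex.circleIntegral_eq_zero_of_differentiable_on_off_countable hρ
    Set.countable_empty, mul_zero]
  · intro z hz
    exact (hF z (by simpa using hz)).continuousAt.continuousWithinAt
  · intro z hz
    exact hF z (by simpa using (Metric.ball_subset_closedBall hz.1))

lemma contourIntegral_circ_sub_inv {ρ : ℝ} {c : ℂ} (hc : ‖c‖ < ρ) :
    contourIntegral (circ ρ) (fun z => (z - c)⁻¹) = 1 := by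
  rw [contourIntegral_circ, circleIntegral.integral_sub_inv_of_mem_ball (by simpa using hc)]
  exact inv_mul_cancel₀ Complex.two_pi_I_ne_zero

lemma contourIntegral_circ_inv {ρ : ℝ} (hρ : 0 < ρ) :
    contourIntegral (circ ρ) (fun z => z⁻¹) = 1 := by
  simpa using contourIntegral_circ_sub_inv (c := 0) (by simpa using hρ)

/-- The pole `1/a` is removed by shrinking the circle. -/
lemma contourIntegral_circ_shrink {s ρ : ℝ} (hs : 0 < s) {a : ℂ} (h1 : s * ‖a‖ < 1)
    (h2 : 1 < ρ * ‖a‖) {h : ℂ → ℂ} (hh : ∀ z, s ≤ ‖z‖ → ‖z‖ ≤ ρ → DifferentiableAt ℂ h z) :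
    contourIntegral (circ ρ) (fun z => h a⁻¹ * z⁻¹ + h z * (1 - a * z)⁻¹ * z⁻¹) =
      contourIntegral (circ s) fun z => h z * (1 - a * z)⁻¹ * z⁻¹ := by
  have ha : a ≠ 0 := by rintro rfl; simp at h2; linarith
  have ha' : 0 < ‖a‖ := norm_pos_iff.2 ha
  have hsρ : s < ρ := by
    by_contra hc
    have : ρ * ‖a‖ ≤ s * ‖a‖ := by gcongr; linarith
    linarith
  have c1 : s < ‖a⁻¹‖ := by rw [norm_inv, lt_inv_comm₀ hs ha', lt_inv_comm₀ ha' hs, lt_inv_comm₀ hs ha',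
    ← one_div, lt_div_iff₀ hs]; linarith
  have c2 : ‖a⁻¹‖ < ρ := by rw [norm_inv, ← one_div, div_lt_iff₀ ha']; exact h2
  have hz0 : ∀ z : ℂ, s ≤ ‖z‖ → z ≠ 0 := fun z hz => by rw [← norm_pos_iff]; linarith
  have hF : ∀ z, s ≤ ‖z‖ → ‖z‖ ≤ ρ → DifferentiableAt ℂ (fun z => h z * z⁻¹ - h a⁻¹ * a) z :=
    fun z hz1 hz2 => ((hh z hz1 hz2).mul (differentiableAt_inv (hz0 z hz1))).sub_const _
  have key := contourIntegral_circ_eq_of_zeros hs hsρ.le {a⁻¹} (by simpa using c1.ne')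
    (by simpa using c2) hF (by simp)
  simp only [prod_singleton] at key
  have hne : ∀ z : ℂ, z ≠ a⁻¹ → 1 - a * z ≠ 0 := fun z hz e => hz (by
    rw [eq_comm]
    exact inv_eq_of_mul_eq_one_right (sub_eq_zero.1 e).symm)
  have split : ∀ z : ℂ, z ≠ 0 → z ≠ a⁻¹ → h z * (1 - a * z)⁻¹ * z⁻¹ =
      -a⁻¹ * ((h z * z⁻¹ - h a⁻¹ * a) / (z - a⁻¹)) + -h a⁻¹ * (z - a⁻¹)⁻¹ := by
    intro z hz hz'
    have e1 : (1 - a * z)⁻¹ = -a⁻¹ * (z - a⁻¹)⁻¹ := by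
      rw [← inv_neg, ← mul_inv]
      congr 1; field_simp; ring
    rw [e1]
    have := sub_ne_zero.2 hz'
    field_simp
    ring
  have cont : ∀ r, s ≤ r → r ≤ ρ → r ≠ ‖a⁻¹‖ →
      ContinuousOn (fun z => -a⁻¹ * ((h z * z⁻¹ - h a⁻¹ * a) / (z - a⁻¹))) (trace (circ r)) ∧
      ContinuousOn (fun z => -h a⁻¹ * (z - a⁻¹)⁻¹) (trace (circ r)) := by
    intro r hr1 hr2 hr3
    have hn : ∀ z ∈ trace (circ r), ‖z‖ = r := fun z hz => norm_of_mem_circ (hs.le.trans hr1) hz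
    have hd : ContinuousOn (fun z : ℂ => z - a⁻¹) (trace (circ r)) := by fun_prop
    have hd0 : ∀ z ∈ trace (circ r), z - a⁻¹ ≠ 0 := fun z hz e => by
      apply hr3; rw [← hn z hz, sub_eq_zero.1 e]
    refine ⟨continuousOn_const.mul (ContinuousOn.div (fun z hz => ?_) hd hd0),
      continuousOn_const.mul (hd.inv₀ hd0)⟩
    have := hn z hz
    exact (hF z (this ▸ hr1) (this ▸ hr2)).continuousAt.continuousWithinAt
  have expand : ∀ r, s ≤ r → r ≤ ρ → r ≠ ‖a⁻¹‖ →
      contourIntegral (circ r) (fun z => h z * (1 - a * z)⁻¹ * z⁻¹) =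
        -a⁻¹ * contourIntegral (circ r) (fun z => (h z * z⁻¹ - h a⁻¹ * a) / (z - a⁻¹)) +
          -h a⁻¹ * contourIntegral (circ r) fun z => (z - a⁻¹)⁻¹ := by
    intro r hr1 hr2 hr3
    obtain ⟨k1, k2⟩ := cont r hr1 hr2 hr3
    rw [← contourIntegral_const_mul, ← contourIntegral_const_mul,
      ← contourIntegral_add (isSmooth_circ r) k1 k2]
    refine contourIntegral_congr fun z hz => ?_
    have hn := norm_of_mem_circ (hs.le.trans hr1) hz
    refine split z (hz0 z (hr1.trans hn.ge)) ?_
    rintro rfl; exact hr3 hn.symm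
  have hz : contourIntegral (circ s) (fun z => (z - a⁻¹)⁻¹) = 0 :=
    contourIntegral_circ_eq_zero hs.le fun z hz => by
      refine DifferentiableAt.fun_inv (by fun_prop) fun e => ?_
      rw [sub_eq_zero.1 e] at hz; linarith
  have k0 : ContinuousOn (fun z : ℂ => h a⁻¹ * z⁻¹) (trace (circ ρ)) :=
    continuousOn_const.mul (continuousOn_id.inv₀ fun z hz => by
      have := norm_of_mem_circ (hs.le.trans hsρ.le) hz
      exact hz0 z (this ▸ hsρ.le))
  obtain ⟨k1, k2⟩ := cont ρ hsρ.le le_rfl c2.ne'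
  have k3 : ContinuousOn (fun z => h z * (1 - a * z)⁻¹ * z⁻¹) (trace (circ ρ)) := by
    refine (k1.add k2).congr fun z hz => ?_
    have hn := norm_of_mem_circ (hs.le.trans hsρ.le) hz
    refine split z (hz0 z (by rw [hn]; exact hsρ.le)) ?_
    rintro rfl; exact c2.ne hn
  rw [contourIntegral_add (isSmooth_circ ρ) k0 k3, contourIntegral_const_mul,
    contourIntegral_circ_inv (hs.trans hsρ), expand ρ hsρ.le le_rfl c2.ne',
    expand s le_rfl hsρ.le c1.ne, contourIntegral_circ_sub_inv c2, hz, key]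
  ring

lemma contourIntegral_circ_geometric {s : ℝ} (hs : 0 < s) {a : ℂ} (h : s * ‖a‖ < 1) (n : ℤ) :
    contourIntegral (circ s) (fun z => z ^ n * (1 - a * z)⁻¹ * z⁻¹) =
      if n ≤ 0 then a ^ (-n) else 0 := by
  have hne : ∀ z : ℂ, ‖z‖ ≤ s → 1 - a * z ≠ 0 := fun z hz e => by
    have h1 : ‖a * z‖ = 1 := by rw [← sub_eq_zero.1 e, norm_one]
    rw [norm_mul] at h1
    have : ‖a‖ * ‖z‖ ≤ ‖a‖ * s := by gcongr
    linarith
  have hz0 : ∀ z ∈ trace (circ s), z ≠ 0 := fun z hz => by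
    rw [← norm_pos_iff, norm_of_mem_circ hs.le hz]; exact hs
  have pos : ∀ m : ℕ, contourIntegral (circ s)
      (fun z => z ^ ((m : ℤ) + 1) * (1 - a * z)⁻¹ * z⁻¹) = 0 := by
    intro m
    rw [contourIntegral_congr (G := fun z => z ^ m * (1 - a * z)⁻¹) fun z hz => by
      have := hz0 z hz
      rw [zpow_add_one₀ this, zpow_natCast]; field_simp]
    exact contourIntegral_circ_eq_zero hs.le fun z hz =>
      DifferentiableAt.mul (by fun_prop) (DifferentiableAt.fun_inv (by fun_prop) (hne z hz))
  have neg : ∀ m : ℕ, contourIntegral (circ s)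
      (fun z => z ^ (-(m : ℤ)) * (1 - a * z)⁻¹ * z⁻¹) = a ^ m := by
    have cont : ∀ k : ℤ, ContinuousOn (fun z : ℂ => z ^ k) (trace (circ s)) := fun k z hz =>
      ((differentiableAt_id.zpow (.inl (hz0 z hz))).continuousAt (𝕜 := ℂ)).continuousWithinAt
    have cont' : ∀ k : ℤ, ContinuousOn (fun z : ℂ => a * (z ^ k * (1 - a * z)⁻¹ * z⁻¹))
        (trace (circ s)) := fun k =>
      continuousOn_const.mul (((cont k).mul (ContinuousOn.inv₀ (by fun_prop) fun z hz =>
        hne z (norm_of_mem_circ hs.le hz).le)).mul (continuousOn_id.inv₀ hz0))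
    have step : ∀ k : ℤ, contourIntegral (circ s) (fun z => z ^ k * (1 - a * z)⁻¹ * z⁻¹) =
        (if k - 1 = -1 then 1 else 0) + a * contourIntegral (circ s)
          (fun z => z ^ (k + 1) * (1 - a * z)⁻¹ * z⁻¹) := by
      intro k
      rw [← contourIntegral_circ_zpow hs, ← contourIntegral_const_mul,
        ← contourIntegral_add (isSmooth_circ s) (cont _) (cont' _)]
      refine contourIntegral_congr fun z hz => ?_
      have h0 := hz0 z hz
      have h1 := hne z (norm_of_mem_circ hs.le hz).le
      rw [zpow_sub_one₀ h0, zpow_add_one₀ h0]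
      field_simp
      ring
    intro m
    induction m with
    | zero =>
      rw [step]
      have := pos 0
      simp only [Nat.cast_zero, zero_add] at this
      simp only [zpow_one] at this
      simp [this]
    | succ m ih =>
      rw [step]
      have : -((m + 1 : ℕ) : ℤ) + 1 = -(m : ℤ) := by push_cast; ring
      rw [this, ih, if_neg (by omega), pow_succ]
      ring
  split_ifs with hn
  · obtain ⟨m, hm⟩ := Int.eq_ofNat_of_zero_le (neg_nonneg.2 hn)
    rw [show n = -(m : ℤ) by omega, neg m, neg_neg, zpow_natCast]
  · obtain ⟨m, hm⟩ := Int.eq_ofNat_of_zero_le (show 0 ≤ n - 1 by omega)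
    rw [show n = (m : ℤ) + 1 by omega, pos m]

/-- Integrating over some of the variables of a function of these variables only. -/
lemma iter_comp_injective {ι κ : Type} [DecidableEq ι] [DecidableEq κ] {e : κ → ι}
    (he : Function.Injective e) (Γ : ι → Contour) (l : List κ) (F : (κ → ℂ) → ℂ) (v : ι → ℂ) :
    iter Γ (l.map e) (fun v => F (v ∘ e)) v = iter (Γ ∘ e) l F (v ∘ e) := by
  induction l generalizing v with
  | nil => simp [iter]
  | cons j l ih =>
    simp only [List.map_cons, iter, ih, comp_apply]
    congr 1; funext z
    congr 1
    exact Function.update_comp_eq_of_injective _ he _ _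

/-! ### The integrand of the transition function -/

/-- The values of the variables `ξ_j` and `ζ_k`. -/
abbrev Point (N : ℕ) : Type := Fin N ⊕ Fin N → ℂ

/-- The second set of variables: `ζ_k` for `k ∈ K`, and `1 / ξ_{σ k}` otherwise. -/
def eta (σ : Perm (Fin N)) (K : Finset (Fin N)) (v : Point N) (k : Fin N) : ℂ :=
  if k ∈ K then v (.inr k) else (v (.inl (σ k)))⁻¹

/-- The part of the integrand that does not depend on the initial configurations and on time. -/
def amplitude (Δ : ℝ) (σ : Perm (Fin N)) (K : Finset (Fin N)) (v : Point N) : ℂ :=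
  (sign σ : ℤ) *
      (∏ k, ∏ j ∈ univ.erase (σ k), rFac Δ (v (.inl j)) (eta σ K v k)) *
      (∏ k ∈ K, (1 - v (.inl (σ k)) * v (.inr k))⁻¹) /
    (pairProd univ (fun j j' => pFac Δ (v (.inl j)) (v (.inl j'))) *
      pairProd univ (fun k k' => pFac Δ (eta σ K v k) (eta σ K v k')))

/-- The integrand of the transition function of `X_1(t) ≥ x`. -/
def theta (Δ : ℝ) (y y' : Fin N → ℤ) (x : ℤ) (t : ℝ) (σ : Perm (Fin N))
    (K : Finset (Fin N)) (v : Point N) : ℂ :=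
  amplitude Δ σ K v *
    (∏ j, v (.inl j) ^ (x - y j - 1) * exp (-(I * t * energy Δ (v (.inl j))))) *
    ∏ k, eta σ K v k ^ (x - y' k) * exp (I * t * energy Δ (eta σ K v k)) *
      (v (.inr k))⁻¹

/-- The conditions on the radii of the large circles. -/
structure Radii (Δ R R' : ℝ) : Prop where
  ne_zero : Δ ≠ 0
  two_lt : 2 < R * |Δ|
  lt_fst : 2 + 4 * |Δ| < R
  lt_snd : 2 * R < R'

namespace Radii
variable {Δ R R' : ℝ} (h : Radii Δ R R')
include h

lemma one_lt : 1 < R := by have := h.lt_fst; have := abs_nonneg Δ; linarith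
lemma pos : 0 < R := by have := h.one_lt; linarith
lemma pos' : 0 < R' := by have := h.pos; have := h.lt_snd; linarith
lemma lt : R < R' := by have := h.pos; have := h.lt_snd; linarith
lemma one_lt' : 1 < R' := h.one_lt.trans h.lt
lemma abs_pos : 0 < |Δ| := _root_.abs_pos.2 h.ne_zero

end Radii

/-! ### The values of the factors on the torus -/

/-- The range of the variables `η`. -/
def etaSet (R R' : ℝ) : Set ℂ := {η | R' ≤ ‖η‖ ∨ ‖η‖ = R⁻¹}

lemma rFac_inv (Δ : ℝ) {a b : ℂ} (hb : b ≠ 0) : rFac Δ a b⁻¹ = pFac Δ a b / b := by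
  rw [rFac, pFac]; field_simp; ring

lemma pFac_inv_right (Δ : ℝ) {a b : ℂ} (hb : b ≠ 0) : pFac Δ a b⁻¹ = rFac Δ b a / b := by
  rw [rFac, pFac]; field_simp

lemma pFac_inv_inv (Δ : ℝ) {a b : ℂ} (ha : a ≠ 0) (hb : b ≠ 0) :
    pFac Δ a⁻¹ b⁻¹ = pFac Δ b a / (a * b) := by
  rw [pFac, pFac]; field_simp; ring

lemma eta_mem_etaSet {R R' : ℝ} {σ : Perm (Fin N)} {K : Finset (Fin N)} {v : Point N}
    (h1 : ∀ j, ‖v (.inl j)‖ = R) {k : Fin N} (h2 : k ∈ K → R' ≤ ‖v (.inr k)‖) :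
    eta σ K v k ∈ etaSet R R' := by
  unfold eta
  split_ifs with hk
  · exact .inl (h2 hk)
  · exact .inr (by rw [norm_inv, h1])

namespace Radii
variable {Δ R R' : ℝ} (h : Radii Δ R R')
include h

lemma le_norm_rFac {a w : ℂ} (ha : ‖a‖ = R) (hw : R ≤ ‖w‖) :
    |Δ| * (‖a‖ * ‖w‖) ≤ ‖rFac Δ a w‖ := by
  have hR := h.pos
  have h1 : ‖(2 * Δ * a * w : ℂ)‖ ≤ ‖rFac Δ a w‖ + ‖a‖ + ‖w‖ := by
    have e : (2 * Δ * a * w : ℂ) = a + w - rFac Δ a w := by rw [rFac]; ring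
    rw [e]
    refine (norm_sub_le _ _).trans ?_
    have := norm_add_le a w
    linarith
  simp only [norm_mul, norm_real, norm_eq_abs, norm_ofNat] at h1
  have h2 := h.two_lt
  rw [ha] at h1 ⊢
  have h3 : 2 * ‖w‖ ≤ R * |Δ| * ‖w‖ := by gcongr
  nlinarith

lemma rFac_ne_zero {a w : ℂ} (ha : ‖a‖ = R) (hw : R ≤ ‖w‖) : rFac Δ a w ≠ 0 := by
  rw [← norm_pos_iff]
  refine lt_of_lt_of_le ?_ (h.le_norm_rFac ha hw)
  have := h.pos; have := h.abs_pos
  have : 0 < ‖w‖ := by linarith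
  rw [ha]; positivity

lemma norm_rFac_le {a w : ℂ} (ha : ‖a‖ = R) :
    ‖rFac Δ a w‖ ≤ (R + 1 + 2 * |Δ| * R) * max 1 ‖w‖ := by
  have hR := h.pos
  have h1 : ‖rFac Δ a w‖ ≤ ‖a‖ + ‖w‖ + ‖(2 * Δ * a * w : ℂ)‖ :=
    (norm_sub_le _ _).trans (add_le_add (norm_add_le _ _) le_rfl)
  simp only [norm_mul, norm_real, norm_eq_abs, norm_ofNat, ha] at h1
  have h2 : R * 1 ≤ R * max 1 ‖w‖ := by gcongr; exact le_max_left _ _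
  have h3 : (1 + 2 * |Δ| * R) * ‖w‖ ≤ (1 + 2 * |Δ| * R) * max 1 ‖w‖ := by
    gcongr; exact le_max_right _ _
  nlinarith

/-- The lower bound on the torus for the denominators in the variables `η`. -/
lemma exists_le_norm_pFac_eta : ∃ c : ℝ, 0 < c ∧ ∀ η ∈ etaSet R R', ∀ η' ∈ etaSet R R',
    c * (max 1 ‖η‖ * max 1 ‖η'‖) ≤ ‖pFac Δ η η'‖ := by
  have hR := h.pos
  have hΔ := h.abs_pos
  have hRinv : R⁻¹ ≤ 1 := inv_le_one_of_one_le₀ h.one_lt.le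
  refine ⟨min (1 / 2) (min |Δ| (1 / (4 * R))), by positivity, fun η hη η' hη' => ?_⟩
  have big : ∀ z : ℂ, R' ≤ ‖z‖ → max 1 ‖z‖ = ‖z‖ := fun z hz =>
    max_eq_right (h.one_lt'.le.trans hz)
  have small : ∀ z : ℂ, ‖z‖ = R⁻¹ → max 1 ‖z‖ = 1 := fun z hz => max_eq_left (hz ▸ hRinv)
  have hinv : ∀ z : ℂ, ‖z‖ = R⁻¹ → ‖z⁻¹‖ = R ∧ z⁻¹ ≠ 0 := fun z hz => by
    have : ‖z⁻¹‖ = R := by rw [norm_inv, hz, inv_inv]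
    exact ⟨this, by rw [← norm_pos_iff, this]; exact hR⟩
  rcases hη with h1 | h1 <;> rcases hη' with h2 | h2
  · rw [big η h1, big η' h2]
    refine le_trans ?_ (norm_pFac_ge h.lt_fst.le (h.one_lt'.le.trans h1) (h.lt.le.trans h2))
    gcongr
    exact min_le_left _ _
  · rw [big η h1, small η' h2, mul_one]
    obtain ⟨k1, k2⟩ := hinv η' h2
    have := pFac_inv_right Δ (a := η) k2
    rw [inv_inv] at this
    rw [this, norm_div, k1, le_div_iff₀ hR]
    have k3 := h.le_norm_rFac k1 (h.lt.le.trans h1)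
    rw [k1] at k3
    calc _ ≤ |Δ| * ‖η‖ * R := by
          gcongr; exact (min_le_right _ _).trans (min_le_left _ _)
      _ = |Δ| * (R * ‖η‖) := by ring
      _ ≤ _ := k3
  · rw [small η h1, big η' h2, one_mul]
    obtain ⟨k1, k2⟩ := hinv η h1
    have e : pFac Δ η η' = η * (η' - (2 * Δ - η⁻¹)) := by
      have : η ≠ 0 := by rintro rfl; simp at k2
      rw [pFac]; field_simp; ring
    have k3 : ‖(2 * Δ - η⁻¹ : ℂ)‖ ≤ 2 * |Δ| + R := by
      refine (norm_sub_le _ _).trans ?_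
      simp [k1]
    have k4 := norm_sub_norm_le η' (2 * Δ - η⁻¹ : ℂ)
    have k5 : 1 / 4 * ‖η'‖ ≤ ‖η' - (2 * Δ - η⁻¹ : ℂ)‖ := by
      have := h.lt_snd; have := h.lt_fst; linarith
    rw [e, norm_mul, h1]
    calc _ ≤ 1 / (4 * R) * ‖η'‖ := by
          gcongr; exact (min_le_right _ _).trans (min_le_right _ _)
      _ = R⁻¹ * (1 / 4 * ‖η'‖) := by field_simp
      _ ≤ _ := by gcongr
  · rw [small η h1, small η' h2, mul_one, mul_one]
    obtain ⟨k1, k2⟩ := hinv η h1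
    obtain ⟨k3, k4⟩ := hinv η' h2
    have e := pFac_inv_inv Δ k2 k4
    rw [inv_inv, inv_inv] at e
    rw [e, norm_div, norm_mul, k1, k3, le_div_iff₀ (by positivity)]
    have := norm_pFac_ge h.lt_fst.le (a := η'⁻¹) (b := η⁻¹) (k3 ▸ h.one_lt.le) k1.ge
    rw [k1, k3] at this
    refine le_trans ?_ this
    gcongr
    exact min_le_left _ _

lemma pFac_eta_ne_zero {η η' : ℂ} (hη : η ∈ etaSet R R') (hη' : η' ∈ etaSet R R') :
    pFac Δ η η' ≠ 0 := by
  obtain ⟨c, hc, hb⟩ := h.exists_le_norm_pFac_eta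
  rw [← norm_pos_iff]
  refine lt_of_lt_of_le ?_ (hb η hη η' hη')
  positivity

lemma one_sub_mul_ne_zero {a w : ℂ} (ha : ‖a‖ = R) (hw : R' ≤ ‖w‖) : 1 - a * w ≠ 0 := by
  intro e
  have h1 : ‖a * w‖ = 1 := by rw [← sub_eq_zero.1 e, norm_one]
  rw [norm_mul, ha] at h1
  have h2 := h.one_lt; have h3 := h.one_lt'
  nlinarith

lemma norm_inv_one_sub_le {a w : ℂ} (ha : ‖a‖ = R) (hw : R' ≤ ‖w‖) :
    ‖(1 - a * w)⁻¹‖ ≤ ‖w‖⁻¹ := by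
  have h2 := h.one_lt; have h3 := h.one_lt'; have h4 := h.lt_fst; have h5 := abs_nonneg Δ
  rw [norm_inv]
  refine inv_anti₀ (by linarith) ?_
  have h1 := norm_sub_norm_le (a * w) 1
  rw [norm_mul, ha, norm_one, norm_sub_rev] at h1
  nlinarith

lemma exists_inner : ∃ s : ℝ, 0 < s ∧ s * R < 1 ∧ 1 < s * (R' - 2 * |Δ|) := by
  have h1 := h.lt_snd; have h2 := h.lt_fst; have h3 := abs_nonneg Δ; have hR := h.pos
  refine ⟨2 / (R + (R' - 2 * |Δ|)), div_pos two_pos (by linarith), ?_, ?_⟩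
  · rw [div_mul_eq_mul_div, div_lt_one (by linarith)]; linarith
  · rw [div_mul_eq_mul_div, lt_div_iff₀ (by linarith)]; linarith

end Radii

/-! ### Regularity of the integrand -/

/-- The torus on which the variables are integrated. -/
def torusSet (N : ℕ) (R R' : ℝ) : Fin N ⊕ Fin N → Set ℂ :=
  Sum.elim (fun _ => {z | ‖z‖ = R}) fun _ => {z | ‖z‖ = R'}

/-- The circles on which the variables are integrated. -/
def torus (N : ℕ) (R R' : ℝ) : Fin N ⊕ Fin N → Contour :=
  Sum.elim (fun _ => circ R) fun _ => circ R'

/-- All variables. -/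
def allVars (N : ℕ) : List (Fin N ⊕ Fin N) :=
  (List.finRange N).map .inl ++ (List.finRange N).map .inr

lemma mem_allVars (i : Fin N ⊕ Fin N) : i ∈ allVars N := by
  rcases i with j | j <;> simp [allVars]

lemma nodup_allVars : (allVars N).Nodup := by
  refine List.Nodup.append ((List.nodup_finRange N).map Sum.inl_injective)
    ((List.nodup_finRange N).map Sum.inr_injective) fun i h1 h2 => ?_
  simp only [List.mem_map] at h1 h2
  obtain ⟨_, _, rfl⟩ := h1
  obtain ⟨_, _, h⟩ := h2
  exact absurd h (by simp)

lemma isSmooth_torus (R R' : ℝ) (i : Fin N ⊕ Fin N) : IsSmooth (torus N R R' i) := by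
  rcases i with j | j <;> exact isSmooth_circ _

lemma trace_torus {R R' : ℝ} (hR : 0 ≤ R) (hR' : 0 ≤ R') (i : Fin N ⊕ Fin N) :
    trace (torus N R R' i) ⊆ torusSet N R R' i := by
  rcases i with j | j
  · exact fun z hz => norm_of_mem_circ hR hz
  · exact fun z hz => norm_of_mem_circ hR' hz

lemma mem_torusSet_nil {R R' : ℝ} {v : Point N} :
    v ∈ offBox [] (torusSet N R R') ↔ (∀ j, ‖v (.inl j)‖ = R) ∧ ∀ k, ‖v (.inr k)‖ = R' := by
  rw [mem_offBox_nil, Sum.forall]; rfl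

lemma differentiableAt_eta {σ : Perm (Fin N)} {K : Finset (Fin N)} {v : Point N}
    {k : Fin N} (h : v (.inl (σ k)) ≠ 0) : DifferentiableAt ℂ (fun v => eta σ K v k) v := by
  unfold eta
  split_ifs
  · exact differentiableAt_apply _ v
  · exact (differentiableAt_apply _ v).fun_inv h

lemma differentiableAt_pFac {E : Type*} [NormedAddCommGroup E] [NormedSpace ℂ E] (Δ : ℝ)
    {f g : E → ℂ} {w : E} (hf : DifferentiableAt ℂ f w) (hg : DifferentiableAt ℂ g w) :
    DifferentiableAt ℂ (fun w => pFac Δ (f w) (g w)) w := by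
  unfold pFac; fun_prop

lemma differentiableAt_rFac {E : Type*} [NormedAddCommGroup E] [NormedSpace ℂ E] (Δ : ℝ)
    {f g : E → ℂ} {w : E} (hf : DifferentiableAt ℂ f w) (hg : DifferentiableAt ℂ g w) :
    DifferentiableAt ℂ (fun w => rFac Δ (f w) (g w)) w := by
  unfold rFac; fun_prop

section
variable {Δ R R' : ℝ} (h : Radii Δ R R')
include h

lemma Radii.differentiableAt_amplitude (σ : Perm (Fin N)) (K : Finset (Fin N))
    {v : Point N} (hv : v ∈ offBox [] (torusSet N R R')) :
    DifferentiableAt ℂ (amplitude Δ σ K) v := by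
  obtain ⟨h1, h2⟩ := mem_torusSet_nil.1 hv
  have h0 : ∀ j, v (.inl j) ≠ 0 := fun j => by rw [← norm_pos_iff, h1]; exact h.pos
  have de : ∀ k, DifferentiableAt ℂ (fun v => eta σ K v k) v := fun k => differentiableAt_eta (h0 _)
  have da : ∀ i, DifferentiableAt ℂ (fun v : Point N => v i) v := fun i =>
    differentiableAt_apply i v
  have em : ∀ k, eta σ K v k ∈ etaSet R R' := fun k => eta_mem_etaSet h1 fun _ => (h2 k).ge
  unfold amplitude
  refine differentiableAt_div ((DifferentiableAt.const_mul (differentiableAt_prod fun k _ =>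
    differentiableAt_prod fun j _ => differentiableAt_rFac Δ (da _) (de _)) _).mul
    (differentiableAt_prod fun k _ => DifferentiableAt.fun_inv
      (((da _).mul (da _)).const_sub 1) ?_))
    ((differentiableAt_pairProd fun _ _ _ _ _ => differentiableAt_pFac Δ (da _) (da _)).mul
    (differentiableAt_pairProd fun _ _ _ _ _ => differentiableAt_pFac Δ (de _) (de _))) ?_
  · exact h.one_sub_mul_ne_zero (h1 _) (h2 _).ge
  · refine mul_ne_zero (pairProd_ne_zero fun j _ k _ _ => ?_) (pairProd_ne_zero fun j _ k _ _ =>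
      h.pFac_eta_ne_zero (em j) (em k))
    exact pFac_ne_zero h.lt_fst.le (h.one_lt.le.trans (h1 j).ge) (h1 k).ge

lemma Radii.eta_ne_zero {σ : Perm (Fin N)} {K : Finset (Fin N)}
    {v : Point N} (hv : v ∈ offBox [] (torusSet N R R')) (k : Fin N) :
    eta σ K v k ≠ 0 := by
  obtain ⟨h1, h2⟩ := mem_torusSet_nil.1 hv
  unfold eta
  split_ifs
  · rw [← norm_pos_iff, h2]; exact h.pos'
  · refine inv_ne_zero ?_
    rw [← norm_pos_iff, h1]; exact h.pos

lemma Radii.continuousOn_theta (y y' : Fin N → ℤ) (x : ℤ) (σ : Perm (Fin N))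
    (K : Finset (Fin N)) : ContinuousOn (uncurry fun t => theta Δ y y' x t σ K)
      (Set.univ ×ˢ offBox [] (torusSet N R R')) := by
  rintro ⟨t, v⟩ ⟨-, hv⟩
  obtain ⟨h1, h2⟩ := mem_torusSet_nil.1 hv
  have h0 : ∀ j, v (.inl j) ≠ 0 := fun j => by rw [← norm_pos_iff, h1]; exact h.pos
  have h0' : ∀ j, v (.inr j) ≠ 0 := fun j => by rw [← norm_pos_iff, h2]; exact h.pos'
  have ca : ContinuousAt (fun q : ℝ × (Point N) => amplitude Δ σ K q.2) (t, v) :=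
    (h.differentiableAt_amplitude σ K hv).continuousAt.comp (f := Prod.snd) continuousAt_snd
  have ct : ContinuousAt (fun q : ℝ × (Point N) => I * (q.1 : ℂ)) (t, v) :=
    (continuous_const.mul (Complex.continuous_ofReal.comp continuous_fst)).continuousAt
  have cv : ∀ i, ContinuousAt (fun q : ℝ × (Point N) => q.2 i) (t, v) := fun i =>
    ((continuous_apply i).comp continuous_snd).continuousAt
  have ce : ∀ k, ContinuousAt (fun q : ℝ × (Point N) => eta σ K q.2 k) (t, v) :=
    fun k => ContinuousAt.comp (g := fun v => eta σ K v k) (f := Prod.snd)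
      (differentiableAt_eta (h0 _)).continuousAt continuousAt_snd
  have cen : ∀ {f : ℝ × Point N → ℂ}, ContinuousAt f (t, v) → f (t, v) ≠ 0 →
      ContinuousAt (fun q => energy Δ (f q)) (t, v) := fun hf hne => by
    unfold energy
    exact (hf.add (continuousAt_const.div hf hne)).sub continuousAt_const
  refine ContinuousAt.continuousWithinAt ?_
  unfold theta
  refine (ca.mul (tendsto_finsetProd _ fun j _ => ?_)).mul (tendsto_finsetProd _ fun k _ => ?_)
  · exact ((cv _).zpow₀ _ (.inl (h0 j))).mul (ct.mul (cen (cv _) (h0 j))).neg.cexp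
  · exact (((ce k).zpow₀ _ (.inl (h.eta_ne_zero hv k))).mul
      (ct.mul (cen (ce k) (h.eta_ne_zero hv k))).cexp).mul ((cv _).inv₀ (h0' k))

lemma Radii.continuousOn_theta_apply (y y' : Fin N → ℤ) (x : ℤ) (t : ℝ) (σ : Perm (Fin N))
    (K : Finset (Fin N)) : ContinuousOn (theta Δ y y' x t σ K) (offBox [] (torusSet N R R')) :=
  (h.continuousOn_theta y y' x σ K).comp (f := fun v => (t, v)) (by fun_prop) fun _ hv => ⟨trivial, hv⟩

end

/-! ### The integral over the first of the variables `ζ` -/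

/-- The factors of the integrand at time `0` that do not depend on `η_o`. -/
def coreTerm (Δ : ℝ) (y y' : Fin N → ℤ) (x : ℤ) (o : Fin N) (σ : Perm (Fin N))
    (K : Finset (Fin N)) (v : Point N) : ℂ :=
  (sign σ : ℤ) *
      (∏ k ∈ univ.erase o, ∏ j ∈ univ.erase (σ k), rFac Δ (v (.inl j)) (eta σ K v k)) *
      (∏ k ∈ K, (1 - v (.inl (σ k)) * v (.inr k))⁻¹) *
      (∏ k ∈ univ.erase o \ K, v (.inl (σ k))) /
    (pairProd univ (fun j j' => pFac Δ (v (.inl j)) (v (.inl j'))) *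
      pairProd (univ.erase o) (fun k k' => pFac Δ (eta σ K v k) (eta σ K v k'))) *
    (∏ j, v (.inl j) ^ (x - y j - 1)) *
    ∏ k ∈ univ.erase o, eta σ K v k ^ (x - y' k) * (v (.inr k))⁻¹

lemma coreTerm_congr (Δ : ℝ) (y y' : Fin N → ℤ) (x : ℤ) {o : Fin N} (σ : Perm (Fin N))
    {K : Finset (Fin N)} (hK : o ∉ K) {v w : Point N}
    (h1 : ∀ j, v (.inl j) = w (.inl j)) (h2 : ∀ k, k ≠ o → v (.inr k) = w (.inr k)) :
    coreTerm Δ y y' x o σ K v = coreTerm Δ y y' x o σ K w := by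
  have he : ∀ k, k ≠ o → eta σ K v k = eta σ K w k := fun k hk => by
    simp only [eta, h1, h2 k hk]
  have e1 : (∏ k ∈ univ.erase o, ∏ j ∈ univ.erase (σ k), rFac Δ (v (.inl j)) (eta σ K v k)) =
      ∏ k ∈ univ.erase o, ∏ j ∈ univ.erase (σ k), rFac Δ (w (.inl j)) (eta σ K w k) :=
    prod_congr rfl fun k hk => prod_congr rfl fun j _ => by rw [h1, he k (mem_erase.1 hk).1]
  have e2 : (∏ k ∈ K, (1 - v (.inl (σ k)) * v (.inr k))⁻¹) =
      ∏ k ∈ K, (1 - w (.inl (σ k)) * w (.inr k))⁻¹ :=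
    prod_congr rfl fun k hk => by rw [h1, h2 k fun e => hK (e ▸ hk)]
  have e3 : pairProd (univ.erase o) (fun k k' => pFac Δ (eta σ K v k) (eta σ K v k')) =
      pairProd (univ.erase o) fun k k' => pFac Δ (eta σ K w k) (eta σ K w k') :=
    pairProd_congr fun k hk k' hk' _ => by rw [he k (mem_erase.1 hk).1, he k' (mem_erase.1 hk').1]
  have e4 : (∏ k ∈ univ.erase o, eta σ K v k ^ (x - y' k) * (v (.inr k))⁻¹) =
      ∏ k ∈ univ.erase o, eta σ K w k ^ (x - y' k) * (w (.inr k))⁻¹ :=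
    prod_congr rfl fun k hk => by rw [he k (mem_erase.1 hk).1, h2 k (mem_erase.1 hk).1]
  rw [coreTerm, coreTerm, e1, e2, e3, e4]
  simp only [h1]

lemma theta_zero_eq (Δ : ℝ) (y y' : Fin N → ℤ) (x : ℤ) {o : Fin N} (ho : ∀ k, o ≤ k)
    (σ : Perm (Fin N)) {K K₂ : Finset (Fin N)} (hK : o ∉ K)
    (hK₂ : ∀ k, k ≠ o → (k ∈ K₂ ↔ k ∈ K)) {v : Point N} {E w : ℂ}
    (hE : ∏ k ∈ K₂, (1 - v (.inl (σ k)) * v (.inr k))⁻¹ =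
      (∏ k ∈ K, (1 - v (.inl (σ k)) * v (.inr k))⁻¹) * E)
    (hw : eta σ K₂ v o = w) (h0 : ∀ j, v (.inl j) ≠ 0)
    (hr : ∀ k, k ≠ o → k ∉ K → rFac Δ (v (.inl (σ k))) w ≠ 0) :
    theta Δ y y' x 0 σ K₂ v = coreTerm Δ y y' x o σ K v *
      (∏ k ∈ K, rFac Δ (v (.inl (σ k))) w / pFac Δ w (v (.inr k))) * w ^ (x - y' o) * E *
        (v (.inr o))⁻¹ := by
  have he : ∀ k, k ≠ o → eta σ K₂ v k = eta σ K v k := fun k hk => by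
    simp only [eta, hK₂ k hk]
  have hlt : ∀ k, o < k ↔ k ≠ o := fun k => ⟨fun h => h.ne', fun h => (ho k).lt_of_ne h.symm⟩
  have hKs : K ⊆ univ.erase o := fun k hk =>
    mem_erase.2 ⟨fun e => hK (e ▸ hk), mem_univ k⟩
  have e1 : (∏ k, ∏ j ∈ univ.erase (σ k), rFac Δ (v (.inl j)) (eta σ K₂ v k)) =
      (∏ k ∈ univ.erase o, rFac Δ (v (.inl (σ k))) w) *
        ∏ k ∈ univ.erase o, ∏ j ∈ univ.erase (σ k), rFac Δ (v (.inl j)) (eta σ K v k) := by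
    rw [← mul_prod_erase univ _ (mem_univ o), hw]
    congr 1
    · refine (prod_bij (fun k _ => σ k) (fun k hk => ?_) (fun _ _ _ _ h => σ.injective h)
        (fun j hj => ⟨σ⁻¹ j, ?_, perm_apply_inv σ j⟩) fun _ _ => rfl).symm
      · exact mem_erase.2 ⟨fun e => (mem_erase.1 hk).1 (σ.injective e), mem_univ _⟩
      · refine mem_erase.2 ⟨fun e => (mem_erase.1 hj).1 ?_, mem_univ _⟩
        rw [← e, perm_apply_inv]
    · exact prod_congr rfl fun k hk => prod_congr rfl fun j _ => by rw [he k (mem_erase.1 hk).1]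
  have e2 : pairProd univ (fun k k' => pFac Δ (eta σ K₂ v k) (eta σ K₂ v k')) =
      pairProd (univ.erase o) (fun k k' => pFac Δ (eta σ K v k) (eta σ K v k')) *
        ∏ k ∈ univ.erase o, pFac Δ w (eta σ K v k) := by
    rw [pairProd_erase _ o]
    have k1 : (∏ j, if j < o then pFac Δ (eta σ K₂ v j) (eta σ K₂ v o) else 1) = 1 :=
      prod_eq_one fun j _ => if_neg (ho j).not_gt
    have k2 : (∏ k, if o < k then pFac Δ (eta σ K₂ v o) (eta σ K₂ v k) else 1) =
        ∏ k ∈ univ.erase o, pFac Δ w (eta σ K v k) := by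
      rw [← prod_filter]
      refine prod_congr (by ext k; simp [hlt]) fun k hk => ?_
      rw [hw, he k (mem_erase.1 hk).1]
    rw [k1, k2, mul_one]
    congr 1
    exact pairProd_congr fun k hk k' hk' _ => by rw [he k (mem_erase.1 hk).1, he k' (mem_erase.1 hk').1]
  have e3 : (∏ k, eta σ K₂ v k ^ (x - y' k) * (v (.inr k))⁻¹) =
      w ^ (x - y' o) * (v (.inr o))⁻¹ * ∏ k ∈ univ.erase o, eta σ K v k ^ (x - y' k) * (v (.inr k))⁻¹ := by
    rw [← mul_prod_erase univ _ (mem_univ o), hw]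
    congr 1
    exact prod_congr rfl fun k hk => by rw [he k (mem_erase.1 hk).1]
  have e4 : (∏ k ∈ univ.erase o, rFac Δ (v (.inl (σ k))) w) =
      (∏ k ∈ univ.erase o \ K, rFac Δ (v (.inl (σ k))) w) * ∏ k ∈ K, rFac Δ (v (.inl (σ k))) w :=
    (prod_sdiff hKs).symm
  have e5 : ∏ k ∈ univ.erase o, pFac Δ w (eta σ K v k) =
      (∏ k ∈ univ.erase o \ K, rFac Δ (v (.inl (σ k))) w) / (∏ k ∈ univ.erase o \ K, v (.inl (σ k))) *
        ∏ k ∈ K, pFac Δ w (v (.inr k)) := by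
    rw [← prod_sdiff hKs, ← prod_div_distrib]
    congr 1
    · refine prod_congr rfl fun k hk => ?_
      rw [eta, if_neg (mem_sdiff.1 hk).2, pFac_inv_right Δ (h0 _)]
    · exact prod_congr rfl fun k hk => by rw [eta, if_pos hk]
  have n1 : (∏ k ∈ univ.erase o \ K, rFac Δ (v (.inl (σ k))) w) ≠ 0 :=
    prod_ne_zero_iff.2 fun k hk =>
      hr k (mem_erase.1 (mem_sdiff.1 hk).1).1 (mem_sdiff.1 hk).2
  have n2 : (∏ k ∈ univ.erase o \ K, v (.inl (σ k))) ≠ 0 := prod_ne_zero_iff.2 fun k _ => h0 _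
  have t0 : ∀ z : ℂ, exp (-(I * ((0 : ℝ) : ℂ) * energy Δ z)) = 1 := by simp
  have t1 : ∀ z : ℂ, exp (I * ((0 : ℝ) : ℂ) * energy Δ z) = 1 := by simp
  simp only [theta, amplitude, t0, t1, mul_one]
  rw [e1, e2, e3, e4, e5, hE, coreTerm, prod_div_distrib]
  generalize (∏ k ∈ univ.erase o \ K, rFac Δ (v (.inl (σ k))) w) = A at n1 ⊢
  generalize (∏ k ∈ univ.erase o \ K, v (.inl (σ k))) = B at n2 ⊢
  generalize (∏ k ∈ K, (1 - v (.inl (σ k)) * v (.inr k))⁻¹) = Q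
  simp only [div_eq_mul_inv, mul_inv, inv_inv]
  conv_rhs => rw [← one_mul (_ * (v (.inr o))⁻¹), ← mul_inv_cancel₀ n1]
  ring

/-- The integrand after the integration over the first of the variables `ζ` has been moved to a small
circle, up to the denominator that depends on this variable. -/
def innerTerm (Δ : ℝ) (y y' : Fin N → ℤ) (x : ℤ) (o : Fin N) (σ : Perm (Fin N))
    (K : Finset (Fin N)) (v : Point N) : ℂ :=
  coreTerm Δ y y' x o σ K v * (∏ k ∈ K, rFac Δ (v (.inl (σ k))) (v (.inr o))) *
    v (.inr o) ^ (x - y' o) * (1 - v (.inl (σ o)) * v (.inr o))⁻¹ * (v (.inr o))⁻¹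

lemma Radii.contourIntegral_theta {Δ R R' : ℝ} (h : Radii Δ R R') {s : ℝ} (hs : 0 < s)
    (hsR : s * R < 1) (hsR' : 1 < s * (R' - 2 * |Δ|)) (y y' : Fin N → ℤ) (x : ℤ)
    {o : Fin N} (ho : ∀ k, o ≤ k) (σ : Perm (Fin N)) {K : Finset (Fin N)} (hK : o ∉ K)
    {v : Point N} (hv : v ∈ offBox [.inr o] (torusSet N R R')) :
    contourIntegral (circ R') (fun z => theta Δ y y' x 0 σ K (update v (.inr o) z) +
        theta Δ y y' x 0 σ (insert o K) (update v (.inr o) z)) =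
      contourIntegral (circ s) fun z => innerTerm Δ y y' x o σ K (update v (.inr o) z) /
        ∏ k ∈ K, pFac Δ z (v (.inr k)) := by
  have h1 : ∀ j, ‖v (.inl j)‖ = R := fun j => hv (.inl j) (by simp)
  have h2 : ∀ k, k ≠ o → ‖v (.inr k)‖ = R' := fun k hk => hv (.inr k) (by simpa using hk)
  have h0 : ∀ j, v (.inl j) ≠ 0 := fun j => by rw [← norm_pos_iff, h1]; exact h.pos
  have hKo : ∀ k ∈ K, k ≠ o := by rintro k hk rfl; exact hK hk
  have ul : ∀ z j, update v (.inr o) z (.inl j) = v (.inl j) := fun z j =>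
    update_of_ne (by simp) _ _
  have ur : ∀ z k, k ≠ o → update v (.inr o) z (.inr k) = v (.inr k) := fun z k hk =>
    update_of_ne (by simpa using hk) _ _
  have hc : ∀ z, coreTerm Δ y y' x o σ K (update v (.inr o) z) =
      coreTerm Δ y y' x o σ K v := fun z => coreTerm_congr Δ y y' x σ hK (ul z) (ur z)
  set g : ℂ → ℂ := fun z => coreTerm Δ y y' x o σ K v *
    (∏ k ∈ K, rFac Δ (v (.inl (σ k))) z / pFac Δ z (v (.inr k))) * z ^ (x - y' o) with hg
  have key := contourIntegral_circ_shrink (ρ := R') hs (a := v (.inl (σ o))) (by rw [h1]; exact hsR)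
    (by rw [h1]; have := h.one_lt; have := h.one_lt'; nlinarith) (h := g) (fun z hz1 hz2 => ?_)
  · have ratio : ∀ z, (∏ k ∈ K, rFac Δ (update v (.inr o) z (.inl (σ k))) z /
        pFac Δ z (update v (.inr o) z (.inr k))) =
        ∏ k ∈ K, rFac Δ (v (.inl (σ k))) z / pFac Δ z (v (.inr k)) := fun z =>
      prod_congr rfl fun k hk => by rw [ul, ur z k (hKo k hk)]
    refine (contourIntegral_congr fun z hz => ?_).trans (key.trans
      (contourIntegral_congr fun z hz => ?_))
    · have hz := norm_of_mem_circ h.pos'.le hz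
      have hz0 : z ≠ 0 := by rw [← norm_pos_iff, hz]; exact h.pos'
      congr 1
      · rw [theta_zero_eq Δ y y' x ho σ hK (fun k _ => Iff.rfl) (E := 1) (mul_one _).symm
          (w := (v (.inl (σ o)))⁻¹) (by simp [eta, hK]) (fun j => by rw [ul]; exact h0 j)
          (fun k hk _ => ?_), hc, update_self, mul_one]
        · simp only [hg]
          congr 3
          exact prod_congr rfl fun k hk => by rw [ul, ur z k (hKo k hk)]
        · rw [ul, rFac_inv Δ (h0 _)]
          exact div_ne_zero (pFac_ne_zero h.lt_fst.le (h.one_lt.le.trans (h1 _).ge) (h1 _).ge) (h0 _)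
      · rw [theta_zero_eq Δ y y' x ho σ hK (fun k hk => by simp [hk])
          (E := (1 - v (.inl (σ o)) * z)⁻¹) ?_ (w := z) (by simp [eta])
          (fun j => by rw [ul]; exact h0 j) (fun k hk _ => ?_), hc, update_self, ratio]
        · rw [prod_insert hK, update_self, ul, mul_comm]
        · rw [ul]
          exact h.rFac_ne_zero (h1 _) (hz ▸ h.lt.le)
    · rw [innerTerm, hc, update_self, ul]
      simp only [hg, ul, prod_div_distrib]
      ring
  · have hz0 : z ≠ 0 := by rw [← norm_pos_iff]; linarith
    refine (DifferentiableAt.const_mul (differentiableAt_prod fun k hk => differentiableAt_div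
      (differentiableAt_rFac Δ (differentiableAt_const _) differentiableAt_id)
      (differentiableAt_pFac Δ differentiableAt_id (differentiableAt_const _)) fun e => ?_) _).mul
      (differentiableAt_id.zpow (.inl hz0))
    have e' : z * (2 * Δ - v (.inr k)) = 1 := by
      simp only [pFac, id] at e; linear_combination -e
    have e2 := congrArg norm e'
    rw [norm_mul, norm_one] at e2
    have e3 := norm_sub_norm_le (v (.inr k)) (2 * Δ : ℂ)
    rw [norm_sub_rev, h2 k (hKo k hk), norm_mul, norm_real, norm_eq_abs,
      norm_ofNat] at e3
    have : s * (R' - 2 * |Δ|) ≤ ‖z‖ * ‖(2 * Δ - v (.inr k) : ℂ)‖ := by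
      have := h.lt_snd; have := h.lt_fst; have := abs_nonneg Δ; have := h.pos
      exact mul_le_mul hz1 e3 (by linarith) (norm_nonneg _)
    linarith

/-! ### The contributions with at least one remaining variable `ζ` vanish -/

/-- The range of the variables in the analysis of `innerTerm`. -/
def innerSet (R R' s : ℝ) (o : Fin N) (K : Finset (Fin N)) : Fin N ⊕ Fin N → Set ℂ :=
  Sum.elim (fun _ => {z | ‖z‖ = R}) fun k => if k = o then {z | z ≠ 0 ∧ ‖z‖ ≤ s} else
    if k ∈ K then {z | R' ≤ ‖z‖} else {z | ‖z‖ = R'}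

structure InnerSetData (R R' s : ℝ) (o : Fin N) (K : Finset (Fin N)) (v : Point N) :
    Prop where
  fst : ∀ j, ‖v (.inl j)‖ = R
  ne_zero : v (.inr o) ≠ 0
  le : ‖v (.inr o)‖ ≤ s
  snd : ∀ k, k ≠ o → R' ≤ ‖v (.inr k)‖
  snd_eq : ∀ k, k ≠ o → k ∉ K → ‖v (.inr k)‖ = R'

lemma innerSetData_of_mem {R R' s : ℝ} {o : Fin N} {K : Finset (Fin N)}
    {v : Point N} (hv : v ∈ offBox [] (innerSet R R' s o K)) :
    InnerSetData R R' s o K v := by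
  rw [mem_offBox_nil, Sum.forall] at hv
  obtain ⟨h1, h2⟩ := hv
  have ho := h2 o
  simp only [innerSet, Sum.elim_inr, if_true] at ho
  have heq : ∀ k, k ≠ o → k ∉ K → ‖v (.inr k)‖ = R' := fun k hk hkK => by
    have := h2 k
    simpa only [innerSet, Sum.elim_inr, hk, hkK, if_false, Set.mem_ofPred_eq] using this
  refine ⟨h1, ho.1, ho.2, fun k hk => ?_, heq⟩
  by_cases hkK : k ∈ K
  · have := h2 k
    simpa only [innerSet, Sum.elim_inr, hk, hkK, if_false, if_true, Set.mem_ofPred_eq] using this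
  · exact (heq k hk hkK).ge

section
variable {Δ R R' s : ℝ} (h : Radii Δ R R')
include h

lemma Radii.differentiableAt_innerTerm (hsR : s * R < 1) (y y' : Fin N → ℤ) (x : ℤ) {o : Fin N}
    (σ : Perm (Fin N)) {K : Finset (Fin N)} (hK : o ∉ K) {v : Point N}
    (hv : InnerSetData R R' s o K v) : DifferentiableAt ℂ (innerTerm Δ y y' x o σ K) v := by
  obtain ⟨h1, hz0, hzs, h2, -⟩ := hv
  have h0 : ∀ j, v (.inl j) ≠ 0 := fun j => by rw [← norm_pos_iff, h1]; exact h.pos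
  have h0' : ∀ k, k ≠ o → v (.inr k) ≠ 0 := fun k hk => by
    rw [← norm_pos_iff]; exact h.pos'.trans_le (h2 k hk)
  have hKo : ∀ k ∈ K, k ≠ o := by rintro k hk rfl; exact hK hk
  have de : ∀ k, DifferentiableAt ℂ (fun v => eta σ K v k) v := fun k => differentiableAt_eta (h0 _)
  have da : ∀ i, DifferentiableAt ℂ (fun v : Point N => v i) v := fun i =>
    differentiableAt_apply i v
  have em : ∀ k, k ≠ o → eta σ K v k ∈ etaSet R R' := fun k hk =>
    eta_mem_etaSet h1 fun _ => h2 k hk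
  have en : ∀ k, k ≠ o → eta σ K v k ≠ 0 := fun k hk => by
    unfold eta; split_ifs
    exacts [h0' k hk, inv_ne_zero (h0 _)]
  have hone : 1 - v (.inl (σ o)) * v (.inr o) ≠ 0 := fun e => by
    have h3 : ‖v (.inl (σ o)) * v (.inr o)‖ = 1 := by rw [← sub_eq_zero.1 e, norm_one]
    rw [norm_mul, h1] at h3
    have : R * ‖v (.inr o)‖ ≤ R * s := by have := h.pos; gcongr
    linarith
  unfold innerTerm
  refine ((((DifferentiableAt.mul ?_ (differentiableAt_prod fun k _ => differentiableAt_rFac Δ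
    (da _) (da _))).mul ((da _).zpow (.inl hz0))).mul (DifferentiableAt.fun_inv
      (((da _).mul (da _)).const_sub 1) hone))).mul ((da _).fun_inv hz0)
  unfold coreTerm
  refine ((differentiableAt_div ((((differentiableAt_prod fun k _ => differentiableAt_prod
    fun j _ => differentiableAt_rFac Δ (da _) (de _)).const_mul _).mul
    (differentiableAt_prod fun k hk => DifferentiableAt.fun_inv
      (((da _).mul (da _)).const_sub 1) (h.one_sub_mul_ne_zero (h1 _) (h2 k (hKo k hk))))).mul
    (differentiableAt_prod fun k _ => da _)) ((differentiableAt_pairProd fun _ _ _ _ _ =>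
      differentiableAt_pFac Δ (da _) (da _)).mul (differentiableAt_pairProd fun _ _ _ _ _ =>
        differentiableAt_pFac Δ (de _) (de _))) ?_).mul
    (differentiableAt_prod fun j _ => (da _).zpow (.inl (h0 j)))).mul
    (differentiableAt_prod fun k hk => ((de k).zpow (.inl (en k (mem_erase.1 hk).1))).mul
      ((da _).fun_inv (h0' k (mem_erase.1 hk).1)))
  refine mul_ne_zero (pairProd_ne_zero fun j _ k _ _ => ?_) (pairProd_ne_zero fun j hj k hk _ =>
    h.pFac_eta_ne_zero (em j (mem_erase.1 hj).1) (em k (mem_erase.1 hk).1))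
  exact pFac_ne_zero h.lt_fst.le (h.one_lt.le.trans (h1 j).ge) (h1 k).ge

omit h in
lemma sum_innerTerm_eq_zero (Δ : ℝ) (y y' : Fin N → ℤ) (x : ℤ) {o b c : Fin N}
    {K : Finset (Fin N)} (hK : o ∉ K) (hb : b ∈ K) (hc : c ∈ K) (hbc : b ≠ c)
    {v : Point N} (hv : v (.inr b) = v (.inr c)) :
    ∑ σ, innerTerm Δ y y' x o σ K v = 0 := by
  have hob : o ≠ b := by rintro rfl; exact hK hb
  have hoc : o ≠ c := by rintro rfl; exact hK hc
  have hs : ∀ k, v (.inr (swap b c k)) = v (.inr k) := fun k => by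
    rcases eq_or_ne k b with rfl | h1
    · rw [swap_apply_left, hv]
    rcases eq_or_ne k c with rfl | h2
    · rw [swap_apply_right, hv]
    rw [swap_apply_of_ne_of_ne h1 h2]
  have hsK : ∀ k, swap b c k ∈ K ↔ k ∈ K := fun k => by
    rcases eq_or_ne k b with rfl | h1
    · rw [swap_apply_left]; tauto
    rcases eq_or_ne k c with rfl | h2
    · rw [swap_apply_right]; tauto
    rw [swap_apply_of_ne_of_ne h1 h2]
  have hsn : ∀ k, k ∉ K → swap b c k = k := fun k hk =>
    swap_apply_of_ne_of_ne (by rintro rfl; exact hk hb) (by rintro rfl; exact hk hc)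
  have hso : swap b c o = o := swap_apply_of_ne_of_ne hob hoc
  have hse : ∀ k, swap b c k ≠ o ↔ k ≠ o := fun k => by
    rw [not_iff_not, swap_apply_eq_iff, hso]
  refine sum_involution (fun σ _ => σ * swap b c) (fun σ _ => ?_) (fun σ _ _ e => ?_)
    (fun σ _ => mem_univ _) fun σ _ => ?_
  · have he : eta (σ * swap b c) K v = eta σ K v := by
      funext k
      by_cases hk : k ∈ K
      · simp [eta, hk]
      · simp [eta, hk, hsn k hk]
    have he' : ∀ k, eta σ K v (swap b c k) = eta σ K v k := fun k => by
      by_cases hk : k ∈ K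
      · simp [eta, hk, hsK, hs]
      · rw [hsn k hk]
    have e1 : (∏ k ∈ univ.erase o, ∏ j ∈ univ.erase (σ (swap b c k)),
        rFac Δ (v (.inl j)) (eta σ K v k)) =
        ∏ k ∈ univ.erase o, ∏ j ∈ univ.erase (σ k), rFac Δ (v (.inl j)) (eta σ K v k) :=
      prod_equiv (swap b c) (fun k => by simp [hse]) fun k _ => by rw [he']
    have e2 : (∏ k ∈ K, (1 - v (.inl (σ (swap b c k))) * v (.inr k))⁻¹) =
        ∏ k ∈ K, (1 - v (.inl (σ k)) * v (.inr k))⁻¹ :=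
      prod_equiv (swap b c) (fun k => (hsK k).symm) fun k _ => by rw [hs]
    have e3 : (∏ k ∈ univ.erase o \ K, v (.inl (σ (swap b c k)))) =
        ∏ k ∈ univ.erase o \ K, v (.inl (σ k)) :=
      prod_congr rfl fun k hk => by rw [hsn k (mem_sdiff.1 hk).2]
    have e4 : (∏ k ∈ K, rFac Δ (v (.inl (σ (swap b c k)))) (v (.inr o))) =
        ∏ k ∈ K, rFac Δ (v (.inl (σ k))) (v (.inr o)) :=
      prod_equiv (swap b c) (fun k => (hsK k).symm) fun k _ => rfl
    simp only [innerTerm, coreTerm, he, Equiv.Perm.mul_apply, e1, e2, e3, e4, hso,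
      Equiv.Perm.sign_mul, sign_swap hbc]
    push_cast
    ring
  · have : swap b c = 1 := by simpa using e
    exact hbc (Equiv.swap_eq_one_iff.1 this)
  · simp [mul_assoc]

lemma Radii.exists_innerTerm_le (hsR : s * R < 1) (y y' : Fin N → ℤ) (x : ℤ)
    {o b : Fin N} (σ : Perm (Fin N)) {K : Finset (Fin N)} (hK : o ∉ K) (hb : b ∈ K) (M : ℝ) :
    ∃ C : ℝ, 0 ≤ C ∧ ∀ v : Point N, InnerSetData R R' s o K v →
      (∀ k ∈ K, k ≠ b → ‖v (.inr k)‖ ≤ M) → ‖innerTerm Δ y y' x o σ K v‖ ≤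
        C * (‖v (.inr o)‖ ^ (x - y' o - 1) * ‖v (.inr b)‖ ^ (x - y' b - 1)) := by
  have hob : o ≠ b := by rintro rfl; exact hK hb
  have hKo : ∀ k ∈ K, k ≠ o := by rintro k hk rfl; exact hK hk
  have hKs : K ⊆ univ.erase o := fun k hk => mem_erase.2 ⟨hKo k hk, mem_univ k⟩
  have hR := h.pos
  have hR' := h.pos'
  obtain ⟨c, hc, hpη⟩ := h.exists_le_norm_pFac_eta
  obtain ⟨C₀, hC₀, hmon⟩ := exists_prod_zpow_le hob (fun k => x - y' k - 1) (β := x - y' b - 1)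
    le_rfl (max M 1)
  set n := (univ.erase o).card with hn
  have hn1 : 1 ≤ n := card_pos.2 ⟨b, hKs hb⟩
  set c₁ : ℝ := R + 1 + 2 * |Δ| * R with hc₁
  have hc₁0 : 0 < c₁ := by positivity
  set c₃ : ℝ := pairProd (univ : Finset (Fin N)) fun _ _ => 1 / 2 * (R * R) with hc₃
  have hc₃0 : 0 < c₃ := prod_pos fun _ _ => prod_pos fun _ _ => by split_ifs <;> positivity
  set c₄ : ℝ := pairProd (univ.erase o) fun _ _ => c with hc₄
  have hc₄0 : 0 < c₄ := prod_pos fun _ _ => prod_pos fun _ _ => by split_ifs <;> positivity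
  set c₅ : ℝ := ∏ j, R ^ (x - y j - 1) with hc₅
  set c₆ : ℝ := ∏ k ∈ univ.erase o, (if k ∈ K then 1 else R⁻¹ ^ (x - y' k) * R'⁻¹) with hc₆
  have hc₆0 : 0 ≤ c₆ := prod_nonneg fun k _ => by split_ifs <;> positivity
  set c₇ : ℝ := ∏ _k ∈ univ.erase o \ K, R with hc₇
  set c₈ : ℝ := (c₁ * max 1 s) ^ K.card with hc₈
  set c₉ : ℝ := (1 - s * R)⁻¹ with hc₉
  have hc₉0 : 0 < c₉ := inv_pos.2 (by linarith)
  refine ⟨(∏ k ∈ univ.erase o, ∏ _j ∈ univ.erase (σ k), c₁) * c₇ / (c₃ * c₄) * c₅ * c₆ * c₈ * c₉ * C₀,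
    by positivity, fun v ⟨h1, hz0, hzs, h2, h2'⟩ hM => ?_⟩
  have h0 : ∀ j, v (.inl j) ≠ 0 := fun j => by rw [← norm_pos_iff, h1]; exact h.pos
  have em : ∀ k, k ≠ o → eta σ K v k ∈ etaSet R R' := fun k hk =>
    eta_mem_etaSet h1 fun _ => h2 k hk
  set m : Fin N → ℝ := fun k => max 1 ‖eta σ K v k‖ with hm
  have hm1 : ∀ k, 0 < m k := fun k => lt_of_lt_of_le one_pos (le_max_left _ _)
  have hmK : ∀ k ∈ K, m k = ‖v (.inr k)‖ := fun k hk => by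
    simp only [hm, eta, hk, if_true]
    exact max_eq_right (h.one_lt'.le.trans (h2 k (hKo k hk)))
  have hmK' : ∀ k, k ∉ K → m k = 1 := fun k hk => by
    simp only [hm, eta, hk, if_false, norm_inv, h1]
    exact max_eq_left (inv_le_one_of_one_le₀ h.one_lt.le)
  set P : ℝ := ∏ k ∈ univ.erase o, m k with hP
  have hP0 : 0 < P := prod_pos fun k _ => hm1 k
  have b1 : ‖∏ k ∈ univ.erase o, ∏ j ∈ univ.erase (σ k), rFac Δ (v (.inl j)) (eta σ K v k)‖ ≤
      (∏ k ∈ univ.erase o, ∏ _j ∈ univ.erase (σ k), c₁) * P ^ n := by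
    rw [hP, ← prod_pow, ← prod_mul_distrib, norm_prod]
    refine prod_le_prod (fun _ _ => norm_nonneg _) fun k _ => ?_
    have : n = (univ.erase (σ k)).card := by
      rw [hn, card_erase_of_mem (mem_univ _), card_erase_of_mem (mem_univ _)]
    rw [this, ← prod_const, ← prod_mul_distrib, norm_prod]
    exact prod_le_prod (fun _ _ => norm_nonneg _) fun j _ => h.norm_rFac_le (h1 j)
  have b2 : ‖∏ k ∈ K, (1 - v (.inl (σ k)) * v (.inr k))⁻¹‖ ≤ P⁻¹ := by
    have : P⁻¹ = ∏ k ∈ K, ‖v (.inr k)‖⁻¹ := by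
      rw [hP, ← prod_inv_distrib, ← prod_subset hKs fun k _ hk => by rw [hmK' k hk, inv_one]]
      exact prod_congr rfl fun k hk => by rw [hmK k hk]
    rw [this, norm_prod]
    exact prod_le_prod (fun _ _ => norm_nonneg _) fun k hk =>
      h.norm_inv_one_sub_le (h1 _) (h2 k (hKo k hk))
  have b3 : c₃ ≤ ‖pairProd univ (fun j j' => pFac Δ (v (.inl j)) (v (.inl j')))‖ := by
    rw [norm_pairProd]
    refine pairProd_mono (fun _ _ _ _ _ => by positivity) fun j _ k _ _ => ?_
    have := norm_pFac_ge h.lt_fst.le (h.one_lt.le.trans (h1 j).ge) (h1 k).ge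
    rwa [h1, h1] at this
  have b4 : c₄ * P ^ (n - 1) ≤
      ‖pairProd (univ.erase o) (fun k k' => pFac Δ (eta σ K v k) (eta σ K v k'))‖ := by
    rw [hP, hn, ← pairProd_mul_self, ← pairProd_mul, norm_pairProd]
    refine pairProd_mono (fun j _ k _ _ => ?_) fun j hj k hk _ =>
      hpη _ (em j (mem_erase.1 hj).1) _ (em k (mem_erase.1 hk).1)
    have := hm1 j; have := hm1 k; positivity
  have b5 : ‖∏ j, v (.inl j) ^ (x - y j - 1)‖ = c₅ := by
    rw [norm_prod]
    exact prod_congr rfl fun j _ => by rw [norm_zpow, h1]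
  set q : Fin N → ℝ := fun k => if k = o then ‖v (.inr o)‖ else if k ∈ K then ‖v (.inr k)‖ else 1
    with hq
  have b6 : ‖∏ k ∈ univ.erase o, eta σ K v k ^ (x - y' k) * (v (.inr k))⁻¹‖ =
      c₆ * ∏ k ∈ univ.erase o, q k ^ (x - y' k - 1) := by
    rw [norm_prod, hc₆, ← prod_mul_distrib]
    refine prod_congr rfl fun k hk => ?_
    have hko := (mem_erase.1 hk).1
    by_cases hkK : k ∈ K
    · have : ‖v (.inr k)‖ ≠ 0 := by have := h2 k hko; linarith
      simp only [eta, hq, hkK, hko, if_true, if_false, norm_mul, norm_zpow, norm_inv, one_mul]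
      rw [zpow_sub_one₀ this]
    · simp only [eta, hq, hkK, hko, if_false, norm_mul, norm_zpow, norm_inv, h1, h2' k hko hkK,
        one_zpow, mul_one]
  have b6' : (∏ k ∈ univ.erase o, q k ^ (x - y' k - 1)) * (‖v (.inr o)‖ ^ (x - y' o) * ‖v (.inr o)‖⁻¹) ≤
      C₀ * (‖v (.inr o)‖ ^ (x - y' o - 1) * ‖v (.inr b)‖ ^ (x - y' b - 1)) := by
    have e1 : ‖v (.inr o)‖ ^ (x - y' o) * ‖v (.inr o)‖⁻¹ = q o ^ (x - y' o - 1) := by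
      simp only [hq, if_true]
      rw [zpow_sub_one₀ (norm_ne_zero_iff.2 hz0)]
    rw [e1, prod_erase_mul _ _ (mem_univ o)]
    have := hmon q (fun k hko hkb => ?_) (by simpa [hq] using hz0) ?_
    · simpa only [hq, if_true, hob.symm, if_false, hb] using this
    · simp only [hq, hko, if_false]
      split_ifs with hk
      · exact ⟨h.one_lt'.le.trans (h2 k hko), (hM k hk hkb).trans (le_max_left _ _)⟩
      · exact ⟨le_rfl, le_max_right _ _⟩
    · simp only [hq, hob.symm, if_false, hb, if_true]
      exact h.one_lt'.le.trans (h2 b hob.symm)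
  have b7 : ‖∏ k ∈ univ.erase o \ K, v (.inl (σ k))‖ = c₇ := by
    rw [norm_prod]; exact prod_congr rfl fun j _ => h1 _
  have b8 : ‖∏ k ∈ K, rFac Δ (v (.inl (σ k))) (v (.inr o))‖ ≤ c₈ := by
    rw [norm_prod, hc₈, ← prod_const]
    refine prod_le_prod (fun _ _ => norm_nonneg _) fun k _ => (h.norm_rFac_le (h1 _)).trans ?_
    gcongr
  have b9 : ‖(1 - v (.inl (σ o)) * v (.inr o))⁻¹‖ ≤ c₉ := by
    rw [norm_inv]
    refine inv_anti₀ (by linarith) ?_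
    have := norm_sub_norm_le 1 (v (.inl (σ o)) * v (.inr o))
    rw [norm_one, norm_mul, h1] at this
    have : R * ‖v (.inr o)‖ ≤ R * s := by gcongr
    linarith
  have ks : ‖((sign σ : ℤ) : ℂ)‖ = 1 := by
    rcases Int.units_eq_one_or (sign σ) with h | h <;> simp [h]
  have hPn : P ^ n = P ^ (n - 1) * P := by rw [← pow_succ]; congr 1; omega
  rw [innerTerm, coreTerm]
  simp only [norm_mul, norm_div, ks, one_mul, b5, b6, b7]
  rw [norm_zpow, norm_inv (v (.inr o))]
  calc _ ≤ (((∏ k ∈ univ.erase o, ∏ _j ∈ univ.erase (σ k), c₁) * P ^ n) * P⁻¹ * c₇ /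
        (c₃ * (c₄ * P ^ (n - 1))) * c₅ * (c₆ * ∏ k ∈ univ.erase o, q k ^ (x - y' k - 1))) * c₈ *
        ‖v (.inr o)‖ ^ (x - y' o) * c₉ * ‖v (.inr o)‖⁻¹ := by
        have hq0 : 0 ≤ ∏ k ∈ univ.erase o, q k ^ (x - y' k - 1) :=
          prod_nonneg fun k _ => zpow_nonneg (by
            simp only [hq]; split_ifs <;> [exact norm_nonneg _; exact norm_nonneg _; exact zero_le_one]) _
        gcongr
    _ = (∏ k ∈ univ.erase o, ∏ _j ∈ univ.erase (σ k), c₁) * c₇ / (c₃ * c₄) * c₅ * c₆ * c₈ * c₉ *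
        ((∏ k ∈ univ.erase o, q k ^ (x - y' k - 1)) *
          (‖v (.inr o)‖ ^ (x - y' o) * ‖v (.inr o)‖⁻¹)) := by
        rw [hPn]; field_simp
    _ ≤ _ := by
        rw [mul_assoc _ C₀]
        gcongr

end

lemma prod_prod_erase {M : Type*} [CommMonoid M] (S : Finset (Fin N)) (f : Fin N → Fin N → M) :
    ∏ k ∈ S, ∏ i ∈ S.erase k, f i k = pairProd S fun j k => f j k * f k j := by
  have h1 : pairProd S (fun j k => f j k * f k j) =
      ∏ k ∈ S, ∏ i ∈ S, (if i < k then f i k else 1) * (if k < i then f i k else 1) := by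
    rw [pairProd_mul]
    simp only [prod_mul_distrib, pairProd]
    rw [prod_comm]
  rw [h1]
  refine prod_congr rfl fun k hk => ?_
  rw [← mul_prod_erase S _ hk]
  simp only [lt_irrefl, if_false, one_mul]
  refine prod_congr rfl fun i hi => ?_
  rcases lt_or_gt_of_ne (mem_erase.1 hi).1 with h | h
  · simp [h, h.not_gt]
  · simp [h, h.not_gt]

lemma pairProd_div (S : Finset (Fin N)) (f g : Fin N → Fin N → ℂ) :
    pairProd S (fun j k => f j k / g j k) = pairProd S f / pairProd S g := by
  simp only [pairProd, ← prod_div_distrib]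
  refine prod_congr rfl fun j _ => prod_congr rfl fun k _ => ?_
  split_ifs <;> simp

/-- Without remaining variables `ζ` the integrand is the one of the propagator. -/
lemma coreTerm_empty (Δ : ℝ) (y y' : Fin N → ℤ) (x : ℤ) {o : Fin N} (ho : ∀ k, o ≤ k)
    (σ : Perm (Fin N)) {v : Point N} (h0 : ∀ j, v (.inl j) ≠ 0)
    (hp : ∀ j k, pFac Δ (v (.inl j)) (v (.inl k)) ≠ 0) :
    coreTerm Δ y y' x o σ ∅ v * v (.inl (σ o)) ^ (y' o - x) =
      planeTerm Δ y y' σ (v ∘ .inl) * ∏ k ∈ univ.erase o, (v (.inr k))⁻¹ := by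
  set a : Fin N → ℂ := fun k => v (.inl (σ k)) with ha
  have ha0 : ∀ k, a k ≠ 0 := fun k => h0 _
  have he : ∀ k, eta σ ∅ v k = (a k)⁻¹ := fun k => by simp [eta, ha]
  set q : Fin N → Fin N → ℂ := fun i k => pFac Δ (a i) (a k) with hq
  have hq0 : ∀ i k, q i k ≠ 0 := fun i k => hp _ _
  have hlt : ∀ k, o < k ↔ k ≠ o := fun k => ⟨fun h => h.ne', fun h => (ho k).lt_of_ne h.symm⟩
  set S := (univ : Finset (Fin N)).erase o with hS
  have e1 : (∏ k ∈ S, ∏ j ∈ univ.erase (σ k), rFac Δ (v (.inl j)) (eta σ ∅ v k)) =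
      (∏ k ∈ S, q o k) / (∏ k ∈ S, a k) * (pairProd S (fun j k => q j k * q k j) /
        pairProd S fun j k => a k * a j) := by
    rw [← prod_prod_erase, ← prod_prod_erase, ← prod_div_distrib, ← prod_div_distrib,
      ← prod_mul_distrib]
    refine prod_congr rfl fun k hk => ?_
    have hko := (mem_erase.1 hk).1
    have : ∏ j ∈ univ.erase (σ k), rFac Δ (v (.inl j)) (eta σ ∅ v k) =
        ∏ i ∈ univ.erase k, q i k / a k := by
      refine (prod_bij (fun i _ => σ i) (fun i hi => ?_) (fun _ _ _ _ h => σ.injective h)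
        (fun j hj => ⟨σ⁻¹ j, ?_, perm_apply_inv σ j⟩) fun i _ => ?_).symm
      · exact mem_erase.2 ⟨fun e => (mem_erase.1 hi).1 (σ.injective e), mem_univ _⟩
      · refine mem_erase.2 ⟨fun e => (mem_erase.1 hj).1 ?_, mem_univ _⟩
        rw [← e, perm_apply_inv]
      · rw [he, rFac_inv Δ (ha0 k)]
    rw [this, ← mul_prod_erase _ _ (mem_erase.2 ⟨hko.symm, mem_univ o⟩), ← prod_div_distrib,
      erase_right_comm]
  have e2 : pairProd S (fun k k' => pFac Δ (eta σ ∅ v k) (eta σ ∅ v k')) =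
      pairProd S (fun j k => q k j) / pairProd S fun j k => a k * a j := by
    rw [← pairProd_div]
    refine pairProd_congr fun j _ k _ _ => ?_
    rw [he, he, pFac_inv_inv Δ (ha0 j) (ha0 k), mul_comm (a j)]
  have e3 : pairProd univ (fun k k' => pFac Δ (v (.inl (σ k))) (v (.inl (σ k')))) =
      pairProd S q * ∏ k ∈ S, q o k := by
    have := pairProd_erase q o
    have k1 : (∏ j, if j < o then q j o else 1) = 1 := prod_eq_one fun j _ => if_neg (ho j).not_gt
    have k2 : (∏ k, if o < k then q o k else 1) = ∏ k ∈ S, q o k := by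
      rw [← prod_filter]
      exact prod_congr (by ext k; simp [hlt, hS]) fun _ _ => rfl
    rw [k1, k2, mul_one] at this
    exact this
  have e4 : (∏ k ∈ S, eta σ ∅ v k ^ (x - y' k) * (v (.inr k))⁻¹) =
      (∏ k ∈ S, a k ^ (y' k - x)) * ∏ k ∈ S, (v (.inr k))⁻¹ := by
    rw [← prod_mul_distrib]
    refine prod_congr rfl fun k _ => ?_
    rw [he, inv_zpow', neg_sub]
  have e5 : (∏ j, v (.inl j) ^ (x - y j - 1)) * ((∏ k ∈ S, a k ^ (y' k - x)) * a o ^ (y' o - x)) =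
      ∏ j, v (.inl j) ^ (y' (σ⁻¹ j) - y j - 1) := by
    rw [prod_erase_mul _ _ (mem_univ o), ← Equiv.prod_comp σ⁻¹ fun k => a k ^ (y' k - x),
      ← prod_mul_distrib]
    refine prod_congr rfl fun j _ => ?_
    simp only [ha, perm_apply_inv]
    rw [← zpow_add₀ (h0 j)]
    congr 1; ring
  have n1 : (∏ k ∈ S, a k) ≠ 0 := prod_ne_zero_iff.2 fun k _ => ha0 k
  have n2 : pairProd S (fun j k => a k * a j) ≠ 0 :=
    pairProd_ne_zero fun j _ k _ _ => mul_ne_zero (ha0 k) (ha0 j)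
  have n3 : pairProd S (fun j k => q k j) ≠ 0 := pairProd_ne_zero fun j _ k _ _ => hq0 k j
  simp only [coreTerm, planeTerm, comp_apply, e3]
  rw [e1, e2, e4, ← e5, pairProd_mul, prod_empty, sdiff_empty]
  change _ * a o ^ (y' o - x) = _
  have n4 : pairProd univ (fun j j' => pFac Δ (v (.inl j)) (v (.inl j'))) ≠ 0 :=
    pairProd_ne_zero fun j _ k _ _ => hp _ _
  change (_ * _ * _ * (∏ k ∈ S, a k) / _ * _ * _) * _ = _
  field_simp

/-! ### The transition function -/

/-- The contour integral formula for `ℙ(X_1(t) ≥ x)`, for two initial configurations. -/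
def transition (Δ R R' : ℝ) (y y' : Fin N → ℤ) (x : ℤ) (t : ℝ) : ℂ :=
  ∑ K ∈ (univ : Finset (Fin N)).powerset, ∑ σ,
    iter (torus N R R') (allVars N) (theta Δ y y' x t σ K) 0

lemma mem_offBox_of_forall_mem {ι : Type} {l : List ι} (hl : ∀ j, j ∈ l) {T : ι → Set ℂ}
    (v : ι → ℂ) : v ∈ offBox l T := fun j hj => absurd (hl j) hj

section
variable {Δ R R' s : ℝ} (h : Radii Δ R R')
include h

/-- The list of all variables, with one of the variables `ζ` innermost. -/
def varsLast (o : Fin N) : List (Fin N ⊕ Fin N) :=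
  ((List.finRange N).map .inl ++ (univ.erase o).toList.map .inr) ++ [.inr o]

omit h in
lemma allVars_perm (o : Fin N) : (allVars N).Perm (varsLast o) := by
  refine (List.perm_ext_iff_of_nodup nodup_allVars ?_).2 fun i => ?_
  · refine List.Nodup.append (List.Nodup.append ((List.nodup_finRange N).map Sum.inl_injective)
      ((nodup_toList _).map Sum.inr_injective) ?_) (List.nodup_singleton _) ?_
    · intro i h1 h2
      simp only [List.mem_map] at h1 h2
      obtain ⟨_, _, rfl⟩ := h1
      obtain ⟨_, _, h⟩ := h2
      exact absurd h (by simp)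
    · intro i h1 h2
      rw [List.mem_singleton] at h2
      subst h2
      simp at h1
  · simp only [mem_allVars, varsLast, true_iff]
    rcases i with j | j
    · simp
    · by_cases e : j = o <;> simp [e]

/-- The contours after the integration over the first of the variables `ζ` has been moved. -/
def innerTorus (N : ℕ) (R R' s : ℝ) (o : Fin N) : Fin N ⊕ Fin N → Contour :=
  update (torus N R R') (.inr o) (circ s)

lemma Radii.iter_theta_add (hs : 0 < s) (hsR : s * R < 1) (hsR' : 1 < s * (R' - 2 * |Δ|))
    (y y' : Fin N → ℤ) (x : ℤ) {o : Fin N} (ho : ∀ k, o ≤ k) (σ : Perm (Fin N))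
    {K : Finset (Fin N)} (hK : o ∉ K) :
    iter (torus N R R') (allVars N) (theta Δ y y' x 0 σ K) 0 +
        iter (torus N R R') (allVars N) (theta Δ y y' x 0 σ (insert o K)) 0 =
      iter (innerTorus N R R' s o) (varsLast o) (fun v => innerTerm Δ y y' x o σ K v /
        ∏ k ∈ K, pFac Δ (v (.inr o)) (v (.inr k))) 0 := by
  have hKo : ∀ k ∈ K, k ≠ o := by rintro k hk rfl; exact hK hk
  have htr : ∀ j ∈ allVars N, trace (torus N R R' j) ⊆ torusSet N R R' j :=
    fun j _ => trace_torus h.pos.le h.pos'.le j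
  have hc := h.continuousOn_theta_apply y y' x 0 σ
  have h0 := mem_offBox_of_forall_mem mem_allVars (T := torusSet N R R') 0
  have hadd : ContinuousOn (fun v => theta Δ y y' x 0 σ K v + theta Δ y y' x 0 σ (insert o K) v)
      (offBox [] (torusSet N R R')) := (hc _).add (hc _)
  rw [← iter_add (fun j _ => isSmooth_torus R R' j) htr (hc _) (hc _) h0,
    iter_perm (allVars_perm o) (fun j _ => isSmooth_torus R R' j) htr hadd h0,
    varsLast, iter_append (torus N R R') _ [_], iter_append (innerTorus N R R' s o) _ [_]]
  have hol : ∀ j ∈ (List.finRange N).map Sum.inl ++ (univ.erase o).toList.map Sum.inr,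
      j ≠ (Sum.inr o : Fin N ⊕ Fin N) := by
    intro j hj
    rintro rfl
    simp at hj
  rw [iter_congr_contour (Γ := innerTorus N R R' s o) (Γ' := torus N R R') fun j hj =>
    update_of_ne (hol j hj) _ _]
  refine iter_congr (T := update (torusSet N R R') (.inr o) Set.univ) (fun j hj => ?_)
    (fun v hv => ?_) fun j hj => ?_
  · rw [update_of_ne (hol j hj)]
    exact trace_torus h.pos.le h.pos'.le j
  · simp only [iter, innerTorus, update_self]
    refine (h.contourIntegral_theta hs hsR hsR' y y' x ho σ hK fun j hj => ?_).trans
      (contourIntegral_congr fun z _ => ?_)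
    · have := mem_offBox_nil.1 hv j
      rwa [update_of_ne (by simpa using hj)] at this
    · congr 1
      refine prod_congr rfl fun k hk => ?_
      rw [update_of_ne (by simpa using hKo k hk)]
  · have : j = .inr o := by
      by_contra hne
      exact hj (by
        rcases j with j | j
        · simp
        · have : j ≠ o := by simpa using hne
          simp [this])
    subst this
    simp

/-- The range of the variables after the first of the variables `ζ` has been moved. -/
def innerTorusSet (N : ℕ) (R R' s : ℝ) (o : Fin N) : Fin N ⊕ Fin N → Set ℂ :=
  update (torusSet N R R') (.inr o) {z | ‖z‖ = s}

omit h in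
lemma innerSetData_of_mem_torus (hs : 0 < s) {o : Fin N} (K : Finset (Fin N)) {v : Point N}
    (hv : v ∈ offBox [] (innerTorusSet N R R' s o)) : InnerSetData R R' s o K v := by
  rw [mem_offBox_nil] at hv
  have h1 : ∀ j, ‖v (.inl j)‖ = R := fun j => by
    have := hv (.inl j)
    rwa [innerTorusSet, update_of_ne (by simp)] at this
  have h2 : ∀ k, k ≠ o → ‖v (.inr k)‖ = R' := fun k hk => by
    have := hv (.inr k)
    rwa [innerTorusSet, update_of_ne (by simpa using hk)] at this
  have h3 : ‖v (.inr o)‖ = s := by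
    have := hv (.inr o)
    rwa [innerTorusSet, update_self] at this
  exact ⟨h1, by rw [← norm_pos_iff, h3]; exact hs, h3.le, fun k hk => (h2 k hk).ge,
    fun k hk _ => h2 k hk⟩

omit h in
lemma mem_innerTorusSet {o : Fin N} {v : Point N}
    (hv : v ∈ offBox [] (innerTorusSet N R R' s o)) :
    ‖v (.inr o)‖ = s ∧ ∀ k, k ≠ o → ‖v (.inr k)‖ = R' := by
  rw [mem_offBox_nil] at hv
  refine ⟨?_, fun k hk => ?_⟩
  · have := hv (.inr o)
    rwa [innerTorusSet, update_self] at this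
  · have := hv (.inr k)
    rwa [innerTorusSet, update_of_ne (by simpa using hk)] at this

lemma Radii.trace_innerTorus (hs : 0 < s) (o : Fin N) (j : Fin N ⊕ Fin N) :
    trace (innerTorus N R R' s o j) ⊆ innerTorusSet N R R' s o j := by
  by_cases e : j = .inr o
  · subst e
    rw [innerTorus, innerTorusSet, update_self, update_self]
    exact fun z hz => norm_of_mem_circ hs.le hz
  · rw [innerTorus, innerTorusSet, update_of_ne e, update_of_ne e]
    exact trace_torus h.pos.le h.pos'.le j

omit h in
lemma isSmooth_innerTorus (R R' s : ℝ) (o : Fin N) (j : Fin N ⊕ Fin N) :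
    IsSmooth (innerTorus N R R' s o j) := by
  by_cases e : j = .inr o
  · subst e
    rw [innerTorus, update_self]
    exact isSmooth_circ s
  · rw [innerTorus, update_of_ne e]
    exact isSmooth_torus R R' j

omit h in
lemma pFac_inner_ne_zero (hsR' : 1 < s * (R' - 2 * |Δ|)) {z w : ℂ} (hz : ‖z‖ = s)
    (hw : ‖w‖ = R') : pFac Δ z w ≠ 0 := by
  intro e
  have := le_norm_one_add_mul_sub (Δ := Δ) (κ := s * (R' - 2 * |Δ|) - 1) hz.le (w := w) (by
    rw [hz, hw]; apply le_of_eq; ring)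
  rw [show 1 + z * w - 2 * Δ * z = pFac Δ z w from rfl, e, norm_zero] at this
  linarith

lemma Radii.continuousOn_innerTerm (hs : 0 < s) (hsR : s * R < 1) (hsR' : 1 < s * (R' - 2 * |Δ|))
    (y y' : Fin N → ℤ) (x : ℤ) {o : Fin N} (σ : Perm (Fin N)) {K : Finset (Fin N)}
    (hK : o ∉ K) : ContinuousOn (fun v => innerTerm Δ y y' x o σ K v /
        ∏ k ∈ K, pFac Δ (v (.inr o)) (v (.inr k))) (offBox [] (innerTorusSet N R R' s o)) := by
  intro v hv
  obtain ⟨h1, h2⟩ := mem_innerTorusSet hv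
  refine (differentiableAt_div (h.differentiableAt_innerTerm hsR y y' x σ hK
    (innerSetData_of_mem_torus hs K hv)) (differentiableAt_prod fun k _ =>
    differentiableAt_pFac Δ (differentiableAt_apply _ v) (differentiableAt_apply _ v)) ?_
    ).continuousAt.continuousWithinAt
  exact prod_ne_zero_iff.2 fun k hk =>
    pFac_inner_ne_zero hsR' h1 (h2 k (by rintro rfl; exact hK hk))

/-- The terms with remaining variables `ζ` cancel. -/
lemma Radii.sum_iter_innerTerm_eq_zero (hs : 0 < s) (hsR : s * R < 1)
    (hsR' : 1 < s * (R' - 2 * |Δ|)) {y y' : Fin N → ℤ} (hy' : StrictMono y') (x : ℤ)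
    {o : Fin N} (ho : ∀ k, o ≤ k) {K : Finset (Fin N)} (hK : o ∉ K) (hne : K.Nonempty) :
    ∑ σ, iter (innerTorus N R R' s o) (varsLast o) (fun v => innerTerm Δ y y' x o σ K v /
        ∏ k ∈ K, pFac Δ (v (.inr o)) (v (.inr k))) 0 = 0 := by
  classical
  have hmem : ∀ j, j ∈ varsLast o := fun j => (allVars_perm o).mem_iff.1 (mem_allVars j)
  have hKo : ∀ k ∈ K, k ≠ o := by rintro k hk rfl; exact hK hk
  rw [← iter_sum (fun j _ => isSmooth_innerTorus R R' s o j)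
    (fun j _ => h.trace_innerTorus hs o j) univ
    (fun σ _ => h.continuousOn_innerTerm hs hsR hsR' y y' x σ hK) (mem_offBox_of_forall_mem hmem 0)]
  refine iter_eq_zero (T := innerTorusSet N R R' s o)
    (l' := .inr o :: K.toList.map .inr) ⟨((varsLast o).filter
      fun j => decide (j ∉ ((.inr o :: K.toList.map .inr : List (Fin N ⊕ Fin N))))), ?_⟩
    (fun j _ => isSmooth_innerTorus R R' s o j) (fun j _ => h.trace_innerTorus hs o j)
    (continuousOn_finsetSum _ fun σ _ => h.continuousOn_innerTerm hs hsR hsR' y y' x σ hK)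
    (fun u hu => ?_) (mem_offBox_of_forall_mem hmem 0)
  · have hnd : (varsLast o).Nodup := (allVars_perm o).nodup_iff.1 nodup_allVars
    refine (List.perm_ext_iff_of_nodup hnd ?_).2 fun j => ?_
    · refine List.Nodup.append (hnd.filter _) ?_ ?_
      · refine List.nodup_cons.2 ⟨by simpa using hK, (nodup_toList K).map Sum.inr_injective⟩
      · intro j h1 h2
        exact of_decide_eq_true (List.mem_filter.1 h1).2 h2
    · simp only [hmem, true_iff, List.mem_append, List.mem_filter, true_and, decide_eq_true_eq]
      exact (em _).symm
  have hB : ∀ j, j ∈ K.toList.map (Sum.inr : Fin N → Fin N ⊕ Fin N) ↔ j ∈ K.image Sum.inr := by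
    intro j; simp
  have key := iter_eq_zero_of_growth (Δ := Δ) (r := s) (ρ := R') hs h.pos'
    (by linarith) (a := Sum.inr o) (B := K.image Sum.inr) (hne.image _)
    (by simpa using hK) ((nodup_toList K).map Sum.inr_injective) hB
    (Γ := innerTorus N R R' s o) (by simp [innerTorus]) (fun b hb => ?_)
    (T := innerSet R R' s o K) (fun z h0 h1 => by simp [innerSet, h0, h1]) (fun b hb z hz => ?_)
    (Φ := fun v => ∑ σ, innerTerm Δ y y' x o σ K v)
    (fun w hw => DifferentiableAt.fun_sum fun σ _ =>
      h.differentiableAt_innerTerm hsR y y' x σ hK (innerSetData_of_mem hw))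
    (fun w _ b hb c hc hbc e => ?_) (fun b hb M => ?_) (u := u) ?_
  · rw [← key]
    refine iter_congr (T := innerTorusSet N R R' s o) (fun j _ => h.trace_innerTorus hs o j)
      (fun v _ => ?_) hu
    rw [sum_div, prod_image fun _ _ _ _ h => Sum.inr_injective h]
    rfl
  · obtain ⟨k, hk, rfl⟩ := mem_image.1 hb
    rw [innerTorus, update_of_ne (by simpa using hKo k hk)]
    rfl
  · obtain ⟨k, hk, rfl⟩ := mem_image.1 hb
    simpa only [innerSet, Sum.elim_inr, hKo k hk, hk, if_true, if_false, Set.mem_ofPred_eq] using hz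
  · obtain ⟨k, hk, rfl⟩ := mem_image.1 hb
    obtain ⟨k', hk', rfl⟩ := mem_image.1 hc
    exact sum_innerTerm_eq_zero Δ y y' x hK hk hk' (fun e => hbc (by rw [e])) e
  · obtain ⟨k, hk, rfl⟩ := mem_image.1 hb
    choose C _ hC using fun σ => h.exists_innerTerm_le hsR y y' x σ hK hk M
    refine ⟨∑ σ, C σ, x - y' o - 1, x - y' k - 1, ?_, fun w hw _ _ _ h3 => ?_⟩
    · have := hy' ((ho k).lt_of_ne (hKo k hk).symm); omega
    · rw [sum_mul]
      refine (norm_sum_le _ _).trans (sum_le_sum fun σ _ => hC σ w (innerSetData_of_mem hw) ?_)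
      intro k' hk' hne
      exact h3 _ (mem_image_of_mem _ hk') fun e => hne (Sum.inr_injective e)
  · intro j hj
    have hj' := hu j hj
    rcases j with j | j
    · rwa [innerTorusSet, update_of_ne (by simp)] at hj'
    · simp only [List.mem_cons, List.mem_map, mem_toList, not_or, Sum.inr.injEq, exists_eq_right]
        at hj
      rw [innerTorusSet, update_of_ne (by simpa using hj.1)] at hj'
      simpa only [innerSet, torusSet, Sum.elim_inr, hj.1, hj.2, if_false] using hj'

/-- The transition function at time `0`. -/
theorem Radii.transition_zero {y y' : Fin N → ℤ} (hy : StrictMono y) (hy' : StrictMono y') (x : ℤ)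
    {o : Fin N} (ho : ∀ k, o ≤ k) :
    transition Δ R R' y y' x 0 = if y = y' ∧ x ≤ y' o then 1 else 0 := by
  obtain ⟨s, hs, hsR, hsR'⟩ := h.exists_inner
  have hu : (univ : Finset (Fin N)) = insert o (univ.erase o) := (insert_erase (mem_univ o)).symm
  rw [transition, hu, sum_powerset_insert (notMem_erase o _), ← sum_add_distrib]
  have e1 : ∀ K ∈ (univ.erase o).powerset,
      (∑ σ, iter (torus N R R') (allVars N) (theta Δ y y' x 0 σ K) 0) +
        ∑ σ, iter (torus N R R') (allVars N) (theta Δ y y' x 0 σ (insert o K)) 0 =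
      ∑ σ, iter (innerTorus N R R' s o) (varsLast o) (fun v => innerTerm Δ y y' x o σ K v /
        ∏ k ∈ K, pFac Δ (v (.inr o)) (v (.inr k))) 0 := fun K hK => by
    rw [← sum_add_distrib]
    refine sum_congr rfl fun σ _ => h.iter_theta_add hs hsR hsR' y y' x ho σ fun ho' => ?_
    exact (mem_erase.1 (mem_powerset.1 hK ho')).1 rfl
  rw [sum_congr rfl e1, sum_eq_single ∅]
  · set L₂ : List (Fin N ⊕ Fin N) := (univ.erase o).toList.map .inr with hL₂
    have hol : ∀ j ∈ (List.finRange N).map Sum.inl ++ L₂, j ≠ (Sum.inr o : Fin N ⊕ Fin N) := by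
      intro j hj
      rintro rfl
      simp [hL₂] at hj
    set c : ℂ := if x - y' o ≤ 0 then 1 else 0 with hc
    set F : Perm (Fin N) → (Fin N → ℂ) → ℂ := planeTerm Δ y y' with hF
    have key : ∀ σ, iter (innerTorus N R R' s o) (varsLast o) (fun v => innerTerm Δ y y' x o σ ∅ v /
        ∏ k ∈ ∅, pFac Δ (v (.inr o)) (v (.inr k))) 0 =
        c * iter (fun _ => circ R) (List.finRange N) (F σ) 0 := by
      intro σ
      rw [varsLast, iter_append, iter_congr_contour (Γ' := torus N R R') fun j hj => by
        rw [innerTorus, update_of_ne (hol j hj)]]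
      rw [iter_congr (T := update (torusSet N R R') (.inr o) Set.univ)
        (G := fun v => c * (F σ (v ∘ .inl) * ∏ j ∈ L₂.toFinset, (v j)⁻¹)) (fun j hj => ?_)
        (fun v hv => ?_) fun j hj => ?_, iter_const_mul, iter_append]
      · congr 1
        have : ∀ v, iter (torus N R R') L₂ (fun v => F σ (v ∘ .inl) * ∏ j ∈ L₂.toFinset, (v j)⁻¹) v =
            F σ (v ∘ .inl) := fun v => by
          rw [iter_mul_of_indep (torus N R R') L₂ (fun v => F σ (v ∘ Sum.inl))
            (fun v => ∏ j ∈ L₂.toFinset, (v j)⁻¹) v, iter_prod _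
            ((nodup_toList _).map Sum.inr_injective) fun _ z => z⁻¹, prod_eq_one, mul_one]
          · intro j hj
            obtain ⟨k, -, rfl⟩ := List.mem_map.1 (List.mem_toFinset.1 hj)
            exact contourIntegral_circ_inv h.pos'
          · intro v j hj z
            obtain ⟨k, -, rfl⟩ := List.mem_map.1 hj
            congr 1
        have e := funext this
        rw [e, iter_comp_injective Sum.inl_injective]
        rfl
      · rw [update_of_ne (hol j hj)]
        exact trace_torus h.pos.le h.pos'.le j
      · have h1 : ∀ j, ‖v (.inl j)‖ = R := fun j => by
          have := mem_offBox_nil.1 hv (.inl j)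
          rwa [update_of_ne (by simp)] at this
        have h0 : ∀ j, v (.inl j) ≠ 0 := fun j => by rw [← norm_pos_iff, h1]; exact h.pos
        have hp : ∀ j k, pFac Δ (v (.inl j)) (v (.inl k)) ≠ 0 := fun j k =>
          pFac_ne_zero h.lt_fst.le (h.one_lt.le.trans (h1 j).ge) (h1 k).ge
        simp only [iter, innerTorus, update_self, prod_empty, div_one, innerTerm, mul_one]
        have e2 : ∀ z, update v (.inr o) z (.inl (σ o)) = v (.inl (σ o)) := fun z =>
          update_of_ne (by simp) _ _
        have e3 : ∀ z, coreTerm Δ y y' x o σ ∅ (update v (.inr o) z) =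
            coreTerm Δ y y' x o σ ∅ v := fun z => coreTerm_congr Δ y y' x σ (by simp)
          (fun j => update_of_ne (by simp) _ _) fun k hk =>
            update_of_ne (by simpa using hk) _ _
        simp only [e2, e3, mul_assoc]
        rw [contourIntegral_const_mul]
        have := contourIntegral_circ_geometric hs (a := v (.inl (σ o))) (by rw [h1]; exact hsR)
          (x - y' o)
        simp only [mul_assoc] at this
        rw [this]
        have e4 : ∏ j ∈ L₂.toFinset, (v j)⁻¹ = ∏ k ∈ univ.erase o, (v (.inr k))⁻¹ := by
          have : L₂.toFinset = (univ.erase o).image Sum.inr := by ext j; simp [hL₂]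
          rw [this, prod_image fun _ _ _ _ h => Sum.inr_injective h]
        rw [e4, ← coreTerm_empty Δ y y' x ho σ h0 hp, neg_sub]
        simp only [hc]
        split_ifs <;> simp
      · have : j = .inr o := by
          by_contra hne
          exact hj (by
            rcases j with j | j
            · simp
            · have : j ≠ o := by simpa using hne
              simp [this])
        subst this
        simp
    rw [sum_congr rfl fun σ _ => key σ, ← mul_sum,
      ← iter_sum (T := fun _ => {z : ℂ | ‖z‖ = R}) (fun _ _ => isSmooth_circ R)
        (fun _ _ _ hz => norm_of_mem_circ h.pos.le hz) univ
        (fun σ _ => continuousOn_planeTerm h.lt_fst.le y y' σ)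
        (mem_offBox_of_forall_mem (List.mem_finRange) 0),
      iter_sum_planeTerm h.lt_fst.le hy hy' (List.nodup_finRange N) List.mem_finRange]
    simp only [hc, sub_nonpos]
    by_cases h1 : y = y' <;> by_cases h2 : x ≤ y' o <;> simp [h1, h2]
  · intro K hK hne
    refine h.sum_iter_innerTerm_eq_zero hs hsR hsR' hy' x ho (fun ho' => ?_)
      (nonempty_iff_ne_empty.2 hne)
    exact (mem_erase.1 (mem_powerset.1 hK ho')).1 rfl
  · exact fun h' => absurd (mem_powerset.2 (empty_subset _)) h'

end

/-! ### The evolution equation of the transition function -/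

lemma hasDerivAt_contourIntegral {Γ : Contour} (hΓ : IsSmooth Γ) {G G' : ℝ → ℂ → ℂ}
    (hG : ContinuousOn (uncurry G) (Set.univ ×ˢ trace Γ))
    (hG' : ContinuousOn (uncurry G') (Set.univ ×ˢ trace Γ))
    (h : ∀ z ∈ trace Γ, ∀ t, HasDerivAt (fun t => G t z) (G' t z) t) (t : ℝ) :
    HasDerivAt (fun t => contourIntegral Γ (G t)) (contourIntegral Γ (G' t)) t := by
  induction Γ with
  | nil => simpa [contourIntegral_nil] using hasDerivAt_const t (0 : ℂ)
  | cons γ Γ ih =>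
    rw [isSmooth_cons] at hΓ
    rw [trace_cons] at hG hG' h
    simp only [contourIntegral_cons]
    refine HasDerivAt.add (HasDerivAt.const_mul _ ?_) (ih hΓ.2
      (hG.mono (Set.prod_mono le_rfl Set.subset_union_right))
      (hG'.mono (Set.prod_mono le_rfl Set.subset_union_right)) fun z hz => h z (.inr hz))
    have hmem : ∀ s ∈ Set.Icc (0 : ℝ) 1, γ s ∈ γ '' Set.Icc (0 : ℝ) 1 ∪ trace Γ :=
      fun s hs => .inl ⟨s, hs, rfl⟩
    have cont : ∀ {H : ℝ → ℂ → ℂ}, ContinuousOn (uncurry H)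
        (Set.univ ×ˢ (γ '' Set.Icc (0 : ℝ) 1 ∪ trace Γ)) →
        ContinuousOn (fun q : ℝ × ℝ => H q.1 (γ q.2) * deriv γ q.2)
          (Set.univ ×ˢ Set.Icc (0 : ℝ) 1) := fun hH =>
      (hH.comp (f := fun q : ℝ × ℝ => (q.1, γ q.2)) (Continuous.continuousOn
        (continuous_fst.prodMk (hΓ.1.continuous.comp continuous_snd)))
        fun q hq => ⟨trivial, hmem _ hq.2⟩).mul
        ((hΓ.1.continuous_deriv le_rfl).comp continuous_snd).continuousOn
    have slice : ∀ {H : ℝ → ℂ → ℂ}, ContinuousOn (uncurry H)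
        (Set.univ ×ˢ (γ '' Set.Icc (0 : ℝ) 1 ∪ trace Γ)) → ∀ t,
        IntervalIntegrable (fun s => H t (γ s) * deriv γ s) MeasureTheory.volume 0 1 :=
      fun hH t => by
        refine ContinuousOn.intervalIntegrable ?_
        rw [Set.uIcc_of_le zero_le_one]
        exact (cont hH).comp (f := fun s => (t, s)) (by fun_prop) fun s hs => ⟨trivial, hs⟩
    obtain ⟨C, hC⟩ := (isCompact_Icc.prod isCompact_Icc).exists_bound_of_continuousOn
      (s := Set.Icc (t - 1) (t + 1) ×ˢ Set.Icc (0 : ℝ) 1)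
      ((cont hG').mono (Set.prod_mono (Set.subset_univ _) le_rfl))
    have hio : ∀ s ∈ Set.uIoc (0 : ℝ) 1, s ∈ Set.Icc (0 : ℝ) 1 := fun s hs => by
      rw [Set.uIoc_of_le zero_le_one] at hs
      exact Set.Ioc_subset_Icc_self hs
    refine (intervalIntegral.hasDerivAt_integral_of_dominated_loc_of_deriv_le
      (bound := fun _ => C) (Icc_mem_nhds (by linarith) (by linarith : t < t + 1))
      (.of_forall fun t => (intervalIntegrable_iff.1 (slice hG t)).aestronglyMeasurable) (slice hG t)
      (intervalIntegrable_iff.1 (slice hG' t)).aestronglyMeasurable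
      (.of_forall fun s hs u hu => hC (u, s) ⟨hu, hio s hs⟩) (by simp)
      (.of_forall fun s hs u _ => (h _ (hmem s (hio s hs)) u).mul_const _)).2

lemma hasDerivAt_iter {ι : Type} [DecidableEq ι] {Γ : ι → Contour} {T : ι → Set ℂ} {l : List ι}
    (hs : ∀ j ∈ l, IsSmooth (Γ j)) (hT : ∀ j ∈ l, trace (Γ j) ⊆ T j) {F F' : ℝ → (ι → ℂ) → ℂ}
    (hF : ContinuousOn (uncurry F) (Set.univ ×ˢ offBox [] T))
    (hF' : ContinuousOn (uncurry F') (Set.univ ×ˢ offBox [] T))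
    (h : ∀ v ∈ offBox [] T, ∀ t, HasDerivAt (fun t => F t v) (F' t v) t)
    {v : ι → ℂ} (hv : v ∈ offBox l T) (t : ℝ) :
    HasDerivAt (fun t => iter Γ l (F t) v) (iter Γ l (F' t) v) t := by
  induction l generalizing v t with
  | nil => exact h v hv t
  | cons j l ih =>
    have hs' : ∀ k ∈ l, IsSmooth (Γ k) := fun k hk => hs k (.tail _ hk)
    have hT' : ∀ k ∈ l, trace (Γ k) ⊆ T k := fun k hk => hT k (.tail _ hk)
    have hj := hT j (.head _)
    have cont : ∀ {H : ℝ → (ι → ℂ) → ℂ},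
        ContinuousOn (uncurry H) (Set.univ ×ˢ offBox [] T) →
        ContinuousOn (uncurry fun t z => iter Γ l (H t) (update v j z))
          (Set.univ ×ˢ trace (Γ j)) := fun hH =>
      (continuousOn_iter_param hs' hT' hH).comp
        (f := fun q : ℝ × ℂ => (q.1, update v j q.2))
        (continuous_fst.prodMk ((continuous_const (y := v)).update j continuous_snd)).continuousOn
        fun q hq => ⟨trivial, update_mem_offBox hv (hj hq.2)⟩
    exact hasDerivAt_contourIntegral (hs j (.head _)) (cont hF) (cont hF')
      (fun z hz t => ih hs' hT' (update_mem_offBox hv (hj hz)) t) t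

/-- The generator of free particles on `ℤ`. -/
def discreteLaplacian (Δ : ℝ) (g : (Fin N → ℤ) → ℂ) (y : Fin N → ℤ) : ℂ :=
  ∑ j, (g (update y j (y j + 1)) + g (update y j (y j - 1)) - 2 * Δ * g y)

lemma prod_update_shift (a : Fin N → ℂ) (ha : ∀ j, a j ≠ 0) (b : Fin N → ℂ) (c : ℤ)
    (y : Fin N → ℤ) (k : Fin N) (d : ℤ) :
    ∏ j, a j ^ (c - update y k (y k + d) j) * b j =
      a k ^ (-d) * ∏ j, a j ^ (c - y j) * b j := by
  rw [← mul_prod_erase univ _ (mem_univ k), ← mul_prod_erase univ (fun j => _ * b j) (mem_univ k),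
    update_self, ← mul_assoc, ← mul_assoc, ← zpow_add₀ (ha k)]
  congr 1
  · ring_nf
  · exact prod_congr rfl fun j hj => by rw [update_of_ne (mem_erase.1 hj).1]

lemma theta_update_left (Δ : ℝ) (y y' : Fin N → ℤ) (x : ℤ) (t : ℝ) (σ : Perm (Fin N))
    (K : Finset (Fin N)) {v : Point N} (h0 : ∀ j, v (.inl j) ≠ 0) (k : Fin N) (d : ℤ) :
    theta Δ (update y k (y k + d)) y' x t σ K v =
      v (.inl k) ^ (-d) * theta Δ y y' x t σ K v := by
  have := prod_update_shift (fun j => v (.inl j)) h0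
    (fun j => exp (-(I * t * energy Δ (v (.inl j))))) (x - 1) y k d
  simp only [sub_right_comm x 1] at this
  rw [theta, this, theta]
  ring

lemma theta_update_right (Δ : ℝ) (y y' : Fin N → ℤ) (x : ℤ) (t : ℝ) (σ : Perm (Fin N))
    (K : Finset (Fin N)) {v : Point N} (h0 : ∀ k, eta σ K v k ≠ 0) (k : Fin N) (d : ℤ) :
    theta Δ y (update y' k (y' k + d)) x t σ K v =
      eta σ K v k ^ (-d) * theta Δ y y' x t σ K v := by
  have := prod_update_shift (fun k => eta σ K v k) h0
    (fun k => exp (I * t * energy Δ (eta σ K v k)) * (v (.inr k))⁻¹) x y' k d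
  simp only [← mul_assoc] at this
  rw [theta, this, theta]
  ring

lemma discreteLaplacian_of_shift {Δ : ℝ} {g : (Fin N → ℤ) → ℂ} {y : Fin N → ℤ} {a : Fin N → ℂ}
    (hg : ∀ k (d : ℤ), g (update y k (y k + d)) = a k ^ (-d) * g y) :
    discreteLaplacian Δ g y = (∑ k, energy Δ (a k)) * g y := by
  rw [discreteLaplacian, sum_mul]
  refine sum_congr rfl fun k _ => ?_
  have := hg k (-1)
  rw [← sub_eq_add_neg] at this
  rw [hg, this, energy]
  simp
  ring

lemma hasDerivAt_theta {Δ : ℝ} (y y' : Fin N → ℤ) (x : ℤ) (σ : Perm (Fin N))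
    (K : Finset (Fin N)) {v : Point N} (h0 : ∀ j, v (.inl j) ≠ 0)
    (h0' : ∀ k, eta σ K v k ≠ 0) (t : ℝ) :
    HasDerivAt (fun t : ℝ => theta Δ y y' x t σ K v)
      (-I * discreteLaplacian Δ (fun y => theta Δ y y' x t σ K v) y +
        I * discreteLaplacian Δ (fun y' => theta Δ y y' x t σ K v) y') t := by
  rw [discreteLaplacian_of_shift fun k d => theta_update_left Δ y y' x t σ K h0 k d,
    discreteLaplacian_of_shift fun k d => theta_update_right Δ y y' x t σ K h0' k d]
  set A := ∑ k, energy Δ (v (.inl k)) with hA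
  set B := ∑ k, energy Δ (eta σ K v k) with hB
  have key : ∀ t : ℝ, theta Δ y y' x t σ K v =
      theta Δ y y' x 0 σ K v * exp (t * (-I * A + I * B)) := fun t => by
    simp only [theta, prod_mul_distrib, ← Complex.exp_sum]
    simp only [Complex.ofReal_zero, mul_zero, zero_mul, neg_zero, sum_const_zero, Complex.exp_zero,
      mul_one, sum_neg_distrib, ← mul_sum, ← hA, ← hB]
    rw [show (t : ℂ) * (-I * A + I * B) =
      -(I * t * A) + I * t * B by ring, Complex.exp_add]
    ring
  have hd : HasDerivAt (fun t : ℝ => theta Δ y y' x 0 σ K v *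
      exp (t * (-I * A + I * B))) (theta Δ y y' x 0 σ K v *
      (exp (t * (-I * A + I * B)) *
        (1 * (-I * A + I * B)))) t :=
    (((Complex.ofRealCLM.hasDerivAt (x := t)).mul_const _).cexp).const_mul _
  rw [funext key, key t]
  convert hd using 1
  ring

section
variable {Δ R R' : ℝ} (h : Radii Δ R R')
include h

lemma Radii.iter_discreteLaplacian {g : (Fin N → ℤ) → Point N → ℂ}
    (hg : ∀ y, ContinuousOn (g y) (offBox [] (torusSet N R R'))) (y : Fin N → ℤ) :
    iter (torus N R R') (allVars N) (fun v => discreteLaplacian Δ (fun y => g y v) y) 0 =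
      discreteLaplacian Δ (fun y => iter (torus N R R') (allVars N) (g y) 0) y := by
  have h0 := mem_offBox_of_forall_mem mem_allVars (T := torusSet N R R') 0
  have hs : ∀ j ∈ allVars N, IsSmooth (torus N R R' j) := fun j _ => isSmooth_torus R R' j
  have htr : ∀ j ∈ allVars N, trace (torus N R R' j) ⊆ torusSet N R R' j :=
    fun j _ => trace_torus h.pos.le h.pos'.le j
  have h3 : ∀ _ : Fin N, ContinuousOn (fun v => (-2 * Δ : ℂ) * g y v) (offBox [] (torusSet N R R')) :=
    fun _ => continuousOn_const.mul (hg y)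
  simp only [discreteLaplacian, sub_eq_add_neg, ← neg_mul]
  have h2 : ∀ j, ContinuousOn (fun v => g (update y j (y j + 1)) v +
      g (update y j (y j + -1)) v) (offBox [] (torusSet N R R')) :=
    fun j => (hg _).add (hg _)
  refine (iter_sum hs htr univ (F := fun j v => g (update y j (y j + 1)) v +
    g (update y j (y j + -1)) v + (-2 * Δ : ℂ) * g y v)
    (fun j _ => (h2 j).add (h3 j)) h0).trans (sum_congr rfl fun j _ => ?_)
  rw [iter_add hs htr (h2 j) (h3 j) h0, iter_add hs htr (hg _) (hg _) h0, iter_const_mul]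

lemma Radii.hasDerivAt_iter_theta (y y' : Fin N → ℤ) (x : ℤ) (t : ℝ) (σ : Perm (Fin N))
    (K : Finset (Fin N)) :
    HasDerivAt (fun t => iter (torus N R R') (allVars N) (theta Δ y y' x t σ K) 0)
      (-I * discreteLaplacian Δ
          (fun y => iter (torus N R R') (allVars N) (theta Δ y y' x t σ K) 0) y +
        I * discreteLaplacian Δ
          (fun y' => iter (torus N R R') (allVars N) (theta Δ y y' x t σ K) 0) y') t := by
  have h0 := mem_offBox_of_forall_mem mem_allVars (T := torusSet N R R') 0
  have hs : ∀ j ∈ allVars N, IsSmooth (torus N R R' j) := fun j _ => isSmooth_torus R R' j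
  have htr : ∀ j ∈ allVars N, trace (torus N R R' j) ⊆ torusSet N R R' j :=
    fun j _ => trace_torus h.pos.le h.pos'.le j
  have hc := fun y y' => h.continuousOn_theta (N := N) y y' x σ K
  have cL : ContinuousOn (uncurry fun (t : ℝ) v => -I * discreteLaplacian Δ
      (fun y => theta Δ y y' x t σ K v) y + I * discreteLaplacian Δ
      (fun y' => theta Δ y y' x t σ K v) y') (Set.univ ×ˢ offBox [] (torusSet N R R')) :=
    (continuousOn_const.mul (continuousOn_finsetSum _ fun j _ =>
      ((hc _ _).add (hc _ _)).sub (continuousOn_const.mul (hc _ _)))).add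
    (continuousOn_const.mul (continuousOn_finsetSum _ fun j _ =>
      ((hc _ _).add (hc _ _)).sub (continuousOn_const.mul (hc _ _))))
  have hd := hasDerivAt_iter hs htr (hc y y') cL (fun v hv t => hasDerivAt_theta y y' x σ K
    (fun j => ?_) (fun k => h.eta_ne_zero hv k) t) h0 t
  · have ca := fun y y' => h.continuousOn_theta_apply (N := N) y y' x t σ K
    have cl : ∀ g : (Fin N → ℤ) → Point N → ℂ, (∀ y, ContinuousOn (g y)
        (offBox [] (torusSet N R R'))) → ∀ y, ContinuousOn (fun v =>
        discreteLaplacian Δ (fun y => g y v) y) (offBox [] (torusSet N R R')) := fun g hg y =>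
      continuousOn_finsetSum _ fun j _ =>
        ((hg _).add (hg _)).sub (continuousOn_const.mul (hg _))
    rw [iter_add (F := fun v => -I * discreteLaplacian Δ (fun y => theta Δ y y' x t σ K v) y)
      (G := fun v => I * discreteLaplacian Δ (fun y' => theta Δ y y' x t σ K v) y') hs htr
      (continuousOn_const.mul (cl _ (fun y => ca y y') y))
      (continuousOn_const.mul (cl _ (fun y' => ca y y') y')) h0, iter_const_mul, iter_const_mul,
      h.iter_discreteLaplacian (fun y => ca y y'), h.iter_discreteLaplacian (fun y' => ca y y')]
      at hd
    exact hd
  · obtain ⟨h1, -⟩ := mem_torusSet_nil.1 hv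
    rw [← norm_pos_iff, h1]; exact h.pos

omit h in
lemma discreteLaplacian_sum {α : Type*} (A : Finset α) (g : α → (Fin N → ℤ) → ℂ) (y : Fin N → ℤ) :
    discreteLaplacian Δ (fun y => ∑ a ∈ A, g a y) y = ∑ a ∈ A, discreteLaplacian Δ (g a) y := by
  simp only [discreteLaplacian, mul_sum, ← sum_add_distrib, ← sum_sub_distrib]
  exact sum_comm

/-- The evolution equation of the transition function. -/
theorem Radii.hasDerivAt_transition (y y' : Fin N → ℤ) (x : ℤ) (t : ℝ) :
    HasDerivAt (fun t => transition Δ R R' y y' x t)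
      (-I * discreteLaplacian Δ (fun y => transition Δ R R' y y' x t) y +
        I * discreteLaplacian Δ (fun y' => transition Δ R R' y y' x t) y') t := by
  have := HasDerivAt.fun_sum (u := (univ : Finset (Fin N)).powerset) (x := t) fun K _ =>
    HasDerivAt.fun_sum (u := univ) fun σ _ => h.hasDerivAt_iter_theta y y' x t σ K
  simp only [sum_add_distrib, ← mul_sum, ← discreteLaplacian_sum] at this
  exact this

end

/-! ### The boundary conditions of the transition function -/

lemma swap_lt_swap_iff {a b : Fin N} (hab : (b : ℕ) = a + 1) {j k : Fin N} (h1 : (j, k) ≠ (a, b))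
    (h2 : (j, k) ≠ (b, a)) : swap a b j < swap a b k ↔ j < k := by
  simp only [ne_eq, Prod.mk.injEq, not_and, Fin.ext_iff] at h1 h2
  simp only [Equiv.swap_apply_def, Fin.ext_iff, Fin.lt_def]
  split_ifs <;> omega

lemma pairProd_swap {M : Type*} [CommMonoid M] (f : Fin N → Fin N → M) {a b : Fin N}
    (hab : (b : ℕ) = a + 1) :
    pairProd univ (fun j k => f (swap a b j) (swap a b k)) * f a b =
      pairProd univ f * f b a := by
  set s := swap a b with hs
  have hlt : a < b := by rw [Fin.lt_def]; omega
  have hmem : (b, a) ∈ (univ : Finset (Fin N × Fin N)).erase (a, b) :=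
    mem_erase.2 ⟨fun e => hlt.ne' (Prod.mk.inj e).1, mem_univ _⟩
  have key : ∀ g : Fin N → Fin N → M, pairProd univ g = g a b *
      ∏ p ∈ (univ.erase (a, b)).erase (b, a), if p.1 < p.2 then g p.1 p.2 else 1 := by
    intro g
    have := mul_prod_erase univ (fun p : Fin N × Fin N => if p.1 < p.2 then g p.1 p.2 else 1)
      (mem_univ (a, b))
    rw [pairProd, ← Fintype.prod_prod_type' (f := fun j k => if j < k then g j k else 1), ← this,
      ← mul_prod_erase _ _ hmem, if_pos hlt, if_neg hlt.not_gt, one_mul]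
  have hS : ∀ p : Fin N × Fin N, p ∈ (univ.erase (a, b)).erase (b, a) ↔
      (s p.1, s p.2) ∈ ((univ : Finset (Fin N × Fin N)).erase (a, b)).erase (b, a) := by
    rintro ⟨j, k⟩
    have e1 : s j = a ↔ j = b := by rw [hs, swap_apply_eq_iff, swap_apply_left]
    have e2 : s j = b ↔ j = a := by rw [hs, swap_apply_eq_iff, swap_apply_right]
    have e3 : s k = a ↔ k = b := by rw [hs, swap_apply_eq_iff, swap_apply_left]
    have e4 : s k = b ↔ k = a := by rw [hs, swap_apply_eq_iff, swap_apply_right]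
    simp only [mem_erase, mem_univ, ne_eq, Prod.mk.injEq, e1, e2, e3, e4, and_true]
    tauto
  rw [key, key f, hs, swap_apply_left, swap_apply_right, ← hs]
  have : (∏ p ∈ ((univ : Finset (Fin N × Fin N)).erase (a, b)).erase (b, a),
      if p.1 < p.2 then f (s p.1) (s p.2) else 1) =
      ∏ p ∈ (univ.erase (a, b)).erase (b, a), if p.1 < p.2 then f p.1 p.2 else 1 := by
    refine prod_equiv (Equiv.prodCongr s s) hS fun p hp => ?_
    simp only [mem_erase] at hp
    simp only [Equiv.prodCongr_apply, Prod.map_fst, Prod.map_snd, hs,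
      swap_lt_swap_iff hab (j := p.1) (k := p.2) hp.2.1 hp.1]
  rw [this]
  ac_rfl

lemma prod_swap_shift (c : Fin N → ℂ) (hc : ∀ j, c j ≠ 0) {a b : Fin N} (hab : a ≠ b)
    {y : Fin N → ℤ} (hy : y b = y a + 1) (m : ℤ) :
    (∏ j, c (swap a b j) ^ (m - y j)) * c a = (∏ j, c j ^ (m - y j)) * c b := by
  rw [← Equiv.prod_comp (swap a b) fun j => c (swap a b j) ^ (m - y j)]
  simp only [Equiv.swap_apply_self]
  have hb : b ∈ univ.erase a := mem_erase.2 ⟨hab.symm, mem_univ _⟩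
  rw [← mul_prod_erase univ _ (mem_univ a), ← mul_prod_erase _ _ hb,
    ← mul_prod_erase univ (fun j => c j ^ (m - y j)) (mem_univ a), ← mul_prod_erase _ _ hb,
    swap_apply_left, swap_apply_right, hy]
  have e : ∏ j ∈ (univ.erase a).erase b, c j ^ (m - y (swap a b j)) =
      ∏ j ∈ (univ.erase a).erase b, c j ^ (m - y j) := prod_congr rfl fun j hj => by
    simp only [mem_erase] at hj
    rw [swap_apply_of_ne_of_ne hj.2.1 hj.1]
  rw [e, show m - y a = m - (y a + 1) + 1 by ring, zpow_add_one₀ (hc a), zpow_add_one₀ (hc b)]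
  ring

/-- The factors that come from the interaction at neighbouring sites. -/
lemma theta_boundary_left {Δ : ℝ} {y : Fin N → ℤ} (y' : Fin N → ℤ) (x : ℤ) (t : ℝ)
    (σ : Perm (Fin N)) (K : Finset (Fin N)) {v : Point N}
    (h0 : ∀ j, v (.inl j) ≠ 0) (a b : Fin N) :
    theta Δ (update y a (y a + 1)) y' x t σ K v +
        theta Δ (update y b (y b - 1)) y' x t σ K v - 2 * Δ * theta Δ y y' x t σ K v =
      pFac Δ (v (.inl a)) (v (.inl b)) / v (.inl a) * theta Δ y y' x t σ K v := by
  have := theta_update_left Δ y y' x t σ K h0 b (-1)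
  rw [← sub_eq_add_neg] at this
  rw [this, theta_update_left Δ y y' x t σ K h0, pFac, neg_neg, zpow_one, zpow_neg_one]
  field_simp [h0 a]

lemma theta_boundary_right {Δ : ℝ} (y : Fin N → ℤ) {y' : Fin N → ℤ} (x : ℤ) (t : ℝ)
    (σ : Perm (Fin N)) (K : Finset (Fin N)) {v : Point N}
    (h0 : ∀ k, eta σ K v k ≠ 0) (a b : Fin N) :
    theta Δ y (update y' a (y' a + 1)) x t σ K v +
        theta Δ y (update y' b (y' b - 1)) x t σ K v - 2 * Δ * theta Δ y y' x t σ K v =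
      pFac Δ (eta σ K v a) (eta σ K v b) / eta σ K v a * theta Δ y y' x t σ K v := by
  have := theta_update_right Δ y y' x t σ K h0 b (-1)
  rw [← sub_eq_add_neg] at this
  rw [this, theta_update_right Δ y y' x t σ K h0, pFac, neg_neg, zpow_one, zpow_neg_one]
  field_simp [h0 a]

lemma prod_prod_erase_perm {M : Type*} [CommMonoid M] (s : Perm (Fin N)) (c : Fin N)
    (g : Fin N → M) : ∏ j ∈ univ.erase (s c), g (s j) = ∏ j ∈ univ.erase (s (s c)), g j :=
  prod_equiv s (by simp) fun _ _ => rfl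

lemma theta_swap_left {Δ : ℝ} {y : Fin N → ℤ} (y' : Fin N → ℤ) (x : ℤ) (t : ℝ)
    (σ : Perm (Fin N)) (K : Finset (Fin N)) {v : Point N}
    (h0 : ∀ j, v (.inl j) ≠ 0) {a b : Fin N} (hab : (b : ℕ) = a + 1) (hy : y b = y a + 1)
    (hp : ∀ j k, pFac Δ (v (.inl j)) (v (.inl k)) ≠ 0) :
    pFac Δ (v (.inl b)) (v (.inl a)) / v (.inl b) *
        theta Δ y y' x t (swap a b * σ) K (v ∘ Sum.map (swap a b) id) =
      -(pFac Δ (v (.inl a)) (v (.inl b)) / v (.inl a) * theta Δ y y' x t σ K v) := by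
  have hne : a ≠ b := fun e => by rw [e] at hab; omega
  set s := swap a b with hs
  have hss : ∀ j, s (s j) = j := Equiv.swap_apply_self a b
  have he : ∀ k, eta (s * σ) K (v ∘ Sum.map s id) k = eta σ K v k := fun k => by
    simp [eta, Equiv.Perm.mul_apply, hss]
  have e1 : ∀ k, ∏ j ∈ univ.erase ((s * σ) k), rFac Δ ((v ∘ Sum.map s id) (.inl j)) (eta σ K v k) =
      ∏ j ∈ univ.erase (σ k), rFac Δ (v (.inl j)) (eta σ K v k) := fun k => by
    have := prod_prod_erase_perm s (σ k) fun j => rFac Δ (v (.inl j)) (eta σ K v k)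
    rw [hss] at this
    exact this
  have e2 := pairProd_swap (fun j k => pFac Δ (v (.inl j)) (v (.inl k))) hab
  have e3 := prod_swap_shift (fun j => v (.inl j)) h0 hne hy (x - 1)
  simp only [sub_right_comm x 1] at e3
  have e4 : ∏ j, exp (-(I * t * energy Δ (v (.inl (s j))))) =
      ∏ j, exp (-(I * t * energy Δ (v (.inl j)))) :=
    Equiv.prod_comp s fun j => exp (-(I * t * energy Δ (v (.inl j))))
  have n2 : pairProd univ (fun j k => pFac Δ (v (.inl j)) (v (.inl k))) ≠ 0 :=
    pairProd_ne_zero fun j _ k _ _ => hp j k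
  have n2' : pairProd univ (fun j k => pFac Δ (v (.inl (s j))) (v (.inl (s k)))) ≠ 0 :=
    pairProd_ne_zero fun j _ k _ _ => hp _ _
  simp only [theta, amplitude, he, e1]
  simp only [comp_apply, Sum.map_inl, Sum.map_inr, id, Equiv.Perm.mul_apply, hss,
    prod_mul_distrib, e4, Equiv.Perm.sign_mul]
  rw [show sign s = -1 from sign_swap hne]
  set P := pairProd univ (fun j k => pFac Δ (v (.inl j)) (v (.inl k)))
  set P' := pairProd univ (fun j k => pFac Δ (v (.inl (s j))) (v (.inl (s k))))
  set Z := ∏ j, v (.inl j) ^ (x - y j - 1)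
  set Z' := ∏ j, v (.inl (s j)) ^ (x - y j - 1)
  have f1 : P' = P * pFac Δ (v (.inl b)) (v (.inl a)) / pFac Δ (v (.inl a)) (v (.inl b)) := by
    rw [eq_div_iff (hp a b)]; exact e2
  have f2 : Z' = Z * v (.inl b) / v (.inl a) := by
    rw [eq_div_iff (h0 a)]; exact e3
  have na := h0 a
  have nb := h0 b
  have nab := hp a b
  have nba := hp b a
  rw [f1, f2]
  push_cast
  by_cases hQ : pairProd univ (fun k k' => pFac Δ (eta σ K v k) (eta σ K v k')) = 0
  · simp [hQ]
  · field_simp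

lemma theta_swap_right {Δ : ℝ} (y : Fin N → ℤ) {y' : Fin N → ℤ} (x : ℤ) (t : ℝ)
    (σ : Perm (Fin N)) (K : Finset (Fin N)) {v : Point N}
    (h0 : ∀ k, eta σ K v k ≠ 0) {a b : Fin N} (hab : (b : ℕ) = a + 1) (hy : y' b = y' a + 1)
    (hp : ∀ j k, j ≠ k → pFac Δ (eta σ K v j) (eta σ K v k) ≠ 0) :
    pFac Δ (eta σ K v b) (eta σ K v a) / eta σ K v b *
        theta Δ y y' x t (σ * swap a b) (K.map (swap a b).toEmbedding)
          (v ∘ Sum.map id (swap a b)) =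
      -(pFac Δ (eta σ K v a) (eta σ K v b) / eta σ K v a * theta Δ y y' x t σ K v) := by
  have hne : a ≠ b := fun e => by rw [e] at hab; omega
  set s := swap a b with hs
  have hss : ∀ j, s (s j) = j := Equiv.swap_apply_self a b
  have hsy : s.symm = s := Equiv.symm_swap a b
  have he : ∀ k, eta (σ * s) (K.map s.toEmbedding) (v ∘ Sum.map id s) k = eta σ K v (s k) := by
    intro k
    simp [eta, Equiv.Perm.mul_apply, mem_map_equiv, hsy]
  have e1 : ∏ k, ∏ j ∈ univ.erase ((σ * s) k), rFac Δ (v (.inl j)) (eta σ K v (s k)) =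
      ∏ k, ∏ j ∈ univ.erase (σ k), rFac Δ (v (.inl j)) (eta σ K v k) :=
    Equiv.prod_comp s fun k => ∏ j ∈ univ.erase (σ k), rFac Δ (v (.inl j)) (eta σ K v k)
  have e1' : ∏ k ∈ K.map s.toEmbedding, (1 - v (.inl ((σ * s) k)) * v (.inr (s k)))⁻¹ =
      ∏ k ∈ K, (1 - v (.inl (σ k)) * v (.inr k))⁻¹ := by
    rw [prod_map]
    exact prod_congr rfl fun k _ => by simp [Equiv.Perm.mul_apply, hss]
  have e2 := pairProd_swap (fun j k => pFac Δ (eta σ K v j) (eta σ K v k)) hab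
  have e3 := prod_swap_shift (fun j => eta σ K v j) h0 hne hy x
  have e4 : ∏ k, exp (I * t * energy Δ (eta σ K v (s k))) =
      ∏ k, exp (I * t * energy Δ (eta σ K v k)) :=
    Equiv.prod_comp s fun k => exp (I * t * energy Δ (eta σ K v k))
  have e5 : ∏ k, (v (.inr (s k)))⁻¹ = ∏ k, (v (.inr k))⁻¹ :=
    Equiv.prod_comp s fun k => (v (.inr k))⁻¹
  simp only [theta, amplitude, he, prod_mul_distrib]
  simp only [comp_apply, Sum.map_inl, Sum.map_inr, id, e1, e1', e4, e5,
    Equiv.Perm.sign_mul]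
  rw [hs, sign_swap hne, ← hs]
  have n2 : pairProd univ (fun j k => pFac Δ (eta σ K v j) (eta σ K v k)) ≠ 0 :=
    pairProd_ne_zero fun j _ k _ h => hp j k h.ne
  set P := pairProd univ (fun j k => pFac Δ (eta σ K v j) (eta σ K v k))
  set P' := pairProd univ (fun j k => pFac Δ (eta σ K v (s j)) (eta σ K v (s k)))
  set Z := ∏ j, eta σ K v j ^ (x - y' j)
  set Z' := ∏ j, eta σ K v (s j) ^ (x - y' j)
  have f1 : P' = P * pFac Δ (eta σ K v b) (eta σ K v a) / pFac Δ (eta σ K v a) (eta σ K v b) := by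
    rw [eq_div_iff (hp a b hne)]; exact e2
  have f2 : Z' = Z * eta σ K v b / eta σ K v a := by
    rw [eq_div_iff (h0 a)]; exact e3
  have na := h0 a
  have nb := h0 b
  have nab := hp a b hne
  have nba := hp b a hne.symm
  rw [f1, f2]
  push_cast
  by_cases hQ : pairProd univ (fun j j' => pFac Δ (v (.inl j)) (v (.inl j'))) = 0
  · simp [hQ]
  · field_simp

lemma iter_add_sub {ι : Type} [DecidableEq ι] {Γ : ι → Contour} {T : ι → Set ℂ} {l : List ι}
    (hs : ∀ j ∈ l, IsSmooth (Γ j)) (hT : ∀ j ∈ l, trace (Γ j) ⊆ T j) {F G H : (ι → ℂ) → ℂ}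
    (hF : ContinuousOn F (offBox [] T)) (hG : ContinuousOn G (offBox [] T))
    (hH : ContinuousOn H (offBox [] T)) (c : ℂ) {v : ι → ℂ} (hv : v ∈ offBox l T) :
    iter Γ l (fun v => F v + G v - c * H v) v = iter Γ l F v + iter Γ l G v - c * iter Γ l H v := by
  have h1 : ContinuousOn (fun v => F v + G v) (offBox [] T) := hF.add hG
  have h2 : ContinuousOn (fun v => -c * H v) (offBox [] T) := continuousOn_const.mul hH
  simp only [sub_eq_add_neg, ← neg_mul]
  rw [iter_add hs hT h1 h2 hv, iter_add hs hT hF hG hv, iter_const_mul]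

section
variable {Δ R R' : ℝ} (h : Radii Δ R R')
include h

omit h in
lemma iter_torus_comp {F : Point N → ℂ} (s s' : Perm (Fin N)) (hR : 0 ≤ R)
    (hR' : 0 ≤ R') (hF : ContinuousOn F (offBox [] (torusSet N R R'))) :
    iter (torus N R R') (allVars N) (fun v => F (v ∘ Sum.map s s')) 0 =
      iter (torus N R R') (allVars N) F 0 := by
  have h1 := iter_map (Equiv.sumCongr s s').symm (torus N R R') (allVars N) F 0
  have h2 : torus N R R' ∘ (Equiv.sumCongr s s').symm = torus N R R' := by
    funext i; rcases i with i | i <;> rfl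
  rw [h2] at h1
  refine h1.symm.trans (iter_perm (T := torusSet N R R') ?_ (fun j _ => isSmooth_torus R R' j)
    (fun j _ => trace_torus hR hR' j) hF (mem_offBox_of_forall_mem (fun j => ?_) 0)).symm.symm
  · refine (List.perm_ext_iff_of_nodup (nodup_allVars.map (Equiv.injective _)) nodup_allVars).2
      fun i => ?_
    simp only [mem_allVars, iff_true, List.mem_map, true_and]
    exact ⟨_, Equiv.symm_apply_apply _ i⟩
  · exact List.mem_map.2 ⟨_, mem_allVars _, Equiv.symm_apply_apply _ j⟩

lemma Radii.boundary_left {y : Fin N → ℤ} (y' : Fin N → ℤ) (x : ℤ) (t : ℝ) {a b : Fin N}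
    (hab : (b : ℕ) = a + 1) (hy : y b = y a + 1) :
    transition Δ R R' (update y a (y a + 1)) y' x t +
      transition Δ R R' (update y b (y b - 1)) y' x t -
        2 * Δ * transition Δ R R' y y' x t = 0 := by
  have hs : ∀ j ∈ allVars N, IsSmooth (torus N R R' j) := fun j _ => isSmooth_torus R R' j
  have htr : ∀ j ∈ allVars N, trace (torus N R R' j) ⊆ torusSet N R R' j :=
    fun j _ => trace_torus h.pos.le h.pos'.le j
  have h0 := mem_offBox_of_forall_mem mem_allVars (T := torusSet N R R') 0
  have nz : ∀ v ∈ offBox [] (torusSet N R R'), (∀ j, v (.inl j) ≠ 0) ∧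
      ∀ j k, pFac Δ (v (.inl j)) (v (.inl k)) ≠ 0 := fun v hv => by
    obtain ⟨h1, -⟩ := mem_torusSet_nil.1 hv
    exact ⟨fun j => by rw [← norm_pos_iff, h1]; exact h.pos,
      fun j k => pFac_ne_zero h.lt_fst.le (h.one_lt.le.trans (h1 j).ge) (h1 k).ge⟩
  set G : Perm (Fin N) → Finset (Fin N) → Point N → ℂ := fun σ K v =>
    theta Δ (update y a (y a + 1)) y' x t σ K v +
      theta Δ (update y b (y b - 1)) y' x t σ K v - 2 * Δ * theta Δ y y' x t σ K v with hG
  have hc := fun y σ K => h.continuousOn_theta_apply (N := N) y y' x t σ K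
  have hGc : ∀ σ K, ContinuousOn (G σ K) (offBox [] (torusSet N R R')) := fun σ K =>
    ((hc _ σ K).add (hc _ σ K)).sub (continuousOn_const.mul (hc _ σ K))
  have hsum : ∀ σ K, iter (torus N R R') (allVars N) (G σ K) 0 =
      iter (torus N R R') (allVars N) (theta Δ (update y a (y a + 1)) y' x t σ K) 0 +
      iter (torus N R R') (allVars N) (theta Δ (update y b (y b - 1)) y' x t σ K) 0 -
      2 * Δ * iter (torus N R R') (allVars N) (theta Δ y y' x t σ K) 0 := fun σ K => by
    exact iter_add_sub hs htr (hc _ σ K) (hc _ σ K) (hc _ σ K) (2 * Δ) h0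
  have anti : ∀ σ K, iter (torus N R R') (allVars N) (G (swap a b * σ) K) 0 =
      -iter (torus N R R') (allVars N) (G σ K) 0 := fun σ K => by
    rw [← iter_torus_comp (swap a b) 1 h.pos.le h.pos'.le (hGc _ K), neg_eq_neg_one_mul,
      ← iter_const_mul]
    refine iter_congr htr (fun v hv => ?_) h0
    have hv' : v ∘ Sum.map (swap a b) (1 : Perm (Fin N)) ∈ offBox [] (torusSet N R R') :=
      mem_torusSet_nil.2 ⟨fun j => (mem_torusSet_nil.1 hv).1 _, fun j => (mem_torusSet_nil.1 hv).2 _⟩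
    simp only [hG]
    rw [theta_boundary_left y' x t _ K (nz _ hv').1, theta_boundary_left y' x t σ K (nz v hv).1,
      neg_one_mul, ← theta_swap_left y' x t σ K (nz v hv).1 hab hy (nz v hv).2]
    simp only [comp_apply, Sum.map_inl, swap_apply_left, swap_apply_right]
    rfl
  have key : ∀ K, ∑ σ, iter (torus N R R') (allVars N) (G σ K) 0 = 0 := fun K => by
    have := Equiv.sum_comp (Equiv.mulLeft (swap a b))
      fun σ => iter (torus N R R') (allVars N) (G σ K) 0
    simp only [Equiv.coe_mulLeft, anti, sum_neg_distrib] at this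
    exact self_eq_neg.1 this.symm
  have := sum_eq_zero fun K (_ : K ∈ (univ : Finset (Fin N)).powerset) => key K
  simpa only [hsum, sum_sub_distrib, sum_add_distrib, ← mul_sum, transition] using this

lemma Radii.boundary_right (y : Fin N → ℤ) {y' : Fin N → ℤ} (x : ℤ) (t : ℝ) {a b : Fin N}
    (hab : (b : ℕ) = a + 1) (hy : y' b = y' a + 1) :
    transition Δ R R' y (update y' a (y' a + 1)) x t +
      transition Δ R R' y (update y' b (y' b - 1)) x t -
        2 * Δ * transition Δ R R' y y' x t = 0 := by
  have hs : ∀ j ∈ allVars N, IsSmooth (torus N R R' j) := fun j _ => isSmooth_torus R R' j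
  have htr : ∀ j ∈ allVars N, trace (torus N R R' j) ⊆ torusSet N R R' j :=
    fun j _ => trace_torus h.pos.le h.pos'.le j
  have h0 := mem_offBox_of_forall_mem mem_allVars (T := torusSet N R R') 0
  set s := swap a b with hs'
  set G : Finset (Fin N) × Perm (Fin N) → Point N → ℂ := fun q v =>
    theta Δ y (update y' a (y' a + 1)) x t q.2 q.1 v +
      theta Δ y (update y' b (y' b - 1)) x t q.2 q.1 v - 2 * Δ * theta Δ y y' x t q.2 q.1 v
    with hG
  have hc := fun y' σ K => h.continuousOn_theta_apply (N := N) y y' x t σ K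
  have hGc : ∀ q, ContinuousOn (G q) (offBox [] (torusSet N R R')) := fun q =>
    ((hc _ q.2 q.1).add (hc _ q.2 q.1)).sub (continuousOn_const.mul (hc _ q.2 q.1))
  have hsum : ∀ σ K, iter (torus N R R') (allVars N) (G (K, σ)) 0 =
      iter (torus N R R') (allVars N) (theta Δ y (update y' a (y' a + 1)) x t σ K) 0 +
      iter (torus N R R') (allVars N) (theta Δ y (update y' b (y' b - 1)) x t σ K) 0 -
      2 * Δ * iter (torus N R R') (allVars N) (theta Δ y y' x t σ K) 0 := fun σ K => by
    exact iter_add_sub hs htr (hc _ σ K) (hc _ σ K) (hc _ σ K) (2 * Δ) h0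
  have anti : ∀ q, iter (torus N R R') (allVars N) (G (q.1.map s.toEmbedding, q.2 * s)) 0 =
      -iter (torus N R R') (allVars N) (G q) 0 := by
    rintro ⟨K, σ⟩
    rw [← iter_torus_comp 1 s h.pos.le h.pos'.le (hGc _), neg_eq_neg_one_mul, ← iter_const_mul]
    refine iter_congr htr (fun v hv => ?_) h0
    have hv' : v ∘ Sum.map (1 : Perm (Fin N)) s ∈ offBox [] (torusSet N R R') :=
      mem_torusSet_nil.2 ⟨fun j => (mem_torusSet_nil.1 hv).1 _, fun j => (mem_torusSet_nil.1 hv).2 _⟩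
    have em : ∀ k, eta σ K v k ∈ etaSet R R' := fun k =>
      eta_mem_etaSet (mem_torusSet_nil.1 hv).1 fun _ => ((mem_torusSet_nil.1 hv).2 k).ge
    have he : ∀ k, eta (σ * s) (K.map s.toEmbedding) (v ∘ Sum.map (1 : Perm (Fin N)) s) k =
        eta σ K v (s k) := fun k => by
      simp [eta, Equiv.Perm.mul_apply, mem_map_equiv, hs']
    simp only [hG]
    rw [theta_boundary_right y x t _ _ fun k => h.eta_ne_zero hv' k,
      theta_boundary_right y x t σ K fun k => h.eta_ne_zero hv k, neg_one_mul,
      ← theta_swap_right y x t σ K (fun k => h.eta_ne_zero hv k) hab hy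
        fun j k _ => h.pFac_eta_ne_zero (em j) (em k)]
    simp only [he, show s a = b from swap_apply_left a b,
      show s b = a from swap_apply_right a b]
    rfl
  set e : Finset (Fin N) × Perm (Fin N) ≃ Finset (Fin N) × Perm (Fin N) :=
    Equiv.prodCongr s.finsetCongr (Equiv.mulRight s) with he
  have key : ∑ q, iter (torus N R R') (allVars N) (G q) 0 = 0 := by
    have := Equiv.sum_comp e fun q => iter (torus N R R') (allVars N) (G q) 0
    have h2 : ∀ q, iter (torus N R R') (allVars N) (G (e q)) 0 =
      -iter (torus N R R') (allVars N) (G q) 0 := anti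
    simp only [h2, sum_neg_distrib] at this
    exact self_eq_neg.1 this.symm
  rw [Fintype.sum_prod_type] at key
  simpa only [hsum, sum_sub_distrib, sum_add_distrib, ← mul_sum, transition, powerset_univ] using key

end

/-! ### Configurations in coordinates -/

/-- The sites of the up spins in increasing order. -/
def sites (X : Config N) : Fin N → ℤ := X.1.orderEmbOfFin X.2

lemma strictMono_sites (X : Config N) : StrictMono (sites X) := (X.1.orderEmbOfFin X.2).strictMono

lemma sites_mem (X : Config N) (i : Fin N) : sites X i ∈ X.1 := orderEmbOfFin_mem _ _ _

lemma exists_sites {X : Config N} {k : ℤ} (hk : k ∈ X.1) : ∃ i, sites X i = k := by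
  have := range_orderEmbOfFin X.1 X.2
  rw [← mem_coe, ← this] at hk
  exact hk

lemma sites_eq_of_strictMono {X : Config N} {f : Fin N → ℤ} (hf : StrictMono f)
    (h : ∀ i, f i ∈ X.1) : sites X = f :=
  (orderEmbOfFin_unique X.2 h hf).symm

lemma sites_injective : Function.Injective (sites (N := N)) := by
  intro X X' e
  refine Subtype.ext (Finset.ext fun k => ?_)
  constructor <;> intro hk <;> obtain ⟨i, rfl⟩ := exists_sites hk
  · rw [e]; exact sites_mem _ _
  · rw [← e]; exact sites_mem _ _

lemma sites_initialConfig {y : Fin N → ℤ} (hy : StrictMono y) : sites (initialConfig y hy) = y :=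
  sites_eq_of_strictMono hy fun i => by simp [initialConfig]

/-- Exchange of neighbouring spins, for configurations of `N` up spins. -/
def exchangeConfig (j : ℤ) (X : Config N) : Config N := ⟨exchange j X.1, by rw [card_exchange, X.2]⟩

lemma sites_exchange_right {X : Config N} {i : Fin N} (h : sites X i + 1 ∉ X.1) :
    sites (exchangeConfig (sites X i) X) = update (sites X) i (sites X i + 1) := by
  have hne : ∀ k, sites X k ≠ sites X i + 1 := fun k e => h (e ▸ sites_mem X k)
  have hs := strictMono_sites X
  refine sites_eq_of_strictMono (fun j k hjk => ?_) fun k => ?_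
  · have := hs hjk
    simp only [update_apply]
    have h1 := hne k
    split_ifs with e1 e2 e2
    · exact absurd (e1.trans e2.symm) hjk.ne
    · subst e1; omega
    · subst e2; omega
    · exact this
  · rw [exchangeConfig, mem_exchange, update_apply]
    split_ifs with e
    · rw [swap_apply_right]; exact sites_mem X i
    · rw [swap_apply_of_ne_of_ne (fun e' => e (hs.injective e')) (hne k)]
      exact sites_mem X k

lemma sites_exchange_left {X : Config N} {i : Fin N} (h : sites X i - 1 ∉ X.1) :
    sites (exchangeConfig (sites X i - 1) X) = update (sites X) i (sites X i - 1) := by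
  have hne : ∀ k, sites X k ≠ sites X i - 1 := fun k e => h (e ▸ sites_mem X k)
  have hs := strictMono_sites X
  refine sites_eq_of_strictMono (fun j k hjk => ?_) fun k => ?_
  · have := hs hjk
    simp only [update_apply]
    have h1 := hne j
    split_ifs with e1 e2 e2
    · exact absurd (e1.trans e2.symm) hjk.ne
    · subst e1; omega
    · subst e2; omega
    · exact this
  · rw [exchangeConfig, mem_exchange, update_apply, sub_add_cancel]
    split_ifs with e
    · rw [swap_apply_left]; exact sites_mem X i
    · rw [swap_apply_of_ne_of_ne (hne k) (fun e' => e (hs.injective e'))]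
      exact sites_mem X k

lemma activeBonds_eq (X : Config N) : activeBonds X.1 =
    (univ.filter fun i => sites X i + 1 ∉ X.1).image (sites X) ∪
      (univ.filter fun i => sites X i - 1 ∉ X.1).image fun i => sites X i - 1 := by
  ext j
  simp only [mem_activeBonds, mem_union, mem_image, mem_filter, mem_univ, true_and]
  constructor
  · intro h
    by_cases hj : j ∈ X.1
    · obtain ⟨i, rfl⟩ := exists_sites hj
      exact .inl ⟨i, fun h' => h ⟨fun _ => h', fun _ => hj⟩, rfl⟩
    · have hj' : j + 1 ∈ X.1 := by
        by_contra h'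
        exact h ⟨fun a => absurd a hj, fun a => absurd a h'⟩
      obtain ⟨i, hi⟩ := exists_sites hj'
      have e : sites X i - 1 = j := by omega
      exact .inr ⟨i, e ▸ hj, e⟩
  · rintro (⟨i, hi, rfl⟩ | ⟨i, hi, rfl⟩)
    · exact fun h => hi (h.1 (sites_mem X i))
    · rw [sub_add_cancel]
      exact fun h => hi (h.2 (sites_mem X i))

lemma succ_of_sites {X : Config N} {a b : Fin N} (h : sites X b = sites X a + 1) :
    (b : ℕ) = a + 1 := by
  have hs := strictMono_sites X
  have h1 : a < b := hs.lt_iff_lt.1 (by omega)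
  by_contra hne
  rw [Fin.lt_def] at h1
  have hb := b.2
  have h2 := hs (show a < ⟨a + 1, by omega⟩ by rw [Fin.lt_def]; simp)
  have h3 := hs (show (⟨a + 1, by omega⟩ : Fin N) < b by rw [Fin.lt_def]; simp only; omega)
  omega

/-- With the boundary conditions, the free generator acts as the Hamiltonian. -/
lemma sum_activeBonds_eq {Δ : ℝ} {g : (Fin N → ℤ) → ℂ} (X : Config N)
    (hg : ∀ a b : Fin N, (b : ℕ) = a + 1 → sites X b = sites X a + 1 →
      g (update (sites X) a (sites X a + 1)) +
        g (update (sites X) b (sites X b - 1)) - 2 * Δ * g (sites X) = 0) :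
    ∑ j ∈ activeBonds X.1, (g (sites (exchangeConfig j X)) - Δ * g (sites X)) =
      discreteLaplacian Δ g (sites X) := by
  set y := sites X with hy
  have hinj := (strictMono_sites X).injective
  set p : Fin N → ℂ := fun i => g (update y i (y i + 1)) - Δ * g y with hp
  set m : Fin N → ℂ := fun i => g (update y i (y i - 1)) - Δ * g y with hm
  have ep : ∀ i, p i = (if y i + 1 ∉ X.1 then p i else 0) +
      ∑ k, if y k = y i + 1 then p i else 0 := by
    intro i
    by_cases h : y i + 1 ∉ X.1
    · rw [if_pos h, sum_eq_zero fun k _ => if_neg fun e => h (by rw [← e]; exact sites_mem X k),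
        add_zero]
    · rw [if_neg h]
      obtain ⟨k, hk⟩ := exists_sites (not_not.1 h)
      rw [sum_eq_single k (fun k' _ hne => if_neg fun e => hne (hinj (e.trans hk.symm)))
        (fun h => absurd (mem_univ k) h), if_pos hk, zero_add]
  have em : ∀ k, m k = (if y k - 1 ∉ X.1 then m k else 0) +
      ∑ i, if y k = y i + 1 then m k else 0 := by
    intro k
    by_cases h : y k - 1 ∉ X.1
    · rw [if_pos h, sum_eq_zero fun i _ => if_neg fun e => h (by
        rw [e, add_sub_cancel_right]; exact sites_mem X i), add_zero]
    · rw [if_neg h]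
      obtain ⟨i, hi⟩ := exists_sites (not_not.1 h)
      rw [sum_eq_single i (fun i' _ hne => if_neg fun e => hne (hinj (by
        change y i = y k - 1 at hi
        change y i' = y i
        omega))) (fun h => absurd (mem_univ i) h), if_pos (by
        change y i = y k - 1 at hi
        omega), zero_add]
  have e0 : (∑ i, ∑ k, if y k = y i + 1 then p i else 0) +
      ∑ k, ∑ i, (if y k = y i + 1 then m k else 0) = 0 := by
    rw [sum_comm (f := fun k i => if y k = y i + 1 then m k else 0), ← sum_add_distrib]
    refine sum_eq_zero fun i _ => ?_
    rw [← sum_add_distrib]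
    refine sum_eq_zero fun k _ => ?_
    split_ifs with h
    · simp only [hp, hm]
      linear_combination hg i k (succ_of_sites h) h
    · exact add_zero _
  have e1 : discreteLaplacian Δ g y = ∑ i, p i + ∑ k, m k := by
    rw [discreteLaplacian, ← sum_add_distrib]
    exact sum_congr rfl fun i _ => by simp only [hp, hm]; ring
  rw [e1, sum_congr rfl fun i _ => ep i, sum_congr rfl fun i _ => em i, sum_add_distrib,
    sum_add_distrib, add_add_add_comm, e0, add_zero, activeBonds_eq, sum_union, sum_image, sum_image,
    sum_filter, sum_filter]
  · congr 1
    · refine sum_congr rfl fun i _ => ?_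
      by_cases h : y i + 1 ∉ X.1
      · rw [if_pos h, if_pos h, sites_exchange_right h]
      · rw [if_neg h, if_neg h]
    · refine sum_congr rfl fun i _ => ?_
      by_cases h : y i - 1 ∉ X.1
      · rw [if_pos h, if_pos h, sites_exchange_left h]
      · rw [if_neg h, if_neg h]
  · intro i _ k _ e
    exact hinj (by simpa using e)
  · exact hinj.injOn
  · rw [disjoint_left]
    intro j h1 h2
    obtain ⟨i, -, rfl⟩ := mem_image.1 h1
    obtain ⟨k, hk, e⟩ := mem_image.1 h2
    refine (mem_filter.1 hk).2 ?_
    have e' : sites X k - 1 = sites X i := e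
    rw [e']
    exact sites_mem X i

/-! ### Uniqueness of bounded solutions -/

lemma eq_zero_of_hasDerivAt {I : Type*} {D D' : I → ℝ → ℂ} {w : I → ℝ} {Λ C t₀ : ℝ} (hw : ∀ i, 0 ≤ w i)
    (hΛ : 0 ≤ Λ) (hd : ∀ i t, HasDerivAt (D i) (D' i t) t) (h0 : ∀ i, D i 0 = 0)
    (hC : ∀ i, ∀ t ∈ Set.Icc 0 t₀, ‖D i t‖ ≤ C * w i)
    (hD' : ∀ t b, 0 ≤ b → (∀ i, ‖D i t‖ ≤ b * w i) → ∀ i, ‖D' i t‖ ≤ Λ * (b * w i))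
    (i : I) (ht₀ : 0 ≤ t₀) : D i t₀ = 0 := by
  by_cases hwi : w i = 0
  · have := hC i t₀ ⟨ht₀, le_rfl⟩
    rw [hwi, mul_zero] at this
    exact norm_le_zero_iff.1 this
  have hC0 : 0 ≤ C := by
    have := (norm_nonneg _).trans (hC i t₀ ⟨ht₀, le_rfl⟩)
    exact nonneg_of_mul_nonneg_left this ((hw i).lt_of_ne (Ne.symm hwi))
  have key : ∀ n : ℕ, ∀ i, ∀ t ∈ Set.Icc 0 t₀,
      ‖D i t‖ ≤ C * ((Λ * t) ^ n / n.factorial) * w i := by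
    intro n
    induction n with
    | zero => intro i t ht; simpa using hC i t ht
    | succ n ih =>
      intro i t ht
      refine image_norm_le_of_norm_deriv_right_le_deriv_boundary (a := 0) (b := t₀)
        (B := fun t => C * ((Λ * t) ^ (n + 1) / (n + 1).factorial) * w i)
        (B' := fun t => Λ * (C * ((Λ * t) ^ n / n.factorial) * w i))
        (fun t _ => (hd i t).continuousAt.continuousWithinAt)
        (fun t _ => (hd i t).hasDerivWithinAt) (by simp [h0]) (fun t => ?_) (fun t ht => ?_) ht
      · have := (((((hasDerivAt_id t).const_mul Λ).pow (n + 1)).div_const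
          ((n + 1).factorial : ℝ)).const_mul C).mul_const (w i)
        refine this.congr_deriv ?_
        rw [Nat.factorial_succ]
        push_cast
        have : (n.factorial : ℝ) ≠ 0 := by positivity
        have : (n : ℝ) + 1 ≠ 0 := by positivity
        simp only [id]
        field_simp
      · have ht' : t ∈ Set.Icc 0 t₀ := Set.Ico_subset_Icc_self ht
        have := ht.1
        exact hD' t _ (by positivity) (fun i => ih i t ht') i
  have lim : Filter.Tendsto (fun n : ℕ => C * ((Λ * t₀) ^ n / n.factorial) * w i) Filter.atTop
      (nhds 0) := by
    have := ((FloorSemiring.tendsto_pow_div_factorial_atTop (Λ * t₀)).const_mul C).mul_const (w i)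
    simpa using this
  exact norm_le_zero_iff.1 (ge_of_tendsto' lim fun n => key n i t₀ ⟨ht₀, le_rfl⟩)

/-! ### The evolution of the correlations of the wave function -/

/-- The basis vector `e_X`. -/
def basisVec (X : Config N) : Sector N := lp.single 2 X 1

lemma basisVec_apply (X Z : Config N) : basisVec X Z = if Z = X then 1 else 0 := by
  simp [basisVec, Pi.single_apply]

lemma exchangeConfig_exchangeConfig (j : ℤ) (X : Config N) :
    exchangeConfig j (exchangeConfig j X) = X := Subtype.ext (exchange_exchange j X.1)

lemma hamiltonian_apply (Δ : ℝ) (ψ : Sector N) (Z : Config N) :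
    hamiltonian N Δ ψ Z = ∑ j ∈ activeBonds Z.1, (ψ (exchangeConfig j Z) - Δ * ψ Z) := by
  refine (formalHamiltonian_apply Δ _ Z.1).trans (sum_congr rfl fun j _ => ?_)
  simp only [extend, card_exchange, Z.2, dite_true]
  rfl

lemma hamiltonian_basisVec (Δ : ℝ) (X : Config N) : hamiltonian N Δ (basisVec X) =
    ∑ j ∈ activeBonds X.1, (basisVec (exchangeConfig j X) - (Δ : ℂ) • basisVec X) := by
  ext Z
  have e : (∑ j ∈ activeBonds X.1, (basisVec (exchangeConfig j X) - (Δ : ℂ) • basisVec X)) Z =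
      ∑ j ∈ activeBonds X.1, (basisVec (exchangeConfig j X) Z - Δ * basisVec X Z) := by
    rw [lp.coeFn_sum, Finset.sum_apply]
    rfl
  rw [hamiltonian_apply, e, sum_sub_distrib, sum_sub_distrib]
  simp only [basisVec_apply]
  congr 1
  · rw [sum_boole, sum_boole]
    congr 2
    ext j
    simp only [mem_filter]
    constructor
    · rintro ⟨h1, rfl⟩
      exact ⟨mem_activeBonds_exchange.2 h1, (exchangeConfig_exchangeConfig j Z).symm⟩
    · rintro ⟨h1, rfl⟩
      exact ⟨mem_activeBonds_exchange.2 h1, exchangeConfig_exchangeConfig j X⟩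
  · by_cases h : Z = X
    · rw [h]
    · simp [h]

/-- The projection onto the configurations with the property `p`. -/
def restrict (p : Config N → Prop) [DecidablePred p] : Sector N →L[ℂ] Sector N :=
  LinearMap.mkContinuous
    { toFun := fun ψ => ⟨fun X => if p X then ψ X else 0, (lp.memℓp ψ).mono' fun X => by
        split_ifs <;> simp⟩
      map_add' := fun ψ χ => by
        ext X
        change (if p X then ψ X + χ X else 0) = (if p X then ψ X else 0) + if p X then χ X else 0
        split_ifs <;> simp
      map_smul' := fun c ψ => by
        ext X
        change (if p X then c * ψ X else 0) = c * if p X then ψ X else 0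
        split_ifs <;> simp }
    1 fun ψ => by
      rw [one_mul]
      exact lp.norm_mono two_ne_zero fun X => by
        change ‖if p X then ψ X else 0‖ ≤ ‖ψ X‖
        split_ifs <;> simp

lemma restrict_apply (p : Config N → Prop) [DecidablePred p] (ψ : Sector N) (X : Config N) :
    restrict p ψ X = if p X then ψ X else 0 := rfl

lemma norm_restrict_le (p : Config N → Prop) [DecidablePred p] (ψ : Sector N) :
    ‖restrict p ψ‖ ≤ ‖ψ‖ := by
  have := (restrict p).le_of_opNorm_le (LinearMap.mkContinuous_norm_le _ zero_le_one _) ψ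
  rwa [one_mul] at this

/-- `exp(-itH)`. -/
def evolution (Δ : ℝ) (N : ℕ) (t : ℝ) : Sector N →L[ℂ] Sector N :=
  NormedSpace.exp ((-(I * t)) • hamiltonian N Δ)

lemma hasDerivAt_evolution (Δ : ℝ) (N : ℕ) (t : ℝ) :
    HasDerivAt (evolution Δ N) (-I • (evolution Δ N t * hamiltonian N Δ)) t := by
  have h := hasDerivAt_exp_smul_const (𝕂 := ℂ) (hamiltonian N Δ) (-(I * t))
  have h2 : HasDerivAt (fun t : ℝ => -(I * (t : ℂ))) (-I) t := by
    simpa using ((Complex.ofRealCLM.hasDerivAt (x := t)).const_mul I).fun_neg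
  exact h.scomp t h2

lemma hasDerivAt_evolution_apply (Δ : ℝ) (t : ℝ) (ψ : Sector N) :
    HasDerivAt (fun t => evolution Δ N t ψ)
      (-I • evolution Δ N t (hamiltonian N Δ ψ)) t :=
  (((ContinuousLinearMap.apply ℂ (Sector N) ψ).restrictScalars ℝ).hasFDerivAt
    (x := evolution Δ N t)).comp_hasDerivAt t (hasDerivAt_evolution Δ N t)

lemma exists_norm_evolution_le (Δ : ℝ) (N : ℕ) (t₀ : ℝ) :
    ∃ C, ∀ t, |t| ≤ t₀ → ‖evolution Δ N t‖ ≤ C := by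
  obtain ⟨C, hC⟩ := isCompact_Icc.exists_bound_of_continuousOn (s := Set.Icc (-t₀) t₀)
    (f := evolution Δ N) fun t _ => (hasDerivAt_evolution Δ N t).continuousAt.continuousWithinAt
  exact ⟨C, fun t ht => hC t (abs_le.1 ht)⟩

/-- `⟨exp(-itH) e_{X'}, P exp(-itH) e_X⟩`, where `P` is the projection onto the configurations with
the property `p`. -/
def correlation (Δ : ℝ) (p : Config N → Prop) [DecidablePred p] (X X' : Config N) (t : ℝ) : ℂ :=
  inner ℂ (evolution Δ N t (basisVec X')) (restrict p (evolution Δ N t (basisVec X)))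

lemma hasDerivAt_correlation (Δ : ℝ) (p : Config N → Prop) [DecidablePred p] (X X' : Config N)
    (t : ℝ) : HasDerivAt (correlation Δ p X X')
      (-I * ∑ j ∈ activeBonds X.1, (correlation Δ p (exchangeConfig j X) X' t -
          Δ * correlation Δ p X X' t) +
        I * ∑ j ∈ activeBonds X'.1, (correlation Δ p X (exchangeConfig j X') t -
          Δ * correlation Δ p X X' t)) t := by
  have h1 := hasDerivAt_evolution_apply Δ t (basisVec X')
  have h2 := ((restrict p).restrictScalars ℝ).hasFDerivAt.comp_hasDerivAt t
    (hasDerivAt_evolution_apply Δ t (basisVec X))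
  have h := HasDerivAt.inner ℂ h1 h2
  refine h.congr_deriv ?_
  simp only [comp_apply, ContinuousLinearMap.coe_restrictScalars', map_smul,
    inner_smul_left, inner_smul_right, hamiltonian_basisVec, map_sum, map_sub, sum_inner, inner_sum,
    inner_sub_left, inner_sub_right, correlation, map_neg, Complex.conj_I, neg_neg,
    Complex.conj_ofReal]

lemma exists_norm_correlation_le (Δ : ℝ) (p : Config N → Prop) [DecidablePred p] (t₀ : ℝ) :
    ∃ C, ∀ X X' t, |t| ≤ t₀ → ‖correlation Δ p X X' t‖ ≤ C := by
  obtain ⟨C, hC⟩ := exists_norm_evolution_le Δ N t₀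
  refine ⟨C * C, fun X X' t ht => ?_⟩
  have h1 : ∀ X : Config N, ‖evolution Δ N t (basisVec X)‖ ≤ C := fun X => by
    have := ContinuousLinearMap.le_of_opNorm_le _ (hC t ht) (basisVec X)
    rwa [basisVec, lp.norm_single (by norm_num), norm_one, mul_one] at this
  exact (norm_inner_le_norm _ _).trans (mul_le_mul (h1 X') ((norm_restrict_le _ _).trans (h1 X))
    (norm_nonneg _) ((norm_nonneg _).trans (hC t ht)))

lemma correlation_zero (Δ : ℝ) (p : Config N → Prop) [DecidablePred p] (X X' : Config N) :
    correlation Δ p X X' 0 = if X = X' ∧ p X' then 1 else 0 := by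
  have h0 : evolution Δ N 0 = 1 := by
    rw [evolution, Complex.ofReal_zero, mul_zero, neg_zero, zero_smul, NormedSpace.exp_zero]
  rw [correlation, h0, one_apply_eq_self, one_apply_eq_self]
  rw [basisVec, lp.inner_single_left, restrict_apply, basisVec_apply]
  by_cases h1 : X = X'
  · subst h1
    by_cases h2 : p X <;> simp [h2]
  · simp [h1, Ne.symm h1]

/-- `ℙ_Y(X_1(t) ≥ x)` as a correlation. -/
lemma leftmostTail_eq (Δ : ℝ) (hN : 0 < N) {y : Fin N → ℤ} (hy : StrictMono y) (x : ℤ) (t : ℝ) :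
    (leftmostTail Δ hN y hy x t : ℂ) = correlation Δ (fun X => x ≤ sites X ⟨0, hN⟩)
      (initialConfig y hy) (initialConfig y hy) t := by
  classical
  set ψ := wave Δ y hy t with hψ
  set f : Config N → ℝ := fun X => ‖ψ X‖ ^ 2 with hf
  have hfs : Summable f := by
    have := lp.summable_inner (𝕜 := ℂ) ψ ψ
    have h2 : ∀ X, inner ℂ (ψ X) (ψ X) = ((f X : ℝ) : ℂ) := fun X => by
      rw [inner_self_eq_norm_sq_to_K]; simp [hf]
    simp only [h2] at this
    exact Complex.summable_ofReal.1 this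
  set g : Config N → ℕ → ℝ := fun X n => if sites X ⟨0, hN⟩ = x + n then f X else 0 with hg
  have hgs : ∀ X, HasSum (g X) (if x ≤ sites X ⟨0, hN⟩ then f X else 0) := fun X => by
    split_ifs with h
    · obtain ⟨n, hn⟩ := Int.le.dest h
      have := hasSum_single (f := g X) n fun m hm => if_neg fun e => hm (by omega)
      rwa [show g X n = f X from if_pos hn.symm] at this
    · rw [show g X = fun _ => 0 from funext fun n => if_neg fun e => h (by omega)]
      exact hasSum_zero
  have hsum : Summable (uncurry g) := by
    refine (summable_prod_of_nonneg fun q => ?_).2 ⟨fun X => (hgs X).summable, ?_⟩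
    · simp only [uncurry, hg, hf, Pi.zero_apply]
      split_ifs <;> positivity
    · refine hfs.of_nonneg_of_le (fun X => ?_) fun X => ?_
      · change 0 ≤ ∑' n, g X n
        rw [(hgs X).tsum_eq]
        simp only [hf]
        split_ifs <;> positivity
      · change ∑' n, g X n ≤ _
        rw [(hgs X).tsum_eq]
        simp only [hf]
        split_ifs
        · exact le_rfl
        · positivity
  have e1 : leftmostTail Δ hN y hy x t = ∑' X, if x ≤ sites X ⟨0, hN⟩ then f X else 0 := by
    simp only [← fun X => (hgs X).tsum_eq]
    exact hsum.tsum_comm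
  rw [e1, correlation, lp.inner_eq_tsum, Complex.ofReal_tsum]
  refine tsum_congr fun X => ?_
  change _ = inner ℂ (ψ X) (restrict _ ψ X)
  rw [restrict_apply]
  split_ifs
  · rw [inner_self_eq_norm_sq_to_K]; simp [hf]
  · simp

/-! ### The transition function is the correlation -/

/-- The weights in which the transition function is bounded. -/
def weight (r : ℝ) (X X' : Config N) : ℝ :=
  r ^ (∑ i, (sites X i).natAbs) * r ^ (∑ i, (sites X' i).natAbs)

lemma sum_natAbs_sites_exchange (j : ℤ) (X : Config N) :
    ∑ i, (sites (exchangeConfig j X) i).natAbs ≤ ∑ i, (sites X i).natAbs + N := by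
  have e : ∀ X : Config N, ∑ i, (sites X i).natAbs = ∑ k ∈ X.1, k.natAbs := fun X => by
    have : univ.image (sites X) = X.1 := by
      ext k
      simp only [mem_image, mem_univ, true_and]
      exact ⟨fun ⟨i, hi⟩ => hi ▸ sites_mem X i, exists_sites⟩
    rw [← this, sum_image fun _ _ _ _ h => (strictMono_sites X).injective h]
  rw [e, e]
  simp only [exchangeConfig, exchange, sum_map]
  calc _ ≤ ∑ k ∈ X.1, (k.natAbs + 1) := sum_le_sum fun k _ => by
        simp only [Equiv.coe_toEmbedding, Equiv.swap_apply_def]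
        split_ifs <;> omega
    _ = _ := by rw [sum_add_distrib, sum_const, X.2]; simp

lemma weight_exchange_left {r : ℝ} (hr : 1 ≤ r) (j : ℤ) (X X' : Config N) :
    weight r (exchangeConfig j X) X' ≤ r ^ N * weight r X X' := by
  have := pow_le_pow_right₀ hr (sum_natAbs_sites_exchange j X)
  rw [pow_add] at this
  have h0 : (0 : ℝ) ≤ r := by linarith
  rw [weight, weight, ← mul_assoc, mul_comm (r ^ N)]
  gcongr

lemma weight_exchange_right {r : ℝ} (hr : 1 ≤ r) (j : ℤ) (X X' : Config N) :
    weight r X (exchangeConfig j X') ≤ r ^ N * weight r X X' := by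
  have hc : ∀ X X' : Config N, weight r X X' = weight r X' X := fun _ _ => mul_comm _ _
  rw [hc, hc X]
  exact weight_exchange_left hr j X' X

lemma norm_zpow_le {z : ℂ} {r : ℝ} (hr : 1 ≤ r) (h1 : ‖z‖ ≤ r) (h2 : r⁻¹ ≤ ‖z‖) (n : ℤ) :
    ‖z ^ n‖ ≤ r ^ n.natAbs := by
  have hr0 : 0 < r := by linarith
  have hz : 0 < ‖z‖ := lt_of_lt_of_le (by positivity) h2
  rw [norm_zpow]
  rcases Int.natAbs_eq n with h | h
  · conv_lhs => rw [h, zpow_natCast]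
    gcongr
  · conv_lhs => rw [h, zpow_neg, zpow_natCast, ← inv_pow]
    gcongr
    exact inv_le_of_inv_le₀ hr0 h2

section
variable {Δ R R' : ℝ} (h : Radii Δ R R')
include h

lemma Radii.exists_norm_theta_le (x : ℤ) (t₀ : ℝ) (σ : Perm (Fin N)) (K : Finset (Fin N)) :
    ∃ C, ∀ (y y' : Fin N → ℤ) (t : ℝ), |t| ≤ t₀ → ∀ v ∈ offBox [] (torusSet N R R'),
      ‖theta Δ y y' x t σ K v‖ ≤ C * (R' ^ (∑ i, (y i).natAbs) * R' ^ (∑ i, (y' i).natAbs)) := by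
  have hR' := h.one_lt'.le
  have hcomp : IsCompact (offBox [] (torusSet N R R')) := by
    have : offBox [] (torusSet N R R') = Set.pi Set.univ (torusSet N R R') := by
      ext v; simp [mem_offBox_nil, Set.mem_pi]
    rw [this]
    refine isCompact_univ_pi fun i => ?_
    rcases i with i | i
    · simpa [torusSet, Metric.sphere, dist_zero_right] using isCompact_sphere (0 : ℂ) R
    · simpa [torusSet, Metric.sphere, dist_zero_right] using isCompact_sphere (0 : ℂ) R'
  obtain ⟨C, hC⟩ := (isCompact_Icc.prod hcomp).exists_bound_of_continuousOn
    (s := Set.Icc (-t₀) t₀ ×ˢ offBox [] (torusSet N R R'))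
    ((h.continuousOn_theta (N := N) (fun _ => 0) (fun _ => 0) x σ K).mono
      (Set.prod_mono (Set.subset_univ _) le_rfl))
  refine ⟨C, fun y y' t ht v hv => ?_⟩
  obtain ⟨h1, h2⟩ := mem_torusSet_nil.1 hv
  have h0 : ∀ j, v (.inl j) ≠ 0 := fun j => by rw [← norm_pos_iff, h1]; exact h.pos
  have h0' : ∀ k, eta σ K v k ≠ 0 := fun k => h.eta_ne_zero hv k
  have hRR : R'⁻¹ ≤ R⁻¹ := inv_anti₀ h.pos h.lt.le
  have hle : R⁻¹ ≤ 1 := inv_le_one_of_one_le₀ h.one_lt.le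
  have e : theta Δ y y' x t σ K v = theta Δ (fun _ => 0) (fun _ => 0) x t σ K v *
      ((∏ j, v (.inl j) ^ (-y j)) * ∏ k, eta σ K v k ^ (-y' k)) := by
    simp only [theta, prod_mul_distrib]
    have e1 : ∏ j, v (.inl j) ^ (x - y j - 1) =
        (∏ j, v (.inl j) ^ (x - 0 - 1)) * ∏ j, v (.inl j) ^ (-y j) := by
      rw [← prod_mul_distrib]
      exact prod_congr rfl fun j _ => by rw [← zpow_add₀ (h0 j)]; congr 1; ring
    have e2 : ∏ k, eta σ K v k ^ (x - y' k) =
        (∏ k, eta σ K v k ^ (x - 0)) * ∏ k, eta σ K v k ^ (-y' k) := by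
      rw [← prod_mul_distrib]
      exact prod_congr rfl fun j _ => by rw [← zpow_add₀ (h0' j)]; congr 1; ring
    rw [e1, e2]
    ring
  rw [e, norm_mul]
  refine mul_le_mul (hC (t, v) ⟨abs_le.1 ht, hv⟩) ?_ (norm_nonneg _)
    ((norm_nonneg _).trans (hC (t, v) ⟨abs_le.1 ht, hv⟩))
  rw [norm_mul, norm_prod, norm_prod, ← prod_pow_eq_pow_sum, ← prod_pow_eq_pow_sum]
  refine mul_le_mul (prod_le_prod (fun _ _ => norm_nonneg _) fun j _ => ?_)
    (prod_le_prod (fun _ _ => norm_nonneg _) fun k _ => ?_) (by positivity)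
    (prod_nonneg fun _ _ => pow_nonneg (by linarith) _)
  · rw [← Int.natAbs_neg]
    refine norm_zpow_le hR' ((h1 j).trans_le h.lt.le) ?_ _
    rw [h1]
    have := h.one_lt
    linarith
  · rw [← Int.natAbs_neg]
    refine norm_zpow_le hR' ?_ ?_ _
    all_goals
      unfold eta
      split_ifs
    · exact (h2 k).le
    · rw [norm_inv, h1]; linarith
    · rw [h2]; linarith
    · rw [norm_inv, h1]; exact hRR

lemma Radii.exists_norm_transition_le (x : ℤ) (t₀ : ℝ) : ∃ C, ∀ (X X' : Config N) (t : ℝ),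
    |t| ≤ t₀ → ‖transition Δ R R' (sites X) (sites X') x t‖ ≤ C * weight R' X X' := by
  choose C hC using fun (σ : Perm (Fin N)) K => h.exists_norm_theta_le x t₀ σ K
  obtain ⟨c, -, hc⟩ := exists_bound_iter (torus N R R') (allVars N) fun j _ => isSmooth_torus R R' j
  refine ⟨∑ K ∈ (univ : Finset (Fin N)).powerset, ∑ σ, c * C σ K, fun X X' t ht => ?_⟩
  rw [transition, sum_mul]
  refine (norm_sum_le _ _).trans (sum_le_sum fun K _ => ?_)
  rw [sum_mul]
  refine (norm_sum_le _ _).trans (sum_le_sum fun σ _ => ?_)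
  rw [mul_assoc]
  exact hc (torusSet N R R') (fun j _ => trace_torus h.pos.le h.pos'.le j) _ _
    (fun v hv => hC σ K _ _ t ht v hv) 0 (mem_offBox_of_forall_mem mem_allVars 0)

lemma Radii.hasDerivAt_transition_sites (X X' : Config N) (x : ℤ) (t : ℝ) :
    HasDerivAt (fun t => transition Δ R R' (sites X) (sites X') x t)
      (-I * ∑ j ∈ activeBonds X.1,
          (transition Δ R R' (sites (exchangeConfig j X)) (sites X') x t -
            Δ * transition Δ R R' (sites X) (sites X') x t) +
        I * ∑ j ∈ activeBonds X'.1,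
          (transition Δ R R' (sites X) (sites (exchangeConfig j X')) x t -
            Δ * transition Δ R R' (sites X) (sites X') x t)) t := by
  refine (h.hasDerivAt_transition (sites X) (sites X') x t).congr_deriv ?_
  rw [sum_activeBonds_eq (g := fun y => transition Δ R R' y (sites X') x t) X
      fun a b hab e => h.boundary_left (sites X') x t hab e,
    sum_activeBonds_eq (g := fun y' => transition Δ R R' (sites X) y' x t) X'
      fun a b hab e => h.boundary_right (sites X) x t hab e]

omit h in
lemma norm_sum_activeBonds_le {X : Config N} {g : Config N → ℂ} {B M : ℝ} (hM : 1 ≤ M) (hB : 0 ≤ B)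
    (h0 : ‖g X‖ ≤ B) (h1 : ∀ j, ‖g (exchangeConfig j X)‖ ≤ M * B) :
    ‖∑ j ∈ activeBonds X.1, (g (exchangeConfig j X) - Δ * g X)‖ ≤ 2 * N * (M + |Δ|) * B := by
  have hc : ((activeBonds X.1).card : ℝ) ≤ 2 * N := by
    have := card_activeBonds_le X.1
    rw [X.2] at this
    exact_mod_cast this
  have : ∀ j ∈ activeBonds X.1, ‖g (exchangeConfig j X) - Δ * g X‖ ≤ (M + |Δ|) * B := fun j _ => by
    refine (norm_sub_le _ _).trans ?_
    rw [norm_mul, norm_real, norm_eq_abs, add_mul]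
    gcongr
    exact h1 j
  refine (norm_sum_le_of_le _ this).trans ?_
  rw [sum_const, nsmul_eq_mul, mul_assoc (2 * (N : ℝ))]
  have : 0 ≤ (M + |Δ|) * B := by positivity
  gcongr

/-- The contour integral formula for the correlations. -/
theorem Radii.transition_eq_correlation (hN : 0 < N) (x : ℤ) (X X' : Config N) (t : ℝ) :
    transition Δ R R' (sites X) (sites X') x t =
      correlation Δ (fun X => x ≤ sites X ⟨0, hN⟩) X X' t := by
  set F := correlation Δ (fun X : Config N => x ≤ sites X ⟨0, hN⟩) with hF
  set G : Config N → Config N → ℝ → ℂ := fun X X' t => transition Δ R R' (sites X) (sites X') x t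
    with hG
  set D : Config N × Config N → ℝ → ℂ := fun q t => G q.1 q.2 t - F q.1 q.2 t with hD
  set D' : Config N × Config N → ℝ → ℂ := fun q t =>
    -I * ∑ j ∈ activeBonds q.1.1, (D (exchangeConfig j q.1, q.2) t - Δ * D q t) +
      I * ∑ j ∈ activeBonds q.2.1, (D (q.1, exchangeConfig j q.2) t - Δ * D q t) with hD'
  set w : Config N × Config N → ℝ := fun q => weight R' q.1 q.2 with hw
  have hR' := h.one_lt'.le
  have hw1 : ∀ q, 1 ≤ w q := fun q => one_le_mul_of_one_le_of_one_le (one_le_pow₀ hR')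
    (one_le_pow₀ hR')
  have hd : ∀ q t, HasDerivAt (D q) (D' q t) t := fun q t => by
    refine ((h.hasDerivAt_transition_sites q.1 q.2 x t).sub
      (hasDerivAt_correlation Δ _ q.1 q.2 t)).congr_deriv ?_
    simp only [hD', hD, hG, mul_sub, sum_sub_distrib, mul_sum, hF]
    ring
  have h0 : ∀ q, D q 0 = 0 := fun q => by
    simp only [hD, hG, hF]
    rw [h.transition_zero (strictMono_sites _) (strictMono_sites _) x (o := ⟨0, hN⟩)
      (fun k => Nat.zero_le _), correlation_zero]
    simp only [sites_injective.eq_iff, sub_self]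
  obtain ⟨C₁, hC₁⟩ := h.exists_norm_transition_le (N := N) x |t|
  obtain ⟨C₂, hC₂⟩ := exists_norm_correlation_le Δ (fun X : Config N => x ≤ sites X ⟨0, hN⟩) |t|
  have hC : ∀ q s, |s| ≤ |t| → ‖D q s‖ ≤ (C₁ + C₂) * w q := fun q s hs => by
    refine (norm_sub_le _ _).trans ?_
    rw [add_mul]
    have h1 := hC₂ q.1 q.2 s hs
    have : C₂ ≤ C₂ * w q := le_mul_of_one_le_right ((norm_nonneg _).trans h1) (hw1 q)
    exact add_le_add (hC₁ q.1 q.2 s hs) (h1.trans this)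
  set Λ : ℝ := 4 * N * (R' ^ N + |Δ|) with hΛ
  have hb : ∀ t b, 0 ≤ b → (∀ q, ‖D q t‖ ≤ b * w q) → ∀ q, ‖D' q t‖ ≤ Λ * (b * w q) := by
    intro t b hb hq q
    have hB : 0 ≤ b * w q := mul_nonneg hb (by linarith [hw1 q])
    have h1 := norm_sum_activeBonds_le (Δ := Δ) (X := q.1) (g := fun X => D (X, q.2) t)
      (one_le_pow₀ hR' (n := N)) hB (hq q) fun j => (hq _).trans (by
        rw [mul_left_comm]; gcongr; exact weight_exchange_left hR' j q.1 q.2)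
    have h2 := norm_sum_activeBonds_le (Δ := Δ) (X := q.2) (g := fun X => D (q.1, X) t)
      (one_le_pow₀ hR' (n := N)) hB (hq q) fun j => (hq _).trans (by
        rw [mul_left_comm]; gcongr; exact weight_exchange_right hR' j q.1 q.2)
    refine (norm_add_le _ _).trans ?_
    rw [norm_mul, norm_mul, norm_neg, norm_I, one_mul, one_mul]
    refine (add_le_add h1 h2).trans (le_of_eq ?_)
    rw [hΛ]; ring
  have hΛ0 : 0 ≤ Λ := by positivity
  have hw0 : ∀ q, 0 ≤ w q := fun q => by linarith [hw1 q]
  refine sub_eq_zero.1 (?_ : D (X, X') t = 0)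
  rcases le_total 0 t with ht | ht
  · refine eq_zero_of_hasDerivAt hw0 hΛ0 hd h0 (fun q s hs => hC q s ?_) hb (X, X') ht
    rw [abs_of_nonneg hs.1, abs_of_nonneg ht]; exact hs.2
  · have := eq_zero_of_hasDerivAt (D := fun q s => D q (-s)) (D' := fun q s => -D' q (-s)) (t₀ := -t)
      (C := C₁ + C₂) hw0 hΛ0 (fun q s => ?_) (by simpa using h0) (fun q s hs => hC q (-s) ?_)
      (fun s b hb' hq q => by rw [norm_neg]; exact hb (-s) b hb' hq q) (X, X') (by linarith)
    · simpa using this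
    · refine ((hd q (-s)).scomp s (hasDerivAt_neg s)).congr_deriv ?_
      simp
    · rw [abs_neg, abs_of_nonneg hs.1, abs_of_nonpos ht]; exact hs.2

/-- The contour integral formula on circles. -/
theorem Radii.leftmostTail_eq_transition (hN : 0 < N) {y : Fin N → ℤ} (hy : StrictMono y) (x : ℤ)
    (t : ℝ) : (leftmostTail Δ hN y hy x t : ℂ) = transition Δ R R' y y x t := by
  rw [leftmostTail_eq, ← h.transition_eq_correlation hN, sites_initialConfig]

end

/-! ### Expansion of the determinants over permutations -/

/-- The permutations that extend `τ`. -/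
def extensions (τ : Fin N → Option (Fin N)) : Finset (Perm (Fin N)) :=
  univ.filter fun σ => ∀ k, τ k = none ∨ τ k = some (σ k)

lemma mem_setK1 {τ : Fin N → Option (Fin N)} {k : Fin N} : k ∈ setK1 τ ↔ τ k = none := by
  simp [setK1]

section
variable {τ : Fin N → Option (Fin N)} {σ : Perm (Fin N)} (hσ : σ ∈ extensions τ)
include hσ

lemma apply_of_mem_extensions {k : Fin N} (hk : k ∉ setK1 τ) : τ k = some (σ k) :=
  ((mem_filter.1 hσ).2 k).resolve_left fun h => hk (mem_setK1.2 h)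

lemma graph_eq : graph τ = (setK1 τ)ᶜ.map ⟨fun k => (k, σ k), fun _ _ h => (Prod.mk.inj h).1⟩ := by
  ext ⟨k, j⟩
  rw [graph, mem_filter, mem_map]
  constructor
  · rintro ⟨-, h⟩
    have h' : τ k = some j := h
    have hk : k ∉ setK1 τ := fun hk => by rw [mem_setK1.1 hk] at h'; cases h'
    rw [apply_of_mem_extensions hσ hk] at h'
    exact ⟨k, mem_compl.2 hk, Prod.ext rfl (Option.some.inj h')⟩
  · rintro ⟨k', hk, e⟩
    obtain ⟨rfl, rfl⟩ := Prod.mk.inj e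
    exact ⟨mem_univ _, apply_of_mem_extensions hσ (mem_compl.1 hk)⟩

lemma setJ2_eq : setJ2 τ = (setK1 τ)ᶜ.map σ.toEmbedding := by
  ext j
  rw [setJ2, mem_filter, mem_map]
  constructor
  · rintro ⟨-, k, hk, e⟩
    refine ⟨k, hk, ?_⟩
    rw [apply_of_mem_extensions hσ (mem_compl.1 hk)] at e
    exact Option.some.inj e
  · rintro ⟨k, hk, rfl⟩
    exact ⟨mem_univ _, k, hk, apply_of_mem_extensions hσ (mem_compl.1 hk)⟩

lemma setJ1_eq : setJ1 τ = (setK1 τ).map σ.toEmbedding := by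
  rw [setJ1, setJ2_eq hσ]
  ext j
  simp only [mem_compl, mem_map_equiv, not_not]

end

lemma prod_ite_neg_one (S : Finset (Fin N)) (p : Fin N → Prop) [DecidablePred p] :
    (∏ k ∈ S, if p k then (-1 : ℂ) else 1) = (-1) ^ (S.filter p).card := by
  rw [prod_ite, prod_const_one, mul_one, prod_const]

lemma zpow_sum_neg_one (S : Finset (Fin N)) (f : Fin N → ℤ) :
    (-1 : ℂ) ^ (∑ k ∈ S, f k) = ∏ k ∈ S, (-1) ^ f k := by
  induction S using Finset.induction_on with
  | empty => simp
  | insert a S ha ih => rw [sum_insert ha, prod_insert ha, zpow_add₀ (by norm_num), ih]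

lemma prod_ite_lt (m : Fin N) : (∏ k, if k < m then (-1 : ℂ) else 1) = (-1) ^ (m : ℕ) := by
  rw [prod_ite_neg_one]
  congr 1
  have : univ.filter (fun k => k < m) = Iio m := by ext; simp
  rw [this, Fin.card_Iio]

lemma pairProd_map_perm {σ : Perm (Fin N)} (S : Finset (Fin N)) (f : Fin N → Fin N → ℂ) :
    pairProd (S.map σ.toEmbedding) f =
      pairProd S fun j k => if σ j < σ k then f (σ j) (σ k) else f (σ k) (σ j) := by
  have h1 : pairProd S (fun j k => if σ j < σ k then f (σ j) (σ k) else f (σ k) (σ j)) =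
      ∏ k ∈ S, ∏ j ∈ S.erase k, if σ j < σ k then f (σ j) (σ k) else 1 := by
    rw [prod_prod_erase]
    refine pairProd_congr fun j _ k _ hjk => ?_
    rcases lt_or_gt_of_ne (fun e => hjk.ne (σ.injective e) : σ j ≠ σ k) with h | h
    · simp [h, h.not_gt]
    · simp [h, h.not_gt]
  rw [h1, pairProd, prod_comm, prod_map]
  refine prod_congr rfl fun k hk => ?_
  rw [prod_map, ← mul_prod_erase S _ hk]
  simp

lemma pairProd_split (K : Finset (Fin N)) (f : Fin N → Fin N → ℂ) :
    pairProd univ f = pairProd K f * pairProd Kᶜ f *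
      ∏ k ∈ Kᶜ, ∏ j ∈ K, if j < k then f j k else f k j := by
  have h1 : ∀ S T : Finset (Fin N), Disjoint S T → (∏ k ∈ T, ∏ j ∈ S, if j < k then f j k else f k j) =
      (∏ j ∈ S, ∏ k ∈ T, if j < k then f j k else 1) * ∏ k ∈ T, ∏ j ∈ S, if k < j then f k j else 1 := by
    intro S T hST
    rw [prod_comm (s := S), ← prod_mul_distrib]
    refine prod_congr rfl fun k hk => ?_
    rw [← prod_mul_distrib]
    refine prod_congr rfl fun j hj => ?_
    rcases lt_or_gt_of_ne (fun e => disjoint_left.1 hST hj (e ▸ hk) : j ≠ k) with h | h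
    · simp [h, h.not_gt]
    · simp [h, h.not_gt]
  rw [h1 K Kᶜ disjoint_compl_right]
  simp only [pairProd]
  rw [← prod_mul_prod_compl K]
  simp only [← prod_mul_prod_compl K (fun k => ite _ _ _), prod_mul_distrib]
  ring

/-- The sign of a permutation that extends `τ`. -/
lemma sign_of_mem_extensions {τ : Fin N → Option (Fin N)} {σ : Perm (Fin N)}
    (hσ : σ ∈ extensions τ) : ((sign σ : ℤ) : ℂ) =
      (-1) ^ (∑ q ∈ graph τ, (((q.2 : ℕ) : ℤ) - ((q.1 : ℕ) : ℤ))) * (-1) ^ inversions τ *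
        pairProd (setK1 τ) fun j k => if σ j < σ k then 1 else -1 := by
  set K := setK1 τ with hK
  have e0 : ((sign σ : ℤ) : ℂ) = pairProd univ fun j k => if σ j < σ k then 1 else -1 := by
    rw [Equiv.Perm.sign_eq_prod_prod_Ioi]
    push_cast
    refine prod_congr rfl fun j _ => ?_
    rw [← prod_filter, show univ.filter (fun k => j < k) = Ioi j by ext; simp]
    refine prod_congr rfl fun k hk => ?_
    rcases lt_or_gt_of_ne (fun e => (mem_Ioi.1 hk).ne (σ.injective e) : σ j ≠ σ k) with h | h
    · simp [h]
    · simp [h.not_gt]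
  have e1 : pairProd Kᶜ (fun j k => if σ j < σ k then (1 : ℂ) else -1) = (-1) ^ inversions τ := by
    rw [inversions, graph_eq hσ, pairProd, ← prod_product', ← hK]
    have : ∀ p : Fin N × Fin N, (if p.1 < p.2 then if σ p.1 < σ p.2 then (1 : ℂ) else -1 else 1) =
        if p.1 < p.2 ∧ σ p.2 < σ p.1 then -1 else 1 := by
      rintro ⟨j, k⟩
      by_cases h : j < k
      · rcases lt_or_gt_of_ne (fun e => h.ne (σ.injective e) : σ j ≠ σ k) with h' | h'
        · simp [h, h', h'.not_gt]
        · simp [h, h', h'.not_gt]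
      · simp [h]
    rw [prod_congr rfl fun p _ => this p, prod_ite, prod_const_one, mul_one, prod_const, ← card_map
      ((⟨fun k => (k, σ k), fun _ _ h => (Prod.mk.inj h).1⟩ : Fin N ↪ Fin N × Fin N).prodMap
        ⟨fun k => (k, σ k), fun _ _ h => (Prod.mk.inj h).1⟩)]
    congr 2
    ext ⟨⟨a, b⟩, ⟨c, d⟩⟩
    rw [mem_filter, mem_map, mem_product, mem_map, mem_map]
    constructor
    · rintro ⟨p, hp, e⟩
      obtain ⟨h1, h2, h3⟩ := mem_filter.1 hp
      obtain ⟨h4, h5⟩ := mem_product.1 h1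
      obtain ⟨e1, e2⟩ := Prod.mk.inj e
      obtain ⟨rfl, rfl⟩ := Prod.mk.inj e1
      obtain ⟨rfl, rfl⟩ := Prod.mk.inj e2
      exact ⟨⟨⟨_, h4, rfl⟩, _, h5, rfl⟩, h2, h3⟩
    · rintro ⟨⟨⟨j, h1, e1⟩, k, h2, e2⟩, h3, h4⟩
      obtain ⟨rfl, rfl⟩ := Prod.mk.inj e1
      obtain ⟨rfl, rfl⟩ := Prod.mk.inj e2
      exact ⟨(j, k), mem_filter.2 ⟨mem_product.2 ⟨h1, h2⟩, h3, h4⟩, rfl⟩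
  have e2 : (∏ k ∈ Kᶜ, ∏ j ∈ K, if j < k then if σ j < σ k then (1 : ℂ) else -1
      else if σ k < σ j then 1 else -1) =
      (-1) ^ (∑ q ∈ graph τ, (((q.2 : ℕ) : ℤ) - ((q.1 : ℕ) : ℤ))) := by
    set e : Prop → ℂ := fun P => by classical exact if P then -1 else 1 with he
    have he' : ∀ (P : Prop) [Decidable P], e P = if P then -1 else 1 := fun P _ => by
      simp only [he]; congr
    have f1 : ∀ k ∈ Kᶜ, ∀ j ∈ K, (if j < k then if σ j < σ k then (1 : ℂ) else -1
        else if σ k < σ j then 1 else -1) = e (j < k) * e (σ j < σ k) := by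
      intro k hk j hj
      have hne : j ≠ k := by rintro rfl; exact mem_compl.1 hk hj
      simp only [he']
      rcases lt_or_gt_of_ne (fun e => hne (σ.injective e) : σ j ≠ σ k) with h' | h' <;>
        rcases lt_or_gt_of_ne hne with h | h <;> simp [h, h', h.not_gt, h'.not_gt]
    have f2 : ∀ g : Fin N → Fin N, Function.Injective g →
        ∏ k ∈ Kᶜ, ∏ j ∈ Kᶜ, e (g j < g k) = pairProd Kᶜ fun _ _ => (-1 : ℂ) := by
      intro g hg
      rw [← pairProd_congr (f := fun j k => e (g j < g k) * e (g k < g j)), ← prod_prod_erase]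
      · refine prod_congr rfl fun k hk => ?_
        rw [← mul_prod_erase _ _ hk]
        simp [he']
      · intro j _ k _ hjk
        simp only [he']
        rcases lt_or_gt_of_ne (fun e => hjk.ne (hg e) : g j ≠ g k) with h' | h' <;>
          simp [h', h'.not_gt]
    have n2 : (pairProd Kᶜ fun _ _ => (-1 : ℂ)) ≠ 0 := pairProd_ne_zero fun _ _ _ _ _ => by norm_num
    have f3 : ∀ k : Fin N, ∏ j, e (j < k) = (-1) ^ (k : ℕ) := fun k => by
      rw [← prod_ite_lt]; exact prod_congr rfl fun j _ => he' _
    have f4 : ∀ k : Fin N, ∏ j, e (σ j < σ k) = (-1) ^ (σ k : ℕ) := fun k => by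
      rw [← f3, ← Equiv.prod_comp σ fun j => e (j < σ k)]
    have f5 : (∏ k ∈ Kᶜ, ∏ j ∈ K, e (j < k) * e (σ j < σ k)) *
        ((∏ k ∈ Kᶜ, ∏ j ∈ Kᶜ, e (j < k)) * ∏ k ∈ Kᶜ, ∏ j ∈ Kᶜ, e (σ j < σ k)) =
        ∏ k ∈ Kᶜ, (-1 : ℂ) ^ (k : ℕ) * (-1) ^ (σ k : ℕ) := by
      rw [← prod_mul_distrib, ← prod_mul_distrib]
      refine prod_congr rfl fun k _ => ?_
      rw [← f3, ← f4, ← prod_mul_prod_compl K, ← prod_mul_prod_compl K (fun j => e (σ j < σ k)),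
        prod_mul_distrib]
      ring
    rw [prod_congr rfl fun k hk => prod_congr rfl (f1 k hk), graph_eq hσ, sum_map]
    have f6 := f2 id Function.injective_id
    simp only [id] at f6
    rw [f6, f2 σ σ.injective, ← pairProd_mul] at f5
    simp only [mul_neg, mul_one, neg_neg] at f5
    rw [show (pairProd Kᶜ fun _ _ => (1 : ℂ)) = 1 by simp [pairProd], mul_one] at f5
    rw [f5, zpow_sum_neg_one]
    refine prod_congr rfl fun k _ => ?_
    rw [zpow_sub₀ (by norm_num), zpow_natCast, zpow_natCast, mul_comm, div_eq_mul_inv, ← inv_pow]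
    norm_num
    rfl
  rw [e0, pairProd_split K, e1, e2]
  ring

/-! The permutations that extend `τ` correspond to the permutations in the expansion of the minor. -/

section
variable {τ : Fin N → Option (Fin N)} (hτ : ∀ k k', τ k ≠ none → τ k = τ k' → k = k')
  (h : (setJ1 τ).card = (setK1 τ).card)
include hτ

omit hτ in
lemma mem_setJ1_iff {j : Fin N} : j ∈ setJ1 τ ↔ ∀ k, τ k ≠ some j := by
  rw [setJ1, mem_compl, setJ2, mem_filter]
  constructor
  · intro hj k e
    refine hj ⟨mem_univ _, k, mem_compl.2 fun hk => ?_, e⟩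
    rw [mem_setK1.1 hk] at e
    cases e
  · rintro hj ⟨-, k, -, e⟩
    exact hj k e

/-- The extension of `τ` that is given by a permutation of `1, …, n`. -/
def extendFun (π : Perm (Fin (setK1 τ).card)) (k : Fin N) : Fin N :=
  if hk : k ∈ setK1 τ then
    (setJ1 τ).orderEmbOfFin h (π (((setK1 τ).orderIsoOfFin rfl).symm ⟨k, hk⟩))
  else (τ k).getD k

omit hτ in
lemma extendFun_orderEmbOfFin (π : Perm (Fin (setK1 τ).card)) (q : Fin (setK1 τ).card) :
    extendFun h π ((setK1 τ).orderEmbOfFin rfl q) = (setJ1 τ).orderEmbOfFin h (π q) := by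
  rw [extendFun, dif_pos (orderEmbOfFin_mem _ _ _)]
  congr 2
  rw [OrderIso.symm_apply_eq]
  rfl

omit hτ in
lemma extendFun_of_notMem (π : Perm (Fin (setK1 τ).card)) {k : Fin N} (hk : k ∉ setK1 τ) :
    τ k = some (extendFun h π k) := by
  rw [extendFun, dif_neg hk]
  cases e : τ k with
  | none => exact absurd (mem_setK1.2 e) hk
  | some j => rfl

lemma extendFun_injective (π : Perm (Fin (setK1 τ).card)) :
    Function.Injective (extendFun h π) := by
  have hK : ∀ {k}, k ∈ setK1 τ → ∃ q, (setK1 τ).orderEmbOfFin rfl q = k := fun {k} hk => by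
    have := range_orderEmbOfFin (setK1 τ) rfl
    rw [← mem_coe, ← this] at hk
    exact hk
  have hmix : ∀ {k k'}, k ∈ setK1 τ → k' ∉ setK1 τ → extendFun h π k ≠ extendFun h π k' := by
    intro k k' hk hk' e
    obtain ⟨q, rfl⟩ := hK hk
    rw [extendFun_orderEmbOfFin] at e
    have := mem_setJ1_iff.1 (orderEmbOfFin_mem (setJ1 τ) h (π q)) k'
    rw [e] at this
    exact this (extendFun_of_notMem h π hk')
  intro k k' e
  by_cases hk : k ∈ setK1 τ <;> by_cases hk' : k' ∈ setK1 τ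
  · obtain ⟨q, rfl⟩ := hK hk
    obtain ⟨q', rfl⟩ := hK hk'
    rw [extendFun_orderEmbOfFin, extendFun_orderEmbOfFin] at e
    rw [π.injective ((setJ1 τ).orderEmbOfFin h |>.injective e)]
  · exact absurd e (hmix hk hk')
  · exact absurd e.symm (hmix hk' hk)
  · have h1 := extendFun_of_notMem h π hk
    exact hτ k k' (by rw [h1]; simp) (by rw [h1, e, ← extendFun_of_notMem h π hk'])

include h in
/-- Expansion of a minor. -/
lemma minor_eq_sum (a : Fin N → Fin N → ℂ) : minor (setJ1 τ) (setK1 τ) a =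
    ∑ σ ∈ extensions τ, (pairProd (setK1 τ) fun j k => if σ j < σ k then 1 else -1) *
      ∏ k ∈ setK1 τ, a (σ k) k := by
  have hprod : ∀ {M : Type} [CommMonoid M] (g : Fin N → M), ∏ k ∈ setK1 τ, g k =
      ∏ q, g ((setK1 τ).orderEmbOfFin rfl q) := fun g => by
    rw [← prod_coe_sort, ← Equiv.prod_comp ((setK1 τ).orderIsoOfFin rfl).toEquiv]
    rfl
  rw [minor, dif_pos h, Matrix.det_apply']
  refine sum_bij (fun π _ => Equiv.ofBijective _
    (Finite.injective_iff_bijective.1 (extendFun_injective hτ h π))) (fun π _ => ?_)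
    (fun π _ π' _ e => ?_) (fun σ hσ => ?_) fun π _ => ?_
  · refine mem_filter.2 ⟨mem_univ _, fun k => ?_⟩
    by_cases hk : k ∈ setK1 τ
    · exact .inl (mem_setK1.1 hk)
    · exact .inr (extendFun_of_notMem h π hk)
  · ext q : 1
    have := Equiv.congr_fun e ((setK1 τ).orderEmbOfFin rfl q)
    simp only [Equiv.ofBijective_apply, extendFun_orderEmbOfFin] at this
    exact (setJ1 τ).orderEmbOfFin h |>.injective this
  · have hs : ∀ k, k ∈ setK1 τ ↔ σ k ∈ setJ1 τ := fun k => by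
      rw [setJ1_eq hσ, mem_map_equiv, Equiv.symm_apply_apply]
    refine ⟨((setK1 τ).orderIsoOfFin rfl).toEquiv.trans ((σ.subtypeEquiv hs).trans
      ((setJ1 τ).orderIsoOfFin h).toEquiv.symm), mem_univ _, ?_⟩
    ext k : 1
    simp only [Equiv.ofBijective_apply]
    by_cases hk : k ∈ setK1 τ
    · rw [extendFun, dif_pos hk]
      change (((setJ1 τ).orderIsoOfFin h (((setJ1 τ).orderIsoOfFin h).symm
        (σ.subtypeEquiv hs ((setK1 τ).orderIsoOfFin rfl
          (((setK1 τ).orderIsoOfFin rfl).symm ⟨k, hk⟩))))) : Fin N) = σ k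
      rw [OrderIso.apply_symm_apply, OrderIso.apply_symm_apply]
      rfl
    · have := extendFun_of_notMem h (((setK1 τ).orderIsoOfFin rfl).toEquiv.trans
        ((σ.subtypeEquiv hs).trans ((setJ1 τ).orderIsoOfFin h).toEquiv.symm)) hk
      rw [apply_of_mem_extensions hσ hk] at this
      exact (Option.some.inj this).symm
  · simp only [Equiv.ofBijective_apply, pairProd, hprod, extendFun_orderEmbOfFin, Matrix.of_apply,
      OrderEmbedding.lt_iff_lt]
    congr 1
    rw [Equiv.Perm.sign_eq_prod_prod_Ioi]
    push_cast
    refine prod_congr rfl fun j _ => ?_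
    rw [← prod_filter, show univ.filter (fun k => j < k) = Ioi j by ext; simp]
    refine prod_congr rfl fun k hk => ?_
    rcases lt_or_gt_of_ne (fun e => (mem_Ioi.1 hk).ne (π.injective e) : π j ≠ π k) with h | h
    · simp [h]
    · simp [h.not_gt]

end

lemma injective_of_mem_maps {n : ℕ} {τ : Fin N → Option (Fin N)} (h : τ ∈ maps N n) {k k' : Fin N}
    (hk : τ k ≠ none) (e : τ k = τ k') : k = k' := by
  obtain ⟨j, hj⟩ := Option.ne_none_iff_exists'.1 hk
  exact card_le_one.1 ((mem_filter.1 h).2.2 j) k (by simp [hj]) k' (by simp [← e, hj])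

lemma card_setJ1 {τ : Fin N → Option (Fin N)}
    (hτ : ∀ k k', τ k ≠ none → τ k = τ k' → k = k') : (setJ1 τ).card = (setK1 τ).card := by
  have : (setK2 τ).card = (setJ2 τ).card := by
    refine card_bij (fun k _ => (τ k).getD k) (fun k hk => ?_) (fun k hk k' hk' e => ?_) fun j hj => ?_
    · cases e : τ k with
      | none => exact absurd (mem_setK1.2 e) (mem_compl.1 hk)
      | some j => exact mem_filter.2 ⟨mem_univ _, k, hk, e⟩
    · cases h1 : τ k with
      | none => exact absurd (mem_setK1.2 h1) (mem_compl.1 hk)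
      | some j =>
        cases h2 : τ k' with
        | none => exact absurd (mem_setK1.2 h2) (mem_compl.1 hk')
        | some j' =>
          rw [h1, h2] at e
          have e' : j = j' := e
          exact hτ k k' (by rw [h1]; simp) (by rw [h1, h2, e'])
    · obtain ⟨-, k, hk, e⟩ := mem_filter.1 hj
      exact ⟨k, hk, by rw [e]; rfl⟩
  have h1 := card_compl (setJ2 τ)
  have h2 := card_compl (setK1 τ)
  have h3 := card_le_univ (setK1 τ)
  have h4 := card_le_univ (setJ2 τ)
  rw [setK2] at this
  rw [setJ1]
  omega

/-- `D_N` as a sum over permutations. -/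
lemma detD_eq_sum {Δ : ℝ} {τ : Fin N → Option (Fin N)}
    (hτ : ∀ k k', τ k ≠ none → τ k = τ k' → k = k') (ξ ζ : Fin N → ℂ) :
    detD Δ τ ξ ζ = ∑ σ ∈ extensions τ, ((sign σ : ℤ) : ℂ) *
      ∏ k ∈ setK1 τ, dKernel Δ (ξ (σ k)) (ζ k) := by
  rw [detD, minor_eq_sum hτ (card_setJ1 hτ), mul_sum]
  refine sum_congr rfl fun σ hσ => ?_
  rw [sign_of_mem_extensions hσ]
  ring

/-! ### The integrands of the series -/

section
variable (Δ : ℝ) (y : Fin N → ℤ) (x : ℤ) (t : ℝ) (σ : Perm (Fin N)) (K : Finset (Fin N))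
  (v : Point N)

/-- The factor of the pair `k, k'` in `regularMixed`. -/
def mixedFactor (k k' : Fin N) : ℂ :=
  (if σ k < σ k' ∧ (k' ∈ K ∨ k' < k) then
    pFac Δ (v (.inl (σ k'))) (v (.inl (σ k))) / pFac Δ (v (.inl (σ k))) (v (.inl (σ k'))) else 1) *
  if k' ∈ K ∧ k < k' then
    rFac Δ (v (.inl (σ k))) (v (.inr k')) / (v (.inl (σ k)) + v (.inr k') - 2 * Δ) else 1

/-- The part of the integrand that involves the variables `ξ_{σ(k)}` with `k ∉ K`. -/
def regularMixed : ℂ :=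
  (∏ k ∈ Kᶜ, ∏ k', mixedFactor Δ σ K v k k') * ∏ k ∈ Kᶜ, v (.inl (σ k)) ^ (y k - y (σ k) - 1)

/-- The part of the integrand that involves only `ξ_{σ(k)}` and `ζ_k` with `k ∈ K`. -/
def regularMain : ℂ :=
  (sign σ : ℤ) *
      (∏ k ∈ K, ∏ j ∈ K.erase k, rFac Δ (v (.inl (σ j))) (v (.inr k))) *
      (∏ k ∈ K, (1 - v (.inl (σ k)) * v (.inr k))⁻¹) /
    (pairProd (K.map σ.toEmbedding) (fun j k => pFac Δ (v (.inl j)) (v (.inl k))) *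
      pairProd K fun j k => pFac Δ (v (.inr j)) (v (.inr k))) *
    (∏ k ∈ K, v (.inl (σ k)) ^ (x - y (σ k) - 1) *
      exp (-(I * t * energy Δ (v (.inl (σ k)))))) *
    ∏ k ∈ K, v (.inr k) ^ (x - y k - 1) * exp (I * t * energy Δ (v (.inr k)))

/-- The integrand of the series that belongs to the permutation `σ`. -/
def regular : ℂ := regularMain Δ y x t σ K v * regularMixed Δ y σ K v

end

lemma prod_filter_lt_eq_pairProd (S : Finset (Fin N)) (f : Fin N → Fin N → ℂ) :
    (∏ j ∈ S, ∏ k ∈ S with j < k, f j k) = pairProd S f := by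
  simp only [prod_filter, pairProd]

section
variable {Δ : ℝ} {y : Fin N → ℤ} {x : ℤ} {t : ℝ} {τ : Fin N → Option (Fin N)}
  {v : Point N}

lemma integrandF_eq {σ : Perm (Fin N)} (hσ : σ ∈ extensions τ) :
    integrandF Δ y τ (fun j => v (.inl j)) (fun k => v (.inr k)) =
      regularMixed Δ y σ (setK1 τ) v := by
  have hmem : ∀ k, k ∉ setK1 τ → (k, σ k) ∈ graph τ := fun k hk => by
    rw [graph_eq hσ]; exact mem_map.2 ⟨k, mem_compl.2 hk, rfl⟩
  have hgr : ∀ q ∈ graph τ, q.1 ∉ setK1 τ ∧ q.2 = σ q.1 := fun q hq => by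
    rw [graph_eq hσ, mem_map] at hq
    obtain ⟨k, hk, rfl⟩ := hq
    exact ⟨mem_compl.1 hk, rfl⟩
  have hset : graph τ = (setK1 τ)ᶜ.map ⟨fun k => (k, σ k), fun _ _ h => (Prod.mk.inj h).1⟩ :=
    graph_eq hσ
  have e : ∀ g : Fin N × Fin N → ℂ, ∏ q ∈ graph τ, g q = ∏ k ∈ (setK1 τ)ᶜ, g (k, σ k) := fun g => by
    rw [hset, prod_map]; rfl
  rw [integrandF, regularMixed, e, e]
  congr 1
  refine prod_congr rfl fun k hk => ?_
  simp only [mixedFactor]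
  rw [prod_mul_distrib, prod_filter, prod_filter, ← Equiv.prod_comp σ]
  congr 1
  · refine prod_congr rfl fun k' _ => ?_
    rw [pFac, pFac]
    have : (σ k < σ k' ∧ ∀ q' ∈ graph τ, k < q'.1 → σ k' ≠ q'.2) ↔
        σ k < σ k' ∧ (k' ∈ setK1 τ ∨ k' < k) := by
      refine and_congr_right fun hlt => ⟨fun h => ?_, fun h q hq hkq e => ?_⟩
      · by_contra! hc
        refine h _ (hmem k' hc.1) (lt_of_le_of_ne hc.2 ?_) rfl
        rintro rfl
        exact lt_irrefl _ hlt
      · rw [(hgr q hq).2] at e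
        rw [← σ.injective e] at hkq
        rcases h with h | h
        · exact (hgr q hq).1 (σ.injective e ▸ h)
        · exact lt_asymm h hkq
    rw [if_congr this rfl rfl]
    split_ifs
    · congr 1; ring
    · rfl
  · refine prod_congr rfl fun k' _ => ?_
    refine if_congr ⟨fun h => ⟨?_, h.1⟩, fun h => ⟨h.2, fun q hq hkq e => ?_⟩⟩ rfl rfl
    · by_contra hc
      exact h.2 _ (hmem k' hc) h.1 rfl
    · exact (hgr q hq).1 (e ▸ h.1)

lemma integrandI_eq (hτ : ∀ k k', τ k ≠ none → τ k = τ k' → k = k')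
    (hv : ∀ j ∈ setJ1 τ, ∀ k ∈ setK1 τ, rFac Δ (v (.inl j)) (v (.inr k)) ≠ 0) :
    integrandI Δ y x t τ (fun j => v (.inl j)) (fun k => v (.inr k)) =
      ∑ σ ∈ extensions τ, regularMain Δ y x t σ (setK1 τ) v := by
  rw [integrandI, detD_eq_sum hτ, prod_filter_lt_eq_pairProd, prod_filter_lt_eq_pairProd, mul_sum,
    sum_div, sum_mul, sum_mul]
  refine sum_congr rfl fun σ hσ => ?_
  rw [setJ1_eq hσ] at hv ⊢
  have e : (∏ j ∈ (setK1 τ).map σ.toEmbedding, ∏ k ∈ setK1 τ,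
        (v (.inl j) + v (.inr k) - 2 * Δ * v (.inl j) * v (.inr k))) *
      ∏ k ∈ setK1 τ, dKernel Δ (v (.inl (σ k))) (v (.inr k)) =
      (∏ k ∈ setK1 τ, ∏ j ∈ (setK1 τ).erase k, rFac Δ (v (.inl (σ j))) (v (.inr k))) *
        ∏ k ∈ setK1 τ, (1 - v (.inl (σ k)) * v (.inr k))⁻¹ := by
    rw [prod_comm, ← prod_mul_distrib, ← prod_mul_distrib]
    refine prod_congr rfl fun k hk => ?_
    have h0 := hv (σ k) (mem_map_of_mem _ hk) k hk
    rw [prod_map, ← mul_prod_erase _ _ hk]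
    simp only [dKernel, Equiv.coe_toEmbedding]
    rw [rFac] at h0
    simp only [rFac]
    rw [one_div, mul_inv, mul_comm _ (∏ j ∈ _, _), mul_assoc, mul_comm (_ : ℂ)⁻¹, ← mul_assoc (_ + _ - _),
      mul_inv_cancel₀ h0, one_mul]
  have e3 := prod_map (setK1 τ) σ.toEmbedding fun j =>
    v (.inl j) ^ (x - y j - 1) * exp (-(I * t * energy Δ (v (.inl j))))
  rw [mul_left_comm, e, ← mul_assoc, regularMain, e3]
  rfl

end

/-! ### Comparison with the transition function -/

lemma prod_compl_prod_eq_pairProd (K : Finset (Fin N)) (g : Fin N → Fin N → ℂ) (hg : ∀ k, g k k = 1) :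
    ∏ k ∈ Kᶜ, ∏ k', g k k' =
      pairProd univ fun j k => (if k ∈ K then 1 else g k j) * if j ∈ K then 1 else g j k := by
  rw [← prod_prod_erase univ fun j k => if k ∈ K then 1 else g k j, ← prod_mul_prod_compl K]
  rw [prod_eq_one (s := K), one_mul]
  · refine prod_congr rfl fun k hk => ?_
    rw [← mul_prod_erase _ _ (mem_univ k), hg, one_mul]
    refine prod_congr rfl fun j _ => ?_
    rw [if_neg (mem_compl.1 hk)]
  · intro k hk
    exact prod_eq_one fun j _ => if_pos hk

lemma pairProd_eq_univ (K : Finset (Fin N)) (f : Fin N → Fin N → ℂ) :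
    pairProd K f = pairProd univ fun j k => if j ∈ K ∧ k ∈ K then f j k else 1 := by
  rw [pairProd, pairProd, ← prod_mul_prod_compl K]
  rw [prod_eq_one (s := Kᶜ), mul_one]
  · refine prod_congr rfl fun j hj => ?_
    rw [← prod_mul_prod_compl K (fun k => ite (j < k) _ _), prod_eq_one (s := Kᶜ), mul_one]
    · exact prod_congr rfl fun k hk => by simp [hj, hk]
    · exact fun k hk => by simp [mem_compl.1 hk]
  · intro j hj
    exact prod_eq_one fun k _ => by simp [mem_compl.1 hj]

lemma energy_inv (Δ : ℝ) (a : ℂ) : energy Δ a⁻¹ = energy Δ a := by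
  simp only [energy, one_div, inv_inv]; ring

lemma pair_identity {Δ : ℝ} {σ : Perm (Fin N)} {K : Finset (Fin N)} {v : Point N}
    (h0 : ∀ i, v (.inl i) ≠ 0) (hp : ∀ i j, pFac Δ (v (.inl i)) (v (.inl j)) ≠ 0)
    (hr : ∀ i j, rFac Δ (v (.inl i)) (v (.inr j)) ≠ 0) {j k : Fin N} (hjk : j < k) :
    rFac Δ (v (.inl (σ j))) (eta σ K v k) * rFac Δ (v (.inl (σ k))) (eta σ K v j) /
      ((if σ j < σ k then pFac Δ (v (.inl (σ j))) (v (.inl (σ k)))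
        else pFac Δ (v (.inl (σ k))) (v (.inl (σ j)))) * pFac Δ (eta σ K v j) (eta σ K v k)) =
    (if j ∈ K ∧ k ∈ K then
      rFac Δ (v (.inl (σ j))) (v (.inr k)) * rFac Δ (v (.inl (σ k))) (v (.inr j)) /
        ((if σ j < σ k then pFac Δ (v (.inl (σ j))) (v (.inl (σ k)))
          else pFac Δ (v (.inl (σ k))) (v (.inl (σ j)))) * pFac Δ (v (.inr j)) (v (.inr k))) else 1) *
      ((if k ∈ K then 1 else mixedFactor Δ σ K v k j) * if j ∈ K then 1 else mixedFactor Δ σ K v j k) := by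
  have h1 := h0 (σ j)
  have h2 := h0 (σ k)
  have h3 := hp (σ j) (σ k)
  have h4 := hp (σ k) (σ j)
  have h5 := hr (σ j) k
  have h6 := hr (σ k) j
  have hne : σ j ≠ σ k := fun e => hjk.ne (σ.injective e)
  by_cases hj : j ∈ K <;> by_cases hk : k ∈ K
  · simp [eta, hj, hk]
  · simp only [eta, hj, hk, mixedFactor, hjk.not_gt, if_true, if_false, and_false, true_or,
      and_true, mul_one, one_mul, pFac_inv_right Δ h2, rFac_inv Δ h2]
    rcases lt_or_gt_of_ne hne with h | h
    · simp only [h, h.not_gt, if_true, if_false]; field_simp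
    · simp only [h, h.not_gt, if_true, if_false]; field_simp
  · have h7 : pFac Δ (v (.inl (σ j)))⁻¹ (v (.inr k)) =
        (v (.inl (σ j)) + v (.inr k) - 2 * Δ) / v (.inl (σ j)) := by
      rw [pFac]; field_simp
    simp only [eta, hj, hk, mixedFactor, hjk, if_true, if_false, false_and, or_true, true_or,
      and_true, mul_one, one_mul, h7, rFac_inv Δ h1]
    generalize v (.inl (σ j)) + v (.inr k) - 2 * Δ = D
    by_cases hD : D = 0
    · simp [hD]
    · rcases lt_or_gt_of_ne hne with h | h
      · simp only [h, if_true]; field_simp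
      · simp only [h.not_gt, if_false]; field_simp
  · simp only [eta, hj, hk, mixedFactor, hjk, hjk.not_gt, if_false, and_false, or_true, or_false, and_true, mul_one, one_mul, rFac_inv Δ h1, rFac_inv Δ h2, pFac_inv_inv Δ h1 h2]
    rcases lt_or_gt_of_ne hne with h | h
    · simp only [h, h.not_gt, if_true, if_false]; field_simp
    · simp only [h, h.not_gt, if_true, if_false]; field_simp

lemma theta_eq_regular {Δ : ℝ} {y : Fin N → ℤ} {x : ℤ} {t : ℝ} {σ : Perm (Fin N)}
    {K : Finset (Fin N)} {v : Point N}
    (h0 : ∀ i, v i ≠ 0) (hp : ∀ i j, pFac Δ (v (.inl i)) (v (.inl j)) ≠ 0)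
    (hr : ∀ i j, rFac Δ (v (.inl i)) (v (.inr j)) ≠ 0) :
    theta Δ y y x t σ K v = (∏ k ∈ Kᶜ, (v (.inr k))⁻¹) * regular Δ y x t σ K v := by
  have e1 : (∏ k, ∏ j ∈ univ.erase (σ k), rFac Δ (v (.inl j)) (eta σ K v k)) =
      pairProd univ fun j k => rFac Δ (v (.inl (σ j))) (eta σ K v k) *
        rFac Δ (v (.inl (σ k))) (eta σ K v j) := by
    rw [← prod_prod_erase]
    refine prod_congr rfl fun k _ => ?_
    have := map_erase σ.toEmbedding univ k
    rw [map_univ_equiv] at this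
    change _ = univ.erase (σ k) at this
    rw [← this, prod_map]
    rfl
  have e2 := pairProd_map_perm (σ := σ) univ fun j j' => pFac Δ (v (.inl j)) (v (.inl j'))
  rw [map_univ_equiv] at e2
  have e3 : (∏ k, ∏ j ∈ univ.erase (σ k), rFac Δ (v (.inl j)) (eta σ K v k)) /
      (pairProd univ (fun j j' => pFac Δ (v (.inl j)) (v (.inl j'))) *
        pairProd univ (fun k k' => pFac Δ (eta σ K v k) (eta σ K v k'))) =
      (∏ k ∈ K, ∏ j ∈ K.erase k, rFac Δ (v (.inl (σ j))) (v (.inr k))) /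
        (pairProd (K.map σ.toEmbedding) (fun j k => pFac Δ (v (.inl j)) (v (.inl k))) *
          pairProd K fun j k => pFac Δ (v (.inr j)) (v (.inr k))) *
      ∏ k ∈ Kᶜ, ∏ k', mixedFactor Δ σ K v k k' := by
    rw [e1, e2, ← pairProd_mul, ← pairProd_div, prod_prod_erase, pairProd_map_perm, ← pairProd_mul,
      ← pairProd_div, prod_compl_prod_eq_pairProd _ _ fun k => by simp [mixedFactor], pairProd_eq_univ K,
      ← pairProd_mul]
    exact pairProd_congr fun j _ k _ hjk => pair_identity (fun i => h0 _) hp hr hjk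
  have e4 : (∏ j, v (.inl j) ^ (x - y j - 1) * exp (-(I * t * energy Δ (v (.inl j))))) *
      (∏ k, eta σ K v k ^ (x - y k) * exp (I * t * energy Δ (eta σ K v k)) *
        (v (.inr k))⁻¹) =
      (∏ k ∈ K, v (.inl (σ k)) ^ (x - y (σ k) - 1) *
        exp (-(I * t * energy Δ (v (.inl (σ k)))))) *
      (∏ k ∈ K, v (.inr k) ^ (x - y k - 1) * exp (I * t * energy Δ (v (.inr k)))) *
      ((∏ k ∈ Kᶜ, v (.inl (σ k)) ^ (y k - y (σ k) - 1)) * ∏ k ∈ Kᶜ, (v (.inr k))⁻¹) := by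
    rw [← Equiv.prod_comp σ, ← prod_mul_distrib, ← prod_mul_prod_compl K, ← prod_mul_distrib,
      ← prod_mul_distrib]
    congr 1
    · refine prod_congr rfl fun k hk => ?_
      rw [eta, if_pos hk, zpow_sub_one₀ (h0 (.inr k))]
      ring
    · refine prod_congr rfl fun k hk => ?_
      have h1 := h0 (.inl (σ k))
      have e5 : v (.inl (σ k)) ^ (y k - y (σ k) - 1) =
          v (.inl (σ k)) ^ (x - y (σ k) - 1) * (v (.inl (σ k)))⁻¹ ^ (x - y k) := by
        rw [inv_zpow', ← zpow_add₀ h1]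
        congr 1; ring
      rw [eta, if_neg (mem_compl.1 hk), energy_inv, e5, Complex.exp_neg]
      have h2 := Complex.exp_ne_zero (I * t * energy Δ (v (.inl (σ k))))
      field_simp
  rw [theta, amplitude, regular, regularMain, regularMixed, mul_assoc _ (∏ j, _) (∏ k, _), e4]
  rw [mul_div_right_comm, mul_div_assoc, e3]
  ring

/-- The terms of the series and those of the transition function correspond. -/
lemma sum_maps_sum_extensions (F : Perm (Fin N) → Finset (Fin N) → ℂ) :
    ∑ n ∈ range (N + 1), ∑ τ ∈ maps N n, ∑ σ ∈ extensions τ, F σ (setK1 τ) =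
      ∑ K ∈ (univ : Finset (Fin N)).powerset, ∑ σ, F σ K := by
  have e1 : ∀ n ∈ range (N + 1), ∑ τ ∈ maps N n, ∑ σ ∈ extensions τ, F σ (setK1 τ) =
      ∑ τ ∈ univ.filter (fun τ : Fin N → Option (Fin N) => ∀ j : Fin N, (univ.filter fun k => τ k = some j).card ≤ 1) with
        (setK1 τ).card = n, ∑ σ ∈ extensions τ, F σ (setK1 τ) := by
    intro n _
    refine sum_congr ?_ fun _ _ => rfl
    ext τ
    rw [maps, mem_filter, mem_filter, mem_filter, setK1]
    tauto
  rw [sum_congr rfl e1, sum_fiberwise_of_maps_to fun τ _ =>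
    mem_range.2 (Nat.lt_succ_of_le ((card_le_univ _).trans (Fintype.card_fin N).le)), sum_sigma',
    ← sum_product']
  symm
  refine sum_bij (fun p _ => ⟨fun k => if k ∈ p.1 then none else some (p.2 k), p.2⟩)
    (fun p _ => ?_) (fun p _ q _ e => ?_) (fun ⟨τ, σ⟩ h => ?_) fun p _ => ?_
  · refine mem_sigma.2 ⟨mem_filter.2 ⟨mem_univ _, fun j => card_le_one.2 fun a ha b hb => ?_⟩,
      mem_filter.2 ⟨mem_univ _, fun k => ?_⟩⟩
    · have ha := (mem_filter.1 ha).2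
      have hb := (mem_filter.1 hb).2
      dsimp only at ha hb
      split_ifs at ha hb
      exact p.2.injective (Option.some.inj (ha.trans hb.symm))
    · by_cases hk : k ∈ p.1
      · exact .inl (if_pos hk)
      · exact .inr (if_neg hk)
  · obtain ⟨e1, e2⟩ := Sigma.mk.inj e
    refine Prod.ext ?_ (eq_of_heq e2)
    ext k
    have := congrFun e1 k
    by_cases h1 : k ∈ p.1 <;> by_cases h2 : k ∈ q.1 <;> simp_all
  · obtain ⟨h1, h2⟩ := mem_sigma.1 h
    refine ⟨(setK1 τ, σ), mem_product.2 ⟨mem_powerset.2 (subset_univ _), mem_univ _⟩, ?_⟩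
    refine Sigma.ext (funext fun k => ?_) HEq.rfl
    by_cases hk : k ∈ setK1 τ
    · exact (if_pos hk).trans (mem_setK1.1 hk).symm
    · exact (if_neg hk).trans (apply_of_mem_extensions h2 hk).symm
  · congr 1
    ext k
    rw [mem_setK1]
    by_cases hk : k ∈ p.1 <;> simp [hk]

/-! ### Deformation of paths in convex regions -/

/-- The pieces of the contour join to a path from `a` to `b`. -/
def IsPath : Contour → ℂ → ℂ → Prop
  | [], a, b => a = b
  | γ :: Γ, a, b => ContDiff ℝ 1 γ ∧ γ 0 = a ∧ IsPath Γ (γ 1) b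

lemma pieceIntegral_eq_sub {S : Set ℂ} {F g : ℂ → ℂ} (hF : ContinuousOn F S)
    (hg : ∀ a ∈ S, HasDerivWithinAt g (F a) S a) {γ : ℝ → ℂ} (hγ : ContDiff ℝ 1 γ)
    (hS : γ '' Set.Icc (0 : ℝ) 1 ⊆ S) : pieceIntegral γ F = g (γ 1) - g (γ 0) := by
  have hd : ∀ s ∈ Set.Icc (0 : ℝ) 1,
      HasDerivWithinAt (fun s => g (γ s)) (F (γ s) * deriv γ s) (Set.Icc 0 1) s := fun s hs => by
    have := (hg _ (hS ⟨s, hs, rfl⟩)).scomp (t' := S) s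
      (hγ.differentiable one_ne_zero s).hasDerivAt.hasDerivWithinAt (s := Set.Icc (0 : ℝ) 1)
      fun u hu => hS ⟨u, hu, rfl⟩
    rwa [smul_eq_mul, mul_comm] at this
  exact intervalIntegral.integral_eq_sub_of_hasDeriv_right_of_le zero_le_one
    (fun s hs => (hd s hs).continuousWithinAt)
    (fun s hs => ((hd s (Set.Ioo_subset_Icc_self hs)).hasDerivAt (Icc_mem_nhds hs.1 hs.2)).hasDerivWithinAt)
    (intervalIntegrable_piece hγ (hF.mono hS))

lemma contourIntegral_eq_sub {S : Set ℂ} {F g : ℂ → ℂ} (hF : ContinuousOn F S)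
    (hg : ∀ a ∈ S, HasDerivWithinAt g (F a) S a) {Γ : Contour} {a b : ℂ} (hΓ : IsPath Γ a b)
    (hS : trace Γ ⊆ S) :
    contourIntegral Γ F = (2 * pi * I)⁻¹ * (g b - g a) := by
  induction Γ generalizing a with
  | nil => rw [show a = b from hΓ, contourIntegral_nil, sub_self, mul_zero]
  | cons γ Γ ih =>
    obtain ⟨h1, h2, h3⟩ := hΓ
    rw [trace_cons] at hS
    rw [contourIntegral_cons, pieceIntegral_eq_sub hF hg h1 (Set.subset_union_left.trans hS),
      ih h3 (Set.subset_union_right.trans hS), h2]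
    ring

/-- The integrals along two paths in a convex region agree. -/
lemma contourIntegral_eq_of_isPath {S : Set ℂ} (hS : Convex ℝ S) {F : ℂ → ℂ}
    (hF : DifferentiableOn ℂ F S) {Γ Γ' : Contour} {a b : ℂ} (h : IsPath Γ a b) (h' : IsPath Γ' a b)
    (hΓ : trace Γ ⊆ S) (hΓ' : trace Γ' ⊆ S) : contourIntegral Γ F = contourIntegral Γ' F := by
  obtain ⟨g, hg⟩ := hS.exists_forall_hasDerivWithinAt hF
  rw [contourIntegral_eq_sub hF.continuousOn hg h hΓ, contourIntegral_eq_sub hF.continuousOn hg h' hΓ']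

/-! ### Arcs -/

lemma arc_apply (c : ℂ) (r α β s : ℝ) : arc c r α β s = circleMap c r (α + s * (β - α)) := by
  simp only [arc, circleMap]
  congr 3
  push_cast; ring

lemma arc_zero (c : ℂ) (r α β : ℝ) : arc c r α β 0 = circleMap c r α := by
  rw [arc_apply]; congr 1; ring

lemma arc_one (c : ℂ) (r α β : ℝ) : arc c r α β 1 = circleMap c r β := by
  rw [arc_apply]; congr 1; ring

lemma segment_zero (a b : ℂ) : segment a b 0 = a := by simp [segment]

lemma segment_one (a b : ℂ) : segment a b 1 = b := by simp [segment]

lemma pieceIntegral_arc (c : ℂ) (r α β : ℝ) (F : ℂ → ℂ) :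
    pieceIntegral (arc c r α β) F = ∫ θ in α..β, F (circleMap c r θ) * deriv (circleMap c r) θ := by
  have hd : ∀ s : ℝ, deriv (arc c r α β) s =
      (β - α : ℝ) • deriv (circleMap c r) (α + s * (β - α)) := by
    intro s
    rw [show arc c r α β = fun s => circleMap c r (α + s * (β - α)) from funext (arc_apply c r α β)]
    have hin : HasDerivAt (fun s : ℝ => α + s * (β - α)) (β - α) s := by
      simpa using ((hasDerivAt_id s).mul_const (β - α)).const_add α
    exact ((hasDerivAt_circleMap c r (α + s * (β - α))).scomp s hin).deriv.trans
      (congrArg _ (deriv_circleMap c r _).symm)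
  rw [pieceIntegral]
  simp only [hd, arc_apply]
  have := intervalIntegral.smul_integral_comp_add_mul (a := 0) (b := 1)
    (fun θ => F (circleMap c r θ) * deriv (circleMap c r) θ) (β - α) α
  rw [mul_zero, mul_one, add_zero, add_sub_cancel] at this
  rw [← this, ← integral_smul]
  refine integral_congr fun s _ => ?_
  simp only [Complex.real_smul, mul_comm s]
  ring

lemma contourIntegral_singleton (γ : ℝ → ℂ) (F : ℂ → ℂ) :
    contourIntegral [γ] F = (2 * pi * I)⁻¹ * pieceIntegral γ F := by
  rw [contourIntegral_cons, contourIntegral_nil, add_zero]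

lemma contourIntegral_arc_add {r : ℝ} (hr : 0 ≤ r) {F : ℂ → ℂ} (hF : ContinuousOn F {z | ‖z‖ = r})
    (α β γ : ℝ) : contourIntegral [arc 0 r α β] F + contourIntegral [arc 0 r β γ] F =
      contourIntegral [arc 0 r α γ] F := by
  have hi : ∀ a b, IntervalIntegrable
      (fun θ => F (circleMap 0 r θ) * deriv (circleMap 0 r) θ) MeasureTheory.volume a b := by
    intro a b
    refine ContinuousOn.intervalIntegrable (ContinuousOn.mul ?_ ?_)
    · exact hF.comp (continuous_circleMap 0 r).continuousOn fun θ _ => by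
        simp [abs_of_nonneg hr]
    · have : deriv (circleMap 0 r) = fun θ => circleMap 0 r θ * I := by
        funext θ; rw [deriv_circleMap]
      rw [this]
      exact ((continuous_circleMap 0 r).mul continuous_const).continuousOn
  simp only [contourIntegral_singleton, pieceIntegral_arc]
  rw [← mul_add, intervalIntegral.integral_add_adjacent_intervals (hi _ _) (hi _ _)]

lemma contourIntegral_arc_two_pi (r α : ℝ) (F : ℂ → ℂ) :
    contourIntegral [arc 0 r α (α + 2 * pi)] F = contourIntegral (circ r) F := by
  rw [circ, contourIntegral_singleton, contourIntegral_singleton, pieceIntegral_arc, pieceIntegral_arc]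
  have hp : Function.Periodic (fun θ => F (circleMap 0 r θ) * deriv (circleMap 0 r) θ) (2 * pi) := by
    intro θ
    simp only [deriv_circleMap, periodic_circleMap 0 r θ]
  have := hp.intervalIntegral_add_eq α 0
  rw [zero_add] at this
  rw [this]

/-! ### Point reflection of contours -/

lemma contourIntegral_neg (Γ : Contour) (F : ℂ → ℂ) :
    contourIntegral (Γ.map fun γ s => -γ s) F = -contourIntegral Γ fun z => F (-z) := by
  induction Γ with
  | nil => simp [contourIntegral_nil]
  | cons γ Γ ih =>
    rw [List.map_cons, contourIntegral_cons, contourIntegral_cons, ih, neg_add, ← mul_neg]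
    congr 2
    rw [pieceIntegral, pieceIntegral, ← intervalIntegral.integral_neg]
    refine integral_congr fun s _ => ?_
    simp only [deriv.fun_neg, mul_neg]

lemma trace_neg (Γ : Contour) : trace (Γ.map fun γ s => -γ s) = {z | -z ∈ trace Γ} := by
  ext z
  simp only [trace, List.mem_map, Set.mem_ofPred_eq]
  constructor
  · rintro ⟨_, ⟨γ, hγ, rfl⟩, s, hs, rfl⟩
    exact ⟨γ, hγ, s, hs, by simp⟩
  · rintro ⟨γ, hγ, s, hs, e⟩
    exact ⟨_, ⟨γ, hγ, rfl⟩, s, hs, by simp [e]⟩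

lemma contourIntegral_circ_neg (r : ℝ) (F : ℂ → ℂ) :
    contourIntegral (circ r) (fun z => F (-z)) = -contourIntegral (circ r) F := by
  rw [← contourIntegral_arc_two_pi r pi F]
  have : [arc 0 r pi (pi + 2 * pi)] = (circ r).map fun γ s => -γ s := by
    simp only [circ, List.map_cons, List.map_nil, List.cons.injEq, and_true]
    funext s
    rw [arc_apply, arc_apply, circleMap_zero, circleMap_zero, ← mul_neg, ← neg_one_mul (exp _),
      ← Complex.exp_pi_mul_I, ← Complex.exp_add]
    congr 2
    push_cast; ring
  rw [this, contourIntegral_neg, neg_neg]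

/-! ### The contours `Γ_+` and `Γ_-` -/

lemma image_segment_subset {S : Set ℂ} (hS : Convex ℝ S) {a b : ℂ} (ha : a ∈ S) (hb : b ∈ S) :
    segment a b '' Set.Icc (0 : ℝ) 1 ⊆ S := by
  rintro _ ⟨s, hs, rfl⟩
  have := hS.add_smul_sub_mem ha hb hs
  rwa [Complex.real_smul] at this

lemma image_arc_subset {S : Set ℂ} {c : ℂ} {r α β : ℝ} (hαβ : α ≤ β)
    (h : ∀ θ, α ≤ θ → θ ≤ β → circleMap c r θ ∈ S) : arc c r α β '' Set.Icc (0 : ℝ) 1 ⊆ S := by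
  rintro _ ⟨s, hs, rfl⟩
  rw [arc_apply]
  exact h _ (by nlinarith [hs.1]) (by nlinarith [hs.2])

lemma convex_re_im (α β γ : ℝ) : Convex ℝ {z : ℂ | α * z.re + β * z.im ≤ γ} := by
  intro z hz w hw a b ha hb hab
  simp only [Set.mem_ofPred_eq] at hz hw
  simp only [Set.mem_ofPred_eq, Complex.add_re, Complex.add_im, Complex.real_smul, Complex.mul_re,
    Complex.mul_im, Complex.ofReal_re, Complex.ofReal_im, zero_mul, sub_zero, add_zero]
  have : γ = a * γ + b * γ := by rw [← add_mul, hab, one_mul]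
  nlinarith

lemma convex_norm_le (ρ : ℝ) : Convex ℝ {z : ℂ | ‖z‖ ≤ ρ} := by
  have : {z : ℂ | ‖z‖ ≤ ρ} = Metric.closedBall 0 ρ := by ext z; simp
  rw [this]
  exact convex_closedBall 0 ρ

lemma re_circleMap (ρ θ : ℝ) : (circleMap 0 ρ θ).re = ρ * Real.cos θ := by
  simp [circleMap, Complex.exp_ofReal_mul_I_re]

lemma im_circleMap (ρ θ : ℝ) : (circleMap 0 ρ θ).im = ρ * Real.sin θ := by
  simp [circleMap, Complex.exp_ofReal_mul_I_im]

section
variable {ρ h : ℝ} (hh : 0 < h) (hρ : h < ρ)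
include hh hρ

lemma mul_sin_arcsin : ρ * Real.sin (arcsin (h / ρ)) = h := by
  have : 0 < ρ := hh.trans hρ
  rw [Real.sin_arcsin ((by norm_num : (-1 : ℝ) ≤ 0).trans (by positivity)) ((div_le_one this).2 hρ.le)]
  field_simp

lemma mul_cos_arcsin : ρ * Real.cos (arcsin (h / ρ)) = sqrt (ρ ^ 2 - h ^ 2) := by
  have : 0 < ρ := hh.trans hρ
  rw [Real.cos_arcsin, ← Real.sqrt_sq this.le, ← Real.sqrt_mul (sq_nonneg _), Real.sqrt_sq this.le]
  congr 1
  field_simp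

lemma arcsin_pos : 0 < arcsin (h / ρ) := Real.arcsin_pos.2 (div_pos hh (hh.trans hρ))

lemma arcsin_lt : arcsin (h / ρ) < pi / 2 :=
  Real.arcsin_lt_pi_div_two.2 ((div_lt_one (hh.trans hρ)).2 hρ)

lemma circleMap_arcsin : circleMap 0 ρ (arcsin (h / ρ)) =
    sqrt (ρ ^ 2 - h ^ 2) + h * I := by
  apply Complex.ext
  · rw [re_circleMap, mul_cos_arcsin hh hρ]; simp
  · rw [im_circleMap, mul_sin_arcsin hh hρ]; simp

lemma circleMap_pi_sub_arcsin : circleMap 0 ρ (pi - arcsin (h / ρ)) =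
    -sqrt (ρ ^ 2 - h ^ 2) + h * I := by
  apply Complex.ext
  · rw [re_circleMap, Real.cos_pi_sub, mul_neg, mul_cos_arcsin hh hρ]; simp
  · rw [im_circleMap, Real.sin_pi_sub, mul_sin_arcsin hh hρ]; simp

lemma circleMap_pi_add_arcsin : circleMap 0 ρ (pi + arcsin (h / ρ)) =
    -sqrt (ρ ^ 2 - h ^ 2) - h * I := by
  apply Complex.ext
  · rw [re_circleMap, add_comm, Real.cos_add_pi, mul_neg, mul_cos_arcsin hh hρ]; simp
  · rw [im_circleMap, add_comm, Real.sin_add_pi, mul_neg, mul_sin_arcsin hh hρ]; simp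

lemma circleMap_two_pi_sub_arcsin : circleMap 0 ρ (2 * pi - arcsin (h / ρ)) =
    sqrt (ρ ^ 2 - h ^ 2) - h * I := by
  apply Complex.ext
  · rw [re_circleMap, Real.cos_two_pi_sub, mul_cos_arcsin hh hρ]; simp
  · rw [im_circleMap, Real.sin_two_pi_sub, mul_neg, mul_sin_arcsin hh hρ]; simp

lemma circleMap_two_pi_add_arcsin : circleMap 0 ρ (2 * pi + arcsin (h / ρ)) =
    sqrt (ρ ^ 2 - h ^ 2) + h * I := by
  rw [add_comm, periodic_circleMap, circleMap_arcsin hh hρ]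

lemma im_circleMap_ge {θ : ℝ} (h1 : arcsin (h / ρ) ≤ θ) (h2 : θ ≤ pi - arcsin (h / ρ)) :
    h ≤ (circleMap 0 ρ θ).im := by
  have h0 := arcsin_pos hh hρ
  have h3 := arcsin_lt hh hρ
  rw [im_circleMap]
  nth_rewrite 1 [← mul_sin_arcsin hh hρ]
  refine mul_le_mul_of_nonneg_left ?_ (hh.trans hρ).le
  rcases le_total θ (pi / 2) with h4 | h4
  · exact Real.sin_le_sin_of_le_of_le_pi_div_two (by linarith) h4 h1
  · rw [← Real.sin_pi_sub θ]
    exact Real.sin_le_sin_of_le_of_le_pi_div_two (by linarith) (by linarith) (by linarith)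

lemma re_circleMap_ge {θ : ℝ} (h1 : -arcsin (h / ρ) ≤ θ) (h2 : θ ≤ arcsin (h / ρ)) :
    sqrt (ρ ^ 2 - h ^ 2) ≤ (circleMap 0 ρ θ).re := by
  have h0 := arcsin_pos hh hρ
  have h3 := arcsin_lt hh hρ
  rw [re_circleMap, ← mul_cos_arcsin hh hρ]
  refine mul_le_mul_of_nonneg_left ?_ (hh.trans hρ).le
  rw [← Real.cos_abs θ]
  exact Real.cos_le_cos_of_nonneg_of_le_pi (abs_nonneg _) (by linarith) (abs_le.2 ⟨by linarith, h2⟩)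

end

lemma circleMap_sub_pi (ρ θ : ℝ) : circleMap 0 ρ (θ - pi) = -circleMap 0 ρ θ := by
  apply Complex.ext
  · rw [Complex.neg_re, re_circleMap, re_circleMap, Real.cos_sub_pi, mul_neg]
  · rw [Complex.neg_im, im_circleMap, im_circleMap, Real.sin_sub_pi, mul_neg]

/-- The region swept when `Γ_+` is deformed to the circle. -/
def wedge (ρ : ℝ) : Set ℂ :=
  {z | ‖z‖ ≤ ρ ∧ (‖z‖ = ρ ∨ 1 ≤ z.im ∧ (|z.re| ≤ 2 * (z.im - 1) ∨ 3 / 2 ≤ z.im))}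

/-- The region of `wedge` near `i`. -/
def wedgeTip : Set ℂ :=
  {z | 0 * z.re + 1 * z.im ≤ 3 / 2} ∩ ({z | 1 * z.re + (-2) * z.im ≤ -2} ∩
    {z | (-1) * z.re + (-2) * z.im ≤ -2})

/-- The part of a disc above a horizontal line. -/
def capSet (ρ h : ℝ) : Set ℂ := {z | 0 * z.re + (-1) * z.im ≤ -h} ∩ {z | ‖z‖ ≤ ρ}

lemma convex_wedgeTip : Convex ℝ wedgeTip :=
  (convex_re_im _ _ _).inter ((convex_re_im _ _ _).inter (convex_re_im _ _ _))

lemma convex_capSet (ρ h : ℝ) : Convex ℝ (capSet ρ h) := (convex_re_im _ _ _).inter (convex_norm_le _)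

lemma mem_capSet {ρ h : ℝ} {z : ℂ} : z ∈ capSet ρ h ↔ h ≤ z.im ∧ ‖z‖ ≤ ρ := by
  simp [capSet]

lemma mem_wedgeTip {z : ℂ} : z ∈ wedgeTip ↔ z.im ≤ 3 / 2 ∧ |z.re| ≤ 2 * (z.im - 1) := by
  simp only [wedgeTip, Set.mem_inter_iff, Set.mem_ofPred_eq, abs_le]
  constructor
  · rintro ⟨h1, h2, h3⟩; exact ⟨by linarith, by linarith, by linarith⟩
  · rintro ⟨h1, h2, h3⟩; exact ⟨by linarith, by linarith, by linarith⟩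

lemma exp_pi_div_six : exp (I * pi / 6) = (sqrt 3 / 2 : ℝ) + (1 / 2 : ℝ) * I := by
  rw [show I * pi / 6 = ((pi / 6 : ℝ) : ℂ) * I by push_cast; ring,
    Complex.exp_mul_I, ← Complex.ofReal_cos, ← Complex.ofReal_sin, Real.cos_pi_div_six, Real.sin_pi_div_six]

lemma exp_five_pi_div_six : exp (5 * I * pi / 6) =
    (-(sqrt 3 / 2) : ℝ) + (1 / 2 : ℝ) * I := by
  rw [show 5 * I * pi / 6 = ((pi - pi / 6 : ℝ) : ℂ) * I by push_cast; ring,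
    Complex.exp_mul_I, ← Complex.ofReal_cos, ← Complex.ofReal_sin, Real.cos_pi_sub, Real.sin_pi_sub,
    Real.cos_pi_div_six, Real.sin_pi_div_six]

section
variable {ρ : ℝ} (hρ : 2 < ρ)
include hρ

lemma wedgeTip_subset : wedgeTip ⊆ wedge ρ := by
  intro z hz
  rw [mem_wedgeTip] at hz
  refine ⟨?_, .inr ⟨?_, .inl hz.2⟩⟩
  · have h1 := sq_norm z
    rw [normSq_apply] at h1
    have h2 := abs_le.1 hz.2
    have h3 := abs_nonneg z.re
    have : ‖z‖ ^ 2 ≤ 2 ^ 2 := by nlinarith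
    linarith [abs_le_of_sq_le_sq this (by norm_num), le_abs_self ‖z‖]
  · linarith [abs_nonneg z.re, hz.2]

omit hρ in
lemma capSet_subset : capSet ρ (3 / 2) ⊆ wedge ρ := fun z hz => by
  rw [mem_capSet] at hz
  exact ⟨hz.2, .inr ⟨by linarith [hz.1], .inr hz.1⟩⟩

lemma gammaPlus_pieces : ∃ P A B Q : ℂ, ∃ a : ℝ,
    gammaPlus ρ = [segment P A, segment A I, segment I B, segment B Q,
      arc 0 ρ (pi - a) (2 * pi + a)] ∧
    P ∈ capSet ρ (3 / 2) ∧ Q ∈ capSet ρ (3 / 2) ∧ A ∈ capSet ρ (3 / 2) ∧ B ∈ capSet ρ (3 / 2) ∧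
    A ∈ wedgeTip ∧ B ∈ wedgeTip ∧ circleMap 0 ρ a = P ∧ circleMap 0 ρ (pi - a) = Q ∧
    0 < a ∧ a < pi / 2 ∧
    ∀ θ, a ≤ θ → θ ≤ pi - a → circleMap 0 ρ θ ∈ capSet ρ (3 / 2) := by
  have h0 : (0 : ℝ) < 3 / 2 := by norm_num
  have h1 : (3 / 2 : ℝ) < ρ := by linarith
  have e1 : 3 / (2 * ρ) = 3 / 2 / ρ := by ring
  have e2 : ρ ^ 2 - 9 / 4 = ρ ^ 2 - (3 / 2) ^ 2 := by norm_num
  have hs := Real.sq_sqrt (show (0 : ℝ) ≤ 3 by norm_num)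
  have hs0 := Real.sqrt_nonneg 3
  have hs2 : sqrt 3 ≤ 2 := by nlinarith
  have hnorm : ∀ θ, ‖circleMap 0 ρ θ‖ ≤ ρ := fun θ => by
    simp [abs_of_pos (by linarith : 0 < ρ)]
  have hcap : ∀ θ, arcsin (3 / (2 * ρ)) ≤ θ → θ ≤ pi - arcsin (3 / (2 * ρ)) →
      circleMap 0 ρ θ ∈ capSet ρ (3 / 2) := fun θ h2 h3 => by
    rw [e1] at h2 h3
    exact mem_capSet.2 ⟨im_circleMap_ge h0 h1 h2 h3, hnorm θ⟩
  have ha := arcsin_pos h0 h1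
  have ha' := arcsin_lt h0 h1
  rw [← e1] at ha ha'
  have hP : circleMap 0 ρ (arcsin (3 / (2 * ρ))) =
      sqrt (ρ ^ 2 - 9 / 4) + 3 / 2 * I := by
    rw [e1, e2, circleMap_arcsin h0 h1]; norm_num
  have hQ : circleMap 0 ρ (pi - arcsin (3 / (2 * ρ))) =
      -sqrt (ρ ^ 2 - 9 / 4) + 3 / 2 * I := by
    rw [e1, e2, circleMap_pi_sub_arcsin h0 h1]; norm_num
  have tip : ∀ s : ℝ, |s| = sqrt 3 / 2 →
      (I + ((s : ℝ) + (1 / 2 : ℝ) * I)) ∈ wedgeTip := fun s h => by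
    rw [mem_wedgeTip]
    simp
    constructor
    · norm_num
    · rw [h]; linarith
  have cap : ∀ s : ℝ, |s| = sqrt 3 / 2 →
      (I + ((s : ℝ) + (1 / 2 : ℝ) * I)) ∈ capSet ρ (3 / 2) := fun s h => by
    have h2 := (wedgeTip_subset hρ (tip s h)).1
    refine mem_capSet.2 ⟨?_, h2⟩
    simp; norm_num
  have p1 : |sqrt 3 / 2| = sqrt 3 / 2 := abs_of_nonneg (by positivity)
  have p2 : |-(sqrt 3 / 2)| = sqrt 3 / 2 := by rw [abs_neg, p1]
  refine ⟨_, _, _, _, _, rfl, ?_, ?_, ?_, ?_, ?_, ?_, hP, hQ, ha, ha', hcap⟩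
  · rw [← hP]; exact hcap _ le_rfl (by linarith)
  · rw [← hQ]; exact hcap _ (by linarith) le_rfl
  · rw [exp_pi_div_six]; exact cap _ p1
  · rw [exp_five_pi_div_six]; exact cap _ p2
  · rw [exp_pi_div_six]; exact tip _ p1
  · rw [exp_five_pi_div_six]; exact tip _ p2

omit hρ in
lemma I_mem_wedgeTip : I ∈ wedgeTip := by rw [mem_wedgeTip]; norm_num

lemma trace_gammaPlus : trace (gammaPlus ρ) ⊆ wedge ρ := by
  obtain ⟨P, A, B, Q, a, e, hP, hQ, hA, hB, hA', hB', -, -, ha0, ha, -⟩ := gammaPlus_pieces hρ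
  rw [e]
  simp only [trace_cons, trace_nil, Set.union_empty, Set.union_subset_iff]
  refine ⟨(image_segment_subset (convex_capSet _ _) hP hA).trans capSet_subset,
    (image_segment_subset convex_wedgeTip hA' I_mem_wedgeTip).trans (wedgeTip_subset hρ),
    (image_segment_subset convex_wedgeTip I_mem_wedgeTip hB').trans (wedgeTip_subset hρ),
    (image_segment_subset (convex_capSet _ _) hB hQ).trans capSet_subset,
    image_arc_subset (by linarith [Real.pi_pos]) fun θ _ _ => ?_⟩
  have : ‖circleMap 0 ρ θ‖ = ρ := by simp [abs_of_pos (by linarith : 0 < ρ)]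
  exact ⟨this.le, .inl this⟩

omit hρ in
lemma isSmooth_gammaPlus : IsSmooth (gammaPlus ρ) := by
  simp only [gammaPlus, isSmooth_cons, contDiff_segment, contDiff_arc, isSmooth_nil, and_self]

lemma contourIntegral_gammaPlus {F : ℂ → ℂ} (hF : DifferentiableOn ℂ F (wedge ρ)) :
    contourIntegral (gammaPlus ρ) F = contourIntegral (circ ρ) F := by
  obtain ⟨P, A, B, Q, a, e, hP, hQ, hA, hB, hA', hB', eP, eQ, ha, ha', hcap⟩ := gammaPlus_pieces hρ
  have h1 : contourIntegral [segment A I, segment I B] F = contourIntegral [segment A B] F := by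
    refine contourIntegral_eq_of_isPath convex_wedgeTip (a := A) (b := B)
      (hF.mono (wedgeTip_subset hρ)) ?_ ?_ ?_ ?_
    · simp [IsPath, segment_zero, segment_one, contDiff_segment]
    · simp [IsPath, segment_zero, segment_one, contDiff_segment]
    · simp only [trace_cons, trace_nil, Set.union_empty, Set.union_subset_iff]
      exact ⟨image_segment_subset convex_wedgeTip hA' I_mem_wedgeTip,
        image_segment_subset convex_wedgeTip I_mem_wedgeTip hB'⟩
    · simp only [trace_cons, trace_nil, Set.union_empty]
      exact image_segment_subset convex_wedgeTip hA' hB'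
  have h2 : contourIntegral [segment P A, segment A B, segment B Q] F =
      contourIntegral [arc 0 ρ a (pi - a)] F := by
    refine contourIntegral_eq_of_isPath (convex_capSet ρ (3 / 2)) (a := P) (b := Q)
      (hF.mono capSet_subset) ?_ ?_ ?_ ?_
    · simp [IsPath, segment_zero, segment_one, contDiff_segment]
    · simp [IsPath, arc_zero, arc_one, contDiff_arc, eP, eQ]
    · simp only [trace_cons, trace_nil, Set.union_empty, Set.union_subset_iff]
      exact ⟨image_segment_subset (convex_capSet _ _) hP hA,
        image_segment_subset (convex_capSet _ _) hA hB, image_segment_subset (convex_capSet _ _) hB hQ⟩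
    · simp only [trace_cons, trace_nil, Set.union_empty]
      exact image_arc_subset (by linarith) hcap
  have hc : ContinuousOn F {z | ‖z‖ = ρ} := hF.continuousOn.mono fun z hz => ⟨le_of_eq hz, .inl hz⟩
  have h3 := contourIntegral_arc_add (by linarith) hc a (pi - a) (2 * pi + a)
  rw [show 2 * pi + a = a + 2 * pi by ring, contourIntegral_arc_two_pi] at h3
  rw [e, ← h3, ← h2, show 2 * pi + a = a + 2 * pi by ring]
  simp only [contourIntegral_cons, contourIntegral_nil] at h1 ⊢
  linear_combination h1

omit hρ in
lemma gammaMinus_eq : gammaMinus ρ = (gammaPlus ρ).map fun γ s => -γ s := by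
  have s1 : ∀ a b a' b' : ℂ, a' = -a → b' = -b → segment a' b' = fun s => -segment a b s := by
    rintro a b _ _ rfl rfl
    funext s
    simp only [segment]; ring
  have x1 : exp (-(5 * I * pi / 6)) = -exp (I * pi / 6) := by
    rw [show -(5 * I * pi / 6) = I * pi / 6 - pi * I by ring,
      Complex.exp_sub, Complex.exp_pi_mul_I]
    ring
  have x2 : exp (-(I * pi / 6)) = -exp (5 * I * pi / 6) := by
    rw [show -(I * pi / 6) = 5 * I * pi / 6 - pi * I by ring,
      Complex.exp_sub, Complex.exp_pi_mul_I]
    ring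
  simp only [gammaMinus, gammaPlus, List.map_cons, List.map_nil, List.cons.injEq, and_true]
  refine ⟨s1 _ _ _ _ (by ring) (by rw [x1]; ring), s1 _ _ _ _ (by rw [x1]; ring) (by ring),
    s1 _ _ _ _ (by ring) (by rw [x2]; ring), s1 _ _ _ _ (by rw [x2]; ring) (by ring), ?_⟩
  funext s
  rw [arc_apply, arc_apply, ← circleMap_sub_pi]
  congr 1
  ring

lemma trace_gammaMinus : trace (gammaMinus ρ) ⊆ {z | -z ∈ wedge ρ} := by
  rw [gammaMinus_eq, trace_neg]
  exact fun z hz => trace_gammaPlus hρ hz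

omit hρ in
lemma isSmooth_gammaMinus : IsSmooth (gammaMinus ρ) := by
  simp only [gammaMinus, isSmooth_cons, contDiff_segment, contDiff_arc, isSmooth_nil, and_self]

lemma contourIntegral_gammaMinus {F : ℂ → ℂ} (hF : DifferentiableOn ℂ F {z | -z ∈ wedge ρ}) :
    contourIntegral (gammaMinus ρ) F = contourIntegral (circ ρ) F := by
  rw [gammaMinus_eq, contourIntegral_neg, contourIntegral_gammaPlus hρ, contourIntegral_circ_neg, neg_neg]
  exact hF.comp differentiable_id.neg.differentiableOn fun z hz => by
    simpa using hz

end

/-! ### The contour `Γ̂` -/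

/-- The upper side of `Γ̂`; the half-circle around `c = i + 2Δ` is run through from `0` to `β`. -/
def hatTop (Δ R ε₁ ε₂ β : ℝ) : Contour :=
  let L : ℂ := (sqrt (R ^ 2 - 1) : ℝ)
  let i : ℂ := I
  let c : ℂ := i + 2 * Δ
  if 0 < Δ then
    [segment (L + i) (c + ε₂), arc c ε₂ 0 β, segment (c - ε₂) (i + ε₁),
      arc i ε₁ 0 pi, segment (i - ε₁) (-L + i)]
  else
    [segment (L + i) (i + ε₁), arc i ε₁ 0 pi, segment (i - ε₁) (c + ε₂),
      arc c ε₂ 0 β, segment (c - ε₂) (-L + i)]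

/-- The arcs that replace the other three sides of `Γ̂`. -/
def hatArcs (R : ℝ) : Contour :=
  [arc 0 R (pi - arcsin (1 / R)) (pi + arcsin (1 / R)),
    arc 0 R (pi + arcsin (1 / R)) (2 * pi - arcsin (1 / R)),
    arc 0 R (2 * pi - arcsin (1 / R)) (2 * pi + arcsin (1 / R))]

/-- The conditions on the parameters of `Γ̂`. -/
structure HatData (Δ R ε₁ ε₂ : ℝ) : Prop where
  ne_zero : Δ ≠ 0
  pos₁ : 0 < ε₁
  lt_half : ε₁ < 1 / 2
  lt_fst : 3 * ε₁ < 2 * |Δ|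
  pos₂ : 0 < ε₂
  lt_snd : 2 * ε₂ < ε₁
  lt_norm : 1 + ε₂ < ‖(I + 2 * Δ : ℂ)‖
  lt_radius : 2 + 4 * |Δ| < R

/-- The range of the variables on `Γ̂`, up to finitely many points. -/
def hatFar (Δ R ε₁ ε₂ : ℝ) : Set ℂ :=
  {z | ‖z‖ ≤ R ∧ ε₁ ≤ ‖z - I‖ ∧
    (1 ≤ |z.im| ∨ 1 + 2 * |Δ| < ‖z‖ ∨ ‖z - (I + 2 * Δ)‖ ≤ ε₂)}

/-- Points that are not above the upper side of the rectangle, except near `i`. -/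
def hatLow (Δ ε₁ : ℝ) : Set ℂ :=
  {z | (z.im ≤ 1 ∧ z ≠ I + 2 * Δ) ∨ ‖z - I‖ ≤ ε₁}

/-- The region swept when three sides of `Γ̂` are deformed to arcs. -/
def hatSwept (Δ R ε₁ ε₂ : ℝ) : Set ℂ :=
  {z | z ∈ hatFar Δ R ε₁ ε₂ ∧ (1 < ‖z‖ ∨ z = -I) ∧ z ∈ hatLow Δ ε₁}

/-- The part of `hatSwept` outside the two critical points. -/
def hatOuter (Δ R ε₁ ε₂ : ℝ) : Set ℂ :=
  {z | z ∈ hatFar Δ R ε₁ ε₂ ∧ 1 < ‖z‖ ∧ z ≠ 2 * Δ - I ∧ z ∈ hatLow Δ ε₁}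

/-- The closed upper cap of the disc, and the circle. -/
def hatCap (R : ℝ) : Set ℂ := {z | ‖z‖ ≤ R ∧ (1 ≤ z.im ∨ ‖z‖ = R)}

/-- The part of `hatCap` outside the two critical points. -/
def hatCapOff (Δ R : ℝ) : Set ℂ :=
  {z | z ∈ hatCap R ∧ 1 < ‖z‖ ∧ z ≠ I ∧ z ≠ I + 2 * Δ}

lemma image_horizontal_subset {p q : ℂ} {lo hi : ℝ} (hp : p.im = 1) (hq : q.im = 1) (hp1 : lo ≤ p.re)
    (hp2 : p.re ≤ hi) (hq1 : lo ≤ q.re) (hq2 : q.re ≤ hi) :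
    segment p q '' Set.Icc (0 : ℝ) 1 ⊆ {z | z.im = 1 ∧ lo ≤ z.re ∧ z.re ≤ hi} := by
  have h := ((convex_re_im 0 1 1).inter (convex_re_im 0 (-1) (-1))).inter
    ((convex_re_im (-1) 0 (-lo)).inter (convex_re_im 1 0 hi))
  have e : ∀ z : ℂ, z ∈ (({z : ℂ | 0 * z.re + 1 * z.im ≤ 1} ∩ {z | 0 * z.re + (-1) * z.im ≤ -1}) ∩
      ({z | (-1) * z.re + 0 * z.im ≤ -lo} ∩ {z | 1 * z.re + 0 * z.im ≤ hi})) ↔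
      z.im = 1 ∧ lo ≤ z.re ∧ z.re ≤ hi := by
    intro z
    simp only [Set.mem_inter_iff, Set.mem_ofPred_eq]
    constructor
    · rintro ⟨⟨h1, h2⟩, h3, h4⟩; exact ⟨by linarith, by linarith, by linarith⟩
    · rintro ⟨h1, h2, h3⟩; exact ⟨⟨by linarith, by linarith⟩, by linarith, by linarith⟩
  intro z hz
  exact (e z).1 (image_segment_subset h ((e p).2 ⟨hp, hp1, hp2⟩) ((e q).2 ⟨hq, hq1, hq2⟩) hz)

lemma one_le_norm_of_im {z : ℂ} (h : 1 ≤ |z.im|) : 1 ≤ ‖z‖ := h.trans (abs_im_le_norm z)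

lemma re_eq_zero_of_norm {z : ℂ} (h : 1 ≤ |z.im|) (h' : ‖z‖ ≤ 1) : z.re = 0 := by
  have h1 := sq_norm z
  rw [normSq_apply] at h1
  have h2 : 1 ≤ z.im * z.im := by nlinarith [sq_abs z.im, abs_nonneg z.im]
  nlinarith [norm_nonneg z, sq_nonneg z.re]

namespace HatData
variable {Δ R ε₁ ε₂ : ℝ} (h : HatData Δ R ε₁ ε₂)
include h

lemma one_lt : 1 < R := by have := h.lt_radius; linarith [abs_nonneg Δ]

lemma sq_sqrt : sqrt (R ^ 2 - 1) ^ 2 = R ^ 2 - 1 :=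
  Real.sq_sqrt (by nlinarith [h.one_lt])

lemma lt_sqrt : 1 + 2 * |Δ| < sqrt (R ^ 2 - 1) := by
  refine Real.lt_sqrt_of_sq_lt ?_
  nlinarith [h.lt_radius, abs_nonneg Δ]

lemma abs_pos : 0 < |Δ| := _root_.abs_pos.2 h.ne_zero

omit h in
lemma norm_center_le : ‖(I + 2 * Δ : ℂ)‖ ≤ 1 + 2 * |Δ| := by
  refine (norm_add_le _ _).trans ?_
  simp

lemma closedBall_subset {z : ℂ} (hz : ‖z - (I + 2 * Δ)‖ ≤ ε₂) :
    z ∈ hatFar Δ R ε₁ ε₂ ∧ 1 < ‖z‖ := by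
  have h1 := h.lt_norm
  have h2 := norm_center_le (Δ := Δ)
  have h3 := h.lt_fst
  have h4 := h.lt_snd
  have h5 := h.lt_radius
  have h6 := h.lt_half
  have h7 := h.abs_pos
  have t1 := norm_sub_norm_le z (I + 2 * Δ)
  have t2 := norm_sub_norm_le (I + 2 * Δ) z
  rw [norm_sub_rev] at t2
  have t3 : 2 * |Δ| ≤ ‖z - I‖ + ‖z - (I + 2 * Δ)‖ := by
    have := norm_sub_le (z - I) (z - (I + 2 * Δ))
    rw [show z - I - (z - (I + 2 * Δ)) = ((2 * Δ : ℝ) : ℂ) by push_cast; ring,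
      norm_real, norm_eq_abs, abs_mul, abs_two] at this
    exact this
  exact ⟨⟨by linarith, by linarith, .inr (.inr hz)⟩, by linarith⟩

lemma sides_subset {z : ℂ} (hR : ‖z‖ ≤ R) (hz : sqrt (R ^ 2 - 1) ≤ |z.re| ∨ z.im ≤ -1) :
    z ∈ hatSwept Δ R ε₁ ε₂ := by
  have h1 := h.lt_sqrt
  have h2 := h.lt_half
  have h4 := h.abs_pos
  rcases hz with hz | hz
  · have h5 := abs_re_le_norm z
    have h3 : z.im ≤ 1 := by
      have h6 := sq_norm z
      rw [normSq_apply] at h6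
      have h7 := h.sq_sqrt
      have h8 : z.im ^ 2 ≤ 1 := by nlinarith [sq_abs z.re, norm_nonneg z, Real.sqrt_nonneg (R ^ 2 - 1)]
      nlinarith
    refine ⟨⟨hR, ?_, .inr (.inl (by linarith))⟩, .inl (by linarith), .inl ⟨h3, ?_⟩⟩
    · have := abs_re_le_norm (z - I)
      simp at this
      linarith
    · rintro rfl
      simp at hz
      linarith
  · have h3 : 1 ≤ |z.im| := by rw [abs_of_nonpos (by linarith)]; linarith
    refine ⟨⟨hR, ?_, .inl h3⟩, ?_, .inl ⟨by linarith, ?_⟩⟩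
    · have := abs_im_le_norm (z - I)
      simp only [Complex.sub_im, I_im] at this
      rw [abs_of_nonpos (by linarith)] at this
      linarith
    · by_cases h5 : 1 < ‖z‖
      · exact .inl h5
      · refine .inr (Complex.ext ?_ ?_)
        · simpa using re_eq_zero_of_norm h3 (not_lt.1 h5)
        · have := abs_im_le_norm z
          rw [abs_of_nonpos (by linarith)] at this
          simp; linarith
    · rintro rfl
      simp at hz
      linarith

/-- The points of the upper side. -/
lemma trace_hatTop (β : ℝ) {z : ℂ} (hz : z ∈ trace (hatTop Δ R ε₁ ε₂ β)) :
    (z.im = 1 ∧ |z.re| ≤ sqrt (R ^ 2 - 1) ∧ ε₁ ≤ |z.re| ∧ ε₂ ≤ |z.re - 2 * Δ|) ∨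
    (‖z - I‖ = ε₁ ∧ 1 ≤ z.im) ∨ z ∈ arc (I + 2 * Δ) ε₂ 0 β '' Set.Icc (0 : ℝ) 1 := by
  have h1 := h.lt_sqrt
  have h2 := h.lt_half
  have h3 := h.lt_fst
  have h4 := h.lt_snd
  have h5 := h.abs_pos
  have h6 := h.pos₁
  have h7 := h.pos₂
  have hb : arc I ε₁ 0 pi '' Set.Icc (0 : ℝ) 1 ⊆ {z | ‖z - I‖ = ε₁ ∧ 1 ≤ z.im} := by
    refine image_arc_subset Real.pi_pos.le fun θ hθ hθ' => ⟨?_, ?_⟩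
    · simp [circleMap, abs_of_pos h6]
    · simp only [circleMap, Complex.add_im, I_im, Complex.im_ofReal_mul,
        Complex.exp_ofReal_mul_I_im]
      have := mul_nonneg h6.le (Real.sin_nonneg_of_nonneg_of_le_pi hθ hθ')
      linarith
  by_cases hΔ : 0 < Δ
  · rw [abs_of_pos hΔ] at *
    simp only [hatTop, hΔ, if_true, trace_cons, trace_nil, Set.union_empty, Set.mem_union] at hz
    rcases hz with hz | hz | hz | hz | hz
    · obtain ⟨e, e1, e2⟩ := image_horizontal_subset (lo := 2 * Δ + ε₂) (hi := sqrt (R ^ 2 - 1))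
        (by simp) (by simp) (by simp; linarith) (by simp) (by simp) (by simp; linarith) hz
      left
      rw [abs_of_nonneg (by linarith), abs_of_nonneg (by linarith)]
      exact ⟨e, by linarith, by linarith, by linarith⟩
    · exact .inr (.inr hz)
    · obtain ⟨e, e1, e2⟩ := image_horizontal_subset (lo := ε₁) (hi := 2 * Δ - ε₂)
        (by simp) (by simp) (by simp; linarith) (by simp) (by simp) (by simp; linarith) hz
      left
      rw [abs_of_nonneg (by linarith), abs_of_nonpos (by linarith)]
      exact ⟨e, by linarith, by linarith, by linarith⟩
    · exact .inr (.inl (hb hz))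
    · obtain ⟨e, e1, e2⟩ := image_horizontal_subset (lo := -sqrt (R ^ 2 - 1)) (hi := -ε₁)
        (by simp) (by simp) (by simp; linarith) (by simp) (by simp) (by simp; linarith) hz
      left
      rw [abs_of_nonpos (by linarith), abs_of_nonpos (by linarith)]
      exact ⟨e, by linarith, by linarith, by linarith⟩
  · rw [abs_of_nonpos (not_lt.1 hΔ)] at *
    simp only [hatTop, hΔ, if_false, trace_cons, trace_nil, Set.union_empty, Set.mem_union] at hz
    rcases hz with hz | hz | hz | hz | hz
    · obtain ⟨e, e1, e2⟩ := image_horizontal_subset (lo := ε₁) (hi := sqrt (R ^ 2 - 1))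
        (by simp) (by simp) (by simp; linarith) (by simp) (by simp) (by simp; linarith) hz
      left
      rw [abs_of_nonneg (by linarith), abs_of_nonneg (by linarith)]
      exact ⟨e, by linarith, by linarith, by linarith⟩
    · exact .inr (.inl (hb hz))
    · obtain ⟨e, e1, e2⟩ := image_horizontal_subset (lo := 2 * Δ + ε₂) (hi := -ε₁)
        (by simp) (by simp) (by simp; linarith) (by simp) (by simp) (by simp; linarith) hz
      left
      rw [abs_of_nonpos (by linarith), abs_of_nonneg (by linarith)]
      exact ⟨e, by linarith, by linarith, by linarith⟩
    · exact .inr (.inr hz)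
    · obtain ⟨e, e1, e2⟩ := image_horizontal_subset (lo := -sqrt (R ^ 2 - 1)) (hi := 2 * Δ - ε₂)
        (by simp) (by simp) (by simp; linarith) (by simp) (by simp) (by simp; linarith) hz
      left
      rw [abs_of_nonpos (by linarith), abs_of_nonpos (by linarith)]
      exact ⟨e, by linarith, by linarith, by linarith⟩

lemma image_arc_neg {z : ℂ} (hz : z ∈ arc (I + 2 * Δ) ε₂ 0 (-pi) '' Set.Icc (0 : ℝ) 1) :
    ‖z - (I + 2 * Δ)‖ = ε₂ ∧ z.im ≤ 1 := by
  obtain ⟨s, hs, rfl⟩ := hz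
  rw [arc_apply]
  refine ⟨by rw [circleMap, add_sub_cancel_left, norm_mul, Complex.norm_exp_ofReal_mul_I, mul_one,
    norm_real, norm_eq_abs, abs_of_pos h.pos₂], ?_⟩
  simp only [circleMap, Complex.add_im, I_im, Complex.im_ofReal_mul,
    Complex.exp_ofReal_mul_I_im]
  have := mul_nonneg h.pos₂.le (Real.sin_nonneg_of_nonneg_of_le_pi (mul_nonneg hs.1 Real.pi_pos.le)
    (mul_le_of_le_one_left Real.pi_pos.le hs.2))
  rw [show 0 + s * (-pi - 0) = -(s * pi) by ring, Real.sin_neg]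
  simp
  linarith

lemma image_arc_pos {z : ℂ} (hz : z ∈ arc (I + 2 * Δ) ε₂ 0 pi '' Set.Icc (0 : ℝ) 1) :
    ‖z - (I + 2 * Δ)‖ = ε₂ ∧ 1 ≤ z.im := by
  obtain ⟨s, hs, rfl⟩ := hz
  rw [arc_apply]
  refine ⟨by rw [circleMap, add_sub_cancel_left, norm_mul, Complex.norm_exp_ofReal_mul_I, mul_one,
    norm_real, norm_eq_abs, abs_of_pos h.pos₂], ?_⟩
  simp only [circleMap, Complex.add_im, I_im, Complex.im_ofReal_mul,
    Complex.exp_ofReal_mul_I_im]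
  have := mul_nonneg h.pos₂.le (Real.sin_nonneg_of_nonneg_of_le_pi (mul_nonneg hs.1 Real.pi_pos.le)
    (mul_le_of_le_one_left Real.pi_pos.le hs.2))
  rw [show 0 + s * (pi - 0) = s * pi by ring]
  simp
  linarith

lemma horizontal_mem {z : ℂ} (h1 : z.im = 1) (h2 : |z.re| ≤ sqrt (R ^ 2 - 1)) (h3 : ε₁ ≤ |z.re|) :
    z ∈ hatFar Δ R ε₁ ε₂ ∧ 1 < ‖z‖ := by
  have h4 := sq_norm z
  rw [normSq_apply, h1] at h4
  have h5 := h.sq_sqrt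
  have h6 := h.pos₁
  have h7 := h.one_lt
  have h8 := sq_abs z.re
  refine ⟨⟨?_, ?_, .inl (by rw [h1]; simp)⟩, ?_⟩
  · have : ‖z‖ ^ 2 ≤ R ^ 2 := by nlinarith [abs_nonneg z.re, Real.sqrt_nonneg (R ^ 2 - 1)]
    exact (abs_le_of_sq_le_sq' this (by linarith)).2
  · have := abs_re_le_norm (z - I)
    simp at this
    linarith
  · by_contra hc
    nlinarith [norm_nonneg z]

lemma bump_mem {z : ℂ} (h1 : ‖z - I‖ = ε₁) (h2 : 1 ≤ z.im) :
    z ∈ hatFar Δ R ε₁ ε₂ ∧ 1 < ‖z‖ := by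
  have h3 := norm_sub_norm_le z I
  rw [norm_I, h1] at h3
  have h4 := h.lt_half
  have h5 := h.lt_radius
  have h6 := abs_nonneg Δ
  refine ⟨⟨by linarith, h1.ge, .inl (h2.trans (le_abs_self _))⟩, ?_⟩
  by_contra hc
  have h7 := re_eq_zero_of_norm (h2.trans (le_abs_self _)) (not_lt.1 hc)
  have h8 : z = I := Complex.ext (by simpa using h7) (by
    have := (le_abs_self _).trans (abs_im_le_norm z)
    simp; linarith)
  rw [h8, sub_self, norm_zero] at h1
  exact h.pos₁.ne h1

lemma trace_hatTop_neg : trace (hatTop Δ R ε₁ ε₂ (-pi)) ⊆ hatOuter Δ R ε₁ ε₂ := by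
  intro z hz
  have h4 := h.lt_half
  have h5 := h.lt_snd
  rcases h.trace_hatTop _ hz with ⟨e1, e2, e3, e4⟩ | ⟨e1, e2⟩ | hz
  · obtain ⟨e5, e6⟩ := h.horizontal_mem e1 e2 e3
    refine ⟨e5, e6, ?_, .inl ⟨e1.le, ?_⟩⟩
    · rintro rfl; norm_num at e1
    · rintro rfl; simp at e4; linarith [h.pos₂]
  · obtain ⟨e5, e6⟩ := h.bump_mem e1 e2
    refine ⟨e5, e6, ?_, .inr e1.le⟩
    rintro rfl; norm_num at e2
  · obtain ⟨e1, e2⟩ := h.image_arc_neg hz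
    obtain ⟨e5, e6⟩ := h.closedBall_subset e1.le
    refine ⟨e5, e6, ?_, .inl ⟨e2, ?_⟩⟩
    · rintro rfl
      rw [show (2 * Δ - I - (I + 2 * Δ) : ℂ) = -(2 * I) by ring] at e1
      simp at e1
      linarith
    · rintro rfl
      simp at e1
      exact h.pos₂.ne e1

lemma ne_of_norm_eq {z : ℂ} (hz : ‖z‖ = R) : z ≠ I + 2 * Δ := by
  rintro rfl
  linarith [norm_center_le (Δ := Δ), h.lt_radius, abs_nonneg Δ]

lemma trace_hatTop_pos : trace (hatTop Δ R ε₁ ε₂ pi) ⊆ hatCapOff Δ R ∩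
    {z | z ∈ hatFar Δ R ε₁ ε₂ ∧ 1 < ‖z‖} := by
  intro z hz
  have key : z ∈ hatFar Δ R ε₁ ε₂ → 1 < ‖z‖ → 1 ≤ z.im → z ≠ I + 2 * Δ →
      z ∈ hatCapOff Δ R ∩ {z | z ∈ hatFar Δ R ε₁ ε₂ ∧ 1 < ‖z‖} := fun h1 h2 h3 h4 =>
    ⟨⟨⟨h1.1, .inl h3⟩, h2, by rintro rfl; simp at h2, h4⟩, h1, h2⟩
  rcases h.trace_hatTop _ hz with ⟨e1, e2, e3, e4⟩ | ⟨e1, e2⟩ | hz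
  · obtain ⟨e5, e6⟩ := h.horizontal_mem e1 e2 e3
    refine key e5 e6 e1.ge ?_
    rintro rfl; simp at e4; linarith [h.pos₂]
  · obtain ⟨e5, e6⟩ := h.bump_mem e1 e2
    refine key e5 e6 e2 ?_
    rintro rfl
    simp at e1
    linarith [h.lt_fst, h.pos₁]
  · obtain ⟨e1, e2⟩ := h.image_arc_pos hz
    obtain ⟨e5, e6⟩ := h.closedBall_subset e1.le
    refine key e5 e6 e2 ?_
    rintro rfl
    simp at e1
    exact h.pos₂.ne e1

omit h in
lemma hatOuter_subset : hatOuter Δ R ε₁ ε₂ ⊆ hatSwept Δ R ε₁ ε₂ :=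
  fun _ hz => ⟨hz.1, .inl hz.2.1, hz.2.2.2⟩

end HatData

lemma isSmooth_hatArcs (R : ℝ) : IsSmooth (hatArcs R) := by
  simp only [hatArcs, isSmooth_cons, contDiff_arc, isSmooth_nil, and_self]

lemma isSmooth_hatTop (Δ R ε₁ ε₂ β : ℝ) : IsSmooth (hatTop Δ R ε₁ ε₂ β) := by
  unfold hatTop
  split_ifs <;> simp only [isSmooth_cons, contDiff_segment, contDiff_arc, isSmooth_nil, and_self]

lemma gammaHat_eq (Δ R ε₁ ε₂ : ℝ) : gammaHat Δ R ε₁ ε₂ =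
    [segment (-(sqrt (R ^ 2 - 1) : ℝ) + I) (-(sqrt (R ^ 2 - 1) : ℝ) - I),
      segment (-(sqrt (R ^ 2 - 1) : ℝ) - I) ((sqrt (R ^ 2 - 1) : ℝ) - I),
      segment ((sqrt (R ^ 2 - 1) : ℝ) - I) ((sqrt (R ^ 2 - 1) : ℝ) + I)] ++
    hatTop Δ R ε₁ ε₂ (-pi) := rfl

lemma isSmooth_gammaHat (Δ R ε₁ ε₂ : ℝ) : IsSmooth (gammaHat Δ R ε₁ ε₂) := by
  rw [gammaHat_eq, isSmooth_append]
  exact ⟨by simp only [isSmooth_cons, contDiff_segment, isSmooth_nil, and_self], isSmooth_hatTop _ _ _ _ _⟩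

/-- Two pieces with common end points in a convex part of `U`. -/
def Deforms (U : Set ℂ) (γ γ' : ℝ → ℂ) : Prop :=
  ∃ S : Set ℂ, ∃ a b : ℂ, Convex ℝ S ∧ S ⊆ U ∧ IsPath [γ] a b ∧ IsPath [γ'] a b ∧
    trace [γ] ⊆ S ∧ trace [γ'] ⊆ S

lemma Deforms.trace_subset {U : Set ℂ} {γ γ' : ℝ → ℂ} (h : Deforms U γ γ') : trace [γ] ⊆ U := by
  obtain ⟨S, a, b, -, h2, -, -, h5, -⟩ := h
  exact h5.trans h2

lemma Deforms.contourIntegral_eq {U : Set ℂ} {γ γ' : ℝ → ℂ} (h : Deforms U γ γ') {F : ℂ → ℂ}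
    (hF : DifferentiableOn ℂ F U) : contourIntegral [γ] F = contourIntegral [γ'] F := by
  obtain ⟨S, a, b, h1, h2, h3, h4, h5, h6⟩ := h
  exact contourIntegral_eq_of_isPath h1 (hF.mono h2) h3 h4 h5 h6

namespace HatData
variable {Δ R ε₁ ε₂ : ℝ} (h : HatData Δ R ε₁ ε₂)
include h

lemma arc_ends : circleMap 0 R (arcsin (1 / R)) = (sqrt (R ^ 2 - 1) : ℝ) + I ∧
    circleMap 0 R (pi - arcsin (1 / R)) = -(sqrt (R ^ 2 - 1) : ℝ) + I ∧
    circleMap 0 R (pi + arcsin (1 / R)) = -(sqrt (R ^ 2 - 1) : ℝ) - I ∧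
    circleMap 0 R (2 * pi - arcsin (1 / R)) = (sqrt (R ^ 2 - 1) : ℝ) - I ∧
    circleMap 0 R (2 * pi + arcsin (1 / R)) = (sqrt (R ^ 2 - 1) : ℝ) + I := by
  have h1 := h.one_lt
  have h0 : (0 : ℝ) < 1 := one_pos
  refine ⟨?_, ?_, ?_, ?_, ?_⟩
  · rw [circleMap_arcsin h0 h1]; simp
  · rw [circleMap_pi_sub_arcsin h0 h1]; simp
  · rw [circleMap_pi_add_arcsin h0 h1]; simp
  · rw [circleMap_two_pi_sub_arcsin h0 h1]; simp
  · rw [circleMap_two_pi_add_arcsin h0 h1]; simp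

lemma norm_arc (θ : ℝ) : ‖circleMap 0 R θ‖ = R := by
  have := h.one_lt
  simp [abs_of_pos (by linarith : 0 < R)]

lemma hatArcs_pieces :
    arc 0 R (pi - arcsin (1 / R)) (pi + arcsin (1 / R)) '' Set.Icc (0 : ℝ) 1 ⊆
      {z | ‖z‖ = R ∧ z.re ≤ -sqrt (R ^ 2 - 1)} ∧
    arc 0 R (pi + arcsin (1 / R)) (2 * pi - arcsin (1 / R)) '' Set.Icc (0 : ℝ) 1 ⊆
      {z | ‖z‖ = R ∧ z.im ≤ -1} ∧
    arc 0 R (2 * pi - arcsin (1 / R)) (2 * pi + arcsin (1 / R)) '' Set.Icc (0 : ℝ) 1 ⊆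
      {z | ‖z‖ = R ∧ sqrt (R ^ 2 - 1) ≤ z.re} := by
  have h1 := h.one_lt
  have h0 : (0 : ℝ) < 1 := one_pos
  have h2 := arcsin_pos h0 h1
  have h3 := arcsin_lt h0 h1
  refine ⟨image_arc_subset (by linarith) fun θ h4 h5 => ⟨h.norm_arc θ, ?_⟩,
    image_arc_subset (by linarith) fun θ h4 h5 => ⟨h.norm_arc θ, ?_⟩,
    image_arc_subset (by linarith) fun θ h4 h5 => ⟨h.norm_arc θ, ?_⟩⟩
  · have := re_circleMap_ge h0 h1 (θ := θ - pi) (by linarith) (by linarith)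
    rw [circleMap_sub_pi, Complex.neg_re, one_pow] at this
    linarith
  · have := im_circleMap_ge h0 h1 (θ := θ - pi) (by linarith) (by linarith)
    rw [circleMap_sub_pi, Complex.neg_im] at this
    linarith
  · have := re_circleMap_ge h0 h1 (θ := θ - 2 * pi) (by linarith) (by linarith)
    rwa [(periodic_circleMap 0 R).sub_eq, one_pow] at this

lemma trace_hatArcs {z : ℂ} (hz : z ∈ trace (hatArcs R)) :
    ‖z‖ = R ∧ (sqrt (R ^ 2 - 1) ≤ |z.re| ∨ z.im ≤ -1) := by
  obtain ⟨h1, h2, h3⟩ := h.hatArcs_pieces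
  simp only [hatArcs, trace_cons, trace_nil, Set.union_empty, Set.mem_union] at hz
  rcases hz with hz | hz | hz
  · exact ⟨(h1 hz).1, .inl (by have := (h1 hz).2; have := neg_abs_le z.re; linarith)⟩
  · exact ⟨(h2 hz).1, .inr (h2 hz).2⟩
  · exact ⟨(h3 hz).1, .inl ((h3 hz).2.trans (le_abs_self _))⟩

lemma trace_outer : trace (hatArcs R ++ hatTop Δ R ε₁ ε₂ (-pi)) ⊆ hatOuter Δ R ε₁ ε₂ := by
  rw [trace_append]
  refine Set.union_subset (fun z hz => ?_) h.trace_hatTop_neg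
  obtain ⟨h1, h2⟩ := h.trace_hatArcs hz
  have h3 := h.sides_subset h1.le h2
  refine ⟨h3.1, h1 ▸ h.one_lt, ?_, h3.2.2⟩
  rintro rfl
  have := norm_sub_le (2 * Δ : ℂ) I
  rw [h1] at this
  simp at this
  linarith [h.lt_radius, abs_nonneg Δ]

lemma trace_cap : trace (hatArcs R ++ hatTop Δ R ε₁ ε₂ pi) ⊆ hatCapOff Δ R ∩
    {z | z ∈ hatFar Δ R ε₁ ε₂ ∧ 1 < ‖z‖} := by
  rw [trace_append]
  refine Set.union_subset (fun z hz => ?_) h.trace_hatTop_pos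
  obtain ⟨h1, h2⟩ := h.trace_hatArcs hz
  have h4 : 1 < ‖z‖ := h1 ▸ h.one_lt
  exact ⟨⟨⟨h1.le, .inr h1⟩, h4, by rintro rfl; simp at h4, h.ne_of_norm_eq h1⟩,
    (h.sides_subset h1.le h2).1, h4⟩

lemma corners : (-(sqrt (R ^ 2 - 1) : ℝ) + I : ℂ) ∈ {z : ℂ | ‖z‖ ≤ R} ∧
    (-(sqrt (R ^ 2 - 1) : ℝ) - I : ℂ) ∈ {z : ℂ | ‖z‖ ≤ R} ∧
    ((sqrt (R ^ 2 - 1) : ℝ) - I : ℂ) ∈ {z : ℂ | ‖z‖ ≤ R} ∧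
    ((sqrt (R ^ 2 - 1) : ℝ) + I : ℂ) ∈ {z : ℂ | ‖z‖ ≤ R} := by
  obtain ⟨e1, e2, e3, e4, -⟩ := h.arc_ends
  rw [← e1, ← e2, ← e3, ← e4]
  exact ⟨(h.norm_arc _).le, (h.norm_arc _).le, (h.norm_arc _).le, (h.norm_arc _).le⟩

/-- The three pairs of a side and an arc. -/
lemma sides : ∃ γ₁ γ₂ γ₃ γ₁' γ₂' γ₃' : ℝ → ℂ,
    gammaHat Δ R ε₁ ε₂ = [γ₁, γ₂, γ₃] ++ hatTop Δ R ε₁ ε₂ (-pi) ∧ hatArcs R = [γ₁', γ₂', γ₃'] ∧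
    Deforms (hatSwept Δ R ε₁ ε₂) γ₁ γ₁' ∧ Deforms (hatSwept Δ R ε₁ ε₂) γ₂ γ₂' ∧
      Deforms (hatSwept Δ R ε₁ ε₂) γ₃ γ₃' := by
  obtain ⟨e1, e2, e3, e4, e5⟩ := h.arc_ends
  obtain ⟨k1, k2, k3, k4⟩ := h.corners
  obtain ⟨a1, a2, a3⟩ := h.hatArcs_pieces
  have c1 : Convex ℝ ({z : ℂ | 1 * z.re + 0 * z.im ≤ -sqrt (R ^ 2 - 1)} ∩ {z | ‖z‖ ≤ R}) :=
    (convex_re_im _ _ _).inter (convex_norm_le R)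
  have c2 : Convex ℝ ({z : ℂ | 0 * z.re + 1 * z.im ≤ -1} ∩ {z | ‖z‖ ≤ R}) :=
    (convex_re_im _ _ _).inter (convex_norm_le R)
  have c3 : Convex ℝ ({z : ℂ | (-1) * z.re + 0 * z.im ≤ -sqrt (R ^ 2 - 1)} ∩ {z | ‖z‖ ≤ R}) :=
    (convex_re_im _ _ _).inter (convex_norm_le R)
  have hab : ∀ r : ℝ, r ≤ -sqrt (R ^ 2 - 1) → sqrt (R ^ 2 - 1) ≤ |r| := fun r hr => by
    linarith [neg_abs_le r]
  refine ⟨_, _, _, _, _, _, gammaHat_eq Δ R ε₁ ε₂, rfl, ?_, ?_, ?_⟩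
  · refine ⟨_, -(sqrt (R ^ 2 - 1) : ℝ) + I, -(sqrt (R ^ 2 - 1) : ℝ) - I, c1, fun z hz => h.sides_subset hz.2 (.inl (hab _ (by simpa using hz.1))), ?_, ?_, ?_, ?_⟩
    · simp [IsPath, segment_zero, segment_one, contDiff_segment]
    · simp [IsPath, -one_div, arc_zero, arc_one, contDiff_arc, e2, e3]
    · simp only [trace_cons, trace_nil, Set.union_empty]
      exact image_segment_subset c1 ⟨by simp, k1⟩ ⟨by simp, k2⟩
    · simp only [trace_cons, trace_nil, Set.union_empty]
      exact a1.trans fun z hz => ⟨by simpa using hz.2, hz.1.le⟩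
  · refine ⟨_, -(sqrt (R ^ 2 - 1) : ℝ) - I, (sqrt (R ^ 2 - 1) : ℝ) - I, c2, fun z hz => h.sides_subset hz.2 (.inr (by simpa using hz.1)), ?_, ?_, ?_, ?_⟩
    · simp [IsPath, segment_zero, segment_one, contDiff_segment]
    · simp [IsPath, -one_div, arc_zero, arc_one, contDiff_arc, e3, e4]
    · simp only [trace_cons, trace_nil, Set.union_empty]
      exact image_segment_subset c2 ⟨by simp, k2⟩ ⟨by simp, k3⟩
    · simp only [trace_cons, trace_nil, Set.union_empty]
      exact a2.trans fun z hz => ⟨by simpa using hz.2, hz.1.le⟩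
  · refine ⟨_, (sqrt (R ^ 2 - 1) : ℝ) - I, (sqrt (R ^ 2 - 1) : ℝ) + I, c3, fun z hz => h.sides_subset hz.2 (.inl ((by simpa using hz.1 : _ ≤ z.re).trans (le_abs_self _))), ?_, ?_, ?_, ?_⟩
    · simp [IsPath, segment_zero, segment_one, contDiff_segment]
    · simp [IsPath, -one_div, arc_zero, arc_one, contDiff_arc, e4, e5]
    · simp only [trace_cons, trace_nil, Set.union_empty]
      exact image_segment_subset c3 ⟨by simp, k3⟩ ⟨by simp, k4⟩
    · simp only [trace_cons, trace_nil, Set.union_empty]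
      exact a3.trans fun z hz => ⟨by simpa using hz.2, hz.1.le⟩

lemma trace_gammaHat : trace (gammaHat Δ R ε₁ ε₂) ⊆ hatSwept Δ R ε₁ ε₂ := by
  obtain ⟨γ₁, γ₂, γ₃, γ₁', γ₂', γ₃', e1, e2, h1, h2, h3⟩ := h.sides
  rw [e1, trace_append]
  refine Set.union_subset ?_ (h.trace_hatTop_neg.trans hatOuter_subset)
  have h1 := h1.trace_subset
  have h2 := h2.trace_subset
  have h3 := h3.trace_subset
  simp only [trace_cons, trace_nil, Set.union_empty, Set.union_subset_iff] at h1 h2 h3 ⊢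
  exact ⟨h1, h2, h3⟩

lemma contourIntegral_gammaHat {F : ℂ → ℂ} (hF : DifferentiableOn ℂ F (hatSwept Δ R ε₁ ε₂)) :
    contourIntegral (gammaHat Δ R ε₁ ε₂) F =
      contourIntegral (hatArcs R ++ hatTop Δ R ε₁ ε₂ (-pi)) F := by
  obtain ⟨γ₁, γ₂, γ₃, γ₁', γ₂', γ₃', e1, e2, h1, h2, h3⟩ := h.sides
  have h1 := h1.contourIntegral_eq hF
  have h2 := h2.contourIntegral_eq hF
  have h3 := h3.contourIntegral_eq hF
  rw [e1, e2, contourIntegral_append, contourIntegral_append]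
  simp only [contourIntegral_cons, contourIntegral_nil] at h1 h2 h3 ⊢
  linear_combination h1 + h2 + h3

omit h in
lemma contourIntegral_hatTop (hpos : 0 < ε₂) {F : ℂ → ℂ}
    (hF : DifferentiableOn ℂ F (Metric.closedBall (I + 2 * Δ) ε₂)) :
    contourIntegral (hatTop Δ R ε₁ ε₂ (-pi)) F = contourIntegral (hatTop Δ R ε₁ ε₂ pi) F := by
  have h1 : ∀ β, arc (I + 2 * Δ) ε₂ 0 β '' Set.Icc (0 : ℝ) 1 ⊆
      Metric.closedBall (I + 2 * Δ) ε₂ := by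
    rintro β _ ⟨s, -, rfl⟩
    rw [arc_apply]
    exact circleMap_mem_closedBall _ hpos.le _
  have h2 : contourIntegral [arc (I + 2 * Δ) ε₂ 0 (-pi)] F =
      contourIntegral [arc (I + 2 * Δ) ε₂ 0 pi] F := by
    refine contourIntegral_eq_of_isPath (convex_closedBall _ _) hF
      (a := circleMap (I + 2 * Δ) ε₂ 0) (b := circleMap (I + 2 * Δ) ε₂ pi) ?_ ?_ ?_ ?_
    · refine ⟨contDiff_arc _ _ _ _, arc_zero _ _ _ _, ?_⟩
      rw [arc_one]
      simp [IsPath, circleMap, Complex.exp_neg]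
    · exact ⟨contDiff_arc _ _ _ _, arc_zero _ _ _ _, arc_one _ _ _ _⟩
    · simpa only [trace_cons, trace_nil, Set.union_empty] using h1 _
    · simpa only [trace_cons, trace_nil, Set.union_empty] using h1 _
  simp only [contourIntegral_cons, contourIntegral_nil] at h2
  simp only [hatTop]
  split_ifs <;> simp only [contourIntegral_cons, contourIntegral_nil] <;> linear_combination h2

lemma contourIntegral_cap {F : ℂ → ℂ} (hF : DifferentiableOn ℂ F (hatCap R)) :
    contourIntegral (hatArcs R ++ hatTop Δ R ε₁ ε₂ pi) F = contourIntegral (circ R) F := by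
  have h1 := h.one_lt
  have h0 : (0 : ℝ) < 1 := one_pos
  obtain ⟨e1, e2, e3, e4, e5⟩ := h.arc_ends
  have hsub : capSet R 1 ⊆ hatCap R := fun z hz => by
    rw [mem_capSet] at hz; exact ⟨hz.2, .inl hz.1⟩
  have hcirc : circleMap I ε₁ 0 = I + ε₁ ∧ circleMap I ε₁ pi = I - ε₁ ∧
      circleMap (I + 2 * Δ) ε₂ 0 = I + 2 * Δ + ε₂ ∧
      circleMap (I + 2 * Δ) ε₂ pi = I + 2 * Δ - ε₂ := by
    simp [circleMap, sub_eq_add_neg]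
  obtain ⟨f1, f2, f3, f4⟩ := hcirc
  have h2 : contourIntegral (hatTop Δ R ε₁ ε₂ pi) F =
      contourIntegral [arc 0 R (arcsin (1 / R)) (pi - arcsin (1 / R))] F := by
    refine contourIntegral_eq_of_isPath (convex_capSet R 1) (hF.mono hsub)
      (a := (sqrt (R ^ 2 - 1) : ℝ) + I) (b := -(sqrt (R ^ 2 - 1) : ℝ) + I) ?_ ?_ ?_ ?_
    · simp only [hatTop]
      split_ifs <;> simp [IsPath, segment_zero, segment_one, contDiff_segment, contDiff_arc, arc_zero, arc_one,
        f1, f2, f3, f4]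
    · simp [IsPath, -one_div, arc_zero, arc_one, contDiff_arc, e1, e2]
    · intro z hz
      obtain ⟨⟨h3, h4, h5, h6⟩, h7, -⟩ := h.trace_hatTop_pos hz
      refine mem_capSet.2 ⟨?_, h3.1⟩
      rcases h.trace_hatTop _ hz with e | e | e
      exacts [e.1.ge, e.2, (h.image_arc_pos e).2]
    · simp only [trace_cons, trace_nil, Set.union_empty]
      exact image_arc_subset (by linarith [arcsin_lt h0 h1]) fun θ h3 h4 =>
        mem_capSet.2 ⟨im_circleMap_ge h0 h1 h3 h4, (h.norm_arc θ).le⟩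
  have hc : ContinuousOn F {z | ‖z‖ = R} := hF.continuousOn.mono fun z hz => ⟨le_of_eq hz, .inr hz⟩
  set b := arcsin (1 / R) with hb
  have g1 := contourIntegral_arc_add (by linarith) hc b (pi - b) (pi + b)
  have g2 := contourIntegral_arc_add (by linarith) hc b (pi + b) (2 * pi - b)
  have g3 := contourIntegral_arc_add (by linarith) hc b (2 * pi - b) (2 * pi + b)
  have g4 := contourIntegral_arc_two_pi R b F
  rw [show b + 2 * pi = 2 * pi + b by ring] at g4
  rw [contourIntegral_append, h2, hatArcs, ← hb]
  simp only [contourIntegral_cons, contourIntegral_nil] at g1 g2 g3 g4 ⊢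
  linear_combination g1 + g2 + g3 + g4

end HatData

/-! ### Denominators on the contours -/

lemma eq_of_pFac_eq_zero {Δ : ℝ} {u v : ℂ} (h : pFac Δ u v = 0) : u ≠ 0 ∧ v = 2 * Δ - u⁻¹ := by
  have hu : u ≠ 0 := by rintro rfl; simp [pFac] at h
  refine ⟨hu, ?_⟩
  rw [pFac] at h
  field_simp
  linear_combination h

lemma norm_of_pFac_eq_zero {Δ : ℝ} {u v : ℂ} (h : pFac Δ u v = 0) :
    ‖v‖ ≤ 2 * |Δ| + ‖u‖⁻¹ ∧ |v.im| ≤ ‖u‖⁻¹ ∧ v.im = u.im / ‖u‖ ^ 2 := by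
  obtain ⟨hu, rfl⟩ := eq_of_pFac_eq_zero h
  refine ⟨(norm_sub_le _ _).trans (by simp [norm_inv]), ?_, ?_⟩
  · have := abs_im_le_norm (u⁻¹)
    rw [norm_inv] at this
    simpa using this
  · simp [Complex.inv_im, Complex.normSq_eq_norm_sq]
    ring

lemma pFac_neg (Δ : ℝ) (a b : ℂ) : pFac Δ (-a) (-b) = pFac (-Δ) a b := by
  simp only [pFac]; push_cast; ring

section
variable {ρ : ℝ}

lemma one_le_norm_of_mem_wedge (hρ : 1 ≤ ρ) {z : ℂ} (hz : z ∈ wedge ρ) : 1 ≤ ‖z‖ := by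
  rcases hz.2 with h | h
  · rw [h]; exact hρ
  · exact one_le_norm_of_im (h.1.trans (le_abs_self _))

lemma eq_I_of_mem_wedge {z : ℂ} (hz : z ∈ wedge ρ) (h1 : ‖z‖ ≠ ρ) (h2 : z.im ≤ 1) : z = I := by
  obtain ⟨h3, h4⟩ := hz.2.resolve_left h1
  have h5 : z.im = 1 := le_antisymm h2 h3
  rcases h4 with h4 | h4
  · rw [h5, sub_self, mul_zero] at h4
    exact Complex.ext (by simpa using abs_nonpos_iff.1 h4) (by simpa using h5)
  · linarith

lemma one_lt_norm_of_mem_wedge (hρ : 1 < ρ) {z : ℂ} (hz : z ∈ wedge ρ) (hI : z ≠ I) : 1 < ‖z‖ := by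
  by_cases h : ‖z‖ = ρ
  · rwa [h]
  · refine lt_of_le_of_ne (one_le_norm_of_mem_wedge hρ.le hz) fun e => hI (eq_I_of_mem_wedge hz h ?_)
    exact ((le_abs_self _).trans (abs_im_le_norm z)).trans e.symm.le

lemma pFac_wedge_ne_zero {Δ : ℝ} (hΔ : Δ ≠ 0) (hρ : 2 + 4 * |Δ| < ρ) {u v : ℂ} (hu : u ∈ wedge ρ)
    (hv : v ∈ wedge ρ) : pFac Δ u v ≠ 0 := by
  intro h
  have h0 := abs_nonneg Δ
  have h1 := one_le_norm_of_mem_wedge (by linarith) hu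
  obtain ⟨h2, h3, h4⟩ := norm_of_pFac_eq_zero h
  have h5 : ‖u‖⁻¹ ≤ 1 := inv_le_one_of_one_le₀ h1
  have h6 : ‖v‖ ≠ ρ := by linarith
  have h7 : v = I := eq_I_of_mem_wedge hv h6 ((le_abs_self _).trans (h3.trans h5))
  have h8 : ‖u‖ ≤ 1 := by
    rw [h7] at h3
    simp at h3
    exact (one_le_inv₀ (by linarith)).1 h3
  have h9 : u = I := eq_I_of_mem_wedge hu (by linarith)
    (((le_abs_self _).trans (abs_im_le_norm u)).trans h8)
  obtain ⟨-, e⟩ := eq_of_pFac_eq_zero h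
  rw [h7, h9] at e
  simp at e
  exact hΔ e

end

lemma one_sub_mul_ne_zero_of_norm {a b : ℂ} (ha : 1 ≤ ‖a‖) (hb : 1 ≤ ‖b‖) (h : 1 < ‖a‖ ∨ 1 < ‖b‖) :
    1 - a * b ≠ 0 := by
  intro e
  have e1 : a * b = 1 := (sub_eq_zero.1 e).symm
  have := congrArg norm e1
  rw [norm_mul, norm_one] at this
  rcases h with h | h <;> nlinarith

namespace HatData
variable {Δ R R' ε₁ ε₂ : ℝ} (h : HatData Δ R ε₁ ε₂)
include h

lemma pFac_far_ne_zero {u v : ℂ} (hu : 1 < ‖u‖) (hu' : ε₁ ≤ ‖u - I‖)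
    (hv : v ∈ hatFar Δ R ε₁ ε₂) : pFac Δ u v ≠ 0 := by
  intro h0
  obtain ⟨h1, h2, -⟩ := norm_of_pFac_eq_zero h0
  obtain ⟨h3, e⟩ := eq_of_pFac_eq_zero h0
  have h4 : ‖u‖⁻¹ < 1 := inv_lt_one_of_one_lt₀ hu
  rcases hv.2.2 with h5 | h5 | h5
  · linarith
  · linarith
  · have h6 : (v - (I + 2 * Δ)) * u = -(I * (u - I)) := by
      rw [e]
      field_simp
      linear_combination (-1 : ℂ) * Complex.I_sq
    have h7 := congrArg norm h6
    rw [norm_mul, norm_neg, norm_mul, norm_I, one_mul] at h7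
    have h8 := norm_sub_norm_le u I
    rw [norm_I] at h8
    have h9 := h.lt_snd
    have h10 := h.lt_half
    have h11 := h.pos₂
    have h12 : ‖v - (I + 2 * Δ)‖ * ‖u‖ ≤ ε₂ * (1 + ‖u - I‖) := by
      apply mul_le_mul h5 (by linarith) (norm_nonneg _) h11.le
    nlinarith [norm_nonneg (u - I)]

lemma pFac_swept_outer {u v : ℂ} (hu : u ∈ hatSwept Δ R ε₁ ε₂) (hv : v ∈ hatOuter Δ R ε₁ ε₂) :
    pFac Δ u v ≠ 0 := by
  rcases hu.2.1 with h1 | h1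
  · exact h.pFac_far_ne_zero h1 hu.1.2.1 hv.1
  · intro e
    obtain ⟨-, e⟩ := eq_of_pFac_eq_zero e
    refine hv.2.2.1 ?_
    rw [e, h1, ← neg_inv, Complex.inv_I]
    ring

lemma pFac_outer_swept {u v : ℂ} (hu : u ∈ hatOuter Δ R ε₁ ε₂) (hv : v ∈ hatSwept Δ R ε₁ ε₂) :
    pFac Δ u v ≠ 0 := h.pFac_far_ne_zero hu.2.1 hu.1.2.1 hv.1

omit h in
lemma one_le_norm_of_swept {u : ℂ} (hu : u ∈ hatSwept Δ R ε₁ ε₂) : 1 ≤ ‖u‖ := by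
  rcases hu.2.1 with h1 | h1
  · exact h1.le
  · rw [h1]; simp

lemma pFac_swept_wedge {u v : ℂ} (hu : u ∈ hatSwept Δ R ε₁ ε₂) (hv : v ∈ wedge R) : pFac Δ u v ≠ 0 := by
  by_cases hR : ‖v‖ = R
  · exact pFac_ne_zero h.lt_radius.le (one_le_norm_of_swept hu) hR.ge
  · intro e
    obtain ⟨-, h2, h3⟩ := norm_of_pFac_eq_zero e
    have h4 := (hv.2.resolve_left hR).1
    rcases hu.2.1 with h1 | h1
    · have h5 : ‖u‖⁻¹ < 1 := inv_lt_one_of_one_lt₀ h1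
      linarith [le_abs_self v.im]
    · rw [h1] at h3
      norm_num at h3
      linarith

lemma add_sub_ne_zero (hR : 2 * R < R') {u w : ℂ} (hu : u ∈ hatSwept Δ R ε₁ ε₂) (hw : w ∈ wedge R') :
    u + -w - 2 * Δ ≠ 0 := by
  intro e
  have e1 : u = w + 2 * Δ := by linear_combination e
  have h0 := abs_nonneg Δ
  have h1 := h.lt_radius
  by_cases hn : ‖w‖ = R'
  · have h2 := norm_sub_le u (2 * Δ)
    rw [e1, add_sub_cancel_right, ← e1, hn] at h2
    have h3 := hu.1.1
    simp at h2
    linarith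
  · obtain ⟨h4, h5⟩ := hw.2.resolve_left hn
    have h6 : u.im = w.im := by rw [e1]; simp
    have h7 : u.re = w.re + 2 * Δ := by rw [e1]; simp
    rcases hu.2.2 with h8 | h8
    · have h9 := eq_I_of_mem_wedge hw hn (h6 ▸ h8.1)
      exact h8.2 (by rw [e1, h9])
    · have h9 := (abs_re_le_norm _).trans h8
      have h10 := (abs_im_le_norm _).trans h8
      simp only [Complex.sub_re, Complex.sub_im, Complex.I_re, I_im, sub_zero] at h9 h10
      rw [h6] at h10
      rw [h7] at h9
      have h11 := (le_abs_self _).trans h10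
      have h12 := h.lt_half
      have h13 := h.lt_fst
      have h14 := h.pos₁
      rcases h5 with h5 | h5
      · have h15 : |2 * Δ| ≤ |w.re + 2 * Δ| + |w.re| := by
          have := abs_sub (w.re + 2 * Δ) w.re
          rwa [add_sub_cancel_left] at this
        rw [abs_mul, abs_two] at h15
        linarith
      · linarith

lemma pFac_cap_capOff {u v : ℂ} (hu : u ∈ hatCap R) (hv : v ∈ hatCapOff Δ R) :
    pFac Δ u v ≠ 0 ∧ pFac Δ v u ≠ 0 := by
  have h1 := h.lt_radius
  have h2 := abs_nonneg Δ
  have h3 : 1 ≤ ‖u‖ := by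
    rcases hu.2 with h3 | h3
    · exact one_le_norm_of_im (h3.trans (le_abs_self _))
    · rw [h3]; linarith
  constructor
  · intro e
    obtain ⟨h4, h5, h6⟩ := norm_of_pFac_eq_zero e
    have h7 : ‖u‖⁻¹ ≤ 1 := inv_le_one_of_one_le₀ h3
    have h8 : 1 ≤ v.im := hv.1.2.resolve_right (by linarith)
    have h9 : ‖u‖ ≤ 1 := (one_le_inv₀ (by linarith)).1 (h8.trans ((le_abs_self _).trans h5))
    have h10 : ‖u‖ = 1 := le_antisymm h9 h3
    have h11 : 1 ≤ |u.im| := by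
      rw [h10] at h6
      rw [show u.im = v.im by rw [h6]; ring]
      exact h8.trans (le_abs_self _)
    have h12 : u = I := by
      refine Complex.ext (by simpa using re_eq_zero_of_norm h11 h9) ?_
      rw [h10] at h6 h5
      have := (le_abs_self _).trans h5
      simp at this h6 ⊢
      linarith
    obtain ⟨-, e⟩ := eq_of_pFac_eq_zero e
    refine hv.2.2.2 ?_
    rw [e, h12, Complex.inv_I]; ring
  · intro e
    obtain ⟨h4, h5, -⟩ := norm_of_pFac_eq_zero e
    have h7 : ‖v‖⁻¹ < 1 := inv_lt_one_of_one_lt₀ hv.2.1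
    rcases hu.2 with h8 | h8
    · linarith [le_abs_self u.im]
    · linarith

lemma add_sub_ne_zero_of_norm (hR : 2 * R < R') {u w : ℂ} (hu : ‖u‖ ≤ R) (hw : ‖w‖ = R') :
    u + w - 2 * Δ ≠ 0 := by
  intro e
  have e1 : w = 2 * Δ - u := by linear_combination e
  have := norm_sub_le (2 * Δ : ℂ) u
  rw [← e1, hw] at this
  simp at this
  linarith [h.lt_radius, abs_nonneg Δ]

end HatData

/-! ### Regularity of the integrands -/

/-- The denominators of the integrands do not vanish. -/
structure RegularAt (Δ : ℝ) (J K : Finset (Fin N)) (v : Point N) : Prop where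
  left_ne : ∀ j, v (.inl j) ≠ 0
  right_ne : ∀ k ∈ K, v (.inr k) ≠ 0
  one_sub : ∀ j ∈ J, ∀ k ∈ K, 1 - v (.inl j) * v (.inr k) ≠ 0
  left : ∀ j ∈ J, ∀ j' ∈ J, pFac Δ (v (.inl j)) (v (.inl j')) ≠ 0
  right : ∀ k ∈ K, ∀ k' ∈ K, pFac Δ (v (.inr k)) (v (.inr k')) ≠ 0
  mixed : ∀ j ∉ J, ∀ j', j' ≠ j → pFac Δ (v (.inl j)) (v (.inl j')) ≠ 0
  add : ∀ j ∉ J, ∀ k ∈ K, v (.inl j) + v (.inr k) - 2 * Δ ≠ 0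

lemma differentiableAt_exp_energy {E : Type*} [NormedAddCommGroup E] [NormedSpace ℂ E] (Δ : ℝ) (m : ℤ)
    (c : ℂ) {f : E → ℂ} {w : E} (hf : DifferentiableAt ℂ f w) (h0 : f w ≠ 0) :
    DifferentiableAt ℂ (fun w => f w ^ m * exp (c * energy Δ (f w))) w := by
  have h1 : DifferentiableAt ℂ (fun w => energy Δ (f w)) w := by
    unfold energy
    exact (hf.add (differentiableAt_div (differentiableAt_const 1) hf h0)).sub (differentiableAt_const _)
  exact (hf.zpow (.inl h0)).mul (h1.const_mul c).cexp

lemma differentiableAt_regular {Δ : ℝ} {y : Fin N → ℤ} {x : ℤ} {t : ℝ} {σ : Perm (Fin N)}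
    {J K : Finset (Fin N)} (hJ : J = K.map σ.toEmbedding) {v : Point N}
    (hv : RegularAt Δ J K v) : DifferentiableAt ℂ (regular Δ y x t σ K) v := by
  have da : ∀ i, DifferentiableAt ℂ (fun v : Point N => v i) v := fun i =>
    differentiableAt_apply i v
  have hK : ∀ k, k ∈ K → σ k ∈ J := fun k hk => hJ ▸ mem_map_of_mem _ hk
  have hK' : ∀ k, k ∈ Kᶜ → σ k ∉ J := fun k hk hc => by
    rw [hJ, mem_map_equiv, Equiv.symm_apply_apply] at hc
    exact mem_compl.1 hk hc
  have h1 : DifferentiableAt ℂ (regularMain Δ y x t σ K) v := by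
    unfold regularMain
    refine (DifferentiableAt.mul (differentiableAt_div ?_ ?_ ?_) ?_).mul ?_
    · exact (DifferentiableAt.const_mul (differentiableAt_prod fun k _ =>
        differentiableAt_prod fun j _ => differentiableAt_rFac Δ (da _) (da _)) _).mul
        (differentiableAt_prod fun k hk => DifferentiableAt.fun_inv
          (((da _).mul (da _)).const_sub 1) (hv.one_sub _ (hK k hk) k hk))
    · exact (differentiableAt_pairProd fun _ _ _ _ _ => differentiableAt_pFac Δ (da _) (da _)).mul
        (differentiableAt_pairProd fun _ _ _ _ _ => differentiableAt_pFac Δ (da _) (da _))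
    · refine mul_ne_zero (pairProd_ne_zero fun j hj k hk _ => ?_) (pairProd_ne_zero fun j hj k hk _ =>
        hv.right j hj k hk)
      rw [← hJ] at hj hk
      exact hv.left j hj k hk
    · refine differentiableAt_prod fun k _ => ?_
      simp only [← neg_mul]
      exact differentiableAt_exp_energy Δ _ _ (da _) (hv.left_ne _)
    · exact differentiableAt_prod fun k hk => differentiableAt_exp_energy Δ _ _ (da _) (hv.right_ne _ hk)
  have h2 : DifferentiableAt ℂ (regularMixed Δ y σ K) v := by
    unfold regularMixed
    refine DifferentiableAt.mul (differentiableAt_prod fun k hk => differentiableAt_prod fun k' _ => ?_)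
      (differentiableAt_prod fun k _ => (da _).zpow (.inl (hv.left_ne _)))
    unfold mixedFactor
    refine DifferentiableAt.mul ?_ ?_
    · by_cases hc : σ k < σ k' ∧ (k' ∈ K ∨ k' < k)
      · simp only [if_pos hc]
        exact differentiableAt_div (differentiableAt_pFac Δ (da _) (da _))
          (differentiableAt_pFac Δ (da _) (da _)) (hv.mixed _ (hK' k hk) _ hc.1.ne')
      · simp only [if_neg hc]
        exact differentiableAt_const _
    · by_cases hc : k' ∈ K ∧ k < k'
      · simp only [if_pos hc]
        exact differentiableAt_div (differentiableAt_rFac Δ (da _) (da _))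
          (((da _).add (da _)).sub (differentiableAt_const _)) (hv.add _ (hK' k hk) _ hc.1)
      · simp only [if_neg hc]
        exact differentiableAt_const _
  exact h1.mul h2

/-! ### Deformation of the contours of the series -/

lemma iter_congr_off_countable {ι : Type} [DecidableEq ι] {Γ : ι → Contour} {l : List ι}
    (hs : ∀ j ∈ l, IsSmooth (Γ j)) (B : ι → Set ℂ) (hB : ∀ j ∈ l, (B j).Countable)
    {F G : (ι → ℂ) → ℂ} {v : ι → ℂ} (h : ∀ w : ι → ℂ, (∀ j, j ∉ l → w j = v j) →
      (∀ j ∈ l, w j ∈ trace (Γ j) ∧ w j ∉ B j) → F w = G w) : iter Γ l F v = iter Γ l G v := by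
  induction l generalizing v with
  | nil => exact h v (fun _ _ => rfl) fun j hj => by simp at hj
  | cons j l ih =>
    refine contourIntegral_congr_off_countable (hs j (.head _)) (hB j (.head _))
      fun z hz hz' => ih (fun k hk => hs k (.tail _ hk))
        (fun k hk => hB k (.tail _ hk)) fun w h1 h2 => h w (fun k hk => ?_) fun k hk => ?_
    · rw [List.mem_cons, not_or] at hk
      rw [h1 k hk.2, update_of_ne hk.1]
    · by_cases hkl : k ∈ l
      · exact h2 k hkl
      · obtain rfl := (List.mem_cons.1 hk).resolve_right hkl
        rw [h1 k hkl, update_self]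
        exact ⟨hz, hz'⟩

lemma iteratedIntegral_inl (Γ : Contour) (l : List (Fin N)) (F : Point N → ℂ)
    (ξ ζ : Fin N → ℂ) : iteratedIntegral Γ l (fun ξ' => F (Sum.elim ξ' ζ)) ξ =
      iter (fun _ => Γ) (l.map .inl) F (Sum.elim ξ ζ) := by
  induction l generalizing ξ with
  | nil => rfl
  | cons j l ih => simp only [iteratedIntegral, List.map_cons, iter, ih, Sum.update_elim_inl]

lemma iteratedIntegral_inr (Γ : Contour) (l : List (Fin N)) (F : Point N → ℂ)
    (ξ ζ : Fin N → ℂ) : iteratedIntegral Γ l (fun ζ' => F (Sum.elim ξ ζ')) ζ =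
      iter (fun _ => Γ) (l.map .inr) F (Sum.elim ξ ζ) := by
  induction l generalizing ζ with
  | nil => rfl
  | cons j l ih => simp only [iteratedIntegral, List.map_cons, iter, ih, Sum.update_elim_inr]

/-- The contours of the variables `ξ_j` with `j ∈ J`, of the `ζ_k`, and of the other `ξ_j`. -/
def family (J : Finset (Fin N)) (A B C : Contour) : Fin N ⊕ Fin N → Contour :=
  Sum.elim (fun j => if j ∈ J then A else C) fun _ => B

/-- The ranges of the variables. -/
def ranges (J K : Finset (Fin N)) (A B C : Set ℂ) : Fin N ⊕ Fin N → Set ℂ :=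
  Sum.elim (fun j => if j ∈ J then A else C) fun k => if k ∈ K then B else Set.univ

lemma mem_ranges {J K : Finset (Fin N)} {A B C : Set ℂ} {v : Point N} :
    v ∈ offBox [] (ranges J K A B C) ↔ (∀ j ∈ J, v (.inl j) ∈ A) ∧ (∀ j ∉ J, v (.inl j) ∈ C) ∧
      ∀ k ∈ K, v (.inr k) ∈ B := by
  rw [mem_offBox_nil, Sum.forall]
  simp only [ranges, Sum.elim_inl, Sum.elim_inr]
  constructor
  · rintro ⟨h1, h2⟩
    exact ⟨fun j hj => by simpa [hj] using h1 j, fun j hj => by simpa [hj] using h1 j,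
      fun k hk => by simpa [hk] using h2 k⟩
  · rintro ⟨h1, h2, h3⟩
    refine ⟨fun j => ?_, fun k => ?_⟩
    · split_ifs with hj
      exacts [h1 j hj, h2 j hj]
    · split_ifs with hk
      exacts [h3 k hk, trivial]

lemma isSmooth_family {J : Finset (Fin N)} {A B C : Contour} (hA : IsSmooth A) (hB : IsSmooth B)
    (hC : IsSmooth C) (i : Fin N ⊕ Fin N) : IsSmooth (family J A B C i) := by
  rcases i with j | k
  · simp only [family, Sum.elim_inl]
    split_ifs
    exacts [hA, hC]
  · exact hB

lemma trace_family {J K : Finset (Fin N)} {A B C : Contour} {SA SB SC : Set ℂ} (hA : trace A ⊆ SA)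
    (hB : trace B ⊆ SB) (hC : trace C ⊆ SC) (i : Fin N ⊕ Fin N) :
    trace (family J A B C i) ⊆ ranges J K SA SB SC i := by
  rcases i with j | k
  · simp only [family, ranges, Sum.elim_inl]
    split_ifs
    exacts [hA, hC]
  · simp only [family, ranges, Sum.elim_inr]
    split_ifs
    exacts [hB, Set.subset_univ _]

/-- Replacing the contours by type of the variables. -/
lemma iter_family_replace {J K : Finset (Fin N)} {A A' B B' C C' : Contour} {SA SB SC : Set ℂ}
    (hs : IsSmooth A ∧ IsSmooth A' ∧ IsSmooth B ∧ IsSmooth B' ∧ IsSmooth C ∧ IsSmooth C')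
    (ht : trace A ⊆ SA ∧ trace A' ⊆ SA ∧ trace B ⊆ SB ∧ trace B' ⊆ SB ∧ trace C ⊆ SC ∧ trace C' ⊆ SC)
    {l : List (Fin N ⊕ Fin N)} (hl : l.Nodup) (hlK : ∀ k, .inr k ∈ l → k ∈ K)
    {F : Point N → ℂ} (hF : ContinuousOn F (offBox [] (ranges J K SA SB SC)))
    (hA : ∀ j ∈ J, ∀ v ∈ offBox [.inl j] (ranges J K SA SB SC),
      contourIntegral A (fun z => F (update v (.inl j) z)) =
        contourIntegral A' fun z => F (update v (.inl j) z))
    (hB : ∀ k ∈ K, ∀ v ∈ offBox [.inr k] (ranges J K SA SB SC),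
      contourIntegral B (fun z => F (update v (.inr k) z)) =
        contourIntegral B' fun z => F (update v (.inr k) z))
    (hC : ∀ j ∉ J, ∀ v ∈ offBox [.inl j] (ranges J K SA SB SC),
      contourIntegral C (fun z => F (update v (.inl j) z)) =
        contourIntegral C' fun z => F (update v (.inl j) z))
    {v : Point N} (hv : v ∈ offBox l (ranges J K SA SB SC)) :
    iter (family J A B C) l F v = iter (family J A' B' C') l F v := by
  refine iter_replace_all (T := ranges J K SA SB SC) hl
    (fun i _ => isSmooth_family hs.1 hs.2.2.1 hs.2.2.2.2.1 i)
    (fun i _ => isSmooth_family hs.2.1 hs.2.2.2.1 hs.2.2.2.2.2 i)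
    (fun i _ => trace_family ht.1 ht.2.2.1 ht.2.2.2.2.1 i)
    (fun i _ => trace_family ht.2.1 ht.2.2.2.1 ht.2.2.2.2.2 i) hF (fun i hi w hw => ?_) hv
  rcases i with j | k
  · by_cases hj : j ∈ J
    · simpa only [family, Sum.elim_inl, if_pos hj] using hA j hj w hw
    · simpa only [family, Sum.elim_inl, if_neg hj] using hC j hj w hw
  · exact hB k (hlK k hi) w hw

lemma differentiableOn_slice {ι : Type} [DecidableEq ι] [Fintype ι] {F : (ι → ℂ) → ℂ} {v : ι → ℂ} {i : ι}
    {U : Set ℂ} (h : ∀ z ∈ U, DifferentiableAt ℂ F (update v i z)) :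
    DifferentiableOn ℂ (fun z => F (update v i z)) U := fun z hz =>
  ((h z hz).comp z (hasDerivAt_update v i z).differentiableAt).differentiableWithinAt

lemma mem_update_ranges {T : Fin N ⊕ Fin N → Set ℂ} {v : Point N} {i : Fin N ⊕ Fin N}
    (hv : v ∈ offBox [i] T) {z : ℂ} {U : Set ℂ} (hz : z ∈ U) :
    update v i z ∈ offBox [] (update T i U) := by
  refine mem_offBox_nil.2 fun k => ?_
  by_cases e : k = i
  · subst e; simpa using hz
  · rw [update_of_ne e, update_of_ne e]
    exact hv k (by simpa using e)

/-! ### Regularity on the contours -/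

namespace HatData
variable {Δ R R' ε₁ ε₂ : ℝ} (h : HatData Δ R ε₁ ε₂) (hR : 2 * R < R') {J K : Finset (Fin N)}
  {v : Point N}
include h hR

lemma regularAt_of_wedge (h1 : ∀ j ∈ J, v (.inl j) ∈ wedge R) (h2 : ∀ k ∈ K, -v (.inr k) ∈ wedge R')
    (h3 : ∀ j ∈ J, ∀ k ∈ K, v (.inl j) ≠ I ∨ ‖v (.inr k)‖ = R') (h4 : ∀ j ∉ J, 1 ≤ ‖v (.inl j)‖)
    (h5 : ∀ j ∉ J, ∀ j' ∈ J, pFac Δ (v (.inl j)) (v (.inl j')) ≠ 0)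
    (h6 : ∀ j ∉ J, ∀ j' ∉ J, j' ≠ j → pFac Δ (v (.inl j)) (v (.inl j')) ≠ 0)
    (h7 : ∀ j ∉ J, ∀ k ∈ K, v (.inl j) + v (.inr k) - 2 * Δ ≠ 0) : RegularAt Δ J K v := by
  have h0 := h.one_lt
  have n1 : ∀ j ∈ J, 1 ≤ ‖v (.inl j)‖ := fun j hj => one_le_norm_of_mem_wedge h0.le (h1 j hj)
  have n2 : ∀ k ∈ K, 1 ≤ ‖v (.inr k)‖ := fun k hk => by
    have := one_le_norm_of_mem_wedge (by linarith) (h2 k hk)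
    rwa [norm_neg] at this
  have ne : ∀ {z : ℂ}, 1 ≤ ‖z‖ → z ≠ 0 := fun hz => norm_pos_iff.1 (zero_lt_one.trans_le hz)
  refine ⟨fun j => ?_, fun k hk => ne (n2 k hk), fun j hj k hk => ?_, fun j hj j' hj' =>
    pFac_wedge_ne_zero h.ne_zero h.lt_radius (h1 j hj) (h1 j' hj'), fun k hk k' hk' => ?_,
    fun j hj j' hne => ?_, h7⟩
  · by_cases hj : j ∈ J
    exacts [ne (n1 j hj), ne (h4 j hj)]
  · refine one_sub_mul_ne_zero_of_norm (n1 j hj) (n2 k hk) ?_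
    rcases h3 j hj k hk with h8 | h8
    · exact .inl (one_lt_norm_of_mem_wedge h0 (h1 j hj) h8)
    · exact .inr (by linarith)
  · have := pFac_wedge_ne_zero (neg_ne_zero.2 h.ne_zero) (by rw [abs_neg]; linarith [h.lt_radius])
      (h2 k hk) (h2 k' hk')
    rwa [pFac_neg, neg_neg] at this
  · by_cases hj' : j' ∈ J
    exacts [h5 j hj j' hj', h6 j hj j' hj' hne]

lemma regularAt_swept (h1 : ∀ j ∈ J, v (.inl j) ∈ wedge R) (h2 : ∀ k ∈ K, -v (.inr k) ∈ wedge R')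
    (h3 : ∀ j ∈ J, ∀ k ∈ K, v (.inl j) ≠ I ∨ ‖v (.inr k)‖ = R')
    (h4 : ∀ j ∉ J, v (.inl j) ∈ hatSwept Δ R ε₁ ε₂)
    (h5 : ∀ j ∉ J, ∀ j' ∉ J, j' ≠ j →
      v (.inl j) ∈ hatOuter Δ R ε₁ ε₂ ∨ v (.inl j') ∈ hatOuter Δ R ε₁ ε₂) : RegularAt Δ J K v := by
  refine h.regularAt_of_wedge hR h1 h2 h3 (fun j hj => one_le_norm_of_swept (h4 j hj))
    (fun j hj j' hj' => h.pFac_swept_wedge (h4 j hj) (h1 j' hj')) (fun j hj j' hj' hne => ?_)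
    fun j hj k hk => ?_
  · rcases h5 j hj j' hj' hne with h6 | h6
    · exact h.pFac_outer_swept h6 (h4 j' hj')
    · exact h.pFac_swept_outer (h4 j hj) h6
  · have := h.add_sub_ne_zero hR (h4 j hj) (h2 k hk)
    rwa [neg_neg] at this

omit h hR in
lemma mem_wedge_of_norm {z : ℂ} {ρ : ℝ} (hz : ‖z‖ = ρ) : z ∈ wedge ρ := ⟨hz.le, .inl hz⟩

lemma regularAt_of_norm (h1 : ∀ j ∈ J, ‖v (.inl j)‖ = R) (h2 : ∀ k ∈ K, ‖v (.inr k)‖ = R')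
    (h4 : ∀ j ∉ J, 1 ≤ ‖v (.inl j)‖ ∧ ‖v (.inl j)‖ ≤ R)
    (h6 : ∀ j ∉ J, ∀ j' ∉ J, j' ≠ j → pFac Δ (v (.inl j)) (v (.inl j')) ≠ 0) : RegularAt Δ J K v :=
  h.regularAt_of_wedge hR (fun j hj => mem_wedge_of_norm (h1 j hj))
    (fun k hk => mem_wedge_of_norm (by rw [norm_neg, h2 k hk])) (fun _ _ k hk => .inr (h2 k hk))
    (fun j hj => (h4 j hj).1) (fun j hj j' hj' => pFac_ne_zero h.lt_radius.le (h4 j hj).1 (h1 j' hj').ge) h6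
    fun j hj k hk => h.add_sub_ne_zero_of_norm hR (h4 j hj).2 (h2 k hk)

/-- Regularity after the first two groups of variables have been moved to circles. -/
lemma regularAt_far (hv : v ∈ offBox [] (ranges J K {z | ‖z‖ = R} {z | ‖z‖ = R'}
    {z | z ∈ hatFar Δ R ε₁ ε₂ ∧ 1 < ‖z‖})) : RegularAt Δ J K v := by
  obtain ⟨h1, h2, h3⟩ := mem_ranges.1 hv
  exact h.regularAt_of_norm hR h1 h3 (fun j hj => ⟨(h2 j hj).2.le, (h2 j hj).1.1⟩)
    fun j hj j' hj' _ => h.pFac_far_ne_zero (h2 j hj).2 (h2 j hj).1.2.1 (h2 j' hj').1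

lemma regularAt_cap {o : Fin N} (hv : v ∈ offBox [] (update
    (ranges J K {z | ‖z‖ = R} {z | ‖z‖ = R'} (hatCapOff Δ R)) (.inl o) (hatCap R))) (ho : o ∉ J) :
    RegularAt Δ J K v := by
  rw [mem_offBox_nil] at hv
  have h1 : ∀ j ∈ J, ‖v (.inl j)‖ = R := fun j hj => by
    have := hv (.inl j)
    rw [update_of_ne (by rintro ⟨⟩; exact ho hj)] at this
    simpa [ranges, hj] using this
  have h2 : ∀ k ∈ K, ‖v (.inr k)‖ = R' := fun k hk => by
    have := hv (.inr k)
    rw [update_of_ne (by simp)] at this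
    simpa [ranges, hk] using this
  have h3 : ∀ j ∉ J, j ≠ o → v (.inl j) ∈ hatCapOff Δ R := fun j hj hne => by
    have := hv (.inl j)
    rw [update_of_ne (by simpa using hne)] at this
    simpa [ranges, hj] using this
  have h4 : v (.inl o) ∈ hatCap R := by simpa using hv (.inl o)
  have h5 : ∀ j ∉ J, v (.inl j) ∈ hatCap R := fun j hj => by
    by_cases e : j = o
    exacts [e ▸ h4, (h3 j hj e).1]
  refine h.regularAt_of_norm hR h1 h2 (fun j hj => ⟨?_, (h5 j hj).1⟩) fun j hj j' hj' hne => ?_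
  · rcases (h5 j hj).2 with h6 | h6
    · exact one_le_norm_of_im (h6.trans (le_abs_self _))
    · rw [h6]; exact h.one_lt.le
  · by_cases e : j = o
    · exact (h.pFac_cap_capOff (h5 j hj) (h3 j' hj' (e ▸ hne))).1
    · exact (h.pFac_cap_capOff (h5 j' hj') (h3 j hj e)).2

end HatData

/-! ### The terms of the series on circles -/

/-- The variables of the term of the series with index sets `J` and `K`, outermost first. -/
def seriesVars (J K : Finset (Fin N)) : List (Fin N ⊕ Fin N) :=
  (J.sort).map .inl ++ ((K.sort).map .inr ++ (Jᶜ.sort).map .inl)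

lemma mem_seriesVars {J K : Finset (Fin N)} {i : Fin N ⊕ Fin N} :
    i ∈ seriesVars J K ↔ ∀ k, i = .inr k → k ∈ K := by
  rcases i with j | k
  · simpa [seriesVars] using em _
  · simp [seriesVars]

lemma nodup_seriesVars (J K : Finset (Fin N)) : (seriesVars J K).Nodup := by
  refine ((sort_nodup _ _).map Sum.inl_injective).append (((sort_nodup _ _).map Sum.inr_injective).append
    ((sort_nodup _ _).map Sum.inl_injective) ?_) ?_
  · simp [List.Disjoint]
  · simp only [List.Disjoint, List.mem_append, List.mem_map, mem_sort, mem_compl]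
    rintro _ ⟨j, hj, rfl⟩ (⟨k, -, hk⟩ | ⟨j', hj', e⟩)
    · exact absurd hk (by simp)
    · exact hj' (Sum.inl_injective e ▸ hj)

lemma mem_offBox_seriesVars {J K : Finset (Fin N)} {A B C : Set ℂ} (v : Point N) :
    v ∈ offBox (seriesVars J K) (ranges J K A B C) := by
  intro i hi
  rw [mem_seriesVars] at hi
  push Not at hi
  obtain ⟨k, rfl, hk⟩ := hi
  simp [ranges, hk]

namespace HatData
variable {Δ R R' ε₁ ε₂ : ℝ} (h : HatData Δ R ε₁ ε₂) (hR : 2 * R < R') {J K : Finset (Fin N)}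
  {F : Point N → ℂ} (hF : ∀ v, RegularAt Δ J K v → DifferentiableAt ℂ F v)
include h

omit h in
lemma isSmooth_outer (β : ℝ) : IsSmooth (hatArcs R ++ hatTop Δ R ε₁ ε₂ β) :=
  isSmooth_append.2 ⟨isSmooth_hatArcs _, isSmooth_hatTop _ _ _ _ _⟩

lemma two_lt_radius : 2 < R := by linarith [h.lt_radius, abs_nonneg Δ]

lemma trace_circ_subset : trace (circ R) ⊆ hatCapOff Δ R := fun z hz => by
  have h1 := norm_of_mem_circ (zero_le_one.trans h.one_lt.le) hz
  have h4 : 1 < ‖z‖ := h1 ▸ h.one_lt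
  exact ⟨⟨h1.le, .inr h1⟩, h4, by rintro rfl; simp at h4, h.ne_of_norm_eq h1⟩

include hR hF

/-- The straight sides of `Γ̂` may be replaced by arcs. -/
lemma iter_gammaHat {l : List (Fin N)} (hl : l.Nodup) (hlJ : ∀ j ∈ l, j ∉ J) {v : Point N}
    (hv : v ∈ offBox (l.map .inl) (ranges J K (wedge R \ {I}) {z | -z ∈ wedge R'}
      (hatOuter Δ R ε₁ ε₂))) :
    iter (fun _ => gammaHat Δ R ε₁ ε₂) (l.map .inl) F v =
      iter (fun _ => hatArcs R ++ hatTop Δ R ε₁ ε₂ (-pi)) (l.map .inl) F v := by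
  set T := ranges J K (wedge R \ {I}) {z | -z ∈ wedge R'} (hatOuter Δ R ε₁ ε₂) with hT
  set Γ' := hatArcs R ++ hatTop Δ R ε₁ ε₂ (-pi) with hΓ'
  have hreg : ∀ o ∉ J, ∀ w ∈ offBox [] (update T (.inl o) (hatSwept Δ R ε₁ ε₂)),
      RegularAt Δ J K w := by
    intro o ho w hw
    rw [mem_offBox_nil] at hw
    have h1 : ∀ j ∈ J, w (.inl j) ∈ wedge R \ {I} := fun j hj => by
      have := hw (.inl j)
      rw [update_of_ne (by rintro ⟨⟩; exact ho hj)] at this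
      simpa only [hT, ranges, Sum.elim_inl, if_pos hj] using this
    have h2 : ∀ j ∉ J, j ≠ o → w (.inl j) ∈ hatOuter Δ R ε₁ ε₂ := fun j hj hne => by
      have := hw (.inl j)
      rw [update_of_ne (by simpa using hne)] at this
      simpa only [hT, ranges, Sum.elim_inl, if_neg hj] using this
    refine h.regularAt_swept hR (fun j hj => (h1 j hj).1) (fun k hk => ?_)
      (fun j hj _ _ => .inl (h1 j hj).2) (fun j hj => ?_) fun j hj j' hj' hne => ?_
    · have := hw (.inr k)
      rw [update_of_ne (by simp)] at this
      simpa only [hT, ranges, Sum.elim_inr, if_pos hk, Set.mem_ofPred_eq] using this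
    · by_cases e : j = o
      · subst e; simpa using hw (.inl j)
      · exact hatOuter_subset (h2 j hj e)
    · by_cases e : j = o
      · exact .inr (h2 j' hj' (e ▸ hne))
      · exact .inl (h2 j hj e)
  induction l generalizing v with
  | nil => rfl
  | cons o l ih =>
    have hl' := List.nodup_cons.1 hl
    have ho := hlJ o (.head _)
    have hTo : T (.inl o) = hatOuter Δ R ε₁ ε₂ := by simp only [hT, ranges, Sum.elim_inl, if_neg ho]
    have hsub : ∀ i, T i ⊆ update T (.inl o) (hatSwept Δ R ε₁ ε₂) i := fun i => by
      by_cases e : i = .inl o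
      · subst e; rw [update_self, hTo]; exact hatOuter_subset
      · rw [update_of_ne e]
    have hne : ∀ i ∈ l.map Sum.inl, i ≠ (.inl o : Fin N ⊕ Fin N) := by
      rintro i hi rfl
      exact hl'.1 (by simpa using hi)
    have e1 : iter (fun _ => gammaHat Δ R ε₁ ε₂) ((o :: l).map .inl) F v =
        iter (update (fun _ => Γ') (.inl o) (gammaHat Δ R ε₁ ε₂)) ((o :: l).map .inl) F v := by
      simp only [List.map_cons, iter, update_self]
      refine contourIntegral_congr_off_countable (isSmooth_gammaHat _ _ _ _)
        (B := {-I, 2 * Δ - I}) (Set.toFinite _).countable fun z hz hz' => ?_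
      rw [Set.mem_insert_iff, Set.mem_singleton_iff, not_or] at hz'
      obtain ⟨g1, g2, g3⟩ := h.trace_gammaHat hz
      rw [ih hl'.2 (fun j hj => hlJ j (.tail _ hj))
        (update_mem_offBox hv (hTo ▸ ⟨g1, g2.resolve_right hz'.1, hz'.2, g3⟩))]
      exact iter_congr_contour (fun i hi => (update_of_ne (hne i hi) _ _).symm) _ _
    have hin : ∀ i : Fin N ⊕ Fin N, i ∈ l.map Sum.inl → T i = hatOuter Δ R ε₁ ε₂ := fun i hi => by
      obtain ⟨j, hj, rfl⟩ := List.mem_map.1 hi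
      simp only [hT, ranges, Sum.elim_inl, if_neg (hlJ j (.tail _ hj))]
    rw [e1, iter_replace (i := .inl o) (T := update T (.inl o) (hatSwept Δ R ε₁ ε₂))
      (C := Γ') (S := hatOuter Δ R ε₁ ε₂) (by simp) (hl.map Sum.inl_injective) (fun i _ => ?_)
      (isSmooth_outer _) (fun i hi => ?_) h.trace_outer
      (fun w hw => (hF w (hreg o ho w hw)).continuousAt.continuousWithinAt) (fun w hw => ?_)
      (fun w hw => ?_) fun i hi => hsub i (hv i hi)]
    · refine iter_congr_contour (fun i _ => ?_) _ _
      rw [update_idem, update_apply, ite_self]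
    · rw [update_apply]
      split_ifs
      exacts [isSmooth_gammaHat _ _ _ _, isSmooth_outer _]
    · by_cases e : i = .inl o
      · subst e; rw [update_self, update_self]; exact h.trace_gammaHat
      · rw [update_of_ne e, update_of_ne e,
          hin i ((List.mem_cons.1 hi).resolve_left e)]
        exact h.trace_outer
    · rw [update_idem, ← hTo, update_eq_self] at hw
      exact (hF w (hreg o ho w fun i hi => hsub i (hw i hi))).continuousAt.continuousWithinAt
    · rw [update_self]
      refine h.contourIntegral_gammaHat (differentiableOn_slice fun z hz => hF _ (hreg o ho _ ?_))
      have := mem_update_ranges hw hz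
      rwa [update_idem] at this

lemma iter_gammaMinus {w : Point N} (hw : ∀ j ∈ J, w (.inl j) ∈ wedge R \ {I}) :
    iter (family J (circ R) (gammaMinus R') (hatArcs R ++ hatTop Δ R ε₁ ε₂ (-pi)))
        ((K.sort).map .inr ++ (Jᶜ.sort).map .inl) F w =
      iter (family J (circ R) (circ R') (hatArcs R ++ hatTop Δ R ε₁ ε₂ (-pi)))
        ((K.sort).map .inr ++ (Jᶜ.sort).map .inl) F w := by
  have h2 := h.two_lt_radius
  have hreg : ∀ w ∈ offBox [] (ranges J K (wedge R \ {I}) {z | -z ∈ wedge R'}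
      (hatOuter Δ R ε₁ ε₂)), RegularAt Δ J K w := fun w hw => by
    obtain ⟨h1, h2, h3⟩ := mem_ranges.1 hw
    exact h.regularAt_swept hR (fun j hj => (h1 j hj).1) h3 (fun j hj _ _ => .inl (h1 j hj).2)
      (fun j hj => hatOuter_subset (h2 j hj)) fun j hj _ _ _ => .inl (h2 j hj)
  have hc : trace (circ R) ⊆ wedge R \ {I} := fun z hz =>
    ⟨mem_wedge_of_norm (norm_of_mem_circ (by linarith) hz), (h.trace_circ_subset hz).2.2.1⟩
  refine iter_family_replace (K := K) (SA := wedge R \ {I}) (SB := {z | -z ∈ wedge R'})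
    (SC := hatOuter Δ R ε₁ ε₂)
    ⟨isSmooth_circ _, isSmooth_circ _, isSmooth_gammaMinus, isSmooth_circ _, isSmooth_outer _,
      isSmooth_outer _⟩
    ⟨hc, hc, trace_gammaMinus (by linarith), fun z hz => mem_wedge_of_norm ?_, h.trace_outer, h.trace_outer⟩
    (List.nodup_append.1 (nodup_seriesVars J K)).2.1 (fun k hk => by simpa using hk)
    (fun v hv => (hF v (hreg v hv)).continuousAt.continuousWithinAt)
    (fun _ _ _ _ => rfl) (fun k hk v hv => contourIntegral_gammaMinus (by linarith)
      (differentiableOn_slice fun z hz => hF _ (hreg _ ?_))) (fun _ _ _ _ => rfl) fun i hi => ?_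
  · rw [norm_neg, norm_of_mem_circ (by linarith) hz]
  · have hz' : z ∈ ranges J K (wedge R \ {I}) {z | -z ∈ wedge R'} (hatOuter Δ R ε₁ ε₂) (.inr k) := by
      simpa only [ranges, Sum.elim_inr, if_pos hk] using hz
    have := mem_update_ranges hv hz'
    rwa [update_eq_self] at this
  · rcases i with j | k
    · have hj : j ∈ J := by simpa using hi
      simpa only [ranges, Sum.elim_inl, if_pos hj] using hw j hj
    · have hk : k ∉ K := by simpa using hi
      simp [ranges, hk]

/-- Once the other variables run over circles, the remaining contours may be replaced by circles. -/
lemma iter_family_eq_torus :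
    iter (family J (gammaPlus R) (circ R') (hatArcs R ++ hatTop Δ R ε₁ ε₂ (-pi)))
      (seriesVars J K) F 0 = iter (torus N R R') (seriesVars J K) F 0 := by
  have h2 := h.two_lt_radius
  have hl := nodup_seriesVars J K
  have hlK : ∀ k, .inr k ∈ seriesVars J K → k ∈ K := fun k hk => mem_seriesVars.1 hk k rfl
  have cc := isSmooth_circ
  have cR : trace (circ R) ⊆ {z | ‖z‖ = R} := fun z hz => norm_of_mem_circ (by linarith) hz
  have cR' : trace (circ R') ⊆ {z | ‖z‖ = R'} := fun z hz => norm_of_mem_circ (by linarith) hz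
  have hup : ∀ {T : Fin N ⊕ Fin N → Set ℂ} {i v z}, v ∈ offBox [i] T → z ∈ T i →
      update v i z ∈ offBox [] T := fun {T i v z} hv hz => by
    have := mem_update_ranges hv hz
    rwa [update_eq_self] at this
  have hreg : ∀ w ∈ offBox [] (ranges J K (wedge R) {z | ‖z‖ = R'} (hatOuter Δ R ε₁ ε₂)),
      RegularAt Δ J K w := fun w hw => by
    obtain ⟨h1, h2, h3⟩ := mem_ranges.1 hw
    exact h.regularAt_swept hR h1 (fun k hk => mem_wedge_of_norm (by rw [norm_neg]; exact h3 k hk))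
      (fun _ _ k hk => .inr (h3 k hk)) (fun j hj => hatOuter_subset (h2 j hj)) fun j hj _ _ _ => .inl (h2 j hj)
  rw [iter_family_replace (K := K) (A' := circ R) (B' := circ R')
    (C' := hatArcs R ++ hatTop Δ R ε₁ ε₂ (-pi)) (SA := wedge R) (SB := {z | ‖z‖ = R'})
    (SC := hatOuter Δ R ε₁ ε₂)
    ⟨isSmooth_gammaPlus, cc _, cc _, cc _, isSmooth_outer _, isSmooth_outer _⟩
    ⟨trace_gammaPlus h2, fun z hz => mem_wedge_of_norm (cR hz), cR', cR', h.trace_outer, h.trace_outer⟩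
    hl hlK (fun v hv => (hF v (hreg v hv)).continuousAt.continuousWithinAt)
    (fun j hj v hv => contourIntegral_gammaPlus h2 (differentiableOn_slice fun z hz =>
      hF _ (hreg _ (hup hv (by simpa only [ranges, Sum.elim_inl, if_pos hj] using hz)))))
    (fun _ _ _ _ => rfl) (fun _ _ _ _ => rfl) (mem_offBox_seriesVars 0)]
  rw [iter_family_replace (K := K) (A' := circ R) (B' := circ R')
    (C' := hatArcs R ++ hatTop Δ R ε₁ ε₂ pi) (SA := {z | ‖z‖ = R}) (SB := {z | ‖z‖ = R'})
    (SC := {z | z ∈ hatFar Δ R ε₁ ε₂ ∧ 1 < ‖z‖})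
    ⟨cc _, cc _, cc _, cc _, isSmooth_outer _, isSmooth_outer _⟩
    ⟨cR, cR, cR', cR', fun z hz => ⟨(h.trace_outer hz).1, (h.trace_outer hz).2.1⟩,
      fun z hz => (h.trace_cap hz).2⟩
    hl hlK (fun v hv => (hF v (h.regularAt_far hR hv)).continuousAt.continuousWithinAt)
    (fun _ _ _ _ => rfl) (fun _ _ _ _ => rfl) (fun j hj v hv => ?_) (mem_offBox_seriesVars 0)]
  · rw [iter_family_replace (K := K) (A' := circ R) (B' := circ R')
      (C' := circ R) (SA := {z | ‖z‖ = R}) (SB := {z | ‖z‖ = R'}) (SC := hatCapOff Δ R)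
      ⟨cc _, cc _, cc _, cc _, isSmooth_outer _, cc _⟩
      ⟨cR, cR, cR', cR', fun z hz => (h.trace_cap hz).1, h.trace_circ_subset⟩
      hl hlK (fun v hv => ?_) (fun _ _ _ _ => rfl) (fun _ _ _ _ => rfl) (fun j hj v hv => ?_)
      (mem_offBox_seriesVars 0)]
    · refine iter_congr_contour (fun i _ => ?_) _ _
      rcases i with j | k
      · exact ite_self _
      · rfl
    · refine (hF v ?_).continuousAt.continuousWithinAt
      obtain ⟨h1, h2, h3⟩ := mem_ranges.1 hv
      exact h.regularAt_of_norm hR h1 h3 (fun j hj => ⟨(h2 j hj).2.1.le, (h2 j hj).1.1⟩)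
        fun j hj j' hj' _ => (h.pFac_cap_capOff (h2 j hj).1 (h2 j' hj')).1
    · exact h.contourIntegral_cap (differentiableOn_slice fun z hz =>
        hF _ (h.regularAt_cap hR (mem_update_ranges hv hz) hj))
  · rw [contourIntegral_append, contourIntegral_append]
    congr 1
    refine contourIntegral_hatTop h.pos₂ (differentiableOn_slice fun z hz =>
      hF _ (h.regularAt_far hR (hup hv ?_)))
    rw [mem_closedBall_iff_norm] at hz
    simpa only [ranges, Sum.elim_inl, if_neg hj, Set.mem_ofPred_eq] using h.closedBall_subset hz

end HatData

/-! ### The terms of the series as sums over permutations -/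

section
variable {Δ : ℝ} {y : Fin N → ℤ} {x : ℤ} {t : ℝ} {σ : Perm (Fin N)} {K : Finset (Fin N)}
  {v w : Point N}

lemma regularMain_congr (h1 : ∀ k ∈ K, v (.inl (σ k)) = w (.inl (σ k)))
    (h2 : ∀ k ∈ K, v (.inr k) = w (.inr k)) :
    regularMain Δ y x t σ K v = regularMain Δ y x t σ K w := by
  have h3 : ∀ j ∈ K.map σ.toEmbedding, v (.inl j) = w (.inl j) := fun j hj => by
    obtain ⟨k, hk, rfl⟩ := mem_map.1 hj
    exact h1 k hk
  unfold regularMain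
  congr 1
  · congr 1
    · congr 1
      · congr 1
        · exact congrArg _ (prod_congr rfl fun k hk => prod_congr rfl fun j hj => by
            rw [h1 j (mem_of_mem_erase hj), h2 k hk])
        · exact prod_congr rfl fun k hk => by rw [h1 k hk, h2 k hk]
      · congr 1
        · exact pairProd_congr fun j hj k hk _ => by rw [h3 j hj, h3 k hk]
        · exact pairProd_congr fun j hj k hk _ => by rw [h2 j hj, h2 k hk]
    · exact prod_congr rfl fun k hk => by rw [h1 k hk]
  · exact prod_congr rfl fun k hk => by rw [h2 k hk]

lemma regular_update {k : Fin N} (hk : k ∉ K) (z : ℂ) :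
    regular Δ y x t σ K (update v (.inr k) z) = regular Δ y x t σ K v := by
  have h1 : ∀ j, update v (.inr k) z (.inl j) = v (.inl j) := fun j =>
    update_of_ne (by simp) _ _
  have h2 : ∀ j ∈ K, update v (.inr k) z (.inr j) = v (.inr j) := fun j hj =>
    update_of_ne (by rintro ⟨⟩; exact hk hj) _ _
  rw [regular, regularMain_congr (fun k _ => h1 _) h2, regular, regularMixed, regularMixed]
  simp only [h1]
  congr 2
  refine prod_congr rfl fun j _ => prod_congr rfl fun j' _ => ?_
  simp only [mixedFactor, h1]
  congr 1
  by_cases hc : j' ∈ K ∧ j < j'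
  · rw [if_pos hc, if_pos hc, h2 j' hc.1]
  · rw [if_neg hc, if_neg hc]

end

/-- The variables `ζ_k` with `k ∉ K` integrate to `1`. -/
lemma Radii.iter_theta {Δ R R' : ℝ} (h : Radii Δ R R') (y : Fin N → ℤ) (x : ℤ) (t : ℝ)
    (σ : Perm (Fin N)) (J K : Finset (Fin N)) :
    iter (torus N R R') (allVars N) (theta Δ y y x t σ K) 0 =
      iter (torus N R R') (seriesVars J K) (regular Δ y x t σ K) 0 := by
  set l := (Kᶜ.map (Function.Embedding.inr : Fin N ↪ Fin N ⊕ Fin N)).toList with hl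
  have hml : ∀ i, i ∈ l ↔ ∃ k ∉ K, i = .inr k := fun i => by simp [hl, eq_comm]
  have hmem : ∀ i, i ∈ seriesVars J K ++ l := fun i => by
    rw [List.mem_append, mem_seriesVars, hml]
    by_contra! hc
    obtain ⟨⟨k, rfl, hk⟩, h2⟩ := hc
    exact h2 k hk rfl
  have hnd : (seriesVars J K ++ l).Nodup := (nodup_seriesVars J K).append (nodup_toList _)
    fun i hi hi' => by
      obtain ⟨k, hk, rfl⟩ := (hml i).1 hi'
      exact hk (mem_seriesVars.1 hi k rfl)
  have hR := h.pos
  have hR' := h.pos'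
  have hT := fun i (_ : i ∈ allVars N) => trace_torus hR.le hR'.le i
  have hT' := fun i (_ : i ∈ seriesVars J K ++ l) => trace_torus hR.le hR'.le i
  rw [iter_perm ((List.perm_ext_iff_of_nodup nodup_allVars hnd).2 fun i => iff_of_true (mem_allVars i) (hmem i))
    (fun i _ => isSmooth_torus _ _ i) hT (h.continuousOn_theta_apply y y x t σ K)
    (mem_offBox_of_forall_mem mem_allVars 0),
    iter_congr (G := fun v => regular Δ y x t σ K v * ∏ j ∈ l.toFinset, (v j)⁻¹) hT' (fun v hv => ?_)
      (mem_offBox_of_forall_mem hmem 0), iter_append]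
  · congr 1
    funext v
    rw [iter_mul_of_indep]
    · rw [iter_prod _ (nodup_toList _) fun _ z => z⁻¹, prod_eq_one, mul_one]
      intro i hi
      obtain ⟨k, -, rfl⟩ := (hml i).1 (List.mem_toFinset.1 hi)
      have := contourIntegral_circ_zpow hR' (-1)
      rw [if_pos rfl] at this
      simpa only [zpow_neg_one, torus, Sum.elim_inr] using this
    · intro v i hi z
      obtain ⟨k, hk, rfl⟩ := (hml i).1 hi
      exact regular_update hk z
  · obtain ⟨h1, h2⟩ := mem_torusSet_nil.1 hv
    have h3 := h.one_lt
    rw [theta_eq_regular, hl, toList_toFinset, prod_map, mul_comm]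
    · rfl
    · rintro (j | k)
      · exact norm_pos_iff.1 (by rw [h1]; exact hR)
      · exact norm_pos_iff.1 (by rw [h2]; exact hR')
    · exact fun i j => pFac_ne_zero h.lt_fst.le (by rw [h1]; exact h3.le) (h1 j).ge
    · exact fun i j => h.rFac_ne_zero (h1 i) (by rw [h2]; linarith [h.lt_snd])

section
variable {Δ R R' ε₁ ε₂ : ℝ} (h : HatData Δ R ε₁ ε₂) (hR : 2 * R < R') (y : Fin N → ℤ) (x : ℤ) (t : ℝ)
  {τ : Fin N → Option (Fin N)} (hτ : ∀ k k', τ k ≠ none → τ k = τ k' → k = k')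
include hτ

lemma integrandI_mul_iter {v : Point N}
    (hv : ∀ j ∈ setJ1 τ, ∀ k ∈ setK1 τ, rFac Δ (v (.inl j)) (v (.inr k)) ≠ 0) :
    integrandI Δ y x t τ (fun j => v (.inl j)) (fun k => v (.inr k)) *
      iter (fun _ => gammaHat Δ R ε₁ ε₂) (((setJ2 τ).sort).map Sum.inl)
        (fun v => integrandF Δ y τ (fun j => v (.inl j)) (fun k => v (.inr k))) v =
      iter (fun _ => gammaHat Δ R ε₁ ε₂) (((setJ2 τ).sort).map Sum.inl)
        (fun v => ∑ σ ∈ extensions τ, regular Δ y x t σ (setK1 τ) v) v := by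
  rw [← iter_const_mul]
  refine iter_congr_off_countable (fun _ _ => isSmooth_gammaHat _ _ _ _) (fun _ => ∅)
    (fun _ _ => Set.countable_empty) fun w hw _ => ?_
  rw [integrandI_eq hτ hv, sum_mul]
  refine sum_congr rfl fun σ hσ => ?_
  rw [integrandF_eq hσ, regular, regularMain_congr (w := w)]
  · refine fun k hk => (hw _ fun hc => ?_).symm
    have h1 : σ k ∈ setJ2 τ := by simpa using hc
    have h2 : σ k ∈ setJ1 τ := setJ1_eq hσ ▸ mem_map_of_mem _ hk
    exact mem_compl.1 h2 h1
  · exact fun k _ => (hw _ (by simp)).symm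

include h hR

lemma HatData.seriesTerm_eq : seriesTerm Δ y x t R R' ε₁ ε₂ τ =
    iter (ι := Fin N ⊕ Fin N) (family (setJ1 τ) (gammaPlus R) (circ R') (hatArcs R ++ hatTop Δ R ε₁ ε₂ (-pi)))
      (seriesVars (setJ1 τ) (setK1 τ)) (fun v => ∑ σ ∈ extensions τ, regular Δ y x t σ (setK1 τ) v) 0 := by
  set Φ : Point N → ℂ := fun v => ∑ σ ∈ extensions τ, regular Δ y x t σ (setK1 τ) v
  have hF : ∀ v, RegularAt Δ (setJ1 τ) (setK1 τ) v → DifferentiableAt ℂ Φ v := fun v hv =>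
    DifferentiableAt.fun_sum fun σ hσ => differentiableAt_regular (setJ1_eq hσ) hv
  have hJ2 : setJ2 τ = (setJ1 τ)ᶜ := (compl_compl _).symm
  set f : Point N → ℂ :=
    fun v => integrandF Δ y τ (fun j => v (.inl j)) (fun k => v (.inr k))
  have e0 : seriesTerm Δ y x t R R' ε₁ ε₂ τ =
      iter (ι := Fin N ⊕ Fin N) (fun _ => gammaPlus R) (((setJ1 τ).sort).map Sum.inl)
        (fun v => iter (ι := Fin N ⊕ Fin N) (fun _ => gammaMinus R') (((setK1 τ).sort).map Sum.inr)
          (fun v => integrandI Δ y x t τ (fun j => v (.inl j)) (fun k => v (.inr k)) *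
            iter (fun _ => gammaHat Δ R ε₁ ε₂) (((setJ2 τ).sort).map Sum.inl) f v)
          (Sum.elim (fun j => v (.inl j)) 0)) 0 := by
    rw [show (0 : Point N) = Sum.elim (0 : Fin N → ℂ) (0 : Fin N → ℂ) by ext i; rcases i <;> rfl, ← iteratedIntegral_inl,
      seriesTerm]
    congr 1
    funext ξ
    simp only [Sum.elim_inl]
    rw [← iteratedIntegral_inr]
    congr 1
    funext ζ
    rw [← iteratedIntegral_inl]
    rfl
  rw [e0, seriesVars, iter_append]
  have h2 := h.two_lt_radius
  have e1 : iter (family (setJ1 τ) (gammaPlus R) (circ R') (hatArcs R ++ hatTop Δ R ε₁ ε₂ (-pi)))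
      (((setJ1 τ).sort).map Sum.inl) = iter (fun _ => gammaPlus R) (((setJ1 τ).sort).map Sum.inl) := by
    funext G v
    refine iter_congr_contour (fun i hi => ?_) _ _
    obtain ⟨j, hj, rfl⟩ := List.mem_map.1 hi
    exact if_pos (by simpa using hj)
  rw [e1]
  refine iter_congr_off_countable (fun _ _ => isSmooth_gammaPlus) (fun _ => {I})
    (fun _ _ => Set.countable_singleton _) fun w hw0 hw1 => ?_
  have hw : ∀ j ∈ setJ1 τ, w (.inl j) ∈ wedge R \ {I} := fun j hj => by
    obtain ⟨g1, g2⟩ := hw1 (.inl j) (by simpa using hj)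
    exact ⟨trace_gammaPlus h2 g1, g2⟩
  have e2 : (Sum.elim (fun j => w (.inl j)) 0 : Point N) = w := by
    funext i
    rcases i with j | k
    · rfl
    · exact (hw0 (.inr k) (by simp)).symm
  have e4 : iter (family (setJ1 τ) (gammaPlus R) (circ R') (hatArcs R ++ hatTop Δ R ε₁ ε₂ (-pi)))
      (((setK1 τ).sort).map Sum.inr ++ ((setJ1 τ)ᶜ.sort).map Sum.inl) Φ w =
      iter (family (setJ1 τ) (circ R) (circ R') (hatArcs R ++ hatTop Δ R ε₁ ε₂ (-pi)))
      (((setK1 τ).sort).map Sum.inr ++ ((setJ1 τ)ᶜ.sort).map Sum.inl) Φ w := by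
    refine iter_congr_contour (fun i hi => ?_) _ _
    rcases i with j | k
    · have hj : j ∉ setJ1 τ := by simpa using hi
      simp only [family, Sum.elim_inl, if_neg hj]
    · rfl
  rw [e2, e4, ← h.iter_gammaMinus hR hF hw, iter_append]
  have e3 : iter (family (setJ1 τ) (circ R) (gammaMinus R') (hatArcs R ++ hatTop Δ R ε₁ ε₂ (-pi)))
      (((setK1 τ).sort).map Sum.inr) = iter (fun _ => gammaMinus R') (((setK1 τ).sort).map Sum.inr) := by
    funext G v
    refine iter_congr_contour (fun i hi => ?_) _ _
    obtain ⟨j, hj, rfl⟩ := List.mem_map.1 hi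
    rfl
  rw [e3]
  refine iter_congr_off_countable (fun _ _ => isSmooth_gammaMinus)
    (fun _ => ⋃ j ∈ setJ1 τ, {z | rFac Δ (w (.inl j)) z = 0})
    (fun _ _ => (setJ1 τ).countable_toSet.biUnion fun j hj => Set.Subsingleton.countable fun a ha b hb => ?_)
    fun u hu0 hu1 => ?_
  · have h3 : rFac Δ (w (.inl j)) a = 0 := ha
    have h4 : rFac Δ (w (.inl j)) b = 0 := hb
    have h5 := one_le_norm_of_mem_wedge h.one_lt.le (hw j hj).1
    rw [rFac] at h3 h4
    by_cases h6 : (1 - 2 * Δ * w (.inl j) : ℂ) = 0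
    · have : w (.inl j) = 0 := by linear_combination h3 - a * h6
      rw [this] at h5
      norm_num at h5
    · exact mul_left_cancel₀ h6 (by linear_combination h3 - h4)
  · have hu : ∀ j, u (.inl j) = w (.inl j) := fun j => hu0 _ (by simp)
    have hu2 : ∀ k ∈ setK1 τ, -u (.inr k) ∈ wedge R' ∧
        ∀ j ∈ setJ1 τ, rFac Δ (w (.inl j)) (u (.inr k)) ≠ 0 := fun k hk => by
      obtain ⟨g1, g2⟩ := hu1 (.inr k) (by simpa using hk)
      refine ⟨trace_gammaMinus (by linarith) g1, fun j hj hc => g2 ?_⟩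
      exact Set.mem_biUnion hj hc
    rw [integrandI_mul_iter y x t hτ fun j hj k hk => by rw [hu]; exact (hu2 k hk).2 j hj, hJ2,
      h.iter_gammaHat hR hF (sort_nodup _ _) (fun j hj => by simpa using hj)]
    · refine iter_congr_contour (fun i hi => ?_) _ _
      obtain ⟨j, hj, rfl⟩ := List.mem_map.1 hi
      exact (if_neg (by simpa using hj)).symm
    · intro i hi
      rcases i with j | k
      · have hj : j ∈ setJ1 τ := by simpa using hi
        simpa only [ranges, Sum.elim_inl, if_pos hj, hu] using hw j hj
      · simp only [ranges, Sum.elim_inr]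
        by_cases hk : k ∈ setK1 τ
        · rw [if_pos hk]; exact (hu2 k hk).1
        · rw [if_neg hk]; trivial

/-- The term of the series that belongs to `τ` collects the terms of the transition function that
belong to the permutations extending `τ`. -/
lemma HatData.seriesTerm_eq_sum (hr : Radii Δ R R') : seriesTerm Δ y x t R R' ε₁ ε₂ τ =
    ∑ σ ∈ extensions τ, iter (torus N R R') (allVars N) (theta Δ y y x t σ (setK1 τ)) 0 := by
  have hF : ∀ σ ∈ extensions τ, ∀ v, RegularAt Δ (setJ1 τ) (setK1 τ) v →
      DifferentiableAt ℂ (regular Δ y x t σ (setK1 τ)) v := fun σ hσ v hv =>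
    differentiableAt_regular (setJ1_eq hσ) hv
  rw [h.seriesTerm_eq hR y x t hτ, h.iter_family_eq_torus hR fun v hv =>
    DifferentiableAt.fun_sum fun σ hσ => hF σ hσ v hv,
    iter_sum (T := ranges (setJ1 τ) (setK1 τ) {z | ‖z‖ = R} {z | ‖z‖ = R'} {z | ‖z‖ = R})
      (fun i _ => isSmooth_torus _ _ i) (fun i hi => ?_) _ (fun σ hσ v hv => ?_) (mem_offBox_seriesVars 0)]
  · exact sum_congr rfl fun σ _ => (hr.iter_theta y x t σ (setJ1 τ) (setK1 τ)).symm
  · refine (trace_torus hr.pos.le hr.pos'.le i).trans ?_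
    rcases i with j | k
    · simp [ranges, torusSet]
    · have hk := mem_seriesVars.1 hi k rfl
      simp [ranges, torusSet, hk]
  · obtain ⟨h1, h2, h3⟩ := mem_ranges.1 hv
    exact (hF σ hσ v (h.regularAt_of_norm hR h1 h3 (fun j hj => ⟨(h2 j hj).ge.trans' hr.one_lt.le, (h2 j hj).le⟩)
      fun j hj j' hj' _ => pFac_ne_zero hr.lt_fst.le ((h2 j hj).ge.trans' hr.one_lt.le)
        (h2 j' hj').ge)).continuousAt.continuousWithinAt

end

end XXZ

end

theorem proposition7p6 (Δ : ℝ) (hΔ : Δ ≠ 0) :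
    ∃ δ₁ : ℝ, 0 < δ₁ ∧ ∀ ε₁ : ℝ, 0 < ε₁ → ε₁ < δ₁ →
      ∃ δ₂ : ℝ, 0 < δ₂ ∧ ∀ ε₂ : ℝ, 0 < ε₂ → ε₂ < δ₂ →
        ∀ (N : ℕ) (hN : 0 < N) (y : Fin N → ℤ) (hy : StrictMono y) (x : ℤ) (t R R' : ℝ),
          max (2 * |Δ|⁻¹) (2 * (1 + 2 * |Δ|)) < R →
          R < max (4 * |Δ|⁻¹) (4 * (1 + 2 * |Δ|)) →
          max (4 * |Δ|⁻¹) (4 * (1 + 2 * |Δ|)) < R' / 2 →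
          (XXZ.leftmostTail Δ hN y hy x t : ℂ) =
            ∑ n ∈ Finset.range (N + 1), ∑ τ ∈ XXZ.maps N n,
              XXZ.seriesTerm Δ y x t R R' ε₁ ε₂ τ := by
  have hΔ' := abs_pos.2 hΔ
  refine ⟨min (1 / 2) (2 * |Δ| / 3), by positivity, fun ε₁ h1 h1' => ?_⟩
  rw [lt_min_iff] at h1'
  have hnorm : 1 < ‖(Complex.I + 2 * Δ : ℂ)‖ := by
    have e : ‖(Complex.I + 2 * Δ : ℂ)‖ ^ 2 = 1 + 4 * Δ ^ 2 := by
      rw [Complex.sq_norm, Complex.normSq_apply]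
      simp
      ring
    have := sq_pos_of_ne_zero hΔ
    nlinarith [norm_nonneg (Complex.I + 2 * Δ : ℂ)]
  refine ⟨min (ε₁ / 2) (‖(Complex.I + 2 * Δ : ℂ)‖ - 1), lt_min (by linarith) (by linarith),
    fun ε₂ h2 h2' N hN y hy x t R R' hR hR1 hR2 => ?_⟩
  rw [lt_min_iff] at h2'
  obtain ⟨hRa, hRb⟩ := max_lt_iff.1 hR
  have h3 : 2 < R * |Δ| := by
    rw [← div_lt_iff₀ hΔ', div_eq_mul_inv]
    exact hRa
  have hr : XXZ.Radii Δ R R' := ⟨hΔ, h3, by linarith, by linarith⟩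
  have h : XXZ.HatData Δ R ε₁ ε₂ :=
    ⟨hΔ, h1, h1'.1, by linarith [h1'.2], h2, by linarith [h2'.1], by linarith [h2'.2], hr.lt_fst⟩
  rw [hr.leftmostTail_eq_transition, XXZ.transition, ← XXZ.sum_maps_sum_extensions fun σ K =>
    XXZ.iter (XXZ.torus N R R') (XXZ.allVars N) (XXZ.theta Δ y y x t σ K) 0]
  exact Finset.sum_congr rfl fun n _ => Finset.sum_congr rfl fun τ hτ =>
    (h.seriesTerm_eq_sum hr.lt_snd y x t (fun _ _ => XXZ.injective_of_mem_maps hτ) hr).symm
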